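/- Let $X$ be a complex Banach space and let $A$ be a closed (not necessarily densely defined or injective) linear operator on $X$ that is sectorial of angle $\varphi\in(0,\pi)$: with $\Sigma_\psi=\{\lambda\in\mathbb C:|\arg\lambda|\le\psi\}\cup\{0\}$ one has $\sigma(A)\subseteq\Sigma_\varphi$ and $\sup_{\lambda\notin\Sigma_{\varphi'}}\|\lambda(\lambda-A)^{-1}\|<\infty$ for every $\varphi'\in(\varphi,\pi)$. Let $T>0$, $\alpha>0$, $\varepsilon>0$, and let $A^\varepsilon=(1+A)^n\,e(A)$ be the fractional power of $A$ given by the functional calculus for sectorial operators, where $n=\lfloor\varepsilon\rfloor+1$, $e(z)=z^\varepsilon(1+z)^{-n}$, $e(A)=\frac1{2\pi i}\int_{\partial\Sigma_\omega}e(z)(z-A)^{-1}\,dz$, with $\partial\Sigma_\omega$ positively oriented and $\omega\in(\varphi,\pi)$ arbitrary. Put $B=\alpha A^\varepsilon$. Assume that one of the following conditions holds: (a) $\varepsilon=\frac12$ and $\alpha\ge2$; (b) $\varepsilon=\frac12$, $\alpha<2$ and $\varphi<\pi-2\arctan\frac{\sqrt{4-\alpha^2}}{\alpha}$; (c) $\varepsilon\in(\frac12,1]$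 and $\varphi<\frac{\pi}{2\varepsilon}$. Then the problem $$\ddot u+\alpha A^\varepsilon\dot u+Au=f\ \text{ on }[0,T],\qquad u(0)=\dot u(0)=0,\tag{1}$$ has Besov and Hölder maximal regularity, that is: for every $\theta\in(0,1)$ and for each of the following function spaces $\mathbb E$, for every $f\in\mathbb E$ the problem (1) has a unique solution $u$, and $u,\ \dot u,\ \ddot u,\ A^\varepsilon\dot u,\ Au\in\mathbb E$. 1. $\mathbb E=B^\theta_{pq}(0,T;X)$, where $1\le p<\infty$, $1\le q\le\infty$, $\theta<\frac1p$. This is the space of all $u\in L^p(0,T;X)$ for which $h\mapsto h^{-\theta}\|u(\cdot+h)-u\|_{L^p(0,T-h;X)}$ belongs to $L^q(0,T;\frac{dh}{h})$. 2. $\mathbb E=\mathring B^\theta_{pq}(0,T;X)$, where $1\le p<\infty$, $1\le q\le\infty$, $\theta\ge\frac1p$. For $\theta>\frac1p$ this is the space of all $u\in B^\theta_{pq}(0,T;X)$ with trace $u(0)=0$. For $\theta=\frac1p$ it is the space of all $u\in B^\theta_{pq}(0,T;X)$ such that $h\mapsto h^{-\theta}\|u\|_{L^p(0,h;X)}$ belongs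 to $L^q(0,T;\frac{dh}{h})$ (equivalently, the extension of $u$ by $0$ to $(-\infty,T)$ is in $B^\theta_{pq}(-\infty,T;X)$). 3. $\mathbb E=\mathring C^\theta([0,T];X)$, the space of all $\theta$-Hölder continuous $u:[0,T]\to X$ with $u(0)=0$. 4. $\mathbb E=\mathring h^\theta([0,T];X)$, the space of all $u\in\mathring C^\theta([0,T];X)$ with $\lim_{\delta\to0}\sup_{0<|t-s|<\delta}\|u(t)-u(s)\|/|t-s|^\theta=0$. In cases 1 and 2 a solution is a function $u\in W^{2,p}(0,T;X)$ with $u(0)=\dot u(0)=0$, with $u(t)\in D(A)$, $\dot u(t)\in D(A^\varepsilon)$ for almost every $t$, with $Au,A^\varepsilon\dot u\in L^p(0,T;X)$, that satisfies the equation almost everywhere. In cases 3 and 4 it is a function $u\in C^2([0,T];X)$ with $u(0)=\dot u(0)=0$, with $u(t)\in D(A)$, $\dot u(t)\in D(A^\varepsilon)$ for every $t\in[0,T]$, with $Au,A^\varepsilon\dot u\in C([0,T];X)$, that satisfies the equation on $[0,T]$. No further assumptions on $X$ or $A$ (such as the UMD property or a bounded $H^\infty$-calculus) are made. -/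

import Mathlib

open Set MeasureTheory
open scoped ENNReal

noncomputable section

namespace MaxReg

variable {X : Type*} [NormedAddCommGroup X] [NormedSpace ℂ X]

/-! ### Sectorial operators and their fractional powers -/

/-- The closed sector `{z : |arg z| ≤ φ} ∪ {0}` (as `Complex.arg 0 = 0`, it contains `0`
whenever `φ ≥ 0`; the union makes this explicit). -/
def sector (φ : ℝ) : Set ℂ := {z : ℂ | |z.arg| ≤ φ} ∪ {0}

/-- `R = (z - A)⁻¹` as an everywhere defined bounded operator. -/
structure IsResolvent (A : X →ₗ.[ℂ] X) (z : ℂ) (R : X →L[ℂ] X) : Prop where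
  left_inv : ∀ x : A.domain, R (z • (x : X) - A x) = x
  right_inv : ∀ y : X, ∃ h : R y ∈ A.domain, z • R y - A ⟨R y, h⟩ = y

open Classical in
/-- The resolvent `R(z, A) = (z - A)⁻¹` (and `0` if `z` is in the spectrum of `A`). -/
def res (A : X →ₗ.[ℂ] X) (z : ℂ) : X →L[ℂ] X :=
  if h : ∃ R, IsResolvent A z R then h.choose else 0

/-- A closed, not necessarily densely defined or injective, operator `A` is sectorial of
angle `φ` if its spectrum lies in `sector φ` and `z R(z, A)` is bounded outside `sector φ'`
for every `φ' ∈ (φ, π)`. -/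
structure IsSectorial (A : X →ₗ.[ℂ] X) (φ : ℝ) : Prop where
  isClosed : A.IsClosed
  exists_resolvent : ∀ z : ℂ, z ∉ sector φ → ∃ R, IsResolvent A z R
  bound : ∀ φ' : ℝ, φ < φ' → φ' < Real.pi →
    ∃ M : ℝ, ∀ z : ℂ, z ∉ sector φ' → ‖z • res A z‖ ≤ M

/-- The elementary functional calculus
`g(A) = (2πi)⁻¹ ∫ g(z) R(z, A) dz` along the positively oriented boundary of the sector of
half-angle `ω`, that is, outwards on the ray `ℝ₊ e^{-iω}` and inwards on the ray `ℝ₊ e^{iω}`. -/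
def sectorCalc (A : X →ₗ.[ℂ] X) (ω : ℝ) (g : ℂ → ℂ) : X →L[ℂ] X :=
  (2 * (Real.pi : ℂ) * Complex.I)⁻¹ •
    ((∫ r in Ioi (0 : ℝ), (g (r * Complex.exp (-(ω * Complex.I))) *
        Complex.exp (-(ω * Complex.I))) • res A (r * Complex.exp (-(ω * Complex.I)))) -
      ∫ r in Ioi (0 : ℝ), (g (r * Complex.exp (ω * Complex.I)) *
        Complex.exp (ω * Complex.I)) • res A (r * Complex.exp (ω * Complex.I)))

/-- The graph of `A^ε = (1 + A)ⁿ e(A)`, where `e(z) = z^ε / (1 + z)ⁿ` and `n = ⌊ε⌋ + 1 > ε`: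
`(x, y)` belongs to it iff `e(A) x = (1 + A)⁻ⁿ y`, which says that `e(A) x` lies in the domain
of `(1 + A)ⁿ` and that `(1 + A)ⁿ e(A) x = y`. Here `(1 + A)⁻¹ = -R(-1, A)`. -/
def fracPowGraph (A : X →ₗ.[ℂ] X) (ω ε : ℝ) : Submodule ℂ (X × X) where
  carrier := {z | sectorCalc A ω (fun w => w ^ (ε : ℂ) / (1 + w) ^ (⌊ε⌋₊ + 1)) z.1 =
    ((-res A (-1)) ^ (⌊ε⌋₊ + 1)) z.2}
  add_mem' := by
    intro a b ha hb
    simp only [mem_ofPred_eq, Prod.fst_add, Prod.snd_add, map_add] at *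
    rw [ha, hb]
  zero_mem' := by simp only [mem_ofPred_eq, Prod.fst_zero, Prod.snd_zero, map_zero]
  smul_mem' := by
    intro c a ha
    simp only [mem_ofPred_eq, Prod.smul_fst, Prod.smul_snd, map_smul] at *
    rw [ha]

/-- The fractional power `A^ε`, `ε > 0`, of a sectorial operator `A` of angle `< ω < π`, defined
by the regularised functional calculus, with integration along the boundary of the sector of
half-angle `ω` (by Cauchy's theorem the choice of `ω` is immaterial). -/
def fracPow (A : X →ₗ.[ℂ] X) (ω ε : ℝ) : X →ₗ.[ℂ] X := (fracPowGraph A ω ε).toLinearPMap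

theorem isResolvent_res {A : X →ₗ.[ℂ] X} {z : ℂ} (h : ∃ R, IsResolvent A z R) :
    IsResolvent A z (res A z) := by
  rw [res, dif_pos h]
  exact h.choose_spec

theorem IsResolvent.injective {A : X →ₗ.[ℂ] X} {z : ℂ} {R : X →L[ℂ] X}
    (h : IsResolvent A z R) : Function.Injective R := by
  rw [injective_iff_map_eq_zero]
  intro y hy
  obtain ⟨h1, h2⟩ := h.right_inv y
  have h3 : (⟨R y, h1⟩ : A.domain) = 0 := Subtype.ext hy
  rw [h3, hy] at h2
  simpa using h2.symm

/-- For a sectorial operator, `fracPowGraph` is indeed the graph of `fracPow`. -/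
theorem IsSectorial.graph_fracPow {A : X →ₗ.[ℂ] X} {φ : ℝ} (hA : IsSectorial A φ)
    (hφ : φ ∈ Ioo 0 Real.pi) (ω ε : ℝ) : (fracPow A ω ε).graph = fracPowGraph A ω ε := by
  have hz : (-1 : ℂ) ∉ sector φ := by
    simp [sector, Complex.arg_neg_one, abs_of_pos Real.pi_pos, hφ.2]
  have hinj : Function.Injective (-res A (-1)) := by
    have h := (isResolvent_res (hA.exists_resolvent _ hz)).injective
    intro x y hxy
    apply h
    simpa using hxy
  apply Submodule.toLinearPMap_graph_eq
  intro x hx h0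
  change _ = _ at hx
  rw [h0, map_zero] at hx
  have hn : ∀ (n : ℕ) (y : X), ((-res A (-1)) ^ n) y = 0 → y = 0 := by
    intro n
    induction n with
    | zero => intro y hy; simpa using hy
    | succ k ih =>
      intro y hy
      rw [pow_succ] at hy
      exact hinj ((ih _ hy).trans (map_zero _).symm)
  exact hn _ _ hx.symm

/-- The values of an operator, extended by `0` outside of its domain; it is used only for
functions whose values lie in the domain (almost) everywhere. -/
def app (A : X →ₗ.[ℂ] X) (x : X) : X := by
  classical exact if h : x ∈ A.domain then A ⟨x, h⟩ else 0

/-! ### Function spaces on `[0, T]`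

Functions on `[0, T]` are functions on `ℝ`, of which only the values on `[0, T]` matter. -/

/-- The space `L^p(0, T; X)`. -/
def MemLpT (T : ℝ) (p : ℝ≥0∞) (u : ℝ → X) : Prop := MemLp u p (volume.restrict (Ioo 0 T))

/-- The measure `dh / h` on `(0, T)`. -/
def dhh (T : ℝ) : Measure ℝ :=
  (volume.restrict (Ioo 0 T)).withDensity (fun h => ENNReal.ofReal h⁻¹)

/-- The Besov space `B^θ_{pq}(0, T; X)`, `0 < θ < 1`: functions `u ∈ L^p(0, T; X)` such that
`h ↦ h^{-θ} ‖u(· + h) - u‖_{L^p(0, T - h; X)}` belongs to `L^q(0, T; dh / h)`. -/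
def MemBesov (T θ : ℝ) (p q : ℝ≥0∞) (u : ℝ → X) : Prop :=
  MemLpT T p u ∧
    eLpNorm (fun h : ℝ => ENNReal.ofReal (h ^ (-θ)) *
      eLpNorm (fun t => u (t + h) - u t) p (volume.restrict (Ioo 0 (T - h)))) q (dhh T) < ∞

/-- The trace of `u` at `0` exists and is zero: `u` agrees almost everywhere with a continuous
function on `[0, T]` that vanishes at `0`. -/
def ZeroTrace (T : ℝ) (u : ℝ → X) : Prop :=
  ∃ v : ℝ → X, ContinuousOn v (Icc 0 T) ∧ u =ᵐ[volume.restrict (Ioo 0 T)] v ∧ v 0 = 0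

/-- The function `h ↦ h^{-θ} ‖u‖_{L^p(0, h; X)}` belongs to `L^q(0, T; dh / h)`. For
`u ∈ B^θ_{pq}(0, T; X)` this says that the extension of `u` by `0` to `(-∞, T)` is in
`B^θ_{pq}(-∞, T; X)`. -/
def HardyCond (T θ : ℝ) (p q : ℝ≥0∞) (u : ℝ → X) : Prop :=
  eLpNorm (fun h : ℝ => ENNReal.ofReal (h ^ (-θ)) *
    eLpNorm u p (volume.restrict (Ioo 0 h))) q (dhh T) < ∞

/-- The Besov space with zero boundary condition at `0`, for `θ ≥ 1 / p`. For `θ > 1 / p` it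
consists of the functions in `B^θ_{pq}(0, T; X)` with `u(0) = 0`. In the critical case
`θ = 1 / p`, in which functions in `B^θ_{pq}` need not have a trace, it is the real interpolation
space `(L^p, {u ∈ W^{1,p} : u(0) = 0})_{θ, q}`, that is, the space of functions whose extension
by `0` to `(-∞, T)` is in the Besov space. -/
def MemBesovZero (T θ : ℝ) (p q : ℝ≥0∞) (u : ℝ → X) : Prop :=
  MemBesov T θ p q u ∧ (1 / p.toReal < θ → ZeroTrace T u) ∧
    (θ = 1 / p.toReal → HardyCond T θ p q u)

/-- The space of functions `u` in the Hölder space `C^θ([0, T]; X)` with `u(0) = 0`. -/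
def MemHolderZero (T θ : ℝ) (u : ℝ → X) : Prop :=
  ContinuousOn u (Icc 0 T) ∧
    (∃ C : ℝ, ∀ s ∈ Icc 0 T, ∀ t ∈ Icc 0 T, ‖u t - u s‖ ≤ C * |t - s| ^ θ) ∧ u 0 = 0

/-- The space of functions `u` in the little Hölder space `h^θ([0, T]; X)` with `u(0) = 0`. -/
def MemLittleHolderZero (T θ : ℝ) (u : ℝ → X) : Prop :=
  MemHolderZero T θ u ∧ ∀ η > (0 : ℝ), ∃ δ > (0 : ℝ), ∀ s ∈ Icc 0 T, ∀ t ∈ Icc 0 T,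
    |t - s| < δ → ‖u t - u s‖ ≤ η * |t - s| ^ θ

/-! ### The second order Cauchy problem -/

/-- `u ∈ W^{1,p}(0, T; X)` with derivative `u'`; here `u` is the continuous representative. -/
structure HasSobolevDeriv (T : ℝ) (p : ℝ≥0∞) (u u' : ℝ → X) : Prop where
  memLp : MemLpT T p u'
  eq_integral : ∀ t ∈ Icc 0 T, u t = u 0 + ∫ s in (0 : ℝ)..t, u' s

/-- `u ∈ W^{2,p}(0, T; X)`, with derivatives `u'` and `u''`, is a strong solution in
`L^p(0, T; X)` of `u'' + B u' + A u = f`, `u(0) = u'(0) = 0`. -/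
structure IsStrongSolution (A B : X →ₗ.[ℂ] X) (T : ℝ) (p : ℝ≥0∞) (f u u' u'' : ℝ → X) :
    Prop where
  deriv_fst : HasSobolevDeriv T p u u'
  deriv_snd : HasSobolevDeriv T p u' u''
  init_fst : u 0 = 0
  init_snd : u' 0 = 0
  mem_domain_fst : ∀ᵐ t ∂volume.restrict (Ioo 0 T), u t ∈ A.domain
  mem_domain_snd : ∀ᵐ t ∂volume.restrict (Ioo 0 T), u' t ∈ B.domain
  memLp_fst : MemLpT T p (fun t => app A (u t))
  memLp_snd : MemLpT T p (fun t => app B (u' t))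
  equation : ∀ᵐ t ∂volume.restrict (Ioo 0 T), u'' t + app B (u' t) + app A (u t) = f t

/-- `u ∈ C²([0, T]; X)`, with derivatives `u'` and `u''`, is a strict solution in
`C([0, T]; X)` of `u'' + B u' + A u = f`, `u(0) = u'(0) = 0`. -/
structure IsStrictSolution (A B : X →ₗ.[ℂ] X) (T : ℝ) (f u u' u'' : ℝ → X) : Prop where
  deriv_fst : ∀ t ∈ Icc 0 T, HasDerivWithinAt u (u' t) (Icc 0 T) t
  deriv_snd : ∀ t ∈ Icc 0 T, HasDerivWithinAt u' (u'' t) (Icc 0 T) t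
  cont : ContinuousOn u'' (Icc 0 T)
  init_fst : u 0 = 0
  init_snd : u' 0 = 0
  mem_domain_fst : ∀ t ∈ Icc 0 T, u t ∈ A.domain
  mem_domain_snd : ∀ t ∈ Icc 0 T, u' t ∈ B.domain
  cont_fst : ContinuousOn (fun t => app A (u t)) (Icc 0 T)
  cont_snd : ContinuousOn (fun t => app B (u' t)) (Icc 0 T)
  equation : ∀ t ∈ Icc 0 T, u'' t + app B (u' t) + app A (u t) = f t

/-- Maximal regularity in a space `E` of functions on `(0, T)`, described by its membership
predicate, for a notion `Sol` of solution: for every `f` in `E` there is one and only one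
solution `u`, and `u`, `u'`, `u''`, `B u'`, `A u` belong to `E`. -/
def HasMaxReg (A B : X →ₗ.[ℂ] X) (T : ℝ)
    (Sol : (f u u' u'' : ℝ → X) → Prop) (E : (ℝ → X) → Prop) : Prop :=
  ∀ f : ℝ → X, E f → ∃ u u' u'' : ℝ → X, Sol f u u' u'' ∧
    (E u ∧ E u' ∧ E u'' ∧ E (fun t => app B (u' t)) ∧ E (fun t => app A (u t))) ∧
    ∀ v v' v'' : ℝ → X, Sol f v v' v'' → EqOn v u (Icc 0 T)

/-- Besov and Hölder maximal regularity on `[0, T]` of the problem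
`u'' + B u' + A u = f`, `u(0) = u'(0) = 0`. -/
structure HasBesovHolderMaxReg (A B : X →ₗ.[ℂ] X) (T : ℝ) : Prop where
  besov : ∀ (θ : ℝ) (p q : ℝ≥0∞), θ ∈ Ioo 0 1 → 1 ≤ p → p ≠ ∞ → 1 ≤ q → θ < 1 / p.toReal →
    HasMaxReg A B T (IsStrongSolution A B T p) (MemBesov T θ p q)
  besov_zero : ∀ (θ : ℝ) (p q : ℝ≥0∞), θ ∈ Ioo 0 1 → 1 ≤ p → p ≠ ∞ → 1 ≤ q →
    1 / p.toReal ≤ θ → HasMaxReg A B T (IsStrongSolution A B T p) (MemBesovZero T θ p q)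
  holder : ∀ θ : ℝ, θ ∈ Ioo 0 1 →
    HasMaxReg A B T (IsStrictSolution A B T) (MemHolderZero T θ)
  little_holder : ∀ θ : ℝ, θ ∈ Ioo 0 1 →
    HasMaxReg A B T (IsStrictSolution A B T) (MemLittleHolderZero T θ)

end MaxReg

end

open Set MeasureTheory
open scoped ENNReal

noncomputable section

namespace MaxReg

section

/-! ### Complex analysis on strips -/

section Strip

open Filter Topology

variable {E : Type*} [NormedAddCommGroup E] [NormedSpace ℂ E]

/-! On the Laplace side the problem reads `P(λ) u = f` with `P(λ) = λ² + α λ A^ε + A`. The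
conditions on `ε`, `α`, `φ` guarantee parameter ellipticity: `|λ² + α λ z^ε + z|` dominates the sum
of the moduli of its terms for `z` in a sector slightly larger than that of `A` and for large `λ` in
a sector larger than the right half plane (`exists_symbolBound`). From this it follows that `N₁ = λ²
P⁻¹`, `N₂ = λ A^ε P⁻¹` and `N₃ = A P⁻¹` are bounded and holomorphic in `λ`
(`IsSectorial.exists_resolventFamily`).

A bounded `H^∞`-calculus is not needed for that. For `ε < 1` the symbols of `N₁` and `1 - N₃` pass
from `1` to `0` around a single modulus `|z| = |λ|^a`, at an exponential rate in `log |z|`. With `μ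
= |λ|^a`, the function `μ / (μ + z)` has the same transition, and it is the symbol of `μ (μ + A)⁻¹`,
which is bounded uniformly in `μ`. The difference decays away from `|z| = μ`, so the absolutely
convergent elementary calculus applies to it, with a bound that does not depend on `λ`
(`IsTransitionFamily.exists_bound`). For `ε = 1` the operator `P(λ)` is a scalar times a translate
of `A`, and the `N`'s are explicit in the resolvent of `A`.

Inversion of the Laplace transform along a Hankel contour turns `N₁ / λ`, `N₂ / λ`, `N₃ / λ` into
kernels `G₁`, `G₂`, `G₃` with `G₁ + α G₂ + G₃ = 1` and `|G| ≤ C`, `|G'| ≤ C / t`, `|G''| ≤ C / t²`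
(`ResolventFamily.exists_solutionKernels`). Then `u''`, `A^ε u'`, `A u` are the derivatives of the
convolutions of these kernels with `f`, written as the singular integrals `derivConv`. They are not
bounded on `L^p` in general, but they control moduli of continuity: the modulus at `h` of the result
is bounded by that of `f` at `h` and by averages of the modulus of `f`, with the weight `1 / s` for
`s` up to `2 h` and `h / s²` beyond `h` (`enorm_derivConv_sub_le`). For `0 < θ < 1` such averages
preserve Hölder conditions; they preserve Besov conditions by Minkowski's inequality and the
dilation invariance of `dh / h` (`ZeroExtBesov.derivConv`). This is why no geometric property of `X`
enters.

The estimates are for functions extended by `0` to the left. Hardy's inequalities and a trace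
theorem identify the spaces of the theorem with those of functions whose zero extension is regular:
for `θ < 1/p` no condition arises, for `θ > 1/p` it is the vanishing of the trace, and for `θ = 1/p`
it is the Hardy condition itself.

Unbounded operators are kept out of the analysis. With `J = (1 + A)⁻¹` and `e = Jⁿ A^ε`, membership
in the domains and the values of `A` and `A^ε` are expressed by relations between bounded operators,
which pass from the `N`'s to the kernels and from these to the solution. Uniqueness follows by
pairing the primitive of a solution of the homogeneous problem with the kernels at the reflected
time (`SolutionKernels.integral_eq_zero`).

Throughout, `z = e^w` and `λ = e^p`: sectors become strips, rays become lines, `dz / z` becomes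
Lebesgue measure, and the change of scale in `λ` becomes a translation. -/

/-- The point `x + i y`, as a parametrisation of the horizontal line at height `y`. -/
def line (y x : ℝ) : ℂ := (x : ℂ) + (y : ℂ) * Complex.I

@[simp] theorem line_re (y x : ℝ) : (line y x).re = x := by simp [line]

@[simp] theorem line_im (y x : ℝ) : (line y x).im = y := by simp [line]

theorem continuous_line (y : ℝ) : Continuous (line y) := by
  unfold line; fun_prop

theorem hasDerivAt_line (y x : ℝ) : HasDerivAt (line y) 1 x := by
  unfold line
  simpa using (Complex.ofRealCLM.hasDerivAt (x := x)).add_const ((y : ℂ) * Complex.I)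

/-- The closed horizontal strip `a ≤ Im w ≤ b`. -/
def strip (a b : ℝ) : Set ℂ := {w : ℂ | a ≤ w.im ∧ w.im ≤ b}

/-- `H` is holomorphic on the closed strip and decays exponentially at both ends. -/
def StripDecay (a b : ℝ) (H : ℂ → E) : Prop :=
  DifferentiableOn ℂ H (strip a b) ∧
    ∃ C δ : ℝ, 0 < δ ∧ ∀ w ∈ strip a b, ‖H w‖ ≤ C * Real.exp (-δ * |w.re|)

theorem StripDecay.exists_pos {a b : ℝ} {H : ℂ → E} (h : StripDecay a b H) :
    ∃ C δ : ℝ, 0 < C ∧ 0 < δ ∧ ∀ w ∈ strip a b, ‖H w‖ ≤ C * Real.exp (-δ * |w.re|) := by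
  obtain ⟨C, δ, hδ, hC⟩ := h.2
  refine ⟨max C 1, δ, lt_max_of_lt_right one_pos, hδ, fun w hw => (hC w hw).trans ?_⟩
  gcongr
  exact le_max_left _ _

theorem StripDecay.mono {a b a' b' : ℝ} {H : ℂ → E} (h : StripDecay a b H) (ha : a ≤ a')
    (hb : b' ≤ b) : StripDecay a' b' H := by
  have hs : strip a' b' ⊆ strip a b := fun w hw => ⟨ha.trans hw.1, hw.2.trans hb⟩
  obtain ⟨C, δ, hδ, hC⟩ := h.2
  exact ⟨h.1.mono hs, C, δ, hδ, fun w hw => hC w (hs hw)⟩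

theorem StripDecay.congr {a b : ℝ} {H H' : ℂ → E} (h : StripDecay a b H)
    (hH : ∀ w ∈ strip a b, H' w = H w) : StripDecay a b H' := by
  obtain ⟨C, δ, hδ, hC⟩ := h.2
  exact ⟨h.1.congr hH, C, δ, hδ, fun w hw => by rw [hH w hw]; exact hC w hw⟩

theorem StripDecay.sub {a b : ℝ} {H H' : ℂ → E} (h : StripDecay a b H) (h' : StripDecay a b H') :
    StripDecay a b (fun w => H w - H' w) := by
  obtain ⟨C, δ, hC0, hδ, hC⟩ := h.exists_pos
  obtain ⟨C', δ', hC0', hδ', hC'⟩ := h'.exists_pos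
  refine ⟨h.1.sub h'.1, C + C', min δ δ', lt_min hδ hδ', fun w hw => ?_⟩
  refine (norm_sub_le _ _).trans ?_
  rw [add_mul]
  have := abs_nonneg w.re
  refine add_le_add ((hC w hw).trans ?_) ((hC' w hw).trans ?_)
  · gcongr; exact min_le_left _ _
  · gcongr; exact min_le_right _ _

theorem StripDecay.mul_bdd {a b : ℝ} {H : ℂ → E} {m : ℂ → ℂ} (h : StripDecay a b H)
    (hm : DifferentiableOn ℂ m (strip a b)) {B : ℝ} (hB : ∀ w ∈ strip a b, ‖m w‖ ≤ B) :
    StripDecay a b (fun w => m w • H w) := by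
  obtain ⟨C, δ, hC0, hδ, hC⟩ := h.exists_pos
  refine ⟨hm.smul h.1, B * C, δ, hδ, fun w hw => ?_⟩
  rw [norm_smul, mul_assoc]
  exact mul_le_mul (hB w hw) (hC w hw) (norm_nonneg _) ((norm_nonneg _).trans (hB w hw))

theorem StripDecay.const_mul {a b : ℝ} {H : ℂ → ℂ} (h : StripDecay a b H) (c : ℂ) :
    StripDecay a b (fun w => c * H w) := by
  simpa using h.mul_bdd (m := fun _ => c) (differentiableOn_const c) (B := ‖c‖)
    (fun w _ => le_rfl)

theorem integrable_exp_neg_mul_abs {δ : ℝ} (hδ : 0 < δ) :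
    Integrable (fun x : ℝ => Real.exp (-δ * |x|)) := by
  refine LocallyIntegrable.integrable_of_isBigO_atBot_atTop (g := fun x => Real.exp (δ * x))
    (g' := fun x => Real.exp (-δ * x)) ?_ ?_ ?_ ?_ ?_
  · exact (by fun_prop : Continuous fun x : ℝ => Real.exp (-δ * |x|)).locallyIntegrable
  · refine Filter.EventuallyEq.isBigO ?_
    filter_upwards [eventually_le_atBot (0 : ℝ)] with x hx
    rw [abs_of_nonpos hx]; ring_nf
  · refine ⟨Iic 0, Iic_mem_atBot 0, ?_⟩
    exact (integrableOn_exp_mul_Iic hδ 0)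
  · refine Filter.EventuallyEq.isBigO ?_
    filter_upwards [eventually_ge_atTop (0 : ℝ)] with x hx
    rw [abs_of_nonneg hx]
  · refine ⟨Ioi 0, Ioi_mem_atTop 0, ?_⟩
    exact (integrableOn_exp_mul_Ioi (by linarith) 0)

/-- Exponential decay only has to be checked near the two ends of the strip. -/
theorem StripDecay.of_eventually {a b x₀ C δ : ℝ} {H : ℂ → E}
    (hd : DifferentiableOn ℂ H (strip a b)) (hδ : 0 < δ)
    (hC : ∀ w ∈ strip a b, x₀ ≤ |w.re| → ‖H w‖ ≤ C * Real.exp (-δ * |w.re|)) :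
    StripDecay a b H := by
  refine ⟨hd, ?_⟩
  have hK : IsCompact (Icc (-x₀) x₀ ×ℂ Icc a b) := isCompact_Icc.reProdIm isCompact_Icc
  obtain ⟨D, hD⟩ := hK.exists_bound_of_continuousOn
    (hd.continuousOn.mono (fun w hw => ⟨hw.2.1, hw.2.2⟩))
  -- In the compact middle part only a bound `D` is available; the factor `e^{δ x₀}` makes up for
  -- the smallness of `e^{-δ |Re w|}` there.
  refine ⟨max C (D * Real.exp (δ * x₀)), δ, hδ, fun w hw => ?_⟩
  rcases le_total x₀ |w.re| with h | h
  · refine (hC w hw h).trans ?_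
    gcongr
    exact le_max_left _ _
  · have h1 := hD w ⟨abs_le.1 h, hw.1, hw.2⟩
    have h0 : 0 ≤ D := (norm_nonneg _).trans h1
    refine h1.trans ?_
    have h2 : D ≤ D * Real.exp (δ * x₀) * Real.exp (-δ * |w.re|) := by
      rw [mul_assoc, ← Real.exp_add]
      refine le_mul_of_one_le_right h0 (Real.one_le_exp ?_)
      nlinarith
    refine h2.trans ?_
    gcongr
    exact le_max_right _ _

theorem StripDecay.continuous_line {a b y : ℝ} {H : ℂ → E} (h : StripDecay a b H)
    (hy : y ∈ Icc a b) : Continuous (fun x => H (line y x)) :=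
  h.1.continuousOn.comp_continuous (MaxReg.continuous_line y) fun x => by
    simpa [strip] using hy

theorem StripDecay.integrable {a b y : ℝ} {H : ℂ → E} (h : StripDecay a b H)
    (hy : y ∈ Icc a b) : Integrable (fun x => H (line y x)) := by
  obtain ⟨C, δ, hδ, hC⟩ := h.2
  refine Integrable.mono' ((integrable_exp_neg_mul_abs hδ).const_mul C)
    (h.continuous_line hy).aestronglyMeasurable (Eventually.of_forall fun x => ?_)
  simpa using hC (line y x) (by simpa [strip] using hy)

/-- Cauchy's theorem on a strip. -/
theorem StripDecay.integral_eq [CompleteSpace E] {a b : ℝ} {H : ℂ → E} (h : StripDecay a b H)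
    (hab : a ≤ b) : ∫ x, H (line a x) = ∫ x, H (line b x) := by
  obtain ⟨C, δ, hC0, hδ, hC⟩ := h.exists_pos
  have hT : ∀ y ∈ Icc a b, Tendsto (fun n : ℕ => ∫ x in (-(n : ℝ))..n, H (line y x)) atTop
      (𝓝 (∫ x, H (line y x))) := fun y hy =>
    intervalIntegral_tendsto_integral (h.integrable hy)
      (tendsto_neg_atTop_atBot.comp tendsto_natCast_atTop_atTop) tendsto_natCast_atTop_atTop
  -- The vertical sides of the rectangles, on the right for `s = 1` and on the left for `s = -1`,
  -- contribute nothing in the limit.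
  have hV : ∀ s : ℝ, |s| = 1 → Tendsto (fun n : ℕ => Complex.I •
      ∫ y in a..b, H ((s * n : ℝ) + y * Complex.I)) atTop (𝓝 0) := by
    intro s hs
    rw [tendsto_zero_iff_norm_tendsto_zero]
    have hlim : Tendsto (fun n : ℕ => C * Real.exp (-δ * (n : ℝ)) * |b - a|) atTop (𝓝 0) := by
      have : Tendsto (fun n : ℕ => Real.exp (-δ * (n : ℝ))) atTop (𝓝 0) := by
        refine Real.tendsto_exp_atBot.comp ?_
        exact tendsto_natCast_atTop_atTop.const_mul_atTop_of_neg (by linarith)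
      simpa using (this.const_mul C).mul_const |b - a|
    refine squeeze_zero (fun _ => norm_nonneg _) (fun n => ?_) hlim
    rw [norm_smul, Complex.norm_I, one_mul]
    refine intervalIntegral.norm_integral_le_of_norm_le_const fun y hy => ?_
    rw [uIoc_of_le hab] at hy
    have := hC ((s * n : ℝ) + y * Complex.I) (by simpa [strip] using ⟨hy.1.le, hy.2⟩)
    simpa [abs_mul, hs] using this
  have hR : ∀ n : ℕ, (∫ x in (-(n : ℝ))..n, H (line a x)) - (∫ x in (-(n : ℝ))..n, H (line b x)) +
      Complex.I • (∫ y in a..b, H (((1 : ℝ) * n : ℝ) + y * Complex.I)) -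
      Complex.I • (∫ y in a..b, H (((-1 : ℝ) * n : ℝ) + y * Complex.I)) = 0 := by
    intro n
    have := Complex.integral_boundary_rect_eq_zero_of_differentiableOn H ⟨-n, a⟩ ⟨n, b⟩
      (h.1.mono fun w hw => by
        have := hw.2
        simp only [mem_preimage, uIcc_of_le hab] at this
        exact this)
    simpa [line] using this
  have hlim := (((hT a ⟨le_rfl, hab⟩).sub (hT b ⟨hab, le_rfl⟩)).add (hV 1 (by simp))).sub
    (hV (-1) (by simp))
  simp only [hR, add_zero, sub_zero] at hlim
  exact sub_eq_zero.1 (tendsto_nhds_unique tendsto_const_nhds hlim).symm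

/-- The sum of two exponentials whose arguments differ by less than `π` is comparable to the sum
of the moduli. -/
theorem norm_exp_add_exp_ge (a b : ℂ) :
    |Real.cos ((a.im - b.im) / 2)| * (Real.exp a.re + Real.exp b.re) ≤
      ‖Complex.exp a + Complex.exp b‖ := by
  refine abs_le_of_sq_le_sq' ?_ (norm_nonneg _) |>.2
  rw [mul_pow, sq_abs, ← Complex.normSq_eq_norm_sq, Complex.normSq_apply]
  simp only [Complex.add_re, Complex.add_im, Complex.exp_re, Complex.exp_im]
  have h1 : Real.cos (a.im - b.im) = 2 * Real.cos ((a.im - b.im) / 2) ^ 2 - 1 := by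
    rw [← Real.cos_two_mul]; ring_nf
  rw [Real.cos_sub] at h1
  set u := Real.exp a.re
  set v := Real.exp b.re
  have hu : 0 < u := Real.exp_pos _
  have hv : 0 < v := Real.exp_pos _
  have hc : Real.cos ((a.im - b.im) / 2) ^ 2 ≤ 1 := Real.cos_sq_le_one _
  set c := Real.cos ((a.im - b.im) / 2) ^ 2
  have h2 : (u * Real.cos a.im + v * Real.cos b.im) * (u * Real.cos a.im + v * Real.cos b.im) +
      (u * Real.sin a.im + v * Real.sin b.im) * (u * Real.sin a.im + v * Real.sin b.im) =
      u ^ 2 + v ^ 2 + 2 * u * v * (2 * c - 1) := by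
    rw [← h1]
    linear_combination u ^ 2 * Real.sin_sq_add_cos_sq a.im + v ^ 2 * Real.sin_sq_add_cos_sq b.im
  rw [h2]
  -- The difference of the two sides is `(1 - c) (u - v)²`.
  nlinarith [mul_nonneg (sq_nonneg (u - v)) (sub_nonneg.2 hc)]

theorem norm_exp_sub_exp_ge (a b : ℂ) :
    |Real.sin ((a.im - b.im) / 2)| * (Real.exp a.re + Real.exp b.re) ≤
      ‖Complex.exp a - Complex.exp b‖ := by
  have h := norm_exp_add_exp_ge a (b + Real.pi * Complex.I)
  rw [Complex.exp_add, Complex.exp_pi_mul_I] at h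
  have h2 : Real.cos ((a.im - (b + Real.pi * Complex.I).im) / 2) =
      Real.sin ((a.im - b.im) / 2) := by
    rw [← Real.cos_sub_pi_div_two]; congr 1; simp; ring
  rw [h2] at h
  simpa [sub_eq_add_neg] using h

theorem exp_sub_exp_ne_zero {a b : ℂ} (h : a.im ≠ b.im) (h' : |a.im - b.im| < 2 * Real.pi) :
    Complex.exp a - Complex.exp b ≠ 0 := by
  have h0 := norm_exp_sub_exp_ge a b
  have h1 : Real.sin ((a.im - b.im) / 2) ≠ 0 := by
    rw [abs_lt] at h'
    intro h0
    rw [Real.sin_eq_zero_iff_of_lt_of_lt (by linarith) (by linarith)] at h0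
    exact h (by linarith)
  intro h2
  rw [h2, norm_zero] at h0
  have := Real.exp_pos a.re
  have := Real.exp_pos b.re
  have := abs_pos.2 h1
  nlinarith [mul_pos this (add_pos ‹0 < Real.exp a.re› ‹0 < Real.exp b.re›)]

/-- A parameter integral of holomorphic functions is holomorphic if the integrands are locally
uniformly dominated. -/
theorem differentiableOn_integral_param [CompleteSpace E] {Y : Type*} [MeasurableSpace Y]
    {μ : Measure Y}
    {U : Set ℂ} (hU : IsOpen U) {F : ℂ → Y → E}
    (hm : ∀ p ∈ U, AEStronglyMeasurable (F p) μ)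
    (hd : ∀ y, DifferentiableOn ℂ (fun p => F p y) U)
    (hb : ∀ p ∈ U, ∃ r > 0, ∃ g : Y → ℝ, Integrable g μ ∧
      ∀ q ∈ Metric.ball p r, ∀ y, ‖F q y‖ ≤ g y) :
    DifferentiableOn ℂ (fun p => ∫ y, F p y ∂μ) U := by
  intro p hp
  obtain ⟨r, hr, g, hg, hgb⟩ := hb p hp
  obtain ⟨r', hr', hrU⟩ := Metric.isOpen_iff.1 hU p hp
  -- With this radius, discs of radius `ρ / 2` about points of the ball of radius `ρ` stay where
  -- both the domination and the holomorphy are available, so Cauchy's estimate yields a common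
  -- majorant of the derivatives.
  set ρ := min r r' / 2 with hρ
  have hρ0 : 0 < ρ := by positivity
  have hρr : 2 * ρ ≤ r := by rw [hρ]; linarith [min_le_left r r']
  have hρr' : 2 * ρ ≤ r' := by rw [hρ]; linarith [min_le_right r r']
  have hball : Metric.ball p ρ ⊆ U := (Metric.ball_subset_ball (by linarith)).trans hrU
  have hder : ∀ q ∈ Metric.ball p ρ, ∀ y, HasDerivAt (fun p => F p y) (deriv (fun p => F p y) q) q :=
    fun q hq y => ((hd y).differentiableAt (hU.mem_nhds (hball hq))).hasDerivAt
  have hbd : ∀ q ∈ Metric.ball p ρ, ∀ y, ‖deriv (fun p => F p y) q‖ ≤ (2 / ρ) * g y := by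
    intro q hq y
    have hsub : Metric.ball q (ρ / 2) ⊆ Metric.ball p r := by
      intro z hz
      rw [Metric.mem_ball] at *
      linarith [dist_triangle z q p]
    have hcl : Metric.closedBall q (ρ / 2) ⊆ Metric.ball p r ∩ U := by
      intro z hz
      rw [Metric.mem_closedBall] at hz
      have : dist z p < 2 * ρ := by
        rw [Metric.mem_ball] at hq
        linarith [dist_triangle z q p]
      exact ⟨Metric.mem_ball.2 (this.trans_le hρr), hrU (Metric.mem_ball.2 (this.trans_le hρr'))⟩
    have := Complex.norm_deriv_le_of_forall_mem_sphere_norm_le (f := fun p => F p y)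
      (c := q) (R := ρ / 2) (C := g y) (by linarith)
      (DifferentiableOn.diffContOnCl (((hd y).mono fun z hz => (hcl
        (Metric.closure_ball_subset_closedBall hz)).2)))
      (fun z hz => hgb z (hcl (Metric.sphere_subset_closedBall hz)).1 y)
    refine this.trans (le_of_eq ?_)
    field_simp
  have hp_meas : ∀ᶠ q in 𝓝 p, AEStronglyMeasurable (F q) μ := by
    filter_upwards [hU.mem_nhds hp] with q hq using hm q hq
  -- Measurability of the derivative in `y`: it is a pointwise limit of difference quotients along a
  -- sequence.
  have hmeas' : AEStronglyMeasurable (fun y => deriv (fun p => F p y) p) μ := by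
    have hn : ∀ n : ℕ, p + ((ρ / (n + 2) : ℝ) : ℂ) ∈ U := by
      intro n
      apply hball
      rw [Metric.mem_ball, dist_eq_norm, add_sub_cancel_left, Complex.norm_real,
        Real.norm_of_nonneg (by positivity)]
      exact div_lt_self hρ0 (by have : (0:ℝ) ≤ n := Nat.cast_nonneg n; linarith)
    have hlim : Tendsto (fun n : ℕ => p + ((ρ / (n + 2) : ℝ) : ℂ)) atTop (𝓝[≠] p) := by
      rw [tendsto_nhdsWithin_iff]
      constructor
      · have h1 : Tendsto (fun n : ℕ => ρ / ((n : ℝ) + 2)) atTop (𝓝 0) :=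
          Tendsto.div_atTop tendsto_const_nhds
            (tendsto_atTop_add_const_right _ _ tendsto_natCast_atTop_atTop)
        have h2 := (Complex.continuous_ofReal.tendsto 0).comp h1
        simpa using h2.const_add p
      · refine Eventually.of_forall fun n => ?_
        have : ρ / ((n : ℝ) + 2) ≠ 0 := by positivity
        simp only [mem_compl_iff, mem_singleton_iff, add_eq_left]
        exact_mod_cast this
    refine aestronglyMeasurable_of_tendsto_ae atTop
      (f := fun (n : ℕ) y => slope (fun p => F p y) p (p + ((ρ / (n + 2) : ℝ) : ℂ))) ?_ ?_
    · intro n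
      simp only [slope, vsub_eq_sub]
      exact ((hm _ (hn n)).sub (hm p hp)).const_smul _
    · refine Eventually.of_forall fun y => ?_
      exact (hasDerivAt_iff_tendsto_slope.1 (hder p (Metric.mem_ball_self hρ0) y)).comp hlim
  have := hasDerivAt_integral_of_dominated_loc_of_deriv_le (μ := μ) (F := F) (x₀ := p)
    (F' := fun q y => deriv (fun p => F p y) q) (bound := fun y => (2 / ρ) * g y)
    (Metric.ball_mem_nhds p hρ0) hp_meas
    (hg.mono' (hm p hp) (Eventually.of_forall fun y => hgb p (Metric.mem_ball_self hr) y))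
    hmeas' (Eventually.of_forall fun y q hq => hbd q hq y) (hg.const_mul _)
    (Eventually.of_forall fun y q hq => hder q hq y)
  exact this.2.differentiableAt.differentiableWithinAt

end Strip

end

section

/-! ### Cauchy's integral formula for sectors, with the residue read off from logarithms -/

section CauchyFormula

open Filter Topology

/-- If `1 - e^ζ` is a nonpositive real then `e^ζ` is a positive real, so that `Im ζ` is a multiple
of `2π`. This makes the principal branch available for the primitive of `poleFun` along a whole
line. -/
theorem one_sub_exp_mem_slitPlane {ζ : ℂ} (h0 : ζ.im ≠ 0) (h : |ζ.im| < 2 * Real.pi) :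
    1 - Complex.exp ζ ∈ Complex.slitPlane := by
  rw [Complex.mem_slitPlane_iff]
  by_cases hs : Real.sin ζ.im = 0
  · left
    have h2 : Real.cos ζ.im < 1 := by
      refine lt_of_le_of_ne (Real.cos_le_one _) fun hc => h0 ?_
      rw [abs_lt] at h
      exact (Real.cos_eq_one_iff_of_lt_of_lt h.1 h.2).1 hc
    have h3 : Real.cos ζ.im = -1 := by
      have := Real.sin_sq_add_cos_sq ζ.im
      rw [hs] at this
      have h4 : (Real.cos ζ.im - 1) * (Real.cos ζ.im + 1) = 0 := by linear_combination this
      rcases mul_eq_zero.1 h4 with h5 | h5 <;> linarith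
    simp only [Complex.sub_re, Complex.one_re, Complex.exp_re, h3]
    linarith [Real.exp_pos ζ.re]
  · right
    simp only [Complex.sub_im, Complex.one_im, Complex.exp_im]
    have := mul_ne_zero (Real.exp_pos ζ.re).ne' hs
    simpa using this

theorem add_exp_mem_slitPlane {ζ : ℂ} (h : |ζ.im| < Real.pi) {μ : ℝ} (hμ : 0 < μ) :
    (μ : ℂ) + Complex.exp ζ ∈ Complex.slitPlane := by
  rw [Complex.mem_slitPlane_iff]
  rw [abs_lt] at h
  by_cases h0 : ζ.im = 0
  · left
    simp only [Complex.add_re, Complex.ofReal_re, Complex.exp_re, h0, Real.cos_zero]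
    linarith [Real.exp_pos ζ.re]
  · right
    simp only [Complex.add_im, Complex.ofReal_im, Complex.exp_im, zero_add]
    refine mul_ne_zero (Real.exp_pos ζ.re).ne' fun hs => h0 ?_
    exact (Real.sin_eq_zero_iff_of_lt_of_lt h.1 h.2).1 hs

theorem norm_add_exp_ge (w : ℂ) {μ : ℝ} (hμ : 0 < μ) :
    |Real.cos (w.im / 2)| * (μ + Real.exp w.re) ≤ ‖(μ : ℂ) + Complex.exp w‖ := by
  have := norm_exp_add_exp_ge w (Real.log μ : ℝ)
  rw [← Complex.ofReal_exp, Real.exp_log hμ] at this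
  simpa [Real.exp_log hμ, add_comm] using this

/-- `e^w (w - z₀)⁻¹ - e^w (w + μ)⁻¹` in logarithmic coordinates, with `z₀ = e^{w₀}`. -/
def poleFun (w₀ : ℂ) (μ : ℝ) (w : ℂ) : ℂ :=
  Complex.exp w / (Complex.exp w - Complex.exp w₀) - Complex.exp w / (μ + Complex.exp w)

/-- Each of the two fractions tends to `1` at the right end, so only their difference is integrable.
It has the primitive `log (1 - e^{w - w₀}) - log (1 + e^w / μ)` with principal branches along the
whole line, and the integral is the difference of the limits of the primitive. -/
theorem poleFun_line {w₀ : ℂ} {μ y : ℝ} (hμ : 0 < μ) (hy : |y| < Real.pi) (h0 : y ≠ w₀.im)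
    (h : |y - w₀.im| < 2 * Real.pi) :
    Integrable (fun x => poleFun w₀ μ (line y x)) ∧ ∫ x, poleFun w₀ μ (line y x) =
      Complex.log (-Complex.exp (-w₀ + y * Complex.I)) -
        Complex.log (Complex.exp (y * Complex.I) / μ) := by
  have hμ' : (μ : ℂ) ≠ 0 := by exact_mod_cast hμ.ne'
  have hne : ∀ x, Complex.exp (line y x) - Complex.exp w₀ ≠ 0 := fun x =>
    exp_sub_exp_ne_zero (by simpa using h0) (by simpa using h)
  have hne' : ∀ x, (μ : ℂ) + Complex.exp (line y x) ≠ 0 := fun x =>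
    Complex.slitPlane_ne_zero (add_exp_mem_slitPlane (by simpa using hy) hμ)
  have hc1 : 0 < |Real.cos (y / 2)| := by
    rw [abs_lt] at hy
    exact abs_pos.2 (Real.cos_pos_of_mem_Ioo ⟨by linarith, by linarith⟩).ne'
  have hc2 : 0 < |Real.sin ((y - w₀.im) / 2)| := by
    rw [abs_lt] at h
    refine abs_pos.2 fun hs => h0 ?_
    rw [Real.sin_eq_zero_iff_of_lt_of_lt (by linarith) (by linarith)] at hs
    linarith
  set c1 := |Real.cos (y / 2)|
  set c2 := |Real.sin ((y - w₀.im) / 2)|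
  have hint : Integrable (fun x => poleFun w₀ μ (line y x)) := by
    refine Integrable.mono' ((integrable_exp_neg_mul_abs one_pos).const_mul
      ((‖Complex.exp w₀ + μ‖) / (c1 * c2) * max 1 (1 / (Real.exp w₀.re * μ)))) ?_ ?_
    · refine Continuous.aestronglyMeasurable ?_
      have := continuous_line y
      unfold poleFun
      refine Continuous.sub ?_ ?_
      · exact (by fun_prop : Continuous _).div (by fun_prop) hne
      · exact (by fun_prop : Continuous _).div (by fun_prop) hne'
    · refine Eventually.of_forall fun x => ?_
      have h1 := norm_exp_sub_exp_ge (line y x) w₀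
      have h2 := norm_add_exp_ge (line y x) hμ
      simp only [line_im, line_re] at h1 h2
      have heq : poleFun w₀ μ (line y x) = Complex.exp (line y x) * (Complex.exp w₀ + μ) /
          ((Complex.exp (line y x) - Complex.exp w₀) * (μ + Complex.exp (line y x))) := by
        unfold poleFun
        rw [div_sub_div _ _ (hne x) (hne' x)]
        congr 1
        ring
      rw [heq, norm_div, norm_mul, norm_mul, Complex.norm_exp, line_re]
      set A := Real.exp w₀.re
      have hA : 0 < A := Real.exp_pos _
      set ex := Real.exp x
      have hex : 0 < ex := Real.exp_pos _
      have hb : ex / ((ex + A) * (μ + ex)) ≤ max 1 (1 / (A * μ)) * Real.exp (-1 * |x|) := by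
        rcases le_total 0 x with hx | hx
        · rw [abs_of_nonneg hx, neg_one_mul, Real.exp_neg]
          refine le_trans ?_ (mul_le_mul_of_nonneg_right (le_max_left _ _) (by positivity))
          rw [one_mul, div_le_iff₀ (by positivity)]
          change ex ≤ ex⁻¹ * _
          rw [← div_eq_inv_mul, le_div_iff₀ hex]
          nlinarith [mul_pos hA hex, mul_pos hA hμ, mul_pos hex hμ]
        · rw [abs_of_nonpos hx, neg_one_mul, neg_neg]
          refine le_trans ?_ (mul_le_mul_of_nonneg_right (le_max_right _ _) (by positivity))
          change _ ≤ 1 / (A * μ) * ex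
          rw [div_mul_eq_mul_div, one_mul]
          gcongr
          · linarith
          · linarith
      calc _ ≤ ex * ‖Complex.exp w₀ + μ‖ / ((c2 * (ex + A)) * (c1 * (μ + ex))) := by
            gcongr
        _ = ‖Complex.exp w₀ + μ‖ / (c1 * c2) * (ex / ((ex + A) * (μ + ex))) := by
            field_simp
        _ ≤ _ := by
            rw [mul_assoc]
            gcongr
  refine ⟨hint, ?_⟩
  set g : ℝ → ℂ := fun x => Complex.log (1 - Complex.exp (line y x - w₀)) -
    Complex.log (1 + Complex.exp (line y x) / μ) with hg
  have hs1 : ∀ x, 1 - Complex.exp (line y x - w₀) ∈ Complex.slitPlane := fun x =>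
    one_sub_exp_mem_slitPlane (by simpa [sub_eq_zero] using h0) (by simpa using h)
  have hs2 : ∀ x, 1 + Complex.exp (line y x) / μ ∈ Complex.slitPlane := fun x => by
    have := add_exp_mem_slitPlane (ζ := line y x - Real.log μ)
      (by simpa [Complex.log_ofReal_re] using hy) one_pos
    rwa [Complex.exp_sub, ← Complex.ofReal_exp, Real.exp_log hμ, Complex.ofReal_one] at this
  have hderiv : ∀ x, HasDerivAt g (poleFun w₀ μ (line y x)) x := by
    intro x
    have h1 := ((((hasDerivAt_line y x).sub_const w₀).cexp).const_sub 1).clog_real (hs1 x)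
    have h2 := ((((hasDerivAt_line y x).cexp).div_const (μ : ℂ)).const_add 1).clog_real (hs2 x)
    refine (h1.sub h2).congr_deriv (Eq.symm ?_)
    have e1 := hne x
    have e2 := hne' x
    have e3 := Complex.slitPlane_ne_zero (hs1 x)
    have e4 := Complex.slitPlane_ne_zero (hs2 x)
    unfold poleFun
    rw [Complex.exp_sub] at *
    have e5 := Complex.exp_ne_zero w₀
    congr 1
    · rw [div_eq_div_iff e1 e3]
      field_simp
      ring
    · rw [div_eq_div_iff e2 e4]
      field_simp
  have hexp0 : Tendsto (fun x => Complex.exp (line y x)) atBot (𝓝 0) := by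
    rw [tendsto_zero_iff_norm_tendsto_zero]
    simpa [Complex.norm_exp] using Real.tendsto_exp_atBot
  have hbot : Tendsto g atBot (𝓝 0) := by
    have h1 : Tendsto (fun x => 1 - Complex.exp (line y x - w₀)) atBot (𝓝 1) := by
      simpa [Complex.exp_sub] using (hexp0.div_const (Complex.exp w₀)).const_sub 1
    have h2 : Tendsto (fun x => 1 + Complex.exp (line y x) / μ) atBot (𝓝 1) := by
      simpa using (hexp0.div_const (μ : ℂ)).const_add 1
    simpa using (h1.clog Complex.one_mem_slitPlane).sub (h2.clog Complex.one_mem_slitPlane)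
  have htop : Tendsto g atTop (𝓝 (Complex.log (-Complex.exp (-w₀ + y * Complex.I)) -
        Complex.log (Complex.exp (y * Complex.I) / μ))) := by
    have hr : Tendsto (fun x : ℝ => ((Real.exp (-x) : ℝ) : ℂ)) atTop (𝓝 0) := by
      exact_mod_cast (Complex.continuous_ofReal.tendsto 0).comp
        (Real.tendsto_exp_atBot.comp tendsto_neg_atTop_atBot)
    have h1 : Tendsto (fun x : ℝ => ((Real.exp (-x) : ℝ) : ℂ) - Complex.exp (-w₀ + y * Complex.I))
        atTop (𝓝 (-Complex.exp (-w₀ + y * Complex.I))) := by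
      simpa using hr.sub_const (Complex.exp (-w₀ + y * Complex.I))
    have h2 : Tendsto (fun x : ℝ => ((Real.exp (-x) : ℝ) : ℂ) + Complex.exp (y * Complex.I) / μ)
        atTop (𝓝 (Complex.exp (y * Complex.I) / μ)) := by
      simpa using hr.add_const (Complex.exp (y * Complex.I) / μ)
    have hm1 : -Complex.exp (-w₀ + y * Complex.I) ∈ Complex.slitPlane := by
      have hζ : (-w₀ + y * Complex.I).im = y - w₀.im := by simp; ring
      rw [Complex.mem_slitPlane_iff, Complex.neg_im, Complex.neg_re, Complex.exp_re,
        Complex.exp_im, hζ]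
      by_cases hs : Real.sin (y - w₀.im) = 0
      · left
        have h3 : Real.cos (y - w₀.im) = -1 := by
          have := Real.sin_sq_add_cos_sq (y - w₀.im)
          rw [hs] at this
          have h4 : (Real.cos (y - w₀.im) - 1) * (Real.cos (y - w₀.im) + 1) = 0 := by
            linear_combination this
          rcases mul_eq_zero.1 h4 with h5 | h5
          · rw [abs_lt] at h
            have := (Real.cos_eq_one_iff_of_lt_of_lt h.1 h.2).1 (by linarith)
            exact absurd (by linarith) h0
          · linarith
        rw [h3]
        linarith [Real.exp_pos (-w₀ + y * Complex.I).re]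
      · right
        exact neg_ne_zero.2 (mul_ne_zero (Real.exp_pos _).ne' hs)
    have hm2 : Complex.exp (y * Complex.I) / μ ∈ Complex.slitPlane := by
      have : Complex.exp (y * Complex.I) / μ =
          Complex.exp (y * Complex.I + ((-Real.log μ : ℝ) : ℂ)) := by
        rw [Complex.exp_add, ← Complex.ofReal_exp, Real.exp_neg, Real.exp_log hμ]
        push_cast
        rfl
      rw [this, Complex.mem_slitPlane_iff_arg]
      refine ⟨?_, Complex.exp_ne_zero _⟩
      rw [← Complex.log_im, Complex.log_exp (by simpa using (abs_lt.1 hy).1)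
        (by simpa using (abs_lt.1 hy).2.le)]
      simpa using (abs_lt.1 hy).2.ne
    -- The factor `e^x` common to both arguments is positive; its logarithm splits off and cancels
    -- in the difference.
    refine ((h1.clog hm1).sub (h2.clog hm2)).congr fun x => ?_
    have k1 : 1 - Complex.exp (line y x - w₀) = (Real.exp x : ℝ) *
        (((Real.exp (-x) : ℝ) : ℂ) - Complex.exp (-w₀ + y * Complex.I)) := by
      rw [mul_sub, ← Complex.ofReal_mul, ← Real.exp_add, add_neg_cancel, Real.exp_zero,
        Complex.ofReal_exp, ← Complex.exp_add]
      simp only [line, Complex.ofReal_one]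
      congr 2
      ring
    have k2 : 1 + Complex.exp (line y x) / μ = (Real.exp x : ℝ) *
        (((Real.exp (-x) : ℝ) : ℂ) + Complex.exp (y * Complex.I) / μ) := by
      rw [mul_add, ← Complex.ofReal_mul, ← Real.exp_add, add_neg_cancel, Real.exp_zero,
        Complex.ofReal_exp, ← mul_div_assoc, ← Complex.exp_add]
      simp only [line, Complex.ofReal_one]
    have n1 := Complex.slitPlane_ne_zero (hs1 x)
    have n2 := Complex.slitPlane_ne_zero (hs2 x)
    simp only [hg]
    rw [k1] at n1 ⊢
    rw [k2] at n2 ⊢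
    rw [Complex.log_ofReal_mul (Real.exp_pos x) (right_ne_zero_of_mul n1),
      Complex.log_ofReal_mul (Real.exp_pos x) (right_ne_zero_of_mul n2)]
    ring
  simpa using integral_of_hasDerivAt_of_tendsto hderiv hint hbot htop

/-- The residue at `w₀` shows up as the jump of the logarithm: the sign in `-e^{-w₀ ± iω}`
contributes `+iπ` on the lower line and `-iπ` on the upper line. The other pole `-μ` lies outside of
the sector and contributes nothing. -/
theorem integral_poleFun {w₀ : ℂ} {μ ω : ℝ} (hμ : 0 < μ) (hω : ω < Real.pi)
    (h : |w₀.im| < ω) :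
    (∫ x, poleFun w₀ μ (line (-ω) x)) - (∫ x, poleFun w₀ μ (line ω x)) =
      2 * Real.pi * Complex.I := by
  have h' := abs_lt.1 h
  have hω0 : 0 < ω := (abs_nonneg _).trans_lt h
  have hpi := Real.pi_pos
  rw [(poleFun_line hμ (y := -ω) (by rw [abs_neg, abs_of_pos hω0]; exact hω) (by linarith)
      (by rw [abs_lt]; constructor <;> linarith)).2,
    (poleFun_line hμ (y := ω) (by rw [abs_of_pos hω0]; exact hω) (by linarith)
      (by rw [abs_lt]; constructor <;> linarith)).2]
  have hlog : ∀ y : ℝ, |y| < Real.pi → Complex.log (Complex.exp (y * Complex.I) / μ) =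
      y * Complex.I - Real.log μ := by
    intro y hy
    have : Complex.exp (y * Complex.I) / μ = Complex.exp (y * Complex.I - (Real.log μ : ℝ)) := by
      rw [Complex.exp_sub, ← Complex.ofReal_exp, Real.exp_log hμ]
    rw [this, Complex.log_exp (by simpa [Complex.log_ofReal_re] using (abs_lt.1 hy).1)
      (by simpa [Complex.log_ofReal_re] using (abs_lt.1 hy).2.le)]
  have hlog1 : Complex.log (-Complex.exp (-w₀ + (-ω : ℝ) * Complex.I)) =
      -w₀ + (-ω : ℝ) * Complex.I + Real.pi * Complex.I := by
    have : -Complex.exp (-w₀ + (-ω : ℝ) * Complex.I) =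
        Complex.exp (-w₀ + (-ω : ℝ) * Complex.I + Real.pi * Complex.I) := by
      rw [Complex.exp_add _ (Real.pi * Complex.I), Complex.exp_pi_mul_I]; ring
    rw [this, Complex.log_exp] <;> simp <;> linarith
  have hlog2 : Complex.log (-Complex.exp (-w₀ + (ω : ℝ) * Complex.I)) =
      -w₀ + (ω : ℝ) * Complex.I - Real.pi * Complex.I := by
    have : -Complex.exp (-w₀ + (ω : ℝ) * Complex.I) =
        Complex.exp (-w₀ + (ω : ℝ) * Complex.I - Real.pi * Complex.I) := by
      rw [Complex.exp_sub _ (Real.pi * Complex.I), Complex.exp_pi_mul_I]; ring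
    rw [this, Complex.log_exp] <;> simp <;> linarith
  rw [hlog1, hlog2, hlog _ (by rw [abs_neg, abs_of_pos hω0]; exact hω),
    hlog _ (by rw [abs_of_pos hω0]; exact hω)]
  push_cast
  ring

theorem differentiableOn_exp_div {a b : ℝ} {ζ : ℂ}
    (h : ∀ w ∈ strip a b, Complex.exp ζ - Complex.exp w ≠ 0) :
    DifferentiableOn ℂ (fun w => Complex.exp w / (Complex.exp ζ - Complex.exp w)) (strip a b) :=
  Complex.differentiable_exp.differentiableOn.div
    ((differentiableOn_const _).sub Complex.differentiable_exp.differentiableOn) h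

theorem norm_exp_div_exp_sub_exp_le {ζ w : ℂ} (h : Real.sin ((ζ.im - w.im) / 2) ≠ 0) :
    ‖Complex.exp ζ / (Complex.exp ζ - Complex.exp w)‖ ≤ |Real.sin ((ζ.im - w.im) / 2)|⁻¹ := by
  have h1 := norm_exp_sub_exp_ge ζ w
  have h2 := abs_pos.2 h
  have h3 : 0 < ‖Complex.exp ζ - Complex.exp w‖ := lt_of_lt_of_le
    (mul_pos h2 (by positivity)) h1
  rw [norm_div, div_le_iff₀ h3, ← div_eq_inv_mul, le_div_iff₀ h2, Complex.norm_exp]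
  nlinarith [Real.exp_pos w.re]

/-- Cauchy's integral formula for a sector, in logarithmic coordinates. -/
theorem StripDecay.cauchy_formula {ω : ℝ} {e : ℂ → ℂ} (he : StripDecay (-ω) ω e)
    (hω : ω < Real.pi) {w₀ : ℂ} (h : |w₀.im| < ω) :
    (∫ x, e (line (-ω) x) * (Complex.exp (line (-ω) x) /
        (Complex.exp (line (-ω) x) - Complex.exp w₀))) -
      (∫ x, e (line ω x) * (Complex.exp (line ω x) /
        (Complex.exp (line ω x) - Complex.exp w₀))) = 2 * Real.pi * Complex.I * e w₀ := by
  have h' := abs_lt.1 h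
  have hω0 : 0 < ω := (abs_nonneg _).trans_lt h
  have hpi := Real.pi_pos
  have hz1 : ∀ ζ ∈ strip (-ω) ω, 1 + Complex.exp ζ ≠ 0 := fun ζ hζ => by
    have := Complex.slitPlane_ne_zero (add_exp_mem_slitPlane (ζ := ζ)
      (abs_lt.2 ⟨by linarith [hζ.1], by linarith [hζ.2]⟩) one_pos)
    simpa using this
  have hw₀ : w₀ ∈ strip (-ω) ω := ⟨h'.1.le, h'.2.le⟩
  have hnhds : strip (-ω) ω ∈ 𝓝 w₀ := by
    have : IsOpen {w : ℂ | -ω < w.im ∧ w.im < ω} :=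
      (isOpen_lt continuous_const Complex.continuous_im).inter
        (isOpen_lt Complex.continuous_im continuous_const)
    exact mem_of_superset (this.mem_nhds h') fun w hw => ⟨hw.1.le, hw.2.le⟩
  -- The multiple of `1 / (1 + e^ζ)` to be subtracted is the one that makes the numerator vanish at
  -- `w₀`. What it contributes is `e(w₀)` times `poleFun` with `μ = 1`, whose integral is known.
  set c := e w₀ * (1 + Complex.exp w₀) with hc
  set n : ℂ → ℂ := fun ζ => e ζ - c / (1 + Complex.exp ζ) with hn
  have hn0 : n w₀ = 0 := by
    simp only [hn, hc]
    rw [mul_div_assoc, div_self (hz1 _ hw₀), mul_one, sub_self]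
  have hnd : DifferentiableOn ℂ n (strip (-ω) ω) :=
    he.1.sub ((differentiableOn_const _).div
      ((differentiableOn_const _).add Complex.differentiable_exp.differentiableOn) hz1)
  -- The quotient of two divided differences at `w₀` removes the singularity, since the one of `exp`
  -- has no zero in the strip.
  set H : ℂ → ℂ := fun ζ => dslope n w₀ ζ / dslope Complex.exp w₀ ζ * Complex.exp ζ with hH
  have hHne : ∀ ζ, ζ ≠ w₀ → H ζ = n ζ * (Complex.exp ζ / (Complex.exp ζ - Complex.exp w₀)) := by
    intro ζ hζ
    have : ζ - w₀ ≠ 0 := sub_ne_zero.2 hζ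
    simp only [hH, dslope_of_ne _ hζ, slope, vsub_eq_sub, smul_eq_mul, hn0, sub_zero]
    rw [mul_div_mul_left _ _ (inv_ne_zero this)]
    ring
  have hden : ∀ ζ ∈ strip (-ω) ω, dslope Complex.exp w₀ ζ ≠ 0 := by
    intro ζ hζ
    by_cases hζw : ζ = w₀
    · rw [hζw, dslope_same]
      simp [Complex.exp_ne_zero]
    · rw [dslope_of_ne _ hζw, slope, vsub_eq_sub, smul_eq_mul]
      refine mul_ne_zero (inv_ne_zero (sub_ne_zero.2 hζw)) (sub_ne_zero.2 fun heq => hζw ?_)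
      exact Complex.exp_inj_of_neg_pi_lt_of_le_pi (by linarith [hζ.1]) (by linarith [hζ.2])
        (by linarith) (by linarith) heq
  have hHd : DifferentiableOn ℂ H (strip (-ω) ω) :=
    (((Complex.differentiableOn_dslope hnhds).2 hnd).div
      ((Complex.differentiableOn_dslope hnhds).2 Complex.differentiable_exp.differentiableOn)
      hden).mul Complex.differentiable_exp.differentiableOn
  obtain ⟨C, δ, hC0, hδ, hC⟩ := he.exists_pos
  set k := Real.cos (ω / 2) with hk
  have hk0 : 0 < k := Real.cos_pos_of_mem_Ioo ⟨by linarith, by linarith⟩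
  have hcos : ∀ ζ ∈ strip (-ω) ω, k ≤ |Real.cos (ζ.im / 2)| := by
    intro ζ hζ
    refine le_trans ?_ (le_abs_self _)
    rw [hk, ← Real.cos_abs (ζ.im / 2)]
    refine Real.cos_le_cos_of_nonneg_of_le_pi (abs_nonneg _) (by linarith) ?_
    rw [abs_le]
    exact ⟨by linarith [hζ.1], by linarith [hζ.2]⟩
  have hHs : StripDecay (-ω) ω H := by
    refine StripDecay.of_eventually (x₀ := |w₀.re| + 1) (δ := min δ 1)
      (C := 2 * C + 2 * ‖c‖ / k * (1 + Real.exp (-w₀.re))) hHd (lt_min hδ one_pos) ?_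
    intro ζ hζ hx
    have hζw : ζ ≠ w₀ := by
      rintro rfl
      linarith
    rw [hHne ζ hζw, norm_mul]
    set x := ζ.re
    have hx0 := abs_nonneg x
    have hq1 : ‖Complex.exp ζ / (Complex.exp ζ - Complex.exp w₀)‖ ≤ 2 ∧
        (x ≤ 0 → ‖Complex.exp ζ / (Complex.exp ζ - Complex.exp w₀)‖ ≤
          2 * Real.exp (-w₀.re) * Real.exp x) := by
      have hd := abs_norm_sub_norm_le (Complex.exp ζ) (Complex.exp w₀)
      rw [Complex.norm_exp, Complex.norm_exp] at hd
      change |Real.exp x - _| ≤ _ at hd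
      have he1 : 2 * Real.exp (-1) ≤ 1 := by
        have := Real.add_one_le_exp 1
        rw [Real.exp_neg]
        have h3 := Real.exp_pos 1
        rw [← div_eq_mul_inv, div_le_one h3]
        linarith
      rw [norm_div, Complex.norm_exp]
      change Real.exp x / _ ≤ _ ∧ (_ → Real.exp x / _ ≤ _)
      set D := ‖Complex.exp ζ - Complex.exp w₀‖
      have hpx := Real.exp_pos x
      have hpw := Real.exp_pos w₀.re
      rcases le_total 0 x with h0 | h0
      · rw [abs_of_nonneg h0] at hx
        have h1 : Real.exp w₀.re ≤ Real.exp (-1) * Real.exp x := by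
          rw [← Real.exp_add, Real.exp_le_exp]
          linarith [le_abs_self w₀.re]
        have h2 : Real.exp x ≤ 2 * D := by
          have := (le_abs_self _).trans hd
          nlinarith
        have hD : 0 < D := by linarith
        refine ⟨by rw [div_le_iff₀ hD]; exact h2, fun hx0 => ?_⟩
        have : x = 0 := le_antisymm hx0 h0
        exfalso
        rw [this] at hx
        linarith [abs_nonneg w₀.re]
      · rw [abs_of_nonpos h0] at hx
        have h1 : Real.exp x ≤ Real.exp (-1) * Real.exp w₀.re := by
          rw [← Real.exp_add, Real.exp_le_exp]
          linarith [neg_abs_le w₀.re]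
        have h2 : Real.exp w₀.re ≤ 2 * D := by
          have := (neg_abs_le _).trans' (neg_le_neg hd)
          nlinarith
        have hD : 0 < D := by linarith
        refine ⟨by rw [div_le_iff₀ hD]; nlinarith, fun _ => ?_⟩
        rw [div_le_iff₀ hD, Real.exp_neg]
        have : 1 ≤ 2 * (Real.exp w₀.re)⁻¹ * D := by
          rw [mul_assoc, mul_comm _ D, ← mul_assoc, ← div_eq_mul_inv, one_le_div hpw]
          exact h2
        nlinarith
    have hr : ‖c / (1 + Complex.exp ζ)‖ ≤ ‖c‖ / (k * (1 + Real.exp x)) := by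
      have := norm_add_exp_ge ζ one_pos
      rw [Complex.ofReal_one] at this
      rw [norm_div]
      have := hcos ζ hζ
      gcongr
      refine le_trans ?_ ‹_›
      gcongr
    have hexp1 : Real.exp (-δ * |x|) ≤ Real.exp (-(min δ 1) * |x|) := by
      gcongr; exact min_le_left _ _
    have hexp2 : Real.exp (-1 * |x|) ≤ Real.exp (-(min δ 1) * |x|) := by
      gcongr; exact min_le_right _ _
    set Q := ‖Complex.exp ζ / (Complex.exp ζ - Complex.exp w₀)‖
    have hQ0 : 0 ≤ Q := norm_nonneg _
    have hrQ : ‖c / (1 + Complex.exp ζ)‖ * Q ≤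
        2 * ‖c‖ / k * (1 + Real.exp (-w₀.re)) * Real.exp (-1 * |x|) := by
      have hpw := Real.exp_pos (-w₀.re)
      rcases le_total 0 x with h0 | h0
      · rw [abs_of_nonneg h0, neg_one_mul, Real.exp_neg x]
        calc _ ≤ ‖c‖ / (k * Real.exp x) * 2 := by
              refine mul_le_mul (hr.trans ?_) hq1.1 hQ0 (by positivity)
              gcongr
              linarith
          _ = 2 * ‖c‖ / k * 1 * (Real.exp x)⁻¹ := by field_simp
          _ ≤ _ := by gcongr; exact le_add_of_nonneg_right (by positivity)
      · rw [abs_of_nonpos h0, neg_one_mul, neg_neg]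
        calc _ ≤ ‖c‖ / (k * 1) * (2 * Real.exp (-w₀.re) * Real.exp x) := by
              refine mul_le_mul (hr.trans ?_) (hq1.2 h0) hQ0 (by positivity)
              gcongr
              linarith [Real.exp_pos x]
          _ = 2 * ‖c‖ / k * Real.exp (-w₀.re) * Real.exp x := by field_simp
          _ ≤ _ := by gcongr; linarith
    calc ‖n ζ‖ * Q ≤ (‖e ζ‖ + ‖c / (1 + Complex.exp ζ)‖) * Q := by
          gcongr; exact norm_sub_le _ _
      _ = ‖e ζ‖ * Q + ‖c / (1 + Complex.exp ζ)‖ * Q := add_mul _ _ _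
      _ ≤ C * Real.exp (-δ * |x|) * 2 +
          2 * ‖c‖ / k * (1 + Real.exp (-w₀.re)) * Real.exp (-1 * |x|) := by
          refine add_le_add (mul_le_mul (hC ζ hζ) hq1.1 hQ0 (by positivity)) hrQ
      _ ≤ C * Real.exp (-(min δ 1) * |x|) * 2 +
          2 * ‖c‖ / k * (1 + Real.exp (-w₀.re)) * Real.exp (-(min δ 1) * |x|) := by
          gcongr
      _ = _ := by ring
  have key : ∀ y : ℝ, |y| = ω → ∫ x, e (line y x) * (Complex.exp (line y x) /
        (Complex.exp (line y x) - Complex.exp w₀)) =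
        (∫ x, H (line y x)) + e w₀ * ∫ x, poleFun w₀ 1 (line y x) := by
    intro y hy
    have hy' : y ∈ Icc (-ω) ω := abs_le.1 hy.le
    have hyne : y ≠ w₀.im := by rintro rfl; exact absurd hy h.ne
    have hyd : |y - w₀.im| < 2 * Real.pi :=
      abs_lt.2 ⟨by linarith [hy'.1], by linarith [hy'.2]⟩
    rw [← integral_const_mul, ← integral_add (hHs.integrable hy')
      ((poleFun_line one_pos (by rw [hy]; exact hω) hyne hyd).1.const_mul _)]
    refine integral_congr_ae (Eventually.of_forall fun x => ?_)
    have hlw : line y x ≠ w₀ := by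
      intro hh
      apply hyne
      rw [← hh, line_im]
    have n1 := hz1 (line y x) ⟨by simpa using hy'.1, by simpa using hy'.2⟩
    have n2 : Complex.exp (line y x) - Complex.exp w₀ ≠ 0 :=
      exp_sub_exp_ne_zero (by simpa using hyne) (by simpa using hyd)
    simp only [hHne _ hlw, poleFun, hn, hc, Complex.ofReal_one]
    field_simp
    ring
  rw [key (-ω) (by rw [abs_neg, abs_of_pos hω0]), key ω (abs_of_pos hω0),
    hHs.integral_eq (by linarith)]
  have := integral_poleFun (μ := 1) one_pos hω h
  linear_combination e w₀ * this

end CauchyFormula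

end

section

section Calculus

open Filter Topology

variable {X : Type*} [NormedAddCommGroup X] [NormedSpace ℂ X]

/-! ### Resolvents of sectorial operators -/

/-- Stating the position relative to the sector through `cos (Im w)` makes it independent of the
choice of the logarithm, and treats both sides of the sector at once. -/
theorem exp_notMem_sector {w : ℂ} {ψ : ℝ} (h1 : ψ ≤ Real.pi)
    (h : Real.cos w.im < Real.cos ψ) : Complex.exp w ∉ sector ψ := by
  rintro (h' | h')
  · have h2 : Real.cos ψ ≤ Real.cos |(Complex.exp w).arg| :=
      Real.cos_le_cos_of_nonneg_of_le_pi (abs_nonneg _) h1 h'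
    rw [Real.cos_abs, Complex.cos_arg (Complex.exp_ne_zero _), Complex.exp_re, Complex.norm_exp,
      mul_div_cancel_left₀ _ (Real.exp_pos _).ne'] at h2
    linarith
  · exact Complex.exp_ne_zero _ h'

theorem resolvent_identity {A : X →ₗ.[ℂ] X} {z w : ℂ} (hz : ∃ R, IsResolvent A z R)
    (hw : ∃ R, IsResolvent A w R) :
    res A z - res A w = (w - z) • (res A z * res A w) := by
  ext y
  obtain ⟨h1, h2⟩ := (isResolvent_res hw).right_inv y
  have h3 := (isResolvent_res hz).left_inv ⟨_, h1⟩
  set v := res A w y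
  simp only [sub_apply, smul_apply, mul_apply_eq_comp]
  have h4 : res A z y = v + (w - z) • res A z v := by
    have h5 : y = (z • v - A ⟨v, h1⟩) + (w - z) • v := by
      nth_rewrite 1 [← h2]
      rw [sub_smul]; abel
    nth_rewrite 1 [h5]
    rw [map_add, map_smul, h3]
  rw [h4, add_sub_cancel_left]

theorem commute_res {A : X →ₗ.[ℂ] X} {z w : ℂ} (hz : ∃ R, IsResolvent A z R)
    (hw : ∃ R, IsResolvent A w R) : Commute (res A z) (res A w) := by
  rcases eq_or_ne z w with rfl | hne
  · exact Commute.refl _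
  have h1 := resolvent_identity hz hw
  have h2 := resolvent_identity hw hz
  have h3 : (w - z) • (res A z * res A w) = (w - z) • (res A w * res A z) := by
    rw [← h1, ← neg_sub, h2, ← neg_smul, neg_sub]
  exact smul_right_injective _ (sub_ne_zero.2 hne.symm) h3

/-- The scaled resolvent `z R(z, A)` at `z = e^w`. -/
def scaledRes (A : X →ₗ.[ℂ] X) (w : ℂ) : X →L[ℂ] X := Complex.exp w • res A (Complex.exp w)

/-- The Yosida-type approximant `μ (μ + A)⁻¹`. -/
def yos (A : X →ₗ.[ℂ] X) (μ : ℝ) : X →L[ℂ] X := (μ : ℂ) • (-res A (-(μ : ℂ)))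

theorem yos_one (A : X →ₗ.[ℂ] X) : yos A 1 = -res A (-1) := by simp [yos]

theorem scaledRes_add_two_pi (A : X →ₗ.[ℂ] X) (w : ℂ) :
    scaledRes A (w + 2 * Real.pi * Complex.I) = scaledRes A w := by
  simp [scaledRes, Complex.exp_periodic w]

theorem yos_eq_scaledRes (A : X →ₗ.[ℂ] X) {μ : ℝ} (hμ : 0 < μ) :
    yos A μ = scaledRes A (line Real.pi (Real.log μ)) := by
  have : Complex.exp (line Real.pi (Real.log μ)) = -(μ : ℂ) := by
    rw [line, Complex.exp_add, Complex.exp_pi_mul_I, ← Complex.ofReal_exp, Real.exp_log hμ]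
    ring
  rw [scaledRes, this, yos, smul_neg, neg_smul]

variable {A : X →ₗ.[ℂ] X} {φ : ℝ}

theorem IsSectorial.exists_res_exp (hA : IsSectorial A φ) (hφ : φ ∈ Ioo 0 Real.pi) {w : ℂ}
    (h : Real.cos w.im < Real.cos φ) : ∃ R, IsResolvent A (Complex.exp w) R :=
  hA.exists_resolvent _ (exp_notMem_sector hφ.2.le h)

theorem IsSectorial.exists_res_neg (hA : IsSectorial A φ) (hφ : φ ∈ Ioo 0 Real.pi) {μ : ℝ}
    (hμ : 0 < μ) : ∃ R, IsResolvent A (-(μ : ℂ)) R := by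
  have := hA.exists_res_exp hφ (w := line Real.pi (Real.log μ)) (by
    simpa using Real.cos_lt_cos_of_nonneg_of_le_pi hφ.1.le le_rfl hφ.2)
  rwa [line, Complex.exp_add, Complex.exp_pi_mul_I, ← Complex.ofReal_exp, Real.exp_log hμ,
    mul_neg_one] at this

theorem cos_lt_cos_of_mem {φ ω : ℝ} (hφ : φ ∈ Ioo 0 Real.pi) (hω : ω ∈ Ioo φ Real.pi) :
    Real.cos ω < Real.cos φ :=
  Real.cos_lt_cos_of_nonneg_of_le_pi hφ.1.le hω.2.le hω.1

/-- The definition gives a bound off the closed sectors of larger angle only. The boundary rays of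
angle `ω` itself are covered by using the intermediate angle `(φ + ω) / 2`. -/
theorem IsSectorial.exists_scaledRes_bound (hA : IsSectorial A φ) (hφ : φ ∈ Ioo 0 Real.pi) {ω : ℝ}
    (hω : ω ∈ Ioo φ Real.pi) :
    ∃ M : ℝ, 0 < M ∧ ∀ w : ℂ, Real.cos w.im ≤ Real.cos ω → ‖scaledRes A w‖ ≤ M := by
  have hψ : (φ + ω) / 2 ∈ Ioo φ ω := ⟨by linarith [hω.1], by linarith [hω.1]⟩
  obtain ⟨M, hM⟩ := hA.bound ((φ + ω) / 2) hψ.1 (hψ.2.trans hω.2)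
  refine ⟨max M 1, lt_max_of_lt_right one_pos, fun w hw => ?_⟩
  refine (hM _ (exp_notMem_sector (hψ.2.trans hω.2).le (hw.trans_lt ?_))).trans (le_max_left _ _)
  exact Real.cos_lt_cos_of_nonneg_of_le_pi (by linarith [hφ.1, hω.1]) hω.2.le hψ.2

/-- The resolvent identity and the local bound give continuity; inserted in the identity again,
continuity gives convergence of the difference quotients. -/
theorem IsSectorial.differentiableAt_scaledRes (hA : IsSectorial A φ) (hφ : φ ∈ Ioo 0 Real.pi)
    {w₀ : ℂ} (h : Real.cos w₀.im < Real.cos φ) : DifferentiableAt ℂ (scaledRes A) w₀ := by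
  obtain ⟨ω, hω1, hω2⟩ : ∃ ω ∈ Ioo φ Real.pi, Real.cos w₀.im < Real.cos ω := by
    have hc : ContinuousAt Real.cos φ := Real.continuous_cos.continuousAt
    have h1 : ∀ᶠ ω in 𝓝[>] φ, Real.cos w₀.im < Real.cos ω :=
      (hc.eventually_const_lt h).filter_mono nhdsWithin_le_nhds
    obtain ⟨ω, h2, h3⟩ := (h1.and (Ioo_mem_nhdsGT hφ.2)).exists
    exact ⟨ω, h3, h2⟩
  obtain ⟨M, hM0, hM⟩ := hA.exists_scaledRes_bound hφ hω1
  have hU : ∀ᶠ w : ℂ in 𝓝 w₀, Real.cos w.im < Real.cos ω :=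
    ((Real.continuous_cos.comp Complex.continuous_im).continuousAt).eventually_lt_const hω2
  set f : ℂ → X →L[ℂ] X := fun w => res A (Complex.exp w) with hf
  have hlt := cos_lt_cos_of_mem hφ hω1
  have hid : ∀ᶠ w in 𝓝 w₀, f w - f w₀ = (Complex.exp w₀ - Complex.exp w) • (f w * f w₀) := by
    filter_upwards [hU] with w hw
    exact resolvent_identity (hA.exists_res_exp hφ (hw.trans hlt)) (hA.exists_res_exp hφ h)
  have hfM : ∀ w : ℂ, Real.cos w.im < Real.cos ω → ‖f w‖ ≤ M * Real.exp (-w.re) := by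
    intro w hw
    have := hM w hw.le
    rw [scaledRes, norm_smul, Complex.norm_exp] at this
    rw [Real.exp_neg, ← div_eq_mul_inv, le_div_iff₀ (Real.exp_pos _), mul_comm]
    exact this
  have hcont : Tendsto f (𝓝 w₀) (𝓝 (f w₀)) := by
    rw [tendsto_iff_norm_sub_tendsto_zero]
    have hlim : Tendsto (fun w : ℂ => ‖Complex.exp w₀ - Complex.exp w‖ *
        (M * Real.exp (-w.re) * ‖f w₀‖)) (𝓝 w₀) (𝓝 0) := by
      have : Continuous fun w : ℂ => ‖Complex.exp w₀ - Complex.exp w‖ *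
        (M * Real.exp (-w.re) * ‖f w₀‖) := by fun_prop
      simpa using this.tendsto w₀
    refine squeeze_zero' (Eventually.of_forall fun _ => norm_nonneg _) ?_ hlim
    filter_upwards [hid, hU] with w hw hw'
    rw [hw, norm_smul]
    gcongr
    refine (norm_mul_le _ _).trans ?_
    gcongr
    exact hfM w hw'
  have hder : HasDerivAt f (-(Complex.exp w₀ • (f w₀ * f w₀))) w₀ := by
    rw [hasDerivAt_iff_tendsto_slope]
    have h1 := hasDerivAt_iff_tendsto_slope.1 (Complex.hasDerivAt_exp w₀)
    have h2 : Tendsto (fun w => -(slope Complex.exp w₀ w • (f w * f w₀))) (𝓝[≠] w₀)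
        (𝓝 (-(Complex.exp w₀ • (f w₀ * f w₀)))) :=
      (h1.smul ((hcont.mono_left nhdsWithin_le_nhds).mul_const (f w₀))).neg
    refine h2.congr' ?_
    filter_upwards [hid.filter_mono nhdsWithin_le_nhds] with w hw
    simp only [slope, vsub_eq_sub]
    rw [hw, smul_eq_mul, smul_smul, ← neg_smul]
    congr 1
    ring
  exact (Complex.differentiable_exp w₀).smul hder.differentiableAt

theorem IsSectorial.continuous_scaledRes_line (hA : IsSectorial A φ) (hφ : φ ∈ Ioo 0 Real.pi)
    {y : ℝ} (h : Real.cos y < Real.cos φ) : Continuous fun x => scaledRes A (line y x) := by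
  rw [continuous_iff_continuousAt]
  intro x
  have := (hA.differentiableAt_scaledRes hφ (w₀ := line y x) (by simpa using h)).continuousAt
  exact this.comp (continuous_line y).continuousAt

/-! ### The functional calculus in logarithmic coordinates -/

/-- The functional calculus integral along the boundary of the sector of half-angle `ω`, for a
function `g` of the logarithmic variable. -/
def stripCalc (A : X →ₗ.[ℂ] X) (ω : ℝ) (g : ℂ → ℂ) : X →L[ℂ] X :=
  (2 * (Real.pi : ℂ) * Complex.I)⁻¹ •
    ((∫ x, g (line (-ω) x) • scaledRes A (line (-ω) x)) -
      ∫ x, g (line ω x) • scaledRes A (line ω x))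

theorem integral_Ioi_eq_integral_exp {E : Type*} [NormedAddCommGroup E] [NormedSpace ℝ E]
    (f : ℝ → E) : ∫ r in Ioi (0 : ℝ), f r = ∫ x, Real.exp x • f (Real.exp x) := by
  have := integral_image_eq_integral_abs_deriv_smul (s := univ) (f := Real.exp) (f' := Real.exp)
    MeasurableSet.univ (fun x _ => (Real.hasDerivAt_exp x).hasDerivWithinAt)
    Real.exp_injective.injOn f
  rw [image_univ, Real.range_exp] at this
  rw [this, setIntegral_univ]
  simp [abs_of_pos (Real.exp_pos _)]

theorem sectorCalc_eq_stripCalc (A : X →ₗ.[ℂ] X) (ω : ℝ) (g : ℂ → ℂ) :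
    sectorCalc A ω g = stripCalc A ω (fun w => g (Complex.exp w)) := by
  have key : ∀ y : ℝ, ∫ r in Ioi (0 : ℝ), (g (r * Complex.exp (y * Complex.I)) *
        Complex.exp (y * Complex.I)) • res A (r * Complex.exp (y * Complex.I)) =
      ∫ x, g (Complex.exp (line y x)) • scaledRes A (line y x) := by
    intro y
    rw [integral_Ioi_eq_integral_exp]
    refine integral_congr_ae (Eventually.of_forall fun x => ?_)
    have : Complex.exp (line y x) = (Real.exp x : ℝ) * Complex.exp (y * Complex.I) := by
      rw [line, Complex.exp_add, Complex.ofReal_exp]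
    simp only [scaledRes]
    rw [this, smul_smul, ← Complex.coe_smul, smul_smul]
    congr 1
    ring
  have h1 := key ω
  have h2 := key (-ω)
  simp only [Complex.ofReal_neg, neg_mul] at h2
  rw [sectorCalc, stripCalc, ← h1, ← h2]

section

variable {ω : ℝ} {g g' : ℂ → ℂ}

theorem cos_abs_le_of_eq {y ω : ℝ} (h : |y| = ω) : Real.cos y = Real.cos ω := by
  rw [← h, Real.cos_abs]

theorem IsSectorial.integrable_smul_scaledRes (hA : IsSectorial A φ) (hφ : φ ∈ Ioo 0 Real.pi)
    (hω : ω ∈ Ioo φ Real.pi) {y : ℝ} (hy : |y| = ω) {g : ℝ → ℂ} (hg : Integrable g) :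
    Integrable (fun x => g x • scaledRes A (line y x)) := by
  obtain ⟨M, hM0, hM⟩ := hA.exists_scaledRes_bound hφ hω
  have hlt := cos_lt_cos_of_mem hφ hω
  have hc := cos_abs_le_of_eq hy
  refine (hg.norm.mul_const M).mono' ?_ (Eventually.of_forall fun x => ?_)
  · exact hg.aestronglyMeasurable.smul
      (hA.continuous_scaledRes_line hφ (by rw [hc]; exact hlt)).aestronglyMeasurable
  · rw [norm_smul]
    gcongr
    exact hM _ (by simp [hc])

theorem IsSectorial.integrable_calc (hA : IsSectorial A φ) (hφ : φ ∈ Ioo 0 Real.pi)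
    (hω : ω ∈ Ioo φ Real.pi) {y : ℝ} (hy : |y| = ω) (hg : StripDecay (-ω) ω g) :
    Integrable (fun x => g (line y x) • scaledRes A (line y x)) :=
  hA.integrable_smul_scaledRes hφ hω hy (hg.integrable (abs_le.1 hy.le))

theorem stripCalc_congr (h : ∀ w ∈ strip (-ω) ω, g w = g' w) (hω : 0 ≤ ω) :
    stripCalc A ω g = stripCalc A ω g' := by
  unfold stripCalc
  congr 2
  · refine integral_congr_ae (Eventually.of_forall fun x => ?_)
    simp only
    rw [h _ ⟨by simp, by simp; linarith⟩]
  · refine integral_congr_ae (Eventually.of_forall fun x => ?_)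
    simp only
    rw [h _ ⟨by simp; linarith, by simp⟩]

theorem IsSectorial.stripCalc_sub (hA : IsSectorial A φ) (hφ : φ ∈ Ioo 0 Real.pi)
    (hω : ω ∈ Ioo φ Real.pi) (hg : StripDecay (-ω) ω g) (hg' : StripDecay (-ω) ω g') :
    stripCalc A ω (fun w => g w - g' w) = stripCalc A ω g - stripCalc A ω g' := by
  have h0 : 0 < ω := hφ.1.trans hω.1
  have h1 : |(-ω)| = ω := by rw [abs_neg, abs_of_pos h0]
  have h2 : |ω| = ω := abs_of_pos h0
  unfold stripCalc
  simp only [sub_smul]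
  rw [integral_sub (hA.integrable_calc hφ hω h1 hg) (hA.integrable_calc hφ hω h1 hg'),
    integral_sub (hA.integrable_calc hφ hω h2 hg) (hA.integrable_calc hφ hω h2 hg'), ← smul_sub]
  congr 1
  abel

theorem stripCalc_const_mul (c : ℂ) :
    stripCalc A ω (fun w => c * g w) = c • stripCalc A ω g := by
  unfold stripCalc
  simp only [mul_smul]
  rw [integral_smul, integral_smul, ← smul_sub, smul_comm]

/-- The constant does not depend on the centre `x₀` of the decay, because Lebesgue measure in the
logarithmic variable is translation invariant and the scaled resolvent is bounded on the contour.
The uniformity in `λ` rests on this. -/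
theorem IsSectorial.norm_stripCalc_le (hA : IsSectorial A φ) (hφ : φ ∈ Ioo 0 Real.pi)
    (hω : ω ∈ Ioo φ Real.pi) {δ : ℝ} (hδ : 0 < δ) : ∃ B : ℝ, 0 < B ∧ ∀ (g : ℂ → ℂ) (C x₀ : ℝ),
      0 ≤ C → (∀ w ∈ strip (-ω) ω, ‖g w‖ ≤ C * Real.exp (-δ * |w.re - x₀|)) →
      ‖stripCalc A ω g‖ ≤ B * C := by
  obtain ⟨M, hM0, hM⟩ := hA.exists_scaledRes_bound hφ hω
  have h0 : 0 < ω := hφ.1.trans hω.1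
  set I₀ := ∫ x : ℝ, Real.exp (-δ * |x|) with hI
  have hI0 : 0 ≤ I₀ := integral_nonneg fun x => (Real.exp_pos _).le
  refine ⟨‖(2 * (Real.pi : ℂ) * Complex.I)⁻¹‖ * (M * I₀ + M * I₀) + 1, by positivity,
    fun g C x₀ hC hg => ?_⟩
  have key : ∀ y : ℝ, |y| = ω → ‖∫ x, g (line y x) • scaledRes A (line y x)‖ ≤ C * (M * I₀) := by
    intro y hy
    have hi : Integrable fun x : ℝ => C * M * Real.exp (-δ * |x - x₀|) :=
      ((integrable_exp_neg_mul_abs hδ).comp_sub_right x₀).const_mul _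
    refine (norm_integral_le_of_norm_le hi (Eventually.of_forall fun x => ?_)).trans
      (le_of_eq ?_)
    · rw [norm_smul]
      have h1 := hg (line y x) (by simpa [strip] using abs_le.1 hy.le)
      have h2 := hM (line y x) (by simp [cos_abs_le_of_eq hy])
      rw [line_re] at h1
      calc _ ≤ C * Real.exp (-δ * |x - x₀|) * M := by gcongr
        _ = _ := by ring
    · rw [integral_const_mul, integral_sub_right_eq_self (fun x => Real.exp (-δ * |x|)), hI]
      ring
  unfold stripCalc
  rw [norm_smul]
  have h3 := (norm_sub_le _ _).trans (add_le_add (key (-ω) (by rw [abs_neg, abs_of_pos h0]))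
    (key ω (abs_of_pos h0)))
  calc _ ≤ ‖(2 * (Real.pi : ℂ) * Complex.I)⁻¹‖ * (C * (M * I₀) + C * (M * I₀)) := by gcongr
    _ = ‖(2 * (Real.pi : ℂ) * Complex.I)⁻¹‖ * (M * I₀ + M * I₀) * C := by ring
    _ ≤ _ := by gcongr; linarith

end

/-- The resolvent identity in the form of a decomposition into partial fractions. -/
theorem IsSectorial.yos_mul_scaledRes (hA : IsSectorial A φ) (hφ : φ ∈ Ioo 0 Real.pi) {μ : ℝ}
    (hμ : 0 < μ) {w : ℂ} (hw : Real.cos w.im < Real.cos φ) (hne : (μ : ℂ) + Complex.exp w ≠ 0) :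
    yos A μ * scaledRes A w = (Complex.exp w / (μ + Complex.exp w)) • yos A μ +
      ((μ : ℂ) / (μ + Complex.exp w)) • scaledRes A w := by
  have h := resolvent_identity (hA.exists_res_neg hφ hμ) (hA.exists_res_exp hφ hw)
  have h1 : ((μ : ℂ) + Complex.exp w) • (res A (-(μ : ℂ)) * res A (Complex.exp w)) =
      res A (-(μ : ℂ)) - res A (Complex.exp w) := by
    rw [h]; congr 1; ring
  have h2 : res A (-(μ : ℂ)) * res A (Complex.exp w) = ((μ : ℂ) + Complex.exp w)⁻¹ •
      (res A (-(μ : ℂ)) - res A (Complex.exp w)) := by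
    rw [← h1, smul_smul, inv_mul_cancel₀ hne, one_smul]
  rw [yos, scaledRes, smul_mul_smul_comm, neg_mul, h2, ← smul_neg, neg_sub, smul_smul,
    smul_neg, smul_smul, smul_sub, smul_neg, smul_smul]
  rw [sub_eq_add_neg, add_comm]
  congr 2
  · congr 1; field_simp
  · field_simp

theorem IsSectorial.commute_scaledRes (hA : IsSectorial A φ) (hφ : φ ∈ Ioo 0 Real.pi) {w w' : ℂ}
    (hw : Real.cos w.im < Real.cos φ) (hw' : Real.cos w'.im < Real.cos φ) :
    Commute (scaledRes A w) (scaledRes A w') :=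
  ((commute_res (hA.exists_res_exp hφ hw) (hA.exists_res_exp hφ hw')).smul_left _).smul_right _

variable [CompleteSpace X]

theorem commute_integral {Y : Type*} [MeasurableSpace Y] {μ : Measure Y} {f : Y → X →L[ℂ] X}
    {T : X →L[ℂ] X} (hf : Integrable f μ) (h : ∀ y, Commute T (f y)) :
    Commute T (∫ y, f y ∂μ) := by
  have h1 := ContinuousLinearMap.integral_comp_comm
    (ContinuousLinearMap.mul ℂ (X →L[ℂ] X) T) hf
  have h2 := ContinuousLinearMap.integral_comp_comm
    ((ContinuousLinearMap.mul ℂ (X →L[ℂ] X)).flip T) hf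
  simp only [ContinuousLinearMap.mul_apply', ContinuousLinearMap.flip_apply] at h1 h2
  rw [commute_iff_eq, ← h1, ← h2]
  exact integral_congr_ae (Eventually.of_forall fun y => (h y).eq)

theorem mul_integral_op {Y : Type*} [MeasurableSpace Y] {μ : Measure Y} {f : Y → X →L[ℂ] X}
    (T : X →L[ℂ] X) (hf : Integrable f μ) : T * ∫ y, f y ∂μ = ∫ y, T * f y ∂μ :=
  (ContinuousLinearMap.integral_comp_comm (ContinuousLinearMap.mul ℂ (X →L[ℂ] X) T) hf).symm

theorem integral_op_mul {Y : Type*} [MeasurableSpace Y] {μ : Measure Y} {f : Y → X →L[ℂ] X}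
    (T : X →L[ℂ] X) (hf : Integrable f μ) : (∫ y, f y ∂μ) * T = ∫ y, f y * T ∂μ :=
  (ContinuousLinearMap.integral_comp_comm
    ((ContinuousLinearMap.mul ℂ (X →L[ℂ] X)).flip T) hf).symm

variable {ω : ℝ} {g : ℂ → ℂ}

theorem IsSectorial.commute_stripCalc (hA : IsSectorial A φ) (hφ : φ ∈ Ioo 0 Real.pi)
    (hω : ω ∈ Ioo φ Real.pi) (hg : StripDecay (-ω) ω g) {T : X →L[ℂ] X}
    (hT : ∀ w : ℂ, Real.cos w.im < Real.cos φ → Commute T (scaledRes A w)) :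
    Commute T (stripCalc A ω g) := by
  have h0 : 0 < ω := hφ.1.trans hω.1
  have hlt := cos_lt_cos_of_mem hφ hω
  have h1 : |(-ω)| = ω := by rw [abs_neg, abs_of_pos h0]
  have h2 : |ω| = ω := abs_of_pos h0
  refine Commute.smul_right (Commute.sub_right ?_ ?_) _
  · exact commute_integral (hA.integrable_calc hφ hω h1 hg) fun x =>
      (hT _ (by simpa using hlt)).smul_right _
  · exact commute_integral (hA.integrable_calc hφ hω h2 hg) fun x =>
      (hT _ (by simpa using hlt)).smul_right _

theorem add_exp_ne_zero_of_strip (hω : ω ∈ Ioo φ Real.pi) {w : ℂ} (hw : w ∈ strip (-ω) ω)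
    {μ : ℝ} (hμ : 0 < μ) : (μ : ℂ) + Complex.exp w ≠ 0 :=
  Complex.slitPlane_ne_zero (add_exp_mem_slitPlane
    (abs_lt.2 ⟨by linarith [hw.1, hω.2], by linarith [hw.2, hω.2]⟩) hμ)

theorem cos_half_le {ω : ℝ} (hω : ω < Real.pi) {w : ℂ} (hw : w ∈ strip (-ω) ω) :
    Real.cos (ω / 2) ≤ |Real.cos (w.im / 2)| := by
  refine le_trans ?_ (le_abs_self _)
  rw [← Real.cos_abs (w.im / 2)]
  have : 0 ≤ ω := by linarith [hw.1, hw.2]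
  refine Real.cos_le_cos_of_nonneg_of_le_pi (abs_nonneg _) (by linarith) ?_
  rw [abs_le]
  exact ⟨by linarith [hw.1], by linarith [hw.2]⟩

theorem norm_add_exp_ge_of_strip {ω : ℝ} (hω : ω < Real.pi) {w : ℂ} (hw : w ∈ strip (-ω) ω)
    {μ : ℝ} (hμ : 0 < μ) :
    Real.cos (ω / 2) * (μ + Real.exp w.re) ≤ ‖(μ : ℂ) + Complex.exp w‖ := by
  refine le_trans ?_ (norm_add_exp_ge w hμ)
  gcongr
  exact cos_half_le hω hw

theorem cos_half_pos (hφ : φ ∈ Ioo 0 Real.pi) (hω : ω ∈ Ioo φ Real.pi) :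
    0 < Real.cos (ω / 2) :=
  Real.cos_pos_of_mem_Ioo ⟨by linarith [hφ.1, hω.1, Real.pi_pos], by linarith [hω.2]⟩

theorem StripDecay.mul_exp_div (hφ : φ ∈ Ioo 0 Real.pi) (hω : ω ∈ Ioo φ Real.pi)
    (hg : StripDecay (-ω) ω g) {μ : ℝ} (hμ : 0 < μ) :
    StripDecay (-ω) ω (fun w => Complex.exp w / (μ + Complex.exp w) * g w) := by
  have hk := cos_half_pos hφ hω
  refine hg.mul_bdd (B := (Real.cos (ω / 2))⁻¹) ?_ fun w hw => ?_
  · exact Complex.differentiable_exp.differentiableOn.div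
      ((differentiableOn_const _).add Complex.differentiable_exp.differentiableOn)
      fun w hw => add_exp_ne_zero_of_strip hω hw hμ
  · have h1 := norm_add_exp_ge_of_strip hω.2 hw hμ
    have h2 := norm_pos_iff.2 (add_exp_ne_zero_of_strip hω hw hμ)
    rw [norm_div, Complex.norm_exp, div_le_iff₀ h2, ← div_eq_inv_mul, le_div_iff₀ hk]
    nlinarith [Real.exp_pos w.re]

theorem StripDecay.mul_div_add_exp (hφ : φ ∈ Ioo 0 Real.pi) (hω : ω ∈ Ioo φ Real.pi)
    (hg : StripDecay (-ω) ω g) {μ : ℝ} (hμ : 0 < μ) :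
    StripDecay (-ω) ω (fun w => (μ : ℂ) / (μ + Complex.exp w) * g w) := by
  refine (hg.sub (hg.mul_exp_div hφ hω hμ)).congr fun w hw => ?_
  have := add_exp_ne_zero_of_strip hω hw hμ
  field_simp
  ring

/-- Partial fractions produce the desired integral and a scalar multiple of `yos A μ`. The scalars
are integrals of one function over the two boundary lines; as `-μ` is outside of the sector, the
function is holomorphic in the strip and the scalars cancel. -/
theorem IsSectorial.yos_mul_stripCalc (hA : IsSectorial A φ) (hφ : φ ∈ Ioo 0 Real.pi)
    (hω : ω ∈ Ioo φ Real.pi) (hg : StripDecay (-ω) ω g) {μ : ℝ} (hμ : 0 < μ) :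
    yos A μ * stripCalc A ω g =
      stripCalc A ω (fun w => (μ : ℂ) / (μ + Complex.exp w) * g w) := by
  have h0 : 0 < ω := hφ.1.trans hω.1
  have hlt := cos_lt_cos_of_mem hφ hω
  have h1 : |(-ω)| = ω := by rw [abs_neg, abs_of_pos h0]
  have h2 : |ω| = ω := abs_of_pos h0
  have hd1 := hg.mul_exp_div hφ hω hμ
  have hd2 := hg.mul_div_add_exp hφ hω hμ
  have key : ∀ y : ℝ, |y| = ω → yos A μ * ∫ x, g (line y x) • scaledRes A (line y x) =
      (∫ x, Complex.exp (line y x) / (μ + Complex.exp (line y x)) * g (line y x)) • yos A μ +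
      ∫ x, ((μ : ℂ) / (μ + Complex.exp (line y x)) * g (line y x)) • scaledRes A (line y x) := by
    intro y hy
    have hsc := (integral_smul_const (μ := volume) (fun x : ℝ => Complex.exp (line y x) /
      (μ + Complex.exp (line y x)) * g (line y x)) (yos A μ)).symm
    rw [mul_integral_op _ (hA.integrable_calc hφ hω hy hg)]
    refine Eq.trans ?_ (congrArg (· + _) hsc.symm)
    rw [← integral_add ((hd1.integrable (abs_le.1 hy.le)).smul_const _)
        (hA.integrable_calc hφ hω hy hd2)]
    refine integral_congr_ae (Eventually.of_forall fun x => ?_)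
    have hs : line y x ∈ strip (-ω) ω := by simpa [strip] using abs_le.1 hy.le
    simp only [mul_smul_comm]
    rw [hA.yos_mul_scaledRes hφ hμ (by rw [line_im, cos_abs_le_of_eq hy]; exact hlt)
      (add_exp_ne_zero_of_strip hω hs hμ), smul_add, smul_smul, smul_smul]
    congr 2 <;> ring
  unfold stripCalc
  rw [mul_smul_comm, mul_sub, key _ h1, key _ h2, hd1.integral_eq (by linarith)]
  congr 1
  abel

/-- Cauchy's theorem in the two strips between the old and the new boundary lines, on which the
scaled resolvent is holomorphic and bounded. -/
theorem stripCalc_eq_of_lt (hA : IsSectorial A φ) (hφ : φ ∈ Ioo 0 Real.pi) {ω' : ℝ}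
    (hω' : ω' ∈ Ioo φ Real.pi) (hω : ω ∈ Ioo φ Real.pi) (h : ω' ≤ ω)
    (hg : StripDecay (-ω) ω g) : stripCalc A ω g = stripCalc A ω' g := by
  have h0 : 0 < ω' := hφ.1.trans hω'.1
  have hlt := cos_lt_cos_of_mem hφ hω'
  obtain ⟨M, hM0, hM⟩ := hA.exists_scaledRes_bound hφ hω'
  have hdec : ∀ a b : ℝ, -ω ≤ a → b ≤ ω → (∀ y ∈ Icc a b, Real.cos y ≤ Real.cos ω') →
      StripDecay a b (fun w => g w • scaledRes A w) := by
    intro a b ha hb hab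
    have hg' := hg.mono ha hb
    obtain ⟨C, δ, hC0, hδ, hC⟩ := hg'.exists_pos
    refine ⟨hg'.1.smul fun w hw => ?_, C * M, δ, hδ, fun w hw => ?_⟩
    · exact (hA.differentiableAt_scaledRes hφ
        ((hab _ hw).trans_lt hlt)).differentiableWithinAt
    · rw [norm_smul]
      calc _ ≤ C * Real.exp (-δ * |w.re|) * M :=
            mul_le_mul (hC w hw) (hM w (hab _ hw)) (norm_nonneg _) (by positivity)
        _ = _ := by ring
  have e1 := (hdec ω' ω (by linarith) le_rfl fun y hy =>
    Real.cos_le_cos_of_nonneg_of_le_pi h0.le (hy.2.trans hω.2.le) hy.1).integral_eq h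
  have e2 := (hdec (-ω) (-ω') le_rfl (by linarith) fun y hy => by
    rw [← Real.cos_neg y]
    exact Real.cos_le_cos_of_nonneg_of_le_pi h0.le (by linarith [hy.1, hω.2])
      (by linarith [hy.2])).integral_eq (by linarith)
  unfold stripCalc
  rw [e1, e2]

end Calculus

end

section

/-! ### Differences of the approximants `μ (μ + A)⁻¹` in the functional calculus -/

section Calculus

open Filter Topology

variable {X : Type*} [NormedAddCommGroup X] [NormedSpace ℂ X]
variable {A : X →ₗ.[ℂ] X} {φ : ℝ}

theorem exp_add_exp_le_of_one_le_abs_sub {x y : ℝ} (h : 1 ≤ |x - y|) :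
    (Real.exp x + Real.exp y) / 4 ≤ |Real.exp x - Real.exp y| := by
  have he1 : 2 * Real.exp (-1) ≤ 1 := by
    have := Real.add_one_le_exp 1
    rw [Real.exp_neg]
    have h3 := Real.exp_pos 1
    rw [← div_eq_mul_inv, div_le_one h3]
    linarith
  rcases le_total y x with h0 | h0
  · rw [abs_of_nonneg (by linarith)] at h
    rw [abs_of_nonneg (sub_nonneg.2 (Real.exp_le_exp.2 h0))]
    have : Real.exp y ≤ Real.exp (-1) * Real.exp x := by
      rw [← Real.exp_add, Real.exp_le_exp]; linarith
    nlinarith [Real.exp_pos x, Real.exp_pos y]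
  · rw [abs_of_nonpos (by linarith)] at h
    rw [abs_of_nonpos (sub_nonpos.2 (Real.exp_le_exp.2 h0))]
    have : Real.exp x ≤ Real.exp (-1) * Real.exp y := by
      rw [← Real.exp_add, Real.exp_le_exp]; linarith
    nlinarith [Real.exp_pos x, Real.exp_pos y]

theorem exp_add_exp_le_norm_sub {w w' : ℂ} (h : 1 ≤ |w.re - w'.re|) :
    (Real.exp w.re + Real.exp w'.re) / 4 ≤ ‖Complex.exp w - Complex.exp w'‖ := by
  refine (exp_add_exp_le_of_one_le_abs_sub h).trans ?_
  have := abs_norm_sub_norm_le (Complex.exp w) (Complex.exp w')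
  rwa [Complex.norm_exp, Complex.norm_exp] at this

/-- Up to constants this is the form of every difference of two simple fractions that occurs below.
Away from the moduli of the poles it decays at both ends like `e^{-|Re w|}`. -/
theorem norm_exp_div_mul_le {w w₁ w₂ : ℂ} (h₁ : 1 ≤ |w.re - w₁.re|) (h₂ : 1 ≤ |w.re - w₂.re|) :
    ‖Complex.exp w / ((Complex.exp w - Complex.exp w₁) * (Complex.exp w - Complex.exp w₂))‖ ≤
      16 * (1 + Real.exp (-w₁.re - w₂.re)) * Real.exp (-1 * |w.re|) := by
  have k1 := exp_add_exp_le_norm_sub h₁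
  have k2 := exp_add_exp_le_norm_sub h₂
  rw [norm_div, norm_mul, Complex.norm_exp]
  set a := Real.exp w.re with ha
  have ha0 : 0 < a := Real.exp_pos _
  have hb0 := Real.exp_pos w₁.re
  have hc0 := Real.exp_pos w₂.re
  rw [show -w₁.re - w₂.re = -(w₁.re + w₂.re) by ring, Real.exp_neg, Real.exp_add]
  set b := Real.exp w₁.re
  set c := Real.exp w₂.re
  calc _ ≤ a / ((a + b) / 4 * ((a + c) / 4)) := by gcongr
    _ = 16 * (a / ((a + b) * (a + c))) := by field_simp; norm_num
    _ ≤ _ := by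
      rw [mul_assoc]
      gcongr
      rcases le_total 0 w.re with hx | hx
      · rw [abs_of_nonneg hx, neg_one_mul, Real.exp_neg, ← ha, ← div_eq_mul_inv,
          div_le_div_iff₀ (by positivity) ha0]
        have : 0 < (b * c)⁻¹ := by positivity
        nlinarith [mul_pos ha0 hb0, mul_pos ha0 hc0, mul_pos hb0 hc0,
          mul_pos this (mul_pos (add_pos ha0 hb0) (add_pos ha0 hc0))]
      · rw [abs_of_nonpos hx, neg_one_mul, neg_neg, ← ha]
        have : a / ((a + b) * (a + c)) ≤ (b * c)⁻¹ * a := by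
          rw [← div_eq_inv_mul]
          gcongr <;> linarith
        nlinarith

theorem exp_line_pi_log {μ : ℝ} (hμ : 0 < μ) :
    Complex.exp (line Real.pi (Real.log μ)) = -(μ : ℂ) := by
  rw [line, Complex.exp_add, Complex.exp_pi_mul_I, ← Complex.ofReal_exp, Real.exp_log hμ]
  ring

variable [CompleteSpace X] {ω : ℝ} {g : ℂ → ℂ}

/-- Either fraction tends to `1` at the left end, which excludes it from the elementary calculus;
the limits cancel in the difference. -/
theorem stripDecay_yos_sub (hω : ω ∈ Ioo φ Real.pi) {μ ν : ℝ}
    (hμ : 0 < μ) (hν : 0 < ν) : StripDecay (-ω) ω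
      (fun w => (μ : ℂ) / (μ + Complex.exp w) - (ν : ℂ) / (ν + Complex.exp w)) := by
  refine StripDecay.of_eventually (x₀ := |Real.log μ| + |Real.log ν| + 1)
    (C := ‖(μ : ℂ) - ν‖ * (16 * (1 + Real.exp (-Real.log μ - Real.log ν)))) (δ := 1) ?_ one_pos ?_
  · refine DifferentiableOn.sub ?_ ?_
    · exact (differentiableOn_const _).div ((differentiableOn_const _).add
        Complex.differentiable_exp.differentiableOn) fun w hw => add_exp_ne_zero_of_strip hω hw hμ
    · exact (differentiableOn_const _).div ((differentiableOn_const _).add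
        Complex.differentiable_exp.differentiableOn) fun w hw => add_exp_ne_zero_of_strip hω hw hν
  · intro w hw hx
    have n1 := add_exp_ne_zero_of_strip hω hw hμ
    have n2 := add_exp_ne_zero_of_strip hω hw hν
    have key := norm_exp_div_mul_le (w := w) (w₁ := line Real.pi (Real.log μ))
      (w₂ := line Real.pi (Real.log ν))
      (by rw [line_re]; linarith [abs_sub_abs_le_abs_sub w.re (Real.log μ),
            abs_nonneg (Real.log ν)])
      (by rw [line_re]; linarith [abs_sub_abs_le_abs_sub w.re (Real.log ν),
            abs_nonneg (Real.log μ)])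
    rw [exp_line_pi_log hμ, exp_line_pi_log hν, line_re, line_re] at key
    have : (μ : ℂ) / (μ + Complex.exp w) - (ν : ℂ) / (ν + Complex.exp w) = ((μ : ℂ) - ν) *
        (Complex.exp w / ((Complex.exp w - -(μ : ℂ)) * (Complex.exp w - -(ν : ℂ)))) := by
      simp only [sub_neg_eq_add]
      rw [add_comm (Complex.exp w), add_comm (Complex.exp w)]
      field_simp
      ring
    rw [this, norm_mul, mul_assoc]
    gcongr

/-- Differences of the approximants `μ (μ + A)⁻¹` in the functional calculus. -/
theorem IsSectorial.stripCalc_yos_sub (hA : IsSectorial A φ) (hφ : φ ∈ Ioo 0 Real.pi)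
    (hω : ω ∈ Ioo φ Real.pi) {μ ν : ℝ} (hμ : 0 < μ) (hν : 0 < ν) :
    stripCalc A ω (fun w => (μ : ℂ) / (μ + Complex.exp w) - (ν : ℂ) / (ν + Complex.exp w)) =
      yos A μ - yos A ν := by
  have h0 : 0 < ω := hφ.1.trans hω.1
  have hpi := hω.2
  have hlt := cos_lt_cos_of_mem hφ hω
  obtain ⟨M, hM0, hM⟩ := hA.exists_scaledRes_bound hφ hω
  set D := yos A μ - yos A ν with hD
  set q : ℂ → ℂ := fun w => (μ : ℂ) / (μ + Complex.exp w) - (ν : ℂ) / (ν + Complex.exp w) with hq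
  -- The contour is closed through the complementary strip `ω ≤ Im w ≤ 2π - ω`, whose upper line is
  -- the line at height `-ω` up to a period. There `H` is holomorphic: the resolvent has no
  -- singularity, and the poles at `-μ` and `-ν` are hidden in the product with `D`. The scalar
  -- term, with its pole at `1`, is subtracted to make `H` decay.
  set H : ℂ → X →L[ℂ] X := fun w =>
    D * scaledRes A w - (Complex.exp w / (Complex.exp w - Complex.exp 0)) • D with hH
  have hcos : ∀ w ∈ strip ω (2 * Real.pi - ω), Real.cos w.im ≤ Real.cos ω := by
    intro w hw
    rcases le_total w.im Real.pi with h1 | h1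
    · exact Real.cos_le_cos_of_nonneg_of_le_pi h0.le h1 hw.1
    · rw [← Real.cos_two_pi_sub]
      exact Real.cos_le_cos_of_nonneg_of_le_pi h0.le (by linarith) (by linarith [hw.2])
  -- Expanded by partial fractions, `H` is the integrand of the calculus up to multiples of
  -- `poleFun`. This gives the decay at both ends, and on the boundary it brings in the residue
  -- `2πi` twice.
  have hHq : ∀ w : ℂ, Real.cos w.im ≤ Real.cos ω → (μ : ℂ) + Complex.exp w ≠ 0 →
      (ν : ℂ) + Complex.exp w ≠ 0 → H w = q w • scaledRes A w - poleFun 0 μ w • yos A μ +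
        poleFun 0 ν w • yos A ν := by
    intro w hw n1 n2
    simp only [hH, hD, hq, poleFun]
    rw [sub_mul, hA.yos_mul_scaledRes hφ hμ (hw.trans_lt hlt) n1,
      hA.yos_mul_scaledRes hφ hν (hw.trans_lt hlt) n2]
    module
  have hn1 : ∀ w ∈ strip ω (2 * Real.pi - ω), Complex.exp w - Complex.exp 0 ≠ 0 := fun w hw =>
    exp_sub_exp_ne_zero (by simp; linarith [hw.1]) (by
      simp only [Complex.zero_im, sub_zero]
      rw [abs_lt]; constructor <;> linarith [hw.1, hw.2])
  have hpole : ∀ {σ : ℝ} (hσ : 0 < σ) {w : ℂ}, |Real.log σ| + 1 ≤ |w.re| →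
      (σ : ℂ) + Complex.exp w ≠ 0 ∧ ‖poleFun 0 σ w‖ ≤ ‖(σ : ℂ) + 1‖ *
        (16 * (1 + Real.exp (-0 - Real.log σ)) * Real.exp (-1 * |w.re|)) := by
    intro σ hσ w hw
    have h1 : 1 ≤ |w.re - Real.log σ| := by
      linarith [abs_sub_abs_le_abs_sub w.re (Real.log σ)]
    have h2 : 1 ≤ |w.re - (0 : ℂ).re| := by
      simp only [Complex.zero_re, sub_zero]; linarith [abs_nonneg (Real.log σ)]
    have e1 := exp_add_exp_le_norm_sub (w := w) (w' := line Real.pi (Real.log σ))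
      (by simpa using h1)
    have e2 := exp_add_exp_le_norm_sub h2
    have key := norm_exp_div_mul_le (w := w) (w₁ := 0) (w₂ := line Real.pi (Real.log σ))
      h2 (by simpa using h1)
    rw [exp_line_pi_log hσ, line_re] at key
    rw [exp_line_pi_log hσ] at e1
    have p1 : (σ : ℂ) + Complex.exp w ≠ 0 := by
      intro h
      rw [sub_neg_eq_add, add_comm (Complex.exp w), h, norm_zero] at e1
      linarith [Real.exp_pos w.re, Real.exp_pos (line Real.pi (Real.log σ)).re]
    have p2 : Complex.exp w - Complex.exp 0 ≠ 0 := by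
      intro h
      rw [h, norm_zero] at e2
      linarith [Real.exp_pos w.re, Real.exp_pos (0 : ℂ).re]
    refine ⟨p1, ?_⟩
    have : poleFun 0 σ w = ((σ : ℂ) + 1) *
        (Complex.exp w / ((Complex.exp w - Complex.exp 0) * (Complex.exp w - -(σ : ℂ)))) := by
      unfold poleFun
      rw [sub_neg_eq_add, add_comm (Complex.exp w) (σ : ℂ), div_sub_div _ _ p2 p1,
        ← mul_div_assoc, Complex.exp_zero]
      congr 1
      ring
    rw [this, norm_mul]
    gcongr
    simpa using key
  have hHs : StripDecay ω (2 * Real.pi - ω) H := by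
    refine StripDecay.of_eventually (x₀ := |Real.log μ| + |Real.log ν| + 1)
      (C := ‖(μ : ℂ) - ν‖ * (16 * (1 + Real.exp (-Real.log μ - Real.log ν))) * M +
        ‖(μ : ℂ) + 1‖ * (16 * (1 + Real.exp (-0 - Real.log μ))) * ‖yos A μ‖ +
        ‖(ν : ℂ) + 1‖ * (16 * (1 + Real.exp (-0 - Real.log ν))) * ‖yos A ν‖)
      (δ := 1) ?_ one_pos ?_
    · refine DifferentiableOn.sub ?_ ?_
      · exact (differentiableOn_const _).mul fun w hw => (hA.differentiableAt_scaledRes hφ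
          ((hcos w hw).trans_lt hlt)).differentiableWithinAt
      · exact (Complex.differentiable_exp.differentiableOn.div
          (Complex.differentiable_exp.differentiableOn.sub (differentiableOn_const _))
            hn1).smul_const D
    · intro w hw hx
      obtain ⟨n1, b1⟩ := hpole hμ (w := w) (by linarith [abs_nonneg (Real.log ν)])
      obtain ⟨n2, b2⟩ := hpole hν (w := w) (by linarith [abs_nonneg (Real.log μ)])
      rw [hHq w (hcos w hw) n1 n2]
      have key := norm_exp_div_mul_le (w := w) (w₁ := line Real.pi (Real.log μ))
        (w₂ := line Real.pi (Real.log ν))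
        (by rw [line_re]; linarith [abs_sub_abs_le_abs_sub w.re (Real.log μ),
              abs_nonneg (Real.log ν)])
        (by rw [line_re]; linarith [abs_sub_abs_le_abs_sub w.re (Real.log ν),
              abs_nonneg (Real.log μ)])
      rw [exp_line_pi_log hμ, exp_line_pi_log hν, line_re, line_re] at key
      have e : q w = ((μ : ℂ) - ν) *
          (Complex.exp w / ((Complex.exp w - -(μ : ℂ)) * (Complex.exp w - -(ν : ℂ)))) := by
        simp only [sub_neg_eq_add, hq]
        rw [add_comm (Complex.exp w), add_comm (Complex.exp w)]
        field_simp
        ring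
      calc _ ≤ ‖q w‖ * ‖scaledRes A w‖ + ‖poleFun 0 μ w‖ * ‖yos A μ‖ +
            ‖poleFun 0 ν w‖ * ‖yos A ν‖ := by
            refine (norm_add_le _ _).trans (add_le_add ((norm_sub_le _ _).trans ?_) ?_)
            · rw [norm_smul, norm_smul]
            · rw [norm_smul]
        _ ≤ (‖(μ : ℂ) - ν‖ * (16 * (1 + Real.exp (-Real.log μ - Real.log ν)) *
              Real.exp (-1 * |w.re|))) * M + (‖(μ : ℂ) + 1‖ *
              (16 * (1 + Real.exp (-0 - Real.log μ)) * Real.exp (-1 * |w.re|))) * ‖yos A μ‖ +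
            (‖(ν : ℂ) + 1‖ *
              (16 * (1 + Real.exp (-0 - Real.log ν)) * Real.exp (-1 * |w.re|))) * ‖yos A ν‖ := by
            rw [e, norm_mul]
            gcongr
            exact hM w (hcos w hw)
        _ = _ := by ring
  have hqd := stripDecay_yos_sub hω hμ hν
  have habs : |ω| = ω := abs_of_pos h0
  have habs' : |(-ω)| = ω := by rw [abs_neg, habs]
  have hpl : ∀ {σ : ℝ} (_ : 0 < σ) {y : ℝ} (_ : |y| = ω),
      Integrable fun x => poleFun 0 σ (line y x) := fun hσ y hy =>
    (poleFun_line hσ (by rw [hy]; exact hpi) (by rintro rfl; simp at hy; linarith)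
      (by simp only [Complex.zero_im, sub_zero, hy]; linarith)).1
  have hline : ∀ y : ℝ, |y| = ω → ∫ x, H (line y x) =
      (∫ x, q (line y x) • scaledRes A (line y x)) - (∫ x, poleFun 0 μ (line y x)) • yos A μ +
        (∫ x, poleFun 0 ν (line y x)) • yos A ν := by
    intro y hy
    have i1 := hA.integrable_calc hφ hω hy hqd
    have i2 : Integrable fun x => poleFun 0 μ (line y x) • yos A μ := (hpl hμ hy).smul_const _
    have i3 : Integrable fun x => poleFun 0 ν (line y x) • yos A ν := (hpl hν hy).smul_const _
    have s2 := integral_smul_const (μ := volume) (fun x : ℝ => poleFun 0 μ (line y x)) (yos A μ)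
    have s3 := integral_smul_const (μ := volume) (fun x : ℝ => poleFun 0 ν (line y x)) (yos A ν)
    refine Eq.trans ?_ (congrArg₂ (fun a b => _ - a + b) s2 s3)
    have i12 : Integrable fun x => q (line y x) • scaledRes A (line y x) -
        poleFun 0 μ (line y x) • yos A μ := i1.sub i2
    change _ = (∫ x, q (line y x) • scaledRes A (line y x)) - (∫ x, poleFun 0 μ (line y x) • yos A μ) +
        (∫ x, poleFun 0 ν (line y x) • yos A ν)
    rw [← integral_sub i1 i2, ← integral_add i12 i3]
    refine integral_congr_ae (Eventually.of_forall fun x => ?_)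
    have hs : line y x ∈ strip (-ω) ω := by simpa [strip] using abs_le.1 hy.le
    exact hHq _ (by simp [cos_abs_le_of_eq hy]) (add_exp_ne_zero_of_strip hω hs hμ)
      (add_exp_ne_zero_of_strip hω hs hν)
  have hper : ∀ x, H (line (2 * Real.pi - ω) x) = H (line (-ω) x) := by
    intro x
    have : line (2 * Real.pi - ω) x = line (-ω) x + 2 * Real.pi * Complex.I := by
      simp only [line]; push_cast; ring
    simp only [hH]
    rw [this, scaledRes_add_two_pi, Complex.exp_periodic (line (-ω) x)]
  have hC := hHs.integral_eq (by linarith)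
  simp only [hper] at hC
  rw [hline _ habs, hline _ habs'] at hC
  have p1 := integral_poleFun (w₀ := 0) hμ hpi (by simpa using h0)
  have p2 := integral_poleFun (w₀ := 0) hν hpi (by simpa using h0)
  unfold stripCalc
  have hpi0 : (2 * (Real.pi : ℂ) * Complex.I) ≠ 0 := by
    simp [Real.pi_ne_zero]
  rw [inv_smul_eq_iff₀ hpi0, hD, smul_sub]
  nth_rewrite 1 [← p1]
  rw [← p2, sub_smul, sub_smul]
  change (∫ x, q (line (-ω) x) • scaledRes A (line (-ω) x)) -
    (∫ x, q (line ω x) • scaledRes A (line ω x)) = _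
  rw [sub_eq_iff_eq_add]
  rw [sub_add_eq_add_sub, sub_eq_iff_eq_add] at hC
  have hC' := eq_sub_of_add_eq hC.symm
  rw [← sub_eq_zero] at hC ⊢
  rw [← neg_eq_zero, ← hC]
  abel

end Calculus

end

section

/-! ### Multiplicativity of the functional calculus -/

section Calculus

open Filter Topology

variable {X : Type*} [NormedAddCommGroup X] [NormedSpace ℂ X]
variable {A : X →ₗ.[ℂ] X} {φ : ℝ}

theorem IsSectorial.scaledRes_mul_scaledRes (hA : IsSectorial A φ) (hφ : φ ∈ Ioo 0 Real.pi)
    {ζ w : ℂ} (hζ : Real.cos ζ.im < Real.cos φ) (hw : Real.cos w.im < Real.cos φ)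
    (hne : Complex.exp ζ - Complex.exp w ≠ 0) :
    scaledRes A ζ * scaledRes A w =
      (Complex.exp ζ / (Complex.exp ζ - Complex.exp w)) • scaledRes A w -
      (Complex.exp w / (Complex.exp ζ - Complex.exp w)) • scaledRes A ζ := by
  have h := resolvent_identity (hA.exists_res_exp hφ hζ) (hA.exists_res_exp hφ hw)
  have h2 : res A (Complex.exp ζ) * res A (Complex.exp w) =
      (Complex.exp ζ - Complex.exp w)⁻¹ •
      (res A (Complex.exp w) - res A (Complex.exp ζ)) := by
    rw [← neg_sub (res A (Complex.exp ζ)), h, ← neg_smul, neg_sub, smul_smul,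
      inv_mul_cancel₀ hne, one_smul]
  rw [scaledRes, scaledRes, smul_mul_smul_comm, h2, smul_smul, smul_sub, smul_smul, smul_smul]
  congr 2 <;> field_simp

variable [CompleteSpace X] {ω ω' : ℝ} {e g : ℂ → ℂ}

/-- The constant controlling the distance of the boundaries of two sectors. -/
theorem exists_sin_lower {ω ω' : ℝ} (h0 : 0 < ω') (h : ω' < ω) (hω : ω < Real.pi) :
    ∃ κ : ℝ, 0 < κ ∧ ∀ ζ w : ℂ, |ζ.im| = ω → |w.im| ≤ ω' →
      Complex.exp ζ - Complex.exp w ≠ 0 ∧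
      ‖Complex.exp w / (Complex.exp ζ - Complex.exp w)‖ ≤ κ ∧
      ‖Complex.exp ζ / (Complex.exp ζ - Complex.exp w)‖ ≤ κ := by
  -- Up to sign, half the difference of the arguments lies between `(ω - ω') / 2` and `(ω + ω') /
  -- 2`; on such an interval inside `(0, π)` the sine is smallest at an endpoint.
  set s := min (Real.sin ((ω - ω') / 2)) (Real.sin ((ω + ω') / 2)) with hs
  have hs0 : 0 < s := lt_min (Real.sin_pos_of_pos_of_lt_pi (by linarith) (by linarith))
    (Real.sin_pos_of_pos_of_lt_pi (by linarith) (by linarith))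
  have hkey : ∀ t : ℝ, (ω - ω') / 2 ≤ t → t ≤ (ω + ω') / 2 → s ≤ Real.sin t := by
    intro t h1 h2
    rcases le_total t (Real.pi / 2) with h3 | h3
    · exact (min_le_left _ _).trans (Real.sin_le_sin_of_le_of_le_pi_div_two (by linarith) h3 h1)
    · refine (min_le_right _ _).trans ?_
      rw [← Real.sin_pi_sub, ← Real.sin_pi_sub t]
      exact Real.sin_le_sin_of_le_of_le_pi_div_two (by linarith) (by linarith) (by linarith)
  refine ⟨s⁻¹, inv_pos.2 hs0, fun ζ w hζ hw => ?_⟩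
  have hw' := abs_le.1 hw
  have hsin : s ≤ |Real.sin ((ζ.im - w.im) / 2)| := by
    rcases abs_choice ζ.im with h1 | h1
    · rw [h1] at hζ
      refine (hkey _ ?_ ?_).trans (le_abs_self _) <;> linarith
    · rw [h1] at hζ
      rw [← abs_neg, ← Real.sin_neg]
      refine (hkey _ ?_ ?_).trans (le_abs_self _) <;> linarith
  have hne : Real.sin ((ζ.im - w.im) / 2) ≠ 0 := fun h0 => by
    rw [h0, abs_zero] at hsin; linarith
  have hinv : |Real.sin ((ζ.im - w.im) / 2)|⁻¹ ≤ s⁻¹ := inv_anti₀ hs0 hsin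
  have hne2 : Complex.exp ζ - Complex.exp w ≠ 0 := by
    have := norm_exp_sub_exp_ge ζ w
    intro h0
    rw [h0, norm_zero] at this
    have h2 : 0 < |Real.sin ((ζ.im - w.im) / 2)| := abs_pos.2 hne
    have h3 := Real.exp_pos ζ.re
    have h4 := Real.exp_pos w.re
    nlinarith [mul_pos h2 (add_pos h3 h4)]
  refine ⟨hne2, ?_, (norm_exp_div_exp_sub_exp_le hne).trans hinv⟩
  rw [← norm_neg, ← div_neg, neg_sub]
  refine (norm_exp_div_exp_sub_exp_le (ζ := w) (w := ζ) ?_).trans ?_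
  · rw [← neg_sub, neg_div, Real.sin_neg]; exact neg_ne_zero.2 hne
  · rw [← neg_sub ζ.im, neg_div, Real.sin_neg, abs_neg]; exact hinv

/-- Multiplicativity of the functional calculus. -/
theorem IsSectorial.stripCalc_mul (hA : IsSectorial A φ) (hφ : φ ∈ Ioo 0 Real.pi)
    (hω' : ω' ∈ Ioo φ Real.pi) (hω : ω < Real.pi) (hlt' : ω' < ω)
    (he : StripDecay (-ω) ω e) (hg : StripDecay (-ω') ω' g) :
    stripCalc A ω e * stripCalc A ω' g = stripCalc A ω' (fun w => e w * g w) := by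
  have hω1 : ω ∈ Ioo φ Real.pi := ⟨hω'.1.trans hlt', hω⟩
  have h0' : 0 < ω' := hφ.1.trans hω'.1
  have h0 : 0 < ω := h0'.trans hlt'
  obtain ⟨κ, hκ0, hκ⟩ := exists_sin_lower h0' hlt' hω
  obtain ⟨M, hM0, hM⟩ := hA.exists_scaledRes_bound hφ hω1
  have habs : |ω| = ω := abs_of_pos h0
  have habsn : |(-ω)| = ω := by rw [abs_neg, habs]
  have habs' : |ω'| = ω' := abs_of_pos h0'
  have habsn' : |(-ω')| = ω' := by rw [abs_neg, habs']
  have hcos := cos_lt_cos_of_mem hφ hω1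
  have hcos' := cos_lt_cos_of_mem hφ hω'
  obtain ⟨Ce, δe, hCe0, hδe, hCe⟩ := he.exists_pos
  obtain ⟨Cg, δg, hCg0, hδg, hCg⟩ := hg.exists_pos
  have hpi0 : (2 * (Real.pi : ℂ) * Complex.I) ≠ 0 := by simp [Real.pi_ne_zero]
  set N : ℂ := (2 * (Real.pi : ℂ) * Complex.I)⁻¹ with hN
  have hstrip : ∀ {a y : ℝ} (x : ℝ), |y| = a → line y x ∈ strip (-a) a := by
    intro a y x hy
    simpa [strip] using abs_le.1 hy.le
  -- the kernel of the remainder term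
  set k : ℝ → ℝ → ℂ → ℂ := fun σ y w =>
    e (line σ y) * (Complex.exp w / (Complex.exp (line σ y) - Complex.exp w)) with hk
  have hkint : ∀ σ, |σ| = ω → ∀ w : ℂ, |w.im| ≤ ω' → Integrable (fun y => k σ y w) ∧
      Integrable (fun y => e (line σ y) *
        (Complex.exp (line σ y) / (Complex.exp (line σ y) - Complex.exp w))) := by
    intro σ hσ w hw
    have hb : ∀ y, _ := fun y => hκ (line σ y) w (by simpa using hσ) hw
    have hc := continuous_line σ
    have hce := he.continuous_line (abs_le.1 hσ.le)
    constructor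
    · refine ((he.integrable (abs_le.1 hσ.le)).norm.mul_const κ).mono'
        (Continuous.aestronglyMeasurable ?_) (Eventually.of_forall fun y => ?_)
      · exact hce.mul ((by fun_prop : Continuous _).div (by fun_prop) fun y => (hb y).1)
      · rw [norm_mul]; gcongr; exact (hb y).2.1
    · refine ((he.integrable (abs_le.1 hσ.le)).norm.mul_const κ).mono'
        (Continuous.aestronglyMeasurable ?_) (Eventually.of_forall fun y => ?_)
      · exact hce.mul ((by fun_prop : Continuous _).div (by fun_prop) fun y => (hb y).1)
      · rw [norm_mul]; gcongr; exact (hb y).2.2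
  set T : ℝ → ℂ → X →L[ℂ] X := fun σ w => ∫ y, k σ y w • scaledRes A (line σ y) with hT
  -- In the product of the two resolvents, the coefficient of `scaledRes A w` is a scalar integral
  -- over the outer lines, equal to `e w` by Cauchy's formula as `w` lies inside. The other term is
  -- the remainder `T`.
  have hstep : ∀ w : ℂ, |w.im| = ω' → stripCalc A ω e * scaledRes A w =
      e w • scaledRes A w - N • (T (-ω) w - T ω w) := by
    intro w hw
    have hl : ∀ σ, |σ| = ω → (∫ y, e (line σ y) • scaledRes A (line σ y)) * scaledRes A w =
        (∫ y, e (line σ y) * (Complex.exp (line σ y) /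
          (Complex.exp (line σ y) - Complex.exp w))) • scaledRes A w - T σ w := by
      intro σ hσ
      have s1 := integral_smul_const (μ := volume) (fun y : ℝ => e (line σ y) *
        (Complex.exp (line σ y) / (Complex.exp (line σ y) - Complex.exp w))) (scaledRes A w)
      rw [integral_op_mul _ (hA.integrable_calc hφ hω1 hσ he)]
      refine Eq.trans ?_ (congrArg (· - _) s1)
      simp only [hT]
      rw [← integral_sub ((hkint σ hσ w hw.le).2.smul_const _)
        (hA.integrable_smul_scaledRes hφ hω1 hσ (hkint σ hσ w hw.le).1)]
      refine integral_congr_ae (Eventually.of_forall fun y => ?_)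
      simp only [smul_mul_assoc]
      rw [hA.scaledRes_mul_scaledRes hφ (by rw [line_im, cos_abs_le_of_eq hσ]; exact hcos)
        (by rw [cos_abs_le_of_eq hw]; exact hcos')
        (hκ (line σ y) w (by simpa using hσ) hw.le).1, smul_sub, smul_smul, smul_smul]
    have hcf := he.cauchy_formula hω (w₀ := w) (by rw [hw]; exact hlt')
    rw [stripCalc, smul_mul_assoc, sub_mul, hl _ habsn, hl _ habs]
    rw [sub_sub_sub_comm, ← sub_smul, hcf, smul_sub, smul_smul, ← mul_assoc, ← hN]
    rw [hN, inv_mul_cancel₀ hpi0, one_mul]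
  -- the remainder does not depend on the inner line
  have hfub : ∀ σ, |σ| = ω → ∀ τ, |τ| = ω' →
      Integrable (Function.uncurry fun x y => g (line τ x) • (k σ y (line τ x) •
        scaledRes A (line σ y))) (volume.prod volume) := by
    intro σ hσ τ hτ
    have i1 : Integrable (fun x : ℝ => Cg * Real.exp (-δg * |x|)) :=
      (integrable_exp_neg_mul_abs hδg).const_mul _
    have i2 : Integrable (fun x : ℝ => Ce * Real.exp (-δe * |x|) * κ * M) :=
      (((integrable_exp_neg_mul_abs hδe).const_mul _).mul_const _).mul_const _
    refine (i1.mul_prod i2).mono' (Continuous.aestronglyMeasurable ?_)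
      (Eventually.of_forall fun ⟨x, y⟩ => ?_)
    · have c1 : Continuous fun p : ℝ × ℝ => g (line τ p.1) :=
        (hg.continuous_line (abs_le.1 hτ.le)).comp continuous_fst
      have c2 : Continuous fun p : ℝ × ℝ => e (line σ p.2) :=
        (he.continuous_line (abs_le.1 hσ.le)).comp continuous_snd
      have c3 : Continuous fun p : ℝ × ℝ => scaledRes A (line σ p.2) :=
        (hA.continuous_scaledRes_line hφ (y := σ)
          (by rw [cos_abs_le_of_eq hσ]; exact hcos)).comp continuous_snd
      have c4 := continuous_line σ
      have c5 := continuous_line τ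
      refine c1.smul ((c2.mul ((by fun_prop : Continuous fun p : ℝ × ℝ =>
        Complex.exp (line τ p.1)).div (by fun_prop) fun p => ?_)).smul c3)
      exact (hκ (line σ p.2) (line τ p.1) (by simpa using hσ) (by simp [hτ])).1
    · simp only [Function.uncurry, norm_smul, hk, norm_mul]
      have b1 := hCg _ (hstrip x hτ)
      have b2 := hCe _ (hstrip y hσ)
      rw [line_re] at b1 b2
      have b3 := hM (line σ y) (by simp [cos_abs_le_of_eq hσ])
      have b4 := (hκ (line σ y) (line τ x) (by simpa using hσ) (by simp [hτ])).2.1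
      gcongr
  have hrem : ∀ σ, |σ| = ω → ∀ τ, |τ| = ω' → ∫ x, g (line τ x) • T σ (line τ x) =
      ∫ y, (e (line σ y) * ∫ x, (Complex.exp (line τ x) /
        (Complex.exp (line σ y) - Complex.exp (line τ x))) * g (line τ x)) •
        scaledRes A (line σ y) := by
    intro σ hσ τ hτ
    simp only [hT, ← integral_smul]
    rw [integral_integral_swap (hfub σ hσ τ hτ)]
    refine integral_congr_ae (Eventually.of_forall fun y => ?_)
    simp only
    rw [← integral_const_mul]
    refine Eq.trans ?_ (integral_smul_const (μ := volume) (fun x : ℝ => e (line σ y) *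
      ((Complex.exp (line τ x) / (Complex.exp (line σ y) - Complex.exp (line τ x))) *
        g (line τ x))) (scaledRes A (line σ y)))
    refine integral_congr_ae (Eventually.of_forall fun x => ?_)
    simp only [hk, smul_smul]
    congr 1
    ring
  have hremeq : ∀ σ, |σ| = ω → ∫ x, g (line (-ω') x) • T σ (line (-ω') x) =
      ∫ x, g (line ω' x) • T σ (line ω' x) := by
    intro σ hσ
    rw [hrem σ hσ _ habsn', hrem σ hσ _ habs']
    refine integral_congr_ae (Eventually.of_forall fun y => ?_)
    have hb : ∀ w ∈ strip (-ω') ω', _ := fun w hw =>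
      hκ (line σ y) w (by simpa using hσ) (abs_le.2 hw)
    -- The outer point lies off the inner strip, so that the integrand is holomorphic in that strip
    -- and the two inner lines give the same integral.
    have := (hg.mul_bdd (differentiableOn_exp_div fun w hw => (hb w hw).1)
      (fun w hw => (hb w hw).2.1)).integral_eq (by linarith)
    simp only [smul_eq_mul] at this
    simp only [this]
  have hTint : ∀ σ, |σ| = ω → ∀ τ, |τ| = ω' →
      Integrable (fun x => g (line τ x) • T σ (line τ x)) := by
    intro σ hσ τ hτ
    have := (hfub σ hσ τ hτ).integral_prod_left
    refine this.congr (Eventually.of_forall fun x => ?_)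
    simp only [Function.uncurry, hT, integral_smul]
  have heg : StripDecay (-ω') ω' (fun w => e w * g w) := by
    refine hg.mul_bdd (he.mono (by linarith) hlt'.le).1 (B := Ce) fun w hw => ?_
    refine (hCe w ⟨by linarith [hw.1], by linarith [hw.2]⟩).trans ?_
    refine mul_le_of_le_one_right hCe0.le (Real.exp_le_one_iff.2 ?_)
    nlinarith [abs_nonneg w.re]
  have hfin : ∀ τ, |τ| = ω' → stripCalc A ω e * ∫ x, g (line τ x) • scaledRes A (line τ x) =
      (∫ x, (e (line τ x) * g (line τ x)) • scaledRes A (line τ x)) -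
        N • ((∫ x, g (line τ x) • T (-ω) (line τ x)) - ∫ x, g (line τ x) • T ω (line τ x)) := by
    intro τ hτ
    have i1 : Integrable fun x => N • (g (line τ x) • T (-ω) (line τ x) -
        g (line τ x) • T ω (line τ x)) := ((hTint _ habsn τ hτ).sub (hTint _ habs τ hτ)).smul N
    rw [mul_integral_op _ (hA.integrable_calc hφ hω' hτ hg),
      ← integral_sub (hTint _ habsn τ hτ) (hTint _ habs τ hτ), ← integral_smul,
      ← integral_sub (hA.integrable_calc hφ hω' hτ heg) i1]
    refine integral_congr_ae (Eventually.of_forall fun x => ?_)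
    simp only [mul_smul_comm]
    rw [hstep _ (by simpa using hτ)]
    module
  rw [stripCalc.eq_1 A ω', stripCalc.eq_1 A ω', mul_smul_comm, mul_sub, hfin _ habsn', hfin _ habs',
    hremeq _ habsn, hremeq _ habs, ← hN]
  congr 1
  abel

/-- The bounded operator `A (1 + A)⁻²` in the functional calculus. -/
theorem IsSectorial.stripCalc_id_div_sq (hA : IsSectorial A φ) (hφ : φ ∈ Ioo 0 Real.pi)
    (hω : ω ∈ Ioo φ Real.pi) :
    stripCalc A ω (fun w => Complex.exp w / (1 + Complex.exp w) ^ 2) =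
      yos A 1 - yos A 1 * yos A 1 := by
  have h0 : 0 ≤ ω := (hφ.1.trans hω.1).le
  -- With `q(z) = 2 / (2 + z) - 1 / (1 + z)` one has `z / (1 + z)² = q(z) / (1 + z) + q(z)`, and
  -- `q(A)` is already known.
  have d1 := stripDecay_yos_sub hω two_pos one_pos
  have e1 := hA.stripCalc_yos_sub hφ hω two_pos one_pos
  have d2 := d1.mul_div_add_exp hφ hω one_pos
  have e2 := hA.yos_mul_stripCalc hφ hω d1 one_pos
  have e3 := hA.stripCalc_sub hφ hω d2 (d1.const_mul (-1))
  rw [stripCalc_const_mul, ← e2, e1] at e3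
  have hyy : yos A 1 * yos A 2 = (2 : ℂ) • yos A 1 - yos A 2 := by
    have h1 := hA.exists_res_neg hφ one_pos
    have h2 := hA.exists_res_neg hφ two_pos
    have := resolvent_identity h1 h2
    simp only [yos]
    push_cast at *
    rw [show -(2 : ℂ) - -1 = -1 by norm_num] at this
    have h3 : res A (-1) * res A (-2) = res A (-2) - res A (-1) := by
      rw [← neg_sub (res A (-1)), this]; simp
    rw [smul_mul_smul_comm, neg_mul_neg, h3]
    module
  have e4 : yos A 1 - yos A 1 * yos A 1 = yos A 1 * (yos A 2 - yos A 1) -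
      (-1 : ℂ) • (yos A 2 - yos A 1) := by
    rw [mul_sub, hyy]
    module
  rw [e4, ← e3]
  refine stripCalc_congr (fun w hw => ?_) h0
  have n1 := add_exp_ne_zero_of_strip hω hw one_pos
  have n2 := add_exp_ne_zero_of_strip hω hw two_pos
  push_cast at n1 n2 ⊢
  field_simp
  ring

end Calculus

end

section

/-! ### Parameter ellipticity of the symbol -/

section Symbol

open Filter Topology

/-- The symbol `λ² + α λ z^ε + z` in the variables `λ = e^p`, `z = e^w`. -/
def symb (α ε : ℝ) (p w : ℂ) : ℂ :=
  Complex.exp (2 * p) + α * Complex.exp (p + ε * w) + Complex.exp w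

/-- Parameter ellipticity of the symbol `λ² + α λ z^ε + z`: no cancellation for `λ` in the sector
of half-angle `θ`, `|λ| ≥ e^{x₀}`, and `z` in the sector of half-angle `ω'`. -/
structure SymbolBound (α ε ω' θ x₀ c : ℝ) : Prop where
  pos : 0 < c
  nonneg : 0 ≤ x₀
  half_pi_lt : Real.pi / 2 < θ
  lt_pi : θ < Real.pi
  bound : ∀ p w : ℂ, |p.im| ≤ θ → x₀ ≤ p.re → |w.im| ≤ ω' →
    c * (Real.exp (2 * p.re) + Real.exp (p.re + ε * w.re) + Real.exp w.re) ≤ ‖symb α ε p w‖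

theorem norm_exp_add_exp_ge_of_abs_le {a b : ℂ} {η : ℝ} (h : |a.im - b.im| ≤ η) (hη : η ≤ Real.pi) :
    Real.cos (η / 2) * (Real.exp a.re + Real.exp b.re) ≤ ‖Complex.exp a + Complex.exp b‖ := by
  refine le_trans ?_ (norm_exp_add_exp_ge a b)
  gcongr
  refine le_trans ?_ (le_abs_self _)
  rw [← Real.cos_abs ((a.im - b.im) / 2)]
  refine Real.cos_le_cos_of_nonneg_of_le_pi (abs_nonneg _) (by
    linarith [Real.pi_pos, (abs_nonneg _).trans h]) ?_
  rw [abs_div, abs_two]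
  linarith

/-- The symbol is the product of `λ + e^κ z^{1/2}` and `λ + e^{-κ} z^{1/2}`. By hypothesis the
second summands have arguments less than `π / 2` in modulus, which leaves room for `λ` in a sector
of half-angle larger than `π / 2` without cancellation in either factor. -/
theorem symbolBound_of_factor {α : ℝ} {κ : ℂ} {ω' : ℝ}
    (hκ : Complex.exp κ + Complex.exp (-κ) = α) (h0 : 0 ≤ ω')
    (hω' : ω' / 2 + |κ.im| < Real.pi / 2) : ∃ θ x₀ c, SymbolBound α (1 / 2) ω' θ x₀ c := by
  set η := ω' / 2 + |κ.im| with hη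
  have hη0 : 0 ≤ η := by positivity
  -- Halfway between `π / 2` and `π - η`, so that still `θ + η < π`.
  set θ := Real.pi / 2 + (Real.pi / 2 - η) / 2 with hθ
  set k := Real.cos ((θ + η) / 2) with hk
  have hk0 : 0 < k := Real.cos_pos_of_mem_Ioo ⟨by linarith, by linarith⟩
  refine ⟨θ, 0, k ^ 2 * Real.exp (-|κ.re|) ^ 2, by positivity, le_rfl, by linarith, by linarith,
    fun p w hp _ hw => ?_⟩
  have hfac : symb α (1 / 2) p w = (Complex.exp p + Complex.exp (w / 2 + κ)) *
      (Complex.exp p + Complex.exp (w / 2 - κ)) := by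
    have e1 : Complex.exp (2 * p) = Complex.exp p * Complex.exp p := by
      rw [← Complex.exp_add]; congr 1; ring
    have e2 : Complex.exp w = Complex.exp (w / 2) * Complex.exp (w / 2) := by
      rw [← Complex.exp_add]; congr 1; ring
    have e3 : Complex.exp κ * Complex.exp (-κ) = 1 := by
      rw [← Complex.exp_add, add_neg_cancel, Complex.exp_zero]
    rw [symb, e1, e2, ← hκ, Complex.exp_add p, Complex.exp_add (w / 2), sub_eq_add_neg,
      Complex.exp_add (w / 2)]
    have e4 : Complex.exp (((1 / 2 : ℝ) : ℂ) * w) = Complex.exp (w / 2) := by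
      congr 1; push_cast; ring
    rw [e4]
    linear_combination (-Complex.exp (w / 2) * Complex.exp (w / 2)) * e3
  have key : ∀ σ : ℂ, |σ.im| = |κ.im| → |σ.re| = |κ.re| →
      k * Real.exp (-|κ.re|) * (Real.exp p.re + Real.exp (w.re / 2)) ≤
      ‖Complex.exp p + Complex.exp (w / 2 + σ)‖ := by
    intro σ h1 h2
    have h3 := norm_exp_add_exp_ge_of_abs_le (a := p) (b := w / 2 + σ) (η := θ + η) (by
      have : p.im - (w / 2 + σ).im = p.im - (w.im / 2 + σ.im) := by simp
      rw [this]
      have hh := abs_sub p.im (w.im / 2 + σ.im)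
      have hh2 := abs_add_le (w.im / 2) σ.im
      rw [abs_div, abs_two, h1] at hh2
      linarith) (by linarith)
    refine le_trans ?_ h3
    rw [← hk, mul_assoc]
    gcongr
    have h4 : (w / 2 + σ).re = w.re / 2 + σ.re := by simp
    rw [mul_add, ← Real.exp_add, ← Real.exp_add, h4]
    have h5 := neg_abs_le σ.re
    rw [h2] at h5
    gcongr ?_ + ?_
    · rw [Real.exp_le_exp]; linarith [abs_nonneg κ.re]
    · rw [Real.exp_le_exp]; linarith
  rw [hfac, norm_mul]
  have k1 := key κ rfl rfl
  have k2 := key (-κ) (by simp) (by simp)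
  rw [← sub_eq_add_neg] at k2
  refine le_trans ?_ (mul_le_mul k1 k2 (by positivity) (norm_nonneg _))
  have e1 : Real.exp (2 * p.re) = Real.exp p.re * Real.exp p.re := by
    rw [← Real.exp_add]; congr 1; ring
  have e2 : Real.exp w.re = Real.exp (w.re / 2) * Real.exp (w.re / 2) := by
    rw [← Real.exp_add]; congr 1; ring
  have e3 : Real.exp (p.re + 1 / 2 * w.re) = Real.exp p.re * Real.exp (w.re / 2) := by
    rw [← Real.exp_add]; congr 1; ring
  rw [e1, e3, e2]
  have hpos : 0 ≤ k ^ 2 * Real.exp (-|κ.re|) ^ 2 := by positivity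
  have hm := mul_pos (Real.exp_pos p.re) (Real.exp_pos (w.re / 2))
  nlinarith [mul_nonneg hpos hm.le]

/-- In terms of `|λ| = e^P` and `|z| = e^W`: if both alternatives failed, then `|z|` would exceed a
multiple of `|λ|²` and `|λ|` would exceed a multiple of `|z|^ε`, hence of `|λ|^{2ε}`. As `2ε > 1`,
this is impossible for large `|λ|`. -/
theorem dominated_exp_of_large {α ε k P W : ℝ} (hα : 0 < α) (hε : 1 / 2 < ε) (hk0 : 0 < k)
    (hP : (-Real.log (k / 2 * (α * (k / 2) ^ ε))) / (2 * ε - 1) + 1 ≤ P) :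
    Real.exp W ≤ k / 2 * (Real.exp (2 * P) + α * Real.exp (P + ε * W)) ∨
      Real.exp (2 * P) ≤ k / 2 * (α * Real.exp (P + ε * W) + Real.exp W) := by
  by_contra! hcon
  obtain ⟨c1, c2⟩ := hcon
  have hv0 : 0 < α * Real.exp (P + ε * W) := mul_pos hα (Real.exp_pos _)
  have a1 : k / 2 * Real.exp (2 * P) < Real.exp W := by
    have := mul_pos hk0 hv0
    linarith
  have a2 : k / 2 * (α * Real.exp (P + ε * W)) < Real.exp (2 * P) := by
    have := mul_pos hk0 (Real.exp_pos W)
    linarith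
  have l1 : Real.log (k / 2) + 2 * P < W := by
    have := Real.log_lt_log (by positivity) a1
    rwa [Real.log_mul (by positivity) (Real.exp_pos _).ne', Real.log_exp, Real.log_exp] at this
  have l2 : Real.log (k / 2) + (Real.log α + (P + ε * W)) < 2 * P := by
    have := Real.log_lt_log (by positivity) a2
    rwa [Real.log_mul (by positivity) hv0.ne', Real.log_exp,
      Real.log_mul hα.ne' (Real.exp_pos _).ne', Real.log_exp] at this
  have l3 : Real.log (k / 2 * (α * (k / 2) ^ ε)) =
      Real.log (k / 2) + (Real.log α + ε * Real.log (k / 2)) := by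
    rw [Real.log_mul (by positivity) (by positivity), Real.log_mul hα.ne' (by positivity),
      Real.log_rpow (by positivity)]
  have hε2 : 0 < 2 * ε - 1 := by linarith
  have l5 : -Real.log (k / 2 * (α * (k / 2) ^ ε)) < P * (2 * ε - 1) := by
    rw [← div_lt_iff₀ hε2]; linarith
  rw [l3] at l5
  have l6 := mul_lt_mul_of_pos_left l1 (by linarith : 0 < ε)
  linarith

/-- Neighbouring terms among `λ²`, `α λ z^ε`, `z` have arguments that differ by at most `θ + ε ω' <
π` (for the last two terms because `1 - ε ≤ ε`), so they do not cancel each other. The two outer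
terms might, but for large `|λ|` one of them is small compared with the sum of the other two. -/
theorem symbolBound_of_half_lt {α ε ω' : ℝ} (hα : 0 < α) (hε : 1 / 2 < ε) (hε1 : ε ≤ 1)
    (h0 : 0 ≤ ω') (hω' : ε * ω' < Real.pi / 2) : ∃ θ x₀ c, SymbolBound α ε ω' θ x₀ c := by
  set η := ε * ω' with hη
  have hη0 : 0 ≤ η := by positivity
  set θ := Real.pi / 2 + (Real.pi / 2 - η) / 2 with hθ
  set k := Real.cos ((θ + η) / 2) with hk
  have hk0 : 0 < k := Real.cos_pos_of_mem_Ioo ⟨by linarith, by linarith⟩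
  set m := min 1 α with hm
  have hm0 : 0 < m := lt_min one_pos hα
  set x₁ := max 0 ((-Real.log (k / 2 * (α * (k / 2) ^ ε))) / (2 * ε - 1) + 1) with hx₁
  refine ⟨θ, x₁, k / 4 * m, by positivity, le_max_left _ _, by linarith, by linarith,
    fun p w hp hpx hw => ?_⟩
  have hα' : (α : ℂ) = Complex.exp (Real.log α : ℝ) := by
    rw [← Complex.ofReal_exp, Real.exp_log hα]
  have hmid : (α : ℂ) * Complex.exp (p + ε * w) = Complex.exp (p + ε * w + (Real.log α : ℝ)) := by
    rw [Complex.exp_add _ ((Real.log α : ℝ) : ℂ), ← hα', mul_comm]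
  have hmidre : Real.exp (p + ε * w + (Real.log α : ℝ)).re = α * Real.exp (p.re + ε * w.re) := by
    simp only [Complex.add_re, Complex.mul_re, Complex.ofReal_re, Complex.ofReal_im, zero_mul,
      sub_zero]
    rw [Real.exp_add, Real.exp_log hα, mul_comm]
  have him : (p + ε * w + (Real.log α : ℝ)).im = p.im + ε * w.im := by
    simp only [Complex.add_im, Complex.mul_im, Complex.ofReal_re, Complex.ofReal_im, zero_mul,
      add_zero]
  set u := Real.exp (2 * p.re) with hu
  set v := α * Real.exp (p.re + ε * w.re) with hv
  set s := Real.exp w.re with hs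
  have hu0 : 0 < u := Real.exp_pos _
  have hv0 : 0 < v := by positivity
  have hs0 : 0 < s := Real.exp_pos _
  have h1 : k * (u + v) ≤ ‖Complex.exp (2 * p) + α * Complex.exp (p + ε * w)‖ := by
    rw [hmid]
    have := norm_exp_add_exp_ge_of_abs_le (a := 2 * p) (b := p + ε * w + (Real.log α : ℝ))
      (η := θ + η) (by
        rw [him]
        have e1 : (2 * p).im = 2 * p.im := by simp
        rw [e1, show 2 * p.im - (p.im + ε * w.im) = p.im - ε * w.im by ring]
        have := abs_sub p.im (ε * w.im)
        rw [abs_mul, abs_of_pos (by linarith : 0 < ε)] at this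
        nlinarith) (by linarith)
    rw [hmidre] at this
    simpa [← hk] using this
  have h2 : k * (v + s) ≤ ‖α * Complex.exp (p + ε * w) + Complex.exp w‖ := by
    rw [hmid]
    have := norm_exp_add_exp_ge_of_abs_le (a := p + ε * w + (Real.log α : ℝ)) (b := w)
      (η := θ + η) (by
        rw [him, show p.im + ε * w.im - w.im = p.im - (1 - ε) * w.im by ring]
        have := abs_sub p.im ((1 - ε) * w.im)
        rw [abs_mul, abs_of_nonneg (by linarith : 0 ≤ 1 - ε)] at this
        have h3 : (1 - ε) * |w.im| ≤ ε * ω' :=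
          mul_le_mul (by linarith) hw (abs_nonneg _) (by linarith)
        linarith) (by linarith)
    rw [hmidre] at this
    exact this
  have t1 : k * (u + v) - s ≤ ‖symb α ε p w‖ := by
    have := norm_sub_le_norm_add (Complex.exp (2 * p) + α * Complex.exp (p + ε * w))
      (Complex.exp w)
    rw [Complex.norm_exp] at this
    exact (sub_le_sub_right h1 _).trans this
  have t2 : k * (v + s) - u ≤ ‖symb α ε p w‖ := by
    have := norm_sub_le_norm_add (α * Complex.exp (p + ε * w) + Complex.exp w)
      (Complex.exp (2 * p))
    rw [Complex.norm_exp] at this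
    have e : α * Complex.exp (p + ε * w) + Complex.exp w + Complex.exp (2 * p) =
        symb α ε p w := by rw [symb]; ring
    rw [e] at this
    refine (sub_le_sub_right h2 _).trans ((le_of_eq ?_).trans this)
    simp [hu]
  have hk1 : k ≤ 1 := Real.cos_le_one _
  have hgoal : k / 4 * (u + v + s) ≤ ‖symb α ε p w‖ := by
    have n1 := mul_nonneg hk0.le hu0.le
    have n2 := mul_nonneg hk0.le hv0.le
    have n3 := mul_nonneg hk0.le hs0.le
    have n4 : k * u ≤ u := mul_le_of_le_one_left hu0.le hk1
    have n5 : k * s ≤ s := mul_le_of_le_one_left hs0.le hk1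
    rcases dominated_exp_of_large (W := w.re) hα hε hk0 ((le_max_right _ _).trans hpx) with c | c
    · change s ≤ k / 2 * (u + v) at c
      have n6 : k * s ≤ k * (u + v) := by
        refine mul_le_mul_of_nonneg_left (c.trans ?_) hk0.le
        nlinarith
      linarith
    · change u ≤ k / 2 * (v + s) at c
      have n6 : k * u ≤ k * (v + s) := by
        refine mul_le_mul_of_nonneg_left (c.trans ?_) hk0.le
        nlinarith
      linarith
  refine le_trans ?_ hgoal
  rw [mul_assoc]
  gcongr
  have hm1 : m ≤ 1 := min_le_left _ _
  have hmα : m * Real.exp (p.re + ε * w.re) ≤ v := by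
    rw [hv]; gcongr; exact min_le_right _ _
  have q1 := mul_le_mul_of_nonneg_right hm1 hu0.le
  have q2 := mul_le_mul_of_nonneg_right hm1 hs0.le
  linarith

theorem exists_symbolBound {φ α ε ω : ℝ} (hφ : φ ∈ Ioo 0 Real.pi) (hα : 0 < α)
    (hω : ω ∈ Ioo φ Real.pi)
    (h : (ε = 1 / 2 ∧ 2 ≤ α) ∨
      (ε = 1 / 2 ∧ α < 2 ∧ φ < Real.pi - 2 * Real.arctan (Real.sqrt (4 - α ^ 2) / α)) ∨
      (1 / 2 < ε ∧ ε ≤ 1 ∧ φ < Real.pi / (2 * ε))) :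
    ∃ ω' ∈ Ioo φ ω, ∃ θ x₀ c, SymbolBound α ε ω' θ x₀ c := by
  rcases h with ⟨rfl, h2⟩ | ⟨rfl, h2, h3⟩ | ⟨h1, h2, h3⟩
  · obtain ⟨ω', h4, h5⟩ := exists_between hω.1
    refine ⟨ω', ⟨h4, h5⟩, ?_⟩
    -- Here `t` is the larger root of `t² - α t + 1 = 0`, and `κ = log t` is real.
    have hd : 0 ≤ α ^ 2 - 4 := by nlinarith
    set t := (α + Real.sqrt (α ^ 2 - 4)) / 2 with ht
    have ht0 : 0 < t := by positivity
    have hts : t * (α - t) = 1 := by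
      rw [ht]
      have := Real.sq_sqrt hd
      nlinarith
    refine symbolBound_of_factor (κ := (Real.log t : ℝ)) ?_ (hφ.1.trans h4).le ?_
    · rw [← Complex.ofReal_neg, ← Complex.ofReal_exp, ← Complex.ofReal_exp, Real.exp_neg,
        Real.exp_log ht0, ← Complex.ofReal_add]
      congr 1
      field_simp
      linarith
    · simp only [Complex.ofReal_im, abs_zero, add_zero]
      linarith [hω.2]
  -- The angle with `2 cos γ = α`, so that `κ = i γ`; the assumption on `φ` says that `φ / 2 + γ < π
  -- / 2`.
  · set γ := Real.arctan (Real.sqrt (4 - α ^ 2) / α) with hγ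
    obtain ⟨ω', h4, h5⟩ := exists_between (lt_min hω.1 h3)
    refine ⟨ω', ⟨h4, h5.trans_le (min_le_left _ _)⟩, ?_⟩
    have h6 := h5.trans_le (min_le_right _ _)
    have hγ0 : 0 ≤ γ := Real.arctan_nonneg.2 (by positivity)
    have hcos : Real.cos γ = α / 2 := by
      rw [hγ, Real.cos_arctan, div_pow, Real.sq_sqrt (by nlinarith)]
      have : 1 + (4 - α ^ 2) / α ^ 2 = (2 / α) ^ 2 := by field_simp; ring
      rw [this, Real.sqrt_sq (by positivity)]
      field_simp
    refine symbolBound_of_factor (κ := (γ : ℂ) * Complex.I) ?_ (hφ.1.trans h4).le ?_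
    · have h7 := Complex.two_cos (γ : ℂ)
      rw [← neg_mul, ← h7, ← Complex.ofReal_cos, hcos]
      push_cast
      ring
    · have : ((γ : ℂ) * Complex.I).im = γ := by simp
      rw [this, abs_of_nonneg hγ0]
      linarith
  · obtain ⟨ω', h4, h5⟩ := exists_between (lt_min hω.1 h3)
    refine ⟨ω', ⟨h4, h5.trans_le (min_le_left _ _)⟩, ?_⟩
    have h6 := h5.trans_le (min_le_right _ _)
    refine symbolBound_of_half_lt hα h1 h2 (hφ.1.trans h4).le ?_
    rw [lt_div_iff₀ (by linarith)] at h6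
    linarith

end Symbol

end

section

open Filter Topology

/-! ### Symbols which pass from `1` to `0`, and uniform bounds for their operators -/

section Transition

variable {X : Type*} [NormedAddCommGroup X] [NormedSpace ℂ X]
variable {A : X →ₗ.[ℂ] X} {φ : ℝ}

/-- `γ` passes from `1` to `0` exponentially fast around `Re w = x₁`, along a strip. -/
structure IsTransition (ω K δ x₁ : ℝ) (γ : ℂ → ℂ) : Prop where
  right : ∀ w ∈ strip (-ω) ω, x₁ ≤ w.re → ‖γ w‖ ≤ K * Real.exp (-δ * (w.re - x₁))
  left : ∀ w ∈ strip (-ω) ω, w.re ≤ x₁ → ‖1 - γ w‖ ≤ K * Real.exp (δ * (w.re - x₁))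

/-- Both functions are near `1` on the left and near `0` on the right of the same point, so the
non-decaying parts cancel. -/
theorem IsTransition.norm_sub_le {ω K K' δ x₁ : ℝ} {γ γ' : ℂ → ℂ} (h : IsTransition ω K δ x₁ γ)
    (h' : IsTransition ω K' δ x₁ γ') {w : ℂ} (hw : w ∈ strip (-ω) ω) :
    ‖γ w - γ' w‖ ≤ (K + K') * Real.exp (-δ * |w.re - x₁|) := by
  rw [add_mul]
  rcases le_total x₁ w.re with hx | hx
  · rw [abs_of_nonneg (sub_nonneg.2 hx)]
    exact (_root_.norm_sub_le _ _).trans (add_le_add (h.right w hw hx) (h'.right w hw hx))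
  · rw [abs_of_nonpos (sub_nonpos.2 hx), neg_mul_neg]
    have e : γ w - γ' w = (1 - γ' w) - (1 - γ w) := by ring
    rw [e, add_comm]
    exact (_root_.norm_sub_le _ _).trans (add_le_add (h'.left w hw hx) (h.left w hw hx))

/-- Moving the centre to `0` costs the factor `e^{δ L}`. This is harmless where only local
uniformity in `λ` is required, as for holomorphy, but not for the global bound. -/
theorem IsTransition.shift {ω K δ x₁ L : ℝ} {γ : ℂ → ℂ} (h : IsTransition ω K δ x₁ γ)
    (hK : 0 ≤ K) (hδ : 0 ≤ δ) (hL : |x₁| ≤ L) :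
    IsTransition ω ((1 + K) * Real.exp (δ * L)) δ 0 γ := by
  obtain ⟨hL1, hL2⟩ := abs_le.1 hL
  have hL0 := (abs_nonneg x₁).trans hL
  constructor
  · intro w hw hx
    rcases le_total x₁ w.re with h1 | h1
    · refine (h.right w hw h1).trans ?_
      rw [mul_assoc, ← Real.exp_add]
      gcongr
      · linarith
      · nlinarith
    · have h2 := h.left w hw h1
      have h3 : Real.exp (δ * (w.re - x₁)) ≤ 1 := Real.exp_le_one_iff.2 (by nlinarith)
      have h4 : ‖γ w‖ ≤ 1 + K := by
        have e : γ w = 1 - (1 - γ w) := by ring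
        rw [e]
        refine (_root_.norm_sub_le _ _).trans ?_
        rw [norm_one]
        have := h2.trans (mul_le_of_le_one_right hK h3)
        linarith
      refine h4.trans ?_
      rw [mul_assoc, ← Real.exp_add]
      refine le_mul_of_one_le_right (by linarith) (Real.one_le_exp ?_)
      nlinarith
  · intro w hw hx
    rcases le_total x₁ w.re with h1 | h1
    · have h2 := h.right w hw h1
      have h3 : Real.exp (-δ * (w.re - x₁)) ≤ 1 := Real.exp_le_one_iff.2 (by nlinarith)
      have h4 : ‖1 - γ w‖ ≤ 1 + K := by
        refine (_root_.norm_sub_le _ _).trans ?_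
        rw [norm_one]
        have := h2.trans (mul_le_of_le_one_right hK h3)
        linarith
      refine h4.trans ?_
      rw [mul_assoc, ← Real.exp_add]
      refine le_mul_of_one_le_right (by linarith) (Real.one_le_exp ?_)
      nlinarith
    · refine (h.left w hw h1).trans ?_
      rw [mul_assoc, ← Real.exp_add]
      gcongr
      · linarith
      · nlinarith

/-- The model transition, centred at `|z| = μ`. It is useful because it is the symbol of `yos A μ`,
an operator bounded uniformly in `μ`. -/
theorem IsTransition.div_add_exp (hφ : φ ∈ Ioo 0 Real.pi) {ω δ μ : ℝ} (hω : ω ∈ Ioo φ Real.pi)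
    (hδ : δ ≤ 1) (hμ : 0 < μ) :
    IsTransition ω (Real.cos (ω / 2))⁻¹ δ (Real.log μ) (fun w => (μ : ℂ) / (μ + Complex.exp w)) := by
  have hk := cos_half_pos hφ hω
  constructor
  · intro w hw hx
    have h1 := norm_add_exp_ge_of_strip hω.2 hw hμ
    rw [norm_div, Complex.norm_real, Real.norm_of_nonneg hμ.le]
    have h2 : Real.cos (ω / 2) * Real.exp w.re ≤ ‖(μ : ℂ) + Complex.exp w‖ :=
      (mul_le_mul_of_nonneg_left (by linarith) hk.le).trans h1
    calc μ / ‖(μ : ℂ) + Complex.exp w‖ ≤ μ / (Real.cos (ω / 2) * Real.exp w.re) := by gcongr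
      _ = (Real.cos (ω / 2))⁻¹ * Real.exp (-1 * (w.re - Real.log μ)) := by
        rw [show -1 * (w.re - Real.log μ) = Real.log μ - w.re by ring, Real.exp_sub,
          Real.exp_log hμ]
        field_simp
      _ ≤ _ := by
        gcongr
  · intro w hw hx
    have h1 := norm_add_exp_ge_of_strip hω.2 hw hμ
    have hne := add_exp_ne_zero_of_strip hω hw hμ
    have e : 1 - (μ : ℂ) / (μ + Complex.exp w) = Complex.exp w / (μ + Complex.exp w) := by
      field_simp
      ring
    rw [e, norm_div, Complex.norm_exp]
    have h2 : Real.cos (ω / 2) * μ ≤ ‖(μ : ℂ) + Complex.exp w‖ :=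
      (mul_le_mul_of_nonneg_left (by linarith [Real.exp_pos w.re]) hk.le).trans h1
    calc Real.exp w.re / ‖(μ : ℂ) + Complex.exp w‖ ≤ Real.exp w.re / (Real.cos (ω / 2) * μ) := by
          gcongr
      _ = (Real.cos (ω / 2))⁻¹ * Real.exp (1 * (w.re - Real.log μ)) := by
        rw [one_mul, Real.exp_sub, Real.exp_log hμ]
        field_simp
      _ ≤ _ := by
        gcongr ?_ * Real.exp ?_
        nlinarith

/-- The sector in which the Laplace variable lives, in logarithmic coordinates. -/
def halfStrip (x₀ θ : ℝ) : Set ℂ := {p : ℂ | x₀ < p.re ∧ |p.im| < θ}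

theorem isOpen_halfStrip (x₀ θ : ℝ) : IsOpen (halfStrip x₀ θ) :=
  (isOpen_lt continuous_const Complex.continuous_re).inter
    (isOpen_lt (continuous_abs.comp Complex.continuous_im) continuous_const)

/-- A holomorphic family of transitions. -/
structure IsTransitionFamily (ω K δ a x₀ θ : ℝ) (γ : ℂ → ℂ → ℂ) : Prop where
  pos : 0 < δ
  le_one : δ ≤ 1
  nonneg : 0 ≤ K
  trans : ∀ p ∈ halfStrip x₀ θ, IsTransition ω K δ (a * p.re) (γ p)
  diff_right : ∀ p ∈ halfStrip x₀ θ, DifferentiableOn ℂ (γ p) (strip (-ω) ω)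
  diff_left : ∀ w ∈ strip (-ω) ω, DifferentiableOn ℂ (fun p => γ p w) (halfStrip x₀ θ)

variable [CompleteSpace X] {ω K δ a x₀ θ : ℝ} {γ : ℂ → ℂ → ℂ}

theorem IsTransitionFamily.norm_sub_le (h : IsTransitionFamily ω K δ a x₀ θ γ)
    (hφ : φ ∈ Ioo 0 Real.pi) (hω : ω ∈ Ioo φ Real.pi) {L : ℝ} {p : ℂ} (hp : p ∈ halfStrip x₀ θ)
    (hL : |a * p.re| ≤ L) {w : ℂ} (hw : w ∈ strip (-ω) ω) :
    ‖γ p w - 1 / (1 + Complex.exp w)‖ ≤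
      ((1 + K) * Real.exp (δ * L) + (Real.cos (ω / 2))⁻¹) * Real.exp (-δ * |w.re|) := by
  have h1 := (h.trans p hp).shift h.nonneg h.pos.le hL
  have h2 := IsTransition.div_add_exp hφ hω h.le_one one_pos
  rw [Real.log_one] at h2
  simpa using h1.norm_sub_le h2 hw

theorem IsTransitionFamily.stripDecay (h : IsTransitionFamily ω K δ a x₀ θ γ)
    (hφ : φ ∈ Ioo 0 Real.pi) (hω : ω ∈ Ioo φ Real.pi) {p : ℂ} (hp : p ∈ halfStrip x₀ θ) :
    StripDecay (-ω) ω (fun w => γ p w - 1 / (1 + Complex.exp w)) := by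
  refine ⟨(h.diff_right p hp).sub ?_, _, δ, h.pos, fun w hw => h.norm_sub_le hφ hω hp le_rfl hw⟩
  refine (differentiableOn_const _).div ((differentiableOn_const _).add
    Complex.differentiable_exp.differentiableOn) fun w hw => ?_
  simpa using add_exp_ne_zero_of_strip hω hw one_pos

/-- Subtraction of the fixed transition `1 / (1 + z)` leaves integrands which are dominated locally
uniformly in `p`. -/
theorem IsTransitionFamily.differentiableOn (h : IsTransitionFamily ω K δ a x₀ θ γ)
    (hA : IsSectorial A φ) (hφ : φ ∈ Ioo 0 Real.pi) (hω : ω ∈ Ioo φ Real.pi) :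
    DifferentiableOn ℂ
      (fun p => stripCalc A ω (fun w => γ p w - 1 / (1 + Complex.exp w))) (halfStrip x₀ θ) := by
  obtain ⟨M, hM0, hM⟩ := hA.exists_scaledRes_bound hφ hω
  have h0 : 0 < ω := hφ.1.trans hω.1
  have key : ∀ y : ℝ, |y| = ω → DifferentiableOn ℂ (fun p => ∫ x,
      (γ p (line y x) - 1 / (1 + Complex.exp (line y x))) • scaledRes A (line y x))
      (halfStrip x₀ θ) := by
    intro y hy
    have hmem : ∀ x, line y x ∈ strip (-ω) ω := fun x => by
      simpa [strip] using abs_le.1 hy.le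
    refine differentiableOn_integral_param (isOpen_halfStrip _ _) (fun p hp => ?_)
      (fun x => ?_) (fun p hp => ?_)
    · exact (hA.integrable_calc hφ hω hy (h.stripDecay hφ hω hp)).aestronglyMeasurable
    · exact ((h.diff_left _ (hmem x)).sub_const _).smul_const _
    · obtain ⟨r, hr, hr'⟩ := Metric.isOpen_iff.1 (isOpen_halfStrip x₀ θ) p hp
      refine ⟨r, hr, fun x => ((1 + K) * Real.exp (δ * (|a| * (|p.re| + r))) +
        (Real.cos (ω / 2))⁻¹) * Real.exp (-δ * |x|) * M,
        ((integrable_exp_neg_mul_abs h.pos).const_mul _).mul_const _, fun q hq x => ?_⟩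
      have hq' : |a * q.re| ≤ |a| * (|p.re| + r) := by
        rw [abs_mul]
        gcongr
        have h1 : |(q - p).re| ≤ ‖q - p‖ := Complex.abs_re_le_norm _
        rw [mem_ball_iff_norm] at hq
        have h2 : q.re = p.re + (q - p).re := by simp
        rw [h2]
        exact (abs_add_le _ _).trans (by linarith)
      rw [norm_smul]
      have h3 := h.norm_sub_le hφ hω (hr' hq) hq' (hmem x)
      rw [line_re] at h3
      refine mul_le_mul h3 (hM _ ?_) (norm_nonneg _) ((norm_nonneg _).trans h3)
      rw [line_im, cos_abs_le_of_eq hy]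
  unfold stripCalc
  exact ((key (-ω) (by rw [abs_neg, abs_of_pos h0])).sub (key ω (abs_of_pos h0))).const_smul
    (2 * (Real.pi : ℂ) * Complex.I)⁻¹

/-- The comparison is with `μ / (μ + z)` for `μ = |λ|^a`, whose centre moves along with that of `γ
p`. The difference decays away from this common centre, and `IsSectorial.norm_stripCalc_le` does not
see where the centre is. -/
theorem IsTransitionFamily.exists_bound (h : IsTransitionFamily ω K δ a x₀ θ γ)
    (hA : IsSectorial A φ) (hφ : φ ∈ Ioo 0 Real.pi) (hω : ω ∈ Ioo φ Real.pi) :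
    ∃ C, ∀ p ∈ halfStrip x₀ θ,
      ‖yos A 1 + stripCalc A ω (fun w => γ p w - 1 / (1 + Complex.exp w))‖ ≤ C := by
  obtain ⟨M, hM0, hM⟩ := hA.exists_scaledRes_bound hφ hω
  obtain ⟨B, hB0, hB⟩ := hA.norm_stripCalc_le hφ hω h.pos
  have h0 : 0 < ω := hφ.1.trans hω.1
  have hk := cos_half_pos hφ hω
  refine ⟨M + B * (K + (Real.cos (ω / 2))⁻¹), fun p hp => ?_⟩
  set μ := Real.exp (a * p.re) with hμ
  have hμ0 : 0 < μ := Real.exp_pos _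
  have hdec := h.stripDecay hφ hω hp
  have hy := stripDecay_yos_sub hω one_pos hμ0
  have e1 := hA.stripCalc_sub hφ hω hdec (hy.const_mul (-1))
  have e2 := stripCalc_const_mul (A := A) (ω := ω) (-1)
    (g := fun w => ((1 : ℝ) : ℂ) / ((1 : ℝ) + Complex.exp w) - (μ : ℂ) / (μ + Complex.exp w))
  rw [hA.stripCalc_yos_sub hφ hω one_pos hμ0] at e2
  have e3 : yos A 1 + stripCalc A ω (fun w => γ p w - 1 / (1 + Complex.exp w)) =
      yos A μ + stripCalc A ω (fun w => γ p w - 1 / (1 + Complex.exp w) - -1 *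
        (((1 : ℝ) : ℂ) / ((1 : ℝ) + Complex.exp w) - (μ : ℂ) / (μ + Complex.exp w))) := by
    rw [e1, e2, neg_one_smul]
    abel
  rw [e3]
  refine (norm_add_le _ _).trans (add_le_add ?_ (hB _ _ (a * p.re) ?_ fun w hw => ?_))
  · rw [yos_eq_scaledRes A hμ0]
    refine hM _ ?_
    rw [line_im]
    exact Real.cos_le_cos_of_nonneg_of_le_pi h0.le le_rfl hω.2.le
  · have := h.nonneg
    positivity
  · have h4 := IsTransition.div_add_exp hφ hω h.le_one hμ0
    rw [hμ, Real.log_exp] at h4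
    refine (le_of_eq ?_).trans ((h.trans p hp).norm_sub_le h4 hw)
    congr 1
    rw [← hμ, Complex.ofReal_one]
    ring

end Transition

end

section

/-! ### The symbols of the operators `N₁`, `N₃` and of `A^ε (1 + A)⁻ⁿ` -/

section ResolventFamily

variable {X : Type*} [NormedAddCommGroup X] [NormedSpace ℂ X]

/-- The operators `N₁ = λ² P(λ)⁻¹`, `N₂ = λ A^ε P(λ)⁻¹`, `N₃ = A P(λ)⁻¹` for `λ = e^p` and
`P(λ) = λ² + α λ A^ε + A`, described by their relations with `J = (1 + A)⁻¹` and `e = J^n A^ε`. -/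
structure ResolventFamily (J e : X →L[ℂ] X) (n : ℕ) (α θ x₀ : ℝ) (N₁ N₂ N₃ : ℂ → X →L[ℂ] X) :
    Prop where
  half_pi_lt : Real.pi / 2 < θ
  lt_pi : θ < Real.pi
  diff₁ : DifferentiableOn ℂ N₁ (halfStrip x₀ θ)
  diff₂ : DifferentiableOn ℂ N₂ (halfStrip x₀ θ)
  bdd₁ : ∃ C, ∀ p ∈ halfStrip x₀ θ, ‖N₁ p‖ ≤ C
  bdd₂ : ∃ C, ∀ p ∈ halfStrip x₀ θ, ‖N₂ p‖ ≤ C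
  sum : ∀ p ∈ halfStrip x₀ θ, N₁ p + (α : ℂ) • N₂ p + N₃ p = 1
  frac : ∀ p ∈ halfStrip x₀ θ, e * N₁ p = Complex.exp p • (J ^ n * N₂ p)
  main : ∀ p ∈ halfStrip x₀ θ, J * (N₁ p + Complex.exp (2 * p) • N₃ p) = N₁ p
  commute_J : ∀ p ∈ halfStrip x₀ θ, Commute J (N₁ p)
  commute_e : ∀ p ∈ halfStrip x₀ θ, Commute e (N₁ p)

variable {A : X →ₗ.[ℂ] X} {φ α ε ω ω' θ x₀ c : ℝ}

theorem SymbolBound.mem (h : SymbolBound α ε ω' θ x₀ c) {p w : ℂ} (hp : p ∈ halfStrip x₀ θ)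
    (hw : w ∈ strip (-ω') ω') :
    c * (Real.exp (2 * p.re) + Real.exp (p.re + ε * w.re) + Real.exp w.re) ≤ ‖symb α ε p w‖ :=
  h.bound p w hp.2.le hp.1.le (abs_le.2 hw)

theorem SymbolBound.ne_zero (h : SymbolBound α ε ω' θ x₀ c) {p w : ℂ} (hp : p ∈ halfStrip x₀ θ)
    (hw : w ∈ strip (-ω') ω') : symb α ε p w ≠ 0 := by
  have h1 := h.mem hp hw
  have := h.pos
  rw [← norm_pos_iff]
  exact lt_of_lt_of_le (by positivity) h1

theorem differentiable_symb_right (α ε : ℝ) (p : ℂ) : Differentiable ℂ (symb α ε p) := by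
  unfold symb; fun_prop

theorem differentiable_symb_left (α ε : ℝ) (w : ℂ) : Differentiable ℂ (fun p => symb α ε p w) := by
  unfold symb; fun_prop

/-- Any one of the three terms in the ellipticity estimate may serve as the lower bound of the
denominator; the alternatives in `hz` make the choice. -/
theorem SymbolBound.norm_div_le (h : SymbolBound α ε ω' θ x₀ c) {p w : ℂ}
    (hp : p ∈ halfStrip x₀ θ) (hw : w ∈ strip (-ω') ω') {v : ℂ} {y b z : ℝ} (hb : 0 ≤ b)
    (hv : ‖v‖ ≤ b * Real.exp y)
    (hz : y - z ≤ 2 * p.re ∨ y - z ≤ p.re + ε * w.re ∨ y - z ≤ w.re) :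
    ‖v / symb α ε p w‖ ≤ b * c⁻¹ * Real.exp z := by
  have h1 := h.mem hp hw
  have hc := h.pos
  have h2 : c * Real.exp (y - z) ≤ ‖symb α ε p w‖ := by
    refine le_trans (mul_le_mul_of_nonneg_left ?_ hc.le) h1
    have e1 := Real.exp_pos (2 * p.re)
    have e2 := Real.exp_pos (p.re + ε * w.re)
    have e3 := Real.exp_pos w.re
    rcases hz with hz | hz | hz
    all_goals
      have := Real.exp_le_exp.2 hz
      linarith
  rw [norm_div]
  calc ‖v‖ / ‖symb α ε p w‖ ≤ b * Real.exp y / (c * Real.exp (y - z)) := by gcongr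
    _ = b * c⁻¹ * Real.exp z := by
      rw [Real.exp_sub]
      field_simp

/-- The terms `λ²` and `λ z^ε` balance at `|z| = |λ|^{1/ε}`. For smaller `z` the term `λ²`
dominates, for larger `z` the denominator is at least a multiple of `|λ| |z|^ε`, which accounts for
the rate `ε`. -/
theorem SymbolBound.transitionFamily₁ (h : SymbolBound α ε ω' θ x₀ c) (hα : 0 < α)
    (hε : 1 / 2 ≤ ε) (hε1 : ε ≤ 1) :
    IsTransitionFamily ω' ((1 + α) * c⁻¹) ε ε⁻¹ x₀ θ
      (fun p w => Complex.exp (2 * p) / symb α ε p w) := by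
  have hε0 : 0 < ε := by linarith
  have hc := h.pos
  refine ⟨hε0, hε1, by positivity, fun p hp => ⟨fun w hw hx => ?_, fun w hw hx => ?_⟩,
    fun p hp => ?_, fun w hw => ?_⟩
  · refine (h.norm_div_le hp hw (b := 1) (y := 2 * p.re) (z := -ε * (w.re - ε⁻¹ * p.re))
      zero_le_one ?_ (Or.inr (Or.inl (le_of_eq ?_)))).trans ?_
    · rw [Complex.norm_exp]; simp
    · field_simp; ring
    · gcongr; linarith
  · have hne := h.ne_zero hp hw
    have e : 1 - Complex.exp (2 * p) / symb α ε p w =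
        Complex.exp w / symb α ε p w + α * Complex.exp (p + ε * w) / symb α ε p w := by
      rw [← add_div, eq_div_iff hne, sub_mul, div_mul_cancel₀ _ hne, one_mul, symb]
      ring
    have hP : 0 ≤ p.re := h.nonneg.trans hp.1.le
    simp only [e]
    refine (norm_add_le _ _).trans ?_
    rw [one_add_mul, add_mul]
    refine add_le_add ?_ ?_
    · rw [← one_mul c⁻¹]
      refine h.norm_div_le hp hw (y := w.re) zero_le_one ?_ (Or.inl ?_)
      · rw [Complex.norm_exp, one_mul]
      · have h3 : ε * (w.re - ε⁻¹ * p.re) = ε * w.re - p.re := by field_simp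
        rw [h3]
        have h4 : ε * w.re ≤ p.re := by
          have := mul_le_mul_of_nonneg_left hx hε0.le
          rwa [← mul_assoc, mul_inv_cancel₀ hε0.ne', one_mul] at this
        -- What is needed is `(1 - ε) Re w ≤ Re p`. For `Re w ≥ 0` it follows from `ε Re w ≤ Re p`
        -- because `ε ≥ 1 / 2`.
        rcases le_total w.re 0 with h5 | h5 <;> nlinarith
    · refine h.norm_div_le hp hw (y := p.re + ε * w.re) hα.le ?_ (Or.inl (le_of_eq ?_))
      · rw [norm_mul, Complex.norm_real, Real.norm_of_nonneg hα.le, Complex.norm_exp]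
        simp
      · field_simp; ring
  · exact (differentiableOn_const _).div (differentiable_symb_right _ _ _).differentiableOn
      fun w hw => h.ne_zero hp hw
  · refine DifferentiableOn.div ?_ (differentiable_symb_left _ _ _).differentiableOn
      fun p hp => h.ne_zero hp hw
    fun_prop

/-- Now `λ z^ε` and `z` balance, at `|z| = |λ|^{1/(1-ε)}`, and the rate is `1 - ε`. For `ε = 1` the
two terms have the same order in `z` and there is no such transition. -/
theorem SymbolBound.transitionFamily₃ (h : SymbolBound α ε ω' θ x₀ c) (hα : 0 < α)
    (hε : 1 / 2 ≤ ε) (hε1 : ε < 1) :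
    IsTransitionFamily ω' ((1 + α) * c⁻¹) (1 - ε) (1 - ε)⁻¹ x₀ θ
      (fun p w => 1 - Complex.exp w / symb α ε p w) := by
  have hε0 : 0 < 1 - ε := by linarith
  have hc := h.pos
  refine ⟨hε0, by linarith, by positivity, fun p hp => ⟨fun w hw hx => ?_, fun w hw hx => ?_⟩,
    fun p hp => ?_, fun w hw => ?_⟩
  · have hne := h.ne_zero hp hw
    have e : 1 - Complex.exp w / symb α ε p w =
        Complex.exp (2 * p) / symb α ε p w + α * Complex.exp (p + ε * w) / symb α ε p w := by
      rw [← add_div, eq_div_iff hne, sub_mul, div_mul_cancel₀ _ hne, one_mul, symb]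
      ring
    have hP : 0 ≤ p.re := h.nonneg.trans hp.1.le
    have h3 : (1 - ε) * (w.re - (1 - ε)⁻¹ * p.re) = (1 - ε) * w.re - p.re := by field_simp
    rw [neg_mul, h3]
    simp only [e]
    refine (norm_add_le _ _).trans ?_
    rw [one_add_mul, add_mul]
    refine add_le_add ?_ ?_
    · rw [← one_mul c⁻¹]
      refine h.norm_div_le hp hw (y := 2 * p.re) zero_le_one ?_ (Or.inr (Or.inr ?_))
      · rw [Complex.norm_exp]; simp
      · have h4 : p.re ≤ (1 - ε) * w.re := by
          have := mul_le_mul_of_nonneg_left hx hε0.le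
          rwa [← mul_assoc, mul_inv_cancel₀ hε0.ne', one_mul] at this
        have h5 : 0 ≤ w.re := by
          by_contra hcon
          push Not at hcon
          nlinarith
        nlinarith
    · refine h.norm_div_le hp hw (y := p.re + ε * w.re) hα.le ?_ (Or.inr (Or.inr (le_of_eq ?_)))
      · rw [norm_mul, Complex.norm_real, Real.norm_of_nonneg hα.le, Complex.norm_exp]
        simp
      · ring
  · rw [sub_sub_cancel]
    refine (h.norm_div_le hp hw (b := 1) (y := w.re)
      (z := (1 - ε) * (w.re - (1 - ε)⁻¹ * p.re))
      zero_le_one ?_ (Or.inr (Or.inl (le_of_eq ?_)))).trans ?_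
    · rw [Complex.norm_exp]; simp
    · field_simp; ring
    · gcongr; linarith
  · exact (differentiableOn_const _).sub (Complex.differentiable_exp.differentiableOn.div
      (differentiable_symb_right _ _ _).differentiableOn fun w hw => h.ne_zero hp hw)
  · exact (differentiableOn_const _).sub ((differentiableOn_const _).div
      (differentiable_symb_left _ _ _).differentiableOn fun p hp => h.ne_zero hp hw)

/-- The symbol of `A^ε (1 + A)^{-n}`. -/
def fracSymb (ε : ℝ) (n : ℕ) (w : ℂ) : ℂ := Complex.exp (ε * w) / (1 + Complex.exp w) ^ n

theorem stripDecay_fracSymb (hφ : φ ∈ Ioo 0 Real.pi) (hω : ω ∈ Ioo φ Real.pi) (hε : 0 < ε) {n : ℕ}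
    (hn : ε < n) : StripDecay (-ω) ω (fracSymb ε n) := by
  have hk := cos_half_pos hφ hω
  refine ⟨?_, (Real.cos (ω / 2) ^ n)⁻¹, min ε (n - ε), lt_min hε (by linarith), fun w hw => ?_⟩
  · refine DifferentiableOn.div (by fun_prop) (by fun_prop) fun w hw => pow_ne_zero _ ?_
    simpa using add_exp_ne_zero_of_strip hω hw one_pos
  · have h1 := norm_add_exp_ge_of_strip hω.2 hw one_pos
    rw [Complex.ofReal_one] at h1
    have h3 : ∀ x : ℝ, 0 ≤ x → Real.exp x ≤ 1 + Real.exp w.re →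
        ‖fracSymb ε n w‖ ≤ (Real.cos (ω / 2) ^ n)⁻¹ * Real.exp (ε * w.re - n * x) := by
      intro x hx hx2
      have h2 : Real.cos (ω / 2) ^ n * Real.exp (n * x) ≤ ‖1 + Complex.exp w‖ ^ n := by
        rw [Real.exp_nat_mul, ← mul_pow]
        exact pow_le_pow_left₀ (by positivity)
          ((mul_le_mul_of_nonneg_left hx2 hk.le).trans h1) _
      rw [fracSymb, norm_div, norm_pow, Complex.norm_exp]
      have h4 : ((ε : ℂ) * w).re = ε * w.re := by simp
      rw [h4]
      calc Real.exp (ε * w.re) / ‖1 + Complex.exp w‖ ^ n ≤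
          Real.exp (ε * w.re) / (Real.cos (ω / 2) ^ n * Real.exp (n * x)) := by gcongr
        _ = _ := by rw [Real.exp_sub]; field_simp
    rcases le_total 0 w.re with hx | hx
    · refine (h3 w.re hx (by linarith)).trans ?_
      gcongr
      rw [abs_of_nonneg hx]
      have := mul_le_mul_of_nonneg_right (min_le_right ε (n - ε)) hx
      linarith
    · refine (h3 0 le_rfl (by rw [Real.exp_zero]; linarith [Real.exp_pos w.re])).trans ?_
      gcongr
      rw [abs_of_nonpos hx]
      have := mul_le_mul_of_nonneg_right (min_le_left ε (n - ε)) (neg_nonneg.2 hx)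
      linarith

/-- On the strip `|Im w| ≤ ω < π` the principal logarithm of `e^w` is `w`, so the principal power is
`e^{ε w}`. -/
theorem sectorCalc_fracSymb (A : X →ₗ.[ℂ] X) (h0 : 0 ≤ ω) (hω : ω < Real.pi) (n : ℕ) :
    sectorCalc A ω (fun w => w ^ (ε : ℂ) / (1 + w) ^ n) = stripCalc A ω (fracSymb ε n) := by
  rw [sectorCalc_eq_stripCalc]
  refine stripCalc_congr (fun w hw => ?_) h0
  simp only [fracSymb]
  rw [Complex.cpow_def_of_ne_zero (Complex.exp_ne_zero _), Complex.log_exp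
    (by linarith [hw.1]) (by linarith [hw.2]), mul_comm w]

theorem IsSectorial.commute_yos_scaledRes (hA : IsSectorial A φ) (hφ : φ ∈ Ioo 0 Real.pi) {μ : ℝ}
    (hμ : 0 < μ) {w : ℂ} (hw : Real.cos w.im < Real.cos φ) :
    Commute (yos A μ) (scaledRes A w) := by
  rw [yos_eq_scaledRes A hμ]
  have h2 : Real.cos (line Real.pi (Real.log μ)).im < Real.cos φ := by
    rw [line_im]
    exact Real.cos_lt_cos_of_nonneg_of_le_pi hφ.1.le le_rfl hφ.2
  exact ((commute_res (hA.exists_res_exp hφ h2) (hA.exists_res_exp hφ hw)).smul_left _).smul_right _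

end ResolventFamily

end

section

/-! ### The resolvent family for `ε < 1` -/

section Construction

variable {X : Type*} [NormedAddCommGroup X] [NormedSpace ℂ X] [CompleteSpace X]
  {A : X →ₗ.[ℂ] X} {φ α ε ω ω' θ x₀ c : ℝ} {g : ℂ → ℂ}

theorem IsSectorial.yos_one_mul_stripCalc (hA : IsSectorial A φ) (hφ : φ ∈ Ioo 0 Real.pi)
    (hω : ω ∈ Ioo φ Real.pi) (hg : StripDecay (-ω) ω g) :
    yos A 1 * stripCalc A ω g = stripCalc A ω (fun w => 1 / (1 + Complex.exp w) * g w) := by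
  simpa using hA.yos_mul_stripCalc hφ hω hg one_pos

theorem StripDecay.mul_one_div (hφ : φ ∈ Ioo 0 Real.pi) (hω : ω ∈ Ioo φ Real.pi)
    (hg : StripDecay (-ω) ω g) :
    StripDecay (-ω) ω (fun w => 1 / (1 + Complex.exp w) * g w) := by
  simpa using hg.mul_div_add_exp hφ hω one_pos

theorem one_add_exp_ne_zero_of_strip (hω : ω ∈ Ioo φ Real.pi) {w : ℂ} (hw : w ∈ strip (-ω) ω) :
    1 + Complex.exp w ≠ 0 := by
  simpa using add_exp_ne_zero_of_strip hω hw one_pos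

theorem StripDecay.mul_strip {e : ℂ → ℂ} (he : StripDecay (-ω) ω e) (hg : StripDecay (-ω) ω g) :
    StripDecay (-ω) ω (fun w => e w * g w) := by
  obtain ⟨C, δ, hC0, hδ, hC⟩ := he.exists_pos
  refine hg.mul_bdd (B := C) he.1 fun w hw => (hC w hw).trans ?_
  refine mul_le_of_le_one_right hC0.le (Real.exp_le_one_iff.2 ?_)
  nlinarith [abs_nonneg w.re]

/-- The symbols of `N₁` and `1 - N₃` tend to `1` at `0` and to `0` at infinity, so each operator is
`J` plus an operator of the elementary calculus. There is no separate construction of `N₂`: it is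
read off from `N₁ + α N₂ + N₃ = 1`. The relations `frac` and `main` reduce to identities between
symbols by multiplicativity, for which `e` lives on the larger sector of angle `ω` and the symbols
of the `N`'s on that of angle `ω'`. -/
theorem IsSectorial.resolventFamily_of_lt_one (hA : IsSectorial A φ) (hφ : φ ∈ Ioo 0 Real.pi)
    (hω' : ω' ∈ Ioo φ ω) (hω : ω ∈ Ioo φ Real.pi) (h : SymbolBound α ε ω' θ x₀ c) (hα : 0 < α)
    (hε : 1 / 2 ≤ ε) (hε1 : ε < 1) :
    ∃ N₁ N₂ N₃, ResolventFamily (yos A 1) (stripCalc A ω (fracSymb ε 1)) 1 α θ x₀ N₁ N₂ N₃ := by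
  have hω1 : ω' ∈ Ioo φ Real.pi := ⟨hω'.1, hω'.2.trans hω.2⟩
  have h0' : 0 ≤ ω' := (hφ.1.trans hω1.1).le
  have hlt := cos_lt_cos_of_mem hφ hω1
  have t₁ := h.transitionFamily₁ hα hε hε1.le
  have t₃ := h.transitionFamily₃ hα hε hε1
  set J := yos A 1 with hJ
  set g₁ : ℂ → ℂ → ℂ := fun p w => Complex.exp (2 * p) / symb α ε p w - 1 / (1 + Complex.exp w)
    with hg₁
  set g₃ : ℂ → ℂ → ℂ := fun p w => 1 - Complex.exp w / symb α ε p w - 1 / (1 + Complex.exp w)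
    with hg₃
  have d₁ : ∀ p ∈ halfStrip x₀ θ, StripDecay (-ω') ω' (g₁ p) := fun p hp =>
    t₁.stripDecay hφ hω1 hp
  have d₃ : ∀ p ∈ halfStrip x₀ θ, StripDecay (-ω') ω' (g₃ p) := fun p hp =>
    t₃.stripDecay hφ hω1 hp
  set N₁ : ℂ → X →L[ℂ] X := fun p => J + stripCalc A ω' (g₁ p) with hN₁
  set N₃ : ℂ → X →L[ℂ] X := fun p => 1 - (J + stripCalc A ω' (g₃ p)) with hN₃
  have f₁ : DifferentiableOn ℂ N₁ (halfStrip x₀ θ) :=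
    (differentiableOn_const _).add (t₁.differentiableOn hA hφ hω1)
  have f₃ : DifferentiableOn ℂ N₃ (halfStrip x₀ θ) :=
    (differentiableOn_const _).sub ((differentiableOn_const _).add (t₃.differentiableOn hA hφ hω1))
  obtain ⟨C₁, hC₁⟩ := t₁.exists_bound hA hφ hω1
  obtain ⟨C₃, hC₃⟩ := t₃.exists_bound hA hφ hω1
  have hα' : (α : ℂ) ≠ 0 := by exact_mod_cast hα.ne'
  set N₂ : ℂ → X →L[ℂ] X := fun p => (α : ℂ)⁻¹ • ((J + stripCalc A ω' (g₃ p)) - N₁ p) with hN₂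
  have hfd := stripDecay_fracSymb hφ hω (by linarith : 0 < ε) (n := 1) (by simpa using hε1)
  have hfd' : StripDecay (-ω') ω' (fracSymb ε 1) := hfd.mono (by linarith [hω'.2]) hω'.2.le
  set r : ℂ → ℂ := fun w => 1 / (1 + Complex.exp w) with hr
  have hone := fun {w : ℂ} (hw : w ∈ strip (-ω') ω') => one_add_exp_ne_zero_of_strip hω1 hw
  have hcJ : ∀ p ∈ halfStrip x₀ θ, Commute J (N₁ p) := fun p hp =>
    (Commute.refl J).add_right (hA.commute_stripCalc hφ hω1 (d₁ p hp) fun w hw =>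
      hA.commute_yos_scaledRes hφ one_pos hw)
  have hce : ∀ w : ℂ, Real.cos w.im < Real.cos φ →
      Commute (stripCalc A ω (fracSymb ε 1)) (scaledRes A w) := fun w hw =>
    (hA.commute_stripCalc hφ hω hfd fun w' hw' => hA.commute_scaledRes hφ hw hw').symm
  have heJ : Commute (stripCalc A ω (fracSymb ε 1)) J :=
    (hA.commute_stripCalc hφ hω hfd fun w hw => hA.commute_yos_scaledRes hφ one_pos hw).symm
  refine ⟨N₁, N₂, N₃, h.half_pi_lt, h.lt_pi, f₁, ?_, ⟨C₁, hC₁⟩, ⟨α⁻¹ * (C₃ + C₁), ?_⟩, ?_, ?_, ?_,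
    hcJ, ?_⟩
  · exact (((differentiableOn_const _).add (t₃.differentiableOn hA hφ hω1)).sub f₁).const_smul
      (α : ℂ)⁻¹
  · intro p hp
    rw [hN₂, norm_smul, norm_inv, Complex.norm_real, Real.norm_of_nonneg hα.le]
    gcongr
    exact (norm_sub_le _ _).trans (add_le_add (hC₃ p hp) (hC₁ p hp))
  · intro p hp
    simp only [hN₂, hN₃, smul_inv_smul₀ hα']
    abel
  · intro p hp
    have e1 : stripCalc A ω (fracSymb ε 1) * N₁ p =
        stripCalc A ω' (fun w => r w * fracSymb ε 1 w) +
        stripCalc A ω' (fun w => fracSymb ε 1 w * g₁ p w) := by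
      rw [hN₁, mul_add, heJ.eq, hA.yos_one_mul_stripCalc hφ hω hfd,
        stripCalc_eq_of_lt hA hφ hω1 hω hω'.2.le (hfd.mul_one_div hφ hω),
        hA.stripCalc_mul hφ hω1 hω.2 hω'.2 hfd (d₁ p hp)]
    have e2 : J * N₂ p = (α : ℂ)⁻¹ • (stripCalc A ω' (fun w => r w * g₃ p w) -
        stripCalc A ω' (fun w => r w * g₁ p w)) := by
      simp only [hN₂, hN₁, add_sub_add_left_eq_sub]
      rw [mul_smul_comm, mul_sub, hA.yos_one_mul_stripCalc hφ hω1 (d₁ p hp),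
        hA.yos_one_mul_stripCalc hφ hω1 (d₃ p hp)]
    have k1 := hfd'.mul_one_div hφ hω1
    have k2 := hfd'.mul_strip (d₁ p hp)
    have k3 := (d₃ p hp).mul_one_div hφ hω1
    have k4 := (d₁ p hp).mul_one_div hφ hω1
    rw [pow_one, e1, e2, ← hA.stripCalc_sub hφ hω1 k3 k4, smul_smul, ← stripCalc_const_mul,
      ← sub_neg_eq_add, ← neg_one_smul ℂ, ← stripCalc_const_mul,
      ← hA.stripCalc_sub hφ hω1 k1 (k2.const_mul _)]
    refine stripCalc_congr (fun w hw => ?_) h0'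
    have n1 := hone hw
    have n2 := h.ne_zero hp hw
    have hs : α * Complex.exp (p + ε * w) = symb α ε p w - Complex.exp (2 * p) - Complex.exp w := by
      rw [symb]; ring
    have h2 : Complex.exp (2 * p) = Complex.exp p * Complex.exp p := by
      rw [← Complex.exp_add]; congr 1; ring
    have hs' : Complex.exp p * Complex.exp (ε * w) =
        (symb α ε p w - Complex.exp (2 * p) - Complex.exp w) / α := by
      rw [← hs, Complex.exp_add]; field_simp
    have n3 := Complex.exp_ne_zero p
    simp only [hg₁, hg₃, fracSymb]
    -- Both sides are `λ² z^ε / ((1 + z) P)`, where `P` is the symbol at `(λ, z)`.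
    trans Complex.exp (2 * p) * Complex.exp (ε * w) / ((1 + Complex.exp w) * symb α ε p w)
    · field_simp
      ring
    · rw [h2, mul_assoc (Complex.exp p), hs', h2]
      field_simp
      ring
  · intro p hp
    have k3 := (d₃ p hp).mul_one_div hφ hω1
    have k4 := (d₁ p hp).mul_one_div hφ hω1
    have e1 : J * N₁ p = J * J + stripCalc A ω' (fun w => r w * g₁ p w) := by
      simp only [hN₁]
      rw [mul_add, hA.yos_one_mul_stripCalc hφ hω1 (d₁ p hp)]
    have e2 : J * N₃ p = J - J * J - stripCalc A ω' (fun w => r w * g₃ p w) := by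
      simp only [hN₃]
      rw [mul_sub, mul_add, hA.yos_one_mul_stripCalc hφ hω1 (d₃ p hp), mul_one, sub_add_eq_sub_sub]
    -- The part of the relation inside the elementary calculus. Its defect is a multiple of `z / (1
    -- + z)²`, which corresponds to the terms `J` and `J²` outside of that calculus.
    have e3 : stripCalc A ω' (fun w => r w * g₁ p w) - Complex.exp (2 * p) •
        stripCalc A ω' (fun w => r w * g₃ p w) - stripCalc A ω' (g₁ p) =
        (1 - Complex.exp (2 * p)) • (J - J * J) := by
      rw [← hA.stripCalc_id_div_sq hφ hω1, ← stripCalc_const_mul, ← stripCalc_const_mul,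
        ← hA.stripCalc_sub hφ hω1 k4 (k3.const_mul _),
        ← hA.stripCalc_sub hφ hω1 (k4.sub (k3.const_mul _)) (d₁ p hp)]
      refine stripCalc_congr (fun w hw => ?_) h0'
      have n1 := hone hw
      have n2 := h.ne_zero hp hw
      simp only [hg₁, hg₃]
      field_simp
      ring
    rw [mul_add, mul_smul_comm, e1, e2, hN₁]
    linear_combination (norm := module) e3
  · intro p hp
    exact heJ.add_right (hA.commute_stripCalc hφ hω1 (d₁ p hp) hce)

end Construction

end

section

open Filter Topology

/-! ### The resolvent family for `ε = 1` -/

section Linear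

variable {X : Type*} [NormedAddCommGroup X] [NormedSpace ℂ X]
  {A : X →ₗ.[ℂ] X} {φ α ε ω ω' θ x₀ c : ℝ}

/-- The logarithm of `-λ² / (1 + α λ)` for `λ = e^p`. -/
def shiftLog (α : ℝ) (p : ℂ) : ℂ := p + Real.pi * Complex.I - Complex.log (α + Complex.exp (-p))

theorem exp_shiftLog {p : ℂ} (hα : 0 < α) (hp : |p.im| < Real.pi) :
    (1 + α * Complex.exp p) * Complex.exp (shiftLog α p) = -Complex.exp (2 * p) := by
  have hs := add_exp_mem_slitPlane (ζ := -p) (by simpa using hp) hα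
  have hne := Complex.slitPlane_ne_zero hs
  rw [shiftLog, Complex.exp_sub, Complex.exp_add, Complex.exp_pi_mul_I, Complex.exp_log hne]
  have h1 : Complex.exp (2 * p) = Complex.exp p * Complex.exp p := by
    rw [← Complex.exp_add]; congr 1; ring
  have h2 : Complex.exp p * Complex.exp (-p) = 1 := by
    rw [← Complex.exp_add, add_neg_cancel, Complex.exp_zero]
  rw [h1]
  field_simp
  linear_combination h2

/-- If `-λ² / (1 + α λ)` had an argument less than `ω'` in modulus, it would be a zero `z` of the
symbol `λ² + α λ z + z`, contrary to ellipticity. As `shiftLog` need not be the principal logarithm,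
the argument passes to the principal one. -/
theorem SymbolBound.cos_shiftLog_le (h : SymbolBound α 1 ω' θ x₀ c) (hα : 0 < α)
    (h0 : 0 ≤ ω') {p : ℂ} (hp : p ∈ halfStrip x₀ θ) :
    Real.cos (shiftLog α p).im ≤ Real.cos ω' := by
  have he := exp_shiftLog hα (hp.2.trans h.lt_pi)
  by_contra! hcon
  set W := shiftLog α p
  set w := Complex.log (Complex.exp W) with hw
  have hew : Complex.exp w = Complex.exp W := Complex.exp_log (Complex.exp_ne_zero _)
  have h1 : Real.cos w.im = Real.cos W.im := by
    have h2 := congrArg Complex.re hew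
    have h3 := congrArg norm hew
    rw [Complex.norm_exp, Complex.norm_exp] at h3
    rw [Complex.exp_re, Complex.exp_re, h3] at h2
    exact mul_left_cancel₀ (Real.exp_pos _).ne' h2
  have h2 : |w.im| ≤ Real.pi := abs_le.2 ⟨(Complex.neg_pi_lt_log_im _).le, Complex.log_im_le_pi _⟩
  have h3 : |w.im| ≤ ω' := by
    by_contra! h4
    rw [← h1, ← Real.cos_abs w.im] at hcon
    exact absurd (Real.cos_le_cos_of_nonneg_of_le_pi h0 h2 h4.le) (not_le.2 hcon)
  refine h.ne_zero hp (abs_le.1 h3) ?_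
  rw [symb, Complex.ofReal_one, one_mul, Complex.exp_add, hew]
  linear_combination he

theorem norm_one_add_mul_exp_ge {p : ℂ} {η : ℝ} (hα : 0 < α) (hη : η ≤ Real.pi)
    (hp : |p.im| ≤ η) :
    Real.cos (η / 2) * (1 + α * Real.exp p.re) ≤ ‖1 + α * Complex.exp p‖ := by
  have := norm_exp_add_exp_ge_of_abs_le (a := 0) (b := p + Real.log α) (η := η) (by
    simpa using hp) hη
  rw [Complex.exp_zero, Complex.exp_add, ← Complex.ofReal_exp, Real.exp_log hα, Complex.zero_re,
    Real.exp_zero, Complex.add_re, Complex.ofReal_re, Real.exp_add, Real.exp_log hα] at this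
  rwa [mul_comm α, mul_comm (α : ℂ)]

/-- In view of `1 - J = J A` with `J = yos A 1`, this is `A (z R) = -z (1 - z R)`, multiplied by
`J`, for `z = e^w`. -/
theorem IsSectorial.yos_one_mul_scaledRes (hA : IsSectorial A φ) (hφ : φ ∈ Ioo 0 Real.pi) {w : ℂ}
    (hw : Real.cos w.im < Real.cos φ) :
    scaledRes A w - yos A 1 * scaledRes A w =
      (-Complex.exp w) • (yos A 1 * (1 - scaledRes A w)) := by
  have h := resolvent_identity (hA.exists_res_neg hφ one_pos) (hA.exists_res_exp hφ hw)
  rw [Complex.ofReal_one] at h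
  rw [yos_one, scaledRes]
  have h2 : res A (Complex.exp w) = res A (-1) - (Complex.exp w + 1) •
      (res A (-1) * res A (Complex.exp w)) := by
    rw [← sub_neg_eq_add, ← h]; abel
  rw [mul_sub, mul_one, neg_mul, mul_smul_comm]
  nth_rw 1 [h2]
  module

/-- Here `P(λ) = (1 + α λ) (A - ζ)` with `ζ = -λ² / (1 + α λ)`. Therefore `λ² P⁻¹` is the scaled
resolvent at `ζ` and `A P⁻¹ = (1 + α λ)⁻¹ (1 - λ² P⁻¹)`, and the bounds follow from sectoriality
alone. -/
theorem IsSectorial.resolventFamily_one [CompleteSpace X] (hA : IsSectorial A φ)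
    (hφ : φ ∈ Ioo 0 Real.pi)
    (hω' : ω' ∈ Ioo φ ω) (hω : ω ∈ Ioo φ Real.pi) (h : SymbolBound α 1 ω' θ x₀ c) (hα : 0 < α) :
    ∃ N₁ N₂ N₃, ResolventFamily (yos A 1) (stripCalc A ω (fracSymb 1 2)) 2 α θ x₀ N₁ N₂ N₃ := by
  have hω1 : ω' ∈ Ioo φ Real.pi := ⟨hω'.1, hω'.2.trans hω.2⟩
  have h0' : 0 ≤ ω' := (hφ.1.trans hω1.1).le
  have hlt := cos_lt_cos_of_mem hφ hω1
  obtain ⟨M, hM0, hM⟩ := hA.exists_scaledRes_bound hφ hω1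
  have hcos : ∀ p ∈ halfStrip x₀ θ, Real.cos (shiftLog α p).im ≤ Real.cos ω' := fun p hp =>
    h.cos_shiftLog_le hα h0' hp
  have he : stripCalc A ω (fracSymb 1 2) = yos A 1 - yos A 1 * yos A 1 := by
    rw [← hA.stripCalc_id_div_sq hφ hω]
    congr 1
    funext w
    simp [fracSymb]
  set J := yos A 1 with hJ
  set N₁ : ℂ → X →L[ℂ] X := fun p => scaledRes A (shiftLog α p) with hN₁
  set N₃ : ℂ → X →L[ℂ] X := fun p => (1 + α * Complex.exp p)⁻¹ • (1 - N₁ p) with hN₃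
  set N₂ : ℂ → X →L[ℂ] X := fun p => Complex.exp p • N₃ p with hN₂
  set k := Real.cos (θ / 2) with hk
  have hk0 : 0 < k := Real.cos_pos_of_mem_Ioo
    ⟨by linarith [h.half_pi_lt, Real.pi_pos], by linarith [h.lt_pi]⟩
  have hden : ∀ p ∈ halfStrip x₀ θ, k * (1 + α * Real.exp p.re) ≤ ‖1 + α * Complex.exp p‖ :=
    fun p hp => norm_one_add_mul_exp_ge hα h.lt_pi.le hp.2.le
  have hne : ∀ p ∈ halfStrip x₀ θ, 1 + α * Complex.exp p ≠ 0 := fun p hp =>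
    norm_pos_iff.1 (lt_of_lt_of_le (by positivity) (hden p hp))
  have f₁ : DifferentiableOn ℂ N₁ (halfStrip x₀ θ) := by
    intro p hp
    refine DifferentiableAt.differentiableWithinAt ?_
    refine DifferentiableAt.comp p (hA.differentiableAt_scaledRes hφ ((hcos p hp).trans_lt hlt)) ?_
    have hs := add_exp_mem_slitPlane (ζ := -p) (by simpa using hp.2.trans h.lt_pi) hα
    unfold shiftLog
    refine DifferentiableAt.sub (by fun_prop) (DifferentiableAt.clog (by fun_prop) hs)
  have hmain : ∀ p ∈ halfStrip x₀ θ, N₁ p - J * N₁ p = Complex.exp (2 * p) • (J * N₃ p) := by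
    intro p hp
    simp only [hN₁, hN₃]
    rw [hA.yos_one_mul_scaledRes hφ ((hcos p hp).trans_lt hlt), mul_smul_comm, smul_smul]
    congr 1
    rw [← div_eq_mul_inv, eq_div_iff (hne p hp), neg_mul, mul_comm,
      exp_shiftLog hα (hp.2.trans h.lt_pi), neg_neg]
  have hcJ : ∀ p ∈ halfStrip x₀ θ, Commute J (N₁ p) := fun p hp =>
    hA.commute_yos_scaledRes hφ one_pos ((hcos p hp).trans_lt hlt)
  refine ⟨N₁, N₂, N₃, h.half_pi_lt, h.lt_pi, f₁, ?_, ⟨M, fun p hp => hM _ (hcos p hp)⟩,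
    ⟨(k * α)⁻¹ * (1 + M), fun p hp => ?_⟩, ?_, ?_, ?_, hcJ, ?_⟩
  · have f₃ : DifferentiableOn ℂ N₃ (halfStrip x₀ θ) := by
      refine DifferentiableOn.fun_smul ?_ ((differentiableOn_const _).sub f₁)
      exact DifferentiableOn.inv
        (by fun_prop : DifferentiableOn ℂ (fun p : ℂ => 1 + α * Complex.exp p) _) hne
    exact Complex.differentiable_exp.differentiableOn.smul f₃
  · simp only [hN₂, hN₃]
    rw [smul_smul, norm_smul, norm_mul, norm_inv, Complex.norm_exp]
    have h1 : ‖(1 : X →L[ℂ] X) - N₁ p‖ ≤ 1 + M :=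
      (norm_sub_le _ _).trans (add_le_add ContinuousLinearMap.norm_id_le (hM _ (hcos p hp)))
    gcongr
    rw [← div_eq_mul_inv, div_le_iff₀ (norm_pos_iff.2 (hne p hp)), ← div_le_iff₀' (by positivity),
      div_inv_eq_mul]
    refine le_trans ?_ (hden p hp)
    nlinarith [Real.exp_pos p.re]
  · intro p hp
    simp only [hN₂, hN₃]
    have : α * Complex.exp p * (1 + α * Complex.exp p)⁻¹ + (1 + α * Complex.exp p)⁻¹ = 1 := by
      have := hne p hp
      field_simp
      ring
    rw [smul_smul, smul_smul, add_assoc, ← add_smul, this, one_smul]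
    abel
  · intro p hp
    have h2 : Complex.exp (2 * p) = Complex.exp p * Complex.exp p := by
      rw [← Complex.exp_add]; congr 1; ring
    rw [he, hN₂]
    rw [mul_smul_comm, smul_smul, ← h2, pow_two, mul_assoc, ← mul_smul_comm, ← hmain p hp]
    noncomm_ring
  · intro p hp
    rw [mul_add, mul_smul_comm, ← hmain p hp]
    abel
  · intro p hp
    rw [he]
    exact (hcJ p hp).sub_left ((hcJ p hp).mul_left (hcJ p hp))

/-- The existence of the resolvent family, with the operator `e` and the exponent `n` of the
definition of the fractional power. -/
theorem IsSectorial.exists_resolventFamily [CompleteSpace X] (hA : IsSectorial A φ)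
    (hφ : φ ∈ Ioo 0 Real.pi) (hα : 0 < α) (hω : ω ∈ Ioo φ Real.pi)
    (h : (ε = 1 / 2 ∧ 2 ≤ α) ∨
      (ε = 1 / 2 ∧ α < 2 ∧ φ < Real.pi - 2 * Real.arctan (Real.sqrt (4 - α ^ 2) / α)) ∨
      (1 / 2 < ε ∧ ε ≤ 1 ∧ φ < Real.pi / (2 * ε))) :
    ∃ θ x₀ N₁ N₂ N₃, ResolventFamily (-res A (-1))
      (sectorCalc A ω (fun w => w ^ (ε : ℂ) / (1 + w) ^ (⌊ε⌋₊ + 1))) (⌊ε⌋₊ + 1) α θ x₀ N₁ N₂ N₃ := by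
  have hε : 1 / 2 ≤ ε ∧ ε ≤ 1 := by
    rcases h with ⟨rfl, -⟩ | ⟨rfl, -⟩ | ⟨h1, h2, -⟩
    · norm_num
    · norm_num
    · exact ⟨h1.le, h2⟩
  obtain ⟨ω', hω', θ, x₀, c, hS⟩ := exists_symbolBound hφ hα hω h
  rw [sectorCalc_fracSymb A (hφ.1.trans hω.1).le hω.2, ← yos_one]
  -- The exponent `⌊ε⌋ + 1` is `1` for `ε < 1` but `2` for `ε = 1`, in accordance with the two
  -- constructions.
  rcases hε.2.lt_or_eq with h1 | rfl
  · have hfl : ⌊ε⌋₊ = 0 := Nat.floor_eq_zero.2 h1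
    rw [hfl]
    obtain ⟨N₁, N₂, N₃, hN⟩ := hA.resolventFamily_of_lt_one hφ hω' hω hS hα hε.1 h1
    exact ⟨θ, x₀, N₁, N₂, N₃, hN⟩
  · rw [Nat.floor_one]
    obtain ⟨N₁, N₂, N₃, hN⟩ := hA.resolventFamily_one hφ hω' hω hS hα
    exact ⟨θ, x₀, N₁, N₂, N₃, hN⟩

end Linear

end

section

open Filter Topology

/-! ### Inverse Laplace transforms along Hankel contours -/

section Laplace

variable {E : Type*} [NormedAddCommGroup E] [NormedSpace ℂ E]

theorem norm_exp_mul_exp (t : ℝ) (w : ℂ) :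
    ‖Complex.exp (t * Complex.exp w)‖ = Real.exp (t * (Real.exp w.re * Real.cos w.im)) := by
  rw [Complex.norm_exp, Complex.re_ofReal_mul, Complex.exp_re]

/-- For `s` between `t / 2` and `2 t`, the modulus of `e^{s λ}` is at most the sum of its values at
the two endpoints. Integrability at every positive time thus already supplies the majorant. -/
theorem hasDerivAt_integral_exp_mul_exp {Y : Type*} [MeasurableSpace Y] {μ : Measure Y}
    {w : Y → ℂ} {F : Y → E}
    (h : ∀ t : ℝ, 0 < t → Integrable (fun y => Complex.exp (t * Complex.exp (w y)) • F y) μ)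
    (h' : ∀ t : ℝ, 0 < t →
      Integrable (fun y => Complex.exp (t * Complex.exp (w y)) • Complex.exp (w y) • F y) μ)
    {t : ℝ} (ht : 0 < t) :
    HasDerivAt (fun s : ℝ => ∫ y, Complex.exp (s * Complex.exp (w y)) • F y ∂μ)
      (∫ y, Complex.exp (t * Complex.exp (w y)) • Complex.exp (w y) • F y ∂μ) t := by
  have ht2 : 0 < t / 2 := half_pos ht
  have ht3 : 0 < 2 * t := by linarith
  refine (hasDerivAt_integral_of_dominated_loc_of_deriv_le (𝕜 := ℝ)
    (F := fun (s : ℝ) y => Complex.exp (s * Complex.exp (w y)) • F y)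
    (F' := fun (s : ℝ) y => Complex.exp (s * Complex.exp (w y)) • Complex.exp (w y) • F y)
    (Ioo_mem_nhds (by linarith) (by linarith) : Ioo (t / 2) (2 * t) ∈ 𝓝 t) ?_ (h t ht)
    (h' t ht).aestronglyMeasurable (bound := fun y =>
      ‖Complex.exp ((t / 2 : ℝ) * Complex.exp (w y)) • Complex.exp (w y) • F y‖ +
      ‖Complex.exp ((2 * t : ℝ) * Complex.exp (w y)) • Complex.exp (w y) • F y‖)
    (Eventually.of_forall fun y s hs => ?_) ((h' _ ht2).norm.add (h' _ ht3).norm)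
    (Eventually.of_forall fun y s _ => ?_)).2
  · filter_upwards [lt_mem_nhds ht] with s hs using (h s hs).aestronglyMeasurable
  · simp only [norm_smul, norm_exp_mul_exp]
    rw [← add_mul]
    refine mul_le_mul_of_nonneg_right ?_ (by positivity)
    set a := Real.exp (w y).re * Real.cos (w y).im
    have e1 := Real.exp_pos (t / 2 * a)
    have e2 := Real.exp_pos (2 * t * a)
    rcases le_total 0 a with h0 | h0
    · have := Real.exp_le_exp.2 (mul_le_mul_of_nonneg_right hs.2.le h0)
      linarith
    · have := Real.exp_le_exp.2 (mul_le_mul_of_nonpos_right hs.1.le h0)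
      linarith
  · have h1 : HasDerivAt (fun s : ℝ => (s : ℂ) * Complex.exp (w y)) (Complex.exp (w y)) s := by
      simpa using (Complex.ofRealCLM.hasDerivAt (x := s)).mul_const (Complex.exp (w y))
    have := h1.cexp.smul_const (F y)
    rwa [mul_smul] at this

/-- The integral of `H` along the boundary of the half-strip `{Re w > x₁, |Im w| < θ}`, which in
the variable `λ = e^w` is a Hankel contour. -/
def contourInt (θ x₁ : ℝ) (H : ℂ → E) : E :=
  (2 * (Real.pi : ℂ) * Complex.I)⁻¹ •
    ((∫ x in Ioi x₁, H (line θ x)) - (∫ x in Ioi x₁, H (line (-θ) x)) +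
      Complex.I • ∫ y in Ioc (-θ) θ, H (line y x₁))

/-- The integrand of the inverse Laplace transform of `λ^{-m-1} N(log λ)`. -/
def lapIntegrand (N : ℂ → E) (m t : ℝ) (w : ℂ) : E :=
  Complex.exp (t * Complex.exp w) • Complex.exp (-m * w) • N w

/-- A bounded holomorphic function on a half-strip. -/
structure BddHolo (x₀ θ₀ C : ℝ) (N : ℂ → E) : Prop where
  diff : DifferentiableOn ℂ N (halfStrip x₀ θ₀)
  bdd : ∀ p ∈ halfStrip x₀ θ₀, ‖N p‖ ≤ C

/-- Cubic decay on the rays suffices for all exponents `m > -3`, in particular for `m = -2`, which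
is needed for the second derivative of the kernels. -/
theorem exp_neg_le_six_div {y : ℝ} (hy : 0 < y) : Real.exp (-y) ≤ 6 / y ^ 3 := by
  have h := Real.pow_div_factorial_le_exp y hy.le 3
  have h3 : ((Nat.factorial 3 : ℕ) : ℝ) = 6 := by norm_num [Nat.factorial]
  rw [h3] at h
  rw [Real.exp_neg, inv_le_comm₀ (Real.exp_pos _) (by positivity), inv_div]
  exact h

variable {x₀ θ₀ θ C m t x₁ x₂ : ℝ} {N : ℂ → E}

theorem BddHolo.nonneg (h : BddHolo x₀ θ₀ C N) (hθ₀ : 0 < θ₀) : 0 ≤ C :=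
  (norm_nonneg _).trans (h.bdd (line 0 (x₀ + 1)) ⟨by simp, by simpa using hθ₀⟩)

theorem line_mem_halfStrip {x y : ℝ} (hx : x₀ < x) (hy : |y| < θ₀) : line y x ∈ halfStrip x₀ θ₀ :=
  ⟨by simpa using hx, by simpa using hy⟩

theorem BddHolo.differentiableOn_lapIntegrand (h : BddHolo x₀ θ₀ C N) (m t : ℝ) :
    DifferentiableOn ℂ (lapIntegrand N m t) (halfStrip x₀ θ₀) := by
  unfold lapIntegrand
  refine DifferentiableOn.fun_smul (by fun_prop) (DifferentiableOn.fun_smul (by fun_prop) h.diff)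

theorem BddHolo.norm_lapIntegrand_le (h : BddHolo x₀ θ₀ C N) {w : ℂ} (hw : w ∈ halfStrip x₀ θ₀) :
    ‖lapIntegrand N m t w‖ ≤
      C * (Real.exp (t * (Real.exp w.re * Real.cos w.im)) * Real.exp (-m * w.re)) := by
  rw [lapIntegrand, norm_smul, norm_smul, norm_exp_mul_exp, Complex.norm_exp, ← mul_assoc,
    mul_comm C]
  have : (-(m : ℂ) * w).re = -m * w.re := by simp
  rw [this]
  exact mul_le_mul_of_nonneg_left (h.bdd w hw) (by positivity)

theorem BddHolo.norm_lapIntegrand_ray_le (h : BddHolo x₀ θ₀ C N) (hθ : Real.pi / 2 < θ)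
    (hθ₀ : θ < θ₀) (hpi : θ₀ ≤ Real.pi) (ht : 0 < t) {x y : ℝ} (hy : |y| = θ) (hx : x₀ < x) :
    ‖lapIntegrand N m t (line y x)‖ ≤
      C * (6 / (-Real.cos θ * t) ^ 3) * Real.exp (-(3 + m) * x) := by
  have hc : 0 < -Real.cos θ := by
    have := Real.cos_neg_of_pi_div_two_lt_of_lt hθ (by linarith)
    linarith
  have hC := h.nonneg (by linarith [Real.pi_pos])
  refine (h.norm_lapIntegrand_le (line_mem_halfStrip hx (by rw [hy]; exact hθ₀))).trans ?_
  rw [line_re, line_im, cos_abs_le_of_eq hy, mul_assoc]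
  refine mul_le_mul_of_nonneg_left ?_ hC
  have e : t * (Real.exp x * Real.cos θ) = -(-Real.cos θ * t * Real.exp x) := by ring
  rw [e]
  refine (mul_le_mul_of_nonneg_right (exp_neg_le_six_div (by positivity))
    (Real.exp_pos _).le).trans (le_of_eq ?_)
  have e2 : -(3 + m) * x = -m * x - (3 : ℕ) * x := by push_cast; ring
  rw [e2, Real.exp_sub, Real.exp_nat_mul]
  field_simp

theorem BddHolo.continuousOn_ray (h : BddHolo x₀ θ₀ C N) (hx : x₀ < x₁) {y : ℝ} (hy : |y| < θ₀) :
    ContinuousOn (fun x => lapIntegrand N m t (line y x)) (Ici x₁) :=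
  (h.differentiableOn_lapIntegrand m t).continuousOn.comp (continuous_line y).continuousOn
    fun _ hx' => line_mem_halfStrip (hx.trans_le hx') hy

theorem BddHolo.continuousOn_vertical (h : BddHolo x₀ θ₀ C N) (hx : x₀ < x₁) (hθ : θ < θ₀) :
    ContinuousOn (fun y => lapIntegrand N m t (line y x₁)) (Icc (-θ) θ) :=
  (h.differentiableOn_lapIntegrand m t).continuousOn.comp
    (by unfold line; fun_prop : Continuous fun y => line y x₁).continuousOn
    fun _ hy => line_mem_halfStrip hx ((abs_le.2 hy).trans_lt hθ)

theorem BddHolo.integrableOn_ray (h : BddHolo x₀ θ₀ C N) (hθ : Real.pi / 2 < θ)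
    (hθ₀ : θ < θ₀) (hpi : θ₀ ≤ Real.pi) (ht : 0 < t) (hm : -3 < m) {y : ℝ} (hy : |y| = θ)
    (hx : x₀ < x₁) :
    IntegrableOn (fun x => lapIntegrand N m t (line y x)) (Ioi x₁) := by
  refine Integrable.mono' ((integrableOn_exp_mul_Ioi (by linarith : -(3 + m) < 0) x₁).const_mul
    (C * (6 / (-Real.cos θ * t) ^ 3))) ?_ ?_
  · exact ((h.continuousOn_ray hx (by rw [hy]; exact hθ₀)).mono
      Ioi_subset_Ici_self).aestronglyMeasurable measurableSet_Ioi
  · filter_upwards [ae_restrict_mem measurableSet_Ioi] with x hx'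
    exact h.norm_lapIntegrand_ray_le hθ hθ₀ hpi ht hy (hx.trans hx')

theorem BddHolo.integrableOn_vertical (h : BddHolo x₀ θ₀ C N) (hx : x₀ < x₁) (hθ : θ < θ₀) :
    IntegrableOn (fun y => lapIntegrand N m t (line y x₁)) (Ioc (-θ) θ) :=
  ((h.continuousOn_vertical hx hθ).integrableOn_compact isCompact_Icc).mono_set Ioc_subset_Icc_self

/-- The inverse Laplace transform of `λ^{-m-1} N(log λ)`. -/
def invLap (θ x₁ : ℝ) (N : ℂ → E) (m t : ℝ) : E := contourInt θ x₁ (lapIntegrand N m t)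

theorem lapIntegrand_sub_one (N : ℂ → E) (m t : ℝ) (w : ℂ) :
    lapIntegrand N (m - 1) t w =
      Complex.exp (t * Complex.exp w) • Complex.exp w • Complex.exp (-m * w) • N w := by
  rw [lapIntegrand, smul_smul (Complex.exp w), ← Complex.exp_add]
  congr 3
  push_cast
  ring

theorem BddHolo.hasDerivAt_invLap (h : BddHolo x₀ θ₀ C N) (hθ : Real.pi / 2 < θ)
    (hθ₀ : θ < θ₀) (hpi : θ₀ ≤ Real.pi) (ht : 0 < t) (hm : -2 < m) (hx : x₀ < x₁) :
    HasDerivAt (invLap θ x₁ N m) (invLap θ x₁ N (m - 1) t) t := by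
  have h0 : 0 < θ := by linarith [Real.pi_pos]
  have key : ∀ y : ℝ, |y| = θ → HasDerivAt
      (fun s => ∫ x in Ioi x₁, lapIntegrand N m s (line y x))
      (∫ x in Ioi x₁, lapIntegrand N (m - 1) t (line y x)) t := by
    intro y hy
    simp only [lapIntegrand_sub_one]
    refine hasDerivAt_integral_exp_mul_exp (fun s hs => ?_) (fun s hs => ?_) ht
    · exact h.integrableOn_ray hθ hθ₀ hpi hs (by linarith : -3 < m) hy hx
    · have := h.integrableOn_ray hθ hθ₀ hpi hs (by linarith : -3 < m - 1) hy hx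
      simp only [lapIntegrand_sub_one] at this
      exact this
  have key2 : HasDerivAt
      (fun s => ∫ y in Ioc (-θ) θ, lapIntegrand N m s (line y x₁))
      (∫ y in Ioc (-θ) θ, lapIntegrand N (m - 1) t (line y x₁)) t := by
    simp only [lapIntegrand_sub_one]
    refine hasDerivAt_integral_exp_mul_exp (fun s hs => ?_) (fun s hs => ?_) ht
    · exact h.integrableOn_vertical hx hθ₀
    · have : IntegrableOn (fun y => lapIntegrand N (m - 1) s (line y x₁)) (Ioc (-θ) θ) :=
        h.integrableOn_vertical hx hθ₀
      simp only [lapIntegrand_sub_one] at this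
      exact this
  exact (((key θ (abs_of_pos h0)).sub (key (-θ) (by rw [abs_neg, abs_of_pos h0]))).add
    (key2.const_smul Complex.I)).const_smul (2 * (Real.pi : ℂ) * Complex.I)⁻¹

/-- Cauchy's theorem on the rectangle between the two vertical segments. In the variable `λ`, the
arc of the Hankel contour is moved to a larger radius. -/
theorem BddHolo.invLap_eq_of_le (h : BddHolo x₀ θ₀ C N) (hθ : Real.pi / 2 < θ)
    (hθ₀ : θ < θ₀) (hpi : θ₀ ≤ Real.pi) (ht : 0 < t) (hm : -3 < m) (hx : x₀ < x₁) (h12 : x₁ ≤ x₂) :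
    invLap θ x₁ N m t = invLap θ x₂ N m t := by
  have h0 : 0 < θ := by linarith [Real.pi_pos]
  have hint : ∀ y : ℝ, |y| = θ → (∫ x in Ioi x₁, lapIntegrand N m t (line y x)) =
      (∫ x in x₁..x₂, lapIntegrand N m t (line y x)) +
        ∫ x in Ioi x₂, lapIntegrand N m t (line y x) := fun y hy =>
    (intervalIntegral.integral_interval_add_Ioi (h.integrableOn_ray hθ hθ₀ hpi ht hm hy hx)
      (h.integrableOn_ray hθ hθ₀ hpi ht hm hy (hx.trans_le h12))).symm
  have hrect := Complex.integral_boundary_rect_eq_zero_of_differentiableOn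
    (lapIntegrand N m t) (line (-θ) x₁) (line θ x₂) (by
      refine (h.differentiableOn_lapIntegrand m t).mono fun w hw => ?_
      rw [line_re, line_re, line_im, line_im, uIcc_of_le h12, uIcc_of_le (by linarith)] at hw
      exact ⟨hx.trans_le hw.1.1, (abs_le.2 ⟨hw.2.1, hw.2.2⟩).trans_lt hθ₀⟩)
  simp only [line_re, line_im] at hrect
  rw [intervalIntegral.integral_of_le (by linarith : -θ ≤ θ),
    intervalIntegral.integral_of_le (by linarith : -θ ≤ θ)] at hrect
  rw [invLap, invLap, contourInt, contourInt, hint θ (abs_of_pos h0),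
    hint (-θ) (by rw [abs_neg, abs_of_pos h0])]
  congr 1
  simp only [line]
  linear_combination (norm := module) -hrect

theorem BddHolo.norm_integral_ray_le (h : BddHolo x₀ θ₀ C N) (hθ : Real.pi / 2 < θ)
    (hθ₀ : θ < θ₀) (hpi : θ₀ ≤ Real.pi) (ht : 0 < t) (hm : -3 < m) (hx : x₀ < x₁) {y : ℝ}
    (hy : |y| = θ) : ‖∫ x in Ioi x₁, lapIntegrand N m t (line y x)‖ ≤
      C * (6 / (-Real.cos θ * t) ^ 3) * (Real.exp (-(3 + m) * x₁) / (3 + m)) := by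
  refine (norm_integral_le_of_norm_le ((integrableOn_exp_mul_Ioi
    (by linarith : -(3 + m) < 0) x₁).const_mul (C * (6 / (-Real.cos θ * t) ^ 3)))
    ?_).trans (le_of_eq ?_)
  · filter_upwards [ae_restrict_mem measurableSet_Ioi] with x hx'
    exact h.norm_lapIntegrand_ray_le hθ hθ₀ hpi ht hy (hx.trans hx')
  · rw [integral_const_mul, integral_exp_mul_Ioi (by linarith : -(3 + m) < 0), neg_div_neg_eq]

theorem BddHolo.norm_integral_vertical_le (h : BddHolo x₀ θ₀ C N) (h0 : 0 < θ)
    (hθ₀ : θ < θ₀) (ht : 0 < t) (hx : x₀ < x₁) :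
    ‖∫ y in Ioc (-θ) θ, lapIntegrand N m t (line y x₁)‖ ≤
      2 * θ * (C * (Real.exp (t * Real.exp x₁) * Real.exp (-m * x₁))) := by
  have hC := h.nonneg (by linarith)
  refine (norm_setIntegral_le_of_norm_le_const
    (C := C * (Real.exp (t * Real.exp x₁) * Real.exp (-m * x₁)))
    (by simp) fun y hy => ?_).trans (le_of_eq ?_)
  · have hy' : |y| < θ₀ := (abs_le.2 ⟨hy.1.le, hy.2⟩).trans_lt hθ₀
    refine (h.norm_lapIntegrand_le (line_mem_halfStrip hx hy')).trans ?_
    rw [line_re, line_im]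
    have : Real.exp x₁ * Real.cos y ≤ Real.exp x₁ :=
      mul_le_of_le_one_right (Real.exp_pos _).le (Real.cos_le_one _)
    gcongr
  · rw [Real.volume_real_Ioc_of_le (by linarith)]
    ring

/-- The arc is moved to the radius `b / t`, where `t λ` has modulus of fixed size; both rays and the
arc then contribute a multiple of `t^m`. The choice of `b` keeps the radius to the right of `x₀` for
all `t ≤ M`. -/
theorem BddHolo.exists_norm_invLap_le (h : BddHolo x₀ θ₀ C N) (hθ : Real.pi / 2 < θ)
    (hθ₀ : θ < θ₀) (hpi : θ₀ ≤ Real.pi) (hm : -3 < m) {M : ℝ} (hM : 0 < M) :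
    ∃ B, 0 ≤ B ∧ ∀ t ∈ Ioc 0 M, ‖invLap θ (x₀ + 1) N m t‖ ≤ B * t ^ m := by
  have h0 : 0 < θ := by linarith [Real.pi_pos]
  have hC := h.nonneg (by linarith)
  set k := -Real.cos θ with hk
  have hk0 : 0 < k := by
    have := Real.cos_neg_of_pi_div_two_lt_of_lt hθ (by linarith)
    linarith
  set b := M * Real.exp (x₀ + 1) with hb
  have hb0 : 0 < b := by positivity
  set R := C * (6 / k ^ 3) * (b ^ (-(3 + m)) / (3 + m)) with hR
  set V := 2 * θ * (C * (Real.exp b * b ^ (-m))) with hV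
  have h3m : 0 < 3 + m := by linarith
  refine ⟨‖(2 * (Real.pi : ℂ) * Complex.I)⁻¹‖ * (R + R + V), by positivity, fun t ht => ?_⟩
  have ht0 := ht.1
  set x₁ := Real.log (b / t) with hx₁
  have hbt : 0 < b / t := by positivity
  have hex : Real.exp x₁ = b / t := Real.exp_log hbt
  have hxge : x₀ + 1 ≤ x₁ := by
    rw [hx₁, Real.le_log_iff_exp_le hbt, le_div_iff₀ ht0, hb, mul_comm]
    exact mul_le_mul_of_nonneg_right ht.2 (Real.exp_pos _).le
  have hx : x₀ < x₁ := by linarith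
  have hexp : ∀ a : ℝ, Real.exp (-a * x₁) = b ^ (-a) * t ^ a := by
    intro a
    rw [mul_comm, Real.exp_mul, hex, Real.div_rpow hb0.le ht0.le, Real.rpow_neg ht0.le,
      div_inv_eq_mul]
  have hRt : C * (6 / (k * t) ^ 3) * (Real.exp (-(3 + m) * x₁) / (3 + m)) = R * t ^ m := by
    have e : t ^ (3 : ℝ) = t ^ 3 := by norm_cast
    rw [hexp, hR, Real.rpow_add ht0, e]
    field_simp
  have hVt : 2 * θ * (C * (Real.exp (t * Real.exp x₁) * Real.exp (-m * x₁))) = V * t ^ m := by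
    rw [hexp, hex, hV, mul_div_cancel₀ _ ht0.ne']
    ring
  have r1 := h.norm_integral_ray_le hθ hθ₀ hpi ht0 hm hx (abs_of_pos h0)
  have r2 := h.norm_integral_ray_le (y := -θ) hθ hθ₀ hpi ht0 hm hx (by rw [abs_neg, abs_of_pos h0])
  have v := h.norm_integral_vertical_le (m := m) h0 hθ₀ ht0 hx
  rw [hRt] at r1 r2
  rw [hVt] at v
  rw [h.invLap_eq_of_le hθ hθ₀ hpi ht0 hm (by linarith) hxge, invLap, contourInt, norm_smul,
    mul_assoc ‖(2 * (Real.pi : ℂ) * Complex.I)⁻¹‖]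
  refine mul_le_mul_of_nonneg_left ?_ (norm_nonneg (2 * (Real.pi : ℂ) * Complex.I)⁻¹)
  rw [add_mul, add_mul]
  refine (norm_add_le _ _).trans (add_le_add ((norm_sub_le _ _).trans (add_le_add r1 r2)) ?_)
  rw [norm_smul, Complex.norm_I, one_mul]
  exact v

end Laplace

end

section

open Filter Topology

/-! ### Normalisation of the inverse Laplace transform -/

section HankelConstant

/-- `exp(t e^w)`. -/
def expExp (t : ℝ) (w : ℂ) : ℂ := Complex.exp (t * Complex.exp w)

theorem differentiable_expExp (t : ℝ) : Differentiable ℂ (expExp t) := by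
  unfold expExp; fun_prop

variable {k t x₁ y a b : ℝ}

theorem norm_expExp_line_le (hk : 0 < k) (ht : 0 < t) (hy : Real.cos y ≤ -k) (x : ℝ) :
    ‖expExp t (line y x)‖ ≤ 6 / (k * t) ^ 3 * Real.exp (-3 * x) := by
  rw [expExp, norm_exp_mul_exp, line_re, line_im]
  have h1 : t * (Real.exp x * Real.cos y) ≤ -(k * t * Real.exp x) := by
    have := mul_le_mul_of_nonneg_left hy (by positivity : 0 ≤ t * Real.exp x)
    linarith
  refine (Real.exp_le_exp.2 h1).trans ((exp_neg_le_six_div (by positivity)).trans (le_of_eq ?_))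
  rw [neg_mul, Real.exp_neg, show (3 : ℝ) * x = (3 : ℕ) * x by norm_num, Real.exp_nat_mul]
  field_simp

theorem integrableOn_expExp (hk : 0 < k) (ht : 0 < t) (hy : Real.cos y ≤ -k) (x₁ : ℝ) :
    IntegrableOn (fun x => expExp t (line y x)) (Ioi x₁) := by
  refine Integrable.mono' ((integrableOn_exp_mul_Ioi (by norm_num : (-3 : ℝ) < 0) x₁).const_mul
    (6 / (k * t) ^ 3)) ?_ (Eventually.of_forall fun x => norm_expExp_line_le hk ht hy x)
  exact ((differentiable_expExp t).continuous.comp (continuous_line y)).aestronglyMeasurable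

/-- Rays may be rotated as long as `e^{t λ}` decays along all rays in between: the far vertical side
of the rectangle tends to zero. -/
theorem integral_expExp_sub (hk : 0 < k) (ht : 0 < t) (hab : a ≤ b)
    (hy : ∀ y ∈ Icc a b, Real.cos y ≤ -k) (x₁ : ℝ) :
    (∫ x in Ioi x₁, expExp t (line a x)) - ∫ x in Ioi x₁, expExp t (line b x) =
      Complex.I • ∫ y in a..b, expExp t (line y x₁) := by
  have l1 := intervalIntegral_tendsto_integral_Ioi (μ := volume) x₁
    (integrableOn_expExp hk ht (hy a (left_mem_Icc.2 hab)) x₁) tendsto_id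
  have l2 := intervalIntegral_tendsto_integral_Ioi (μ := volume) x₁
    (integrableOn_expExp hk ht (hy b (right_mem_Icc.2 hab)) x₁) tendsto_id
  have l3 : Tendsto (fun R : ℝ => Complex.I • ∫ y in a..b, expExp t (line y R)) atTop (𝓝 0) := by
    have h0 : Tendsto (fun R : ℝ => 6 / (k * t) ^ 3 * Real.exp (-3 * R) * |b - a|) atTop (𝓝 0) := by
      have h1 : Tendsto (fun R : ℝ => Real.exp (-3 * R)) atTop (𝓝 0) :=
        Real.tendsto_exp_atBot.comp (tendsto_id.const_mul_atTop_of_neg (by norm_num))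
      simpa using (h1.const_mul (6 / (k * t) ^ 3)).mul_const |b - a|
    refine squeeze_zero_norm (fun R => ?_) h0
    rw [norm_smul, Complex.norm_I, one_mul]
    refine intervalIntegral.norm_integral_le_of_norm_le_const fun y hy' => ?_
    rw [uIoc_of_le hab] at hy'
    exact norm_expExp_line_le hk ht (hy y (Ioc_subset_Icc_self hy')) R
  have hrect : ∀ R : ℝ, (∫ x in x₁..R, expExp t (line a x)) - (∫ x in x₁..R, expExp t (line b x)) +
      Complex.I • (∫ y in a..b, expExp t (line y R)) =
      Complex.I • ∫ y in a..b, expExp t (line y x₁) := by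
    intro R
    have := Complex.integral_boundary_rect_eq_zero_of_differentiableOn (expExp t) (line a x₁)
      (line b R) (differentiable_expExp t).differentiableOn
    simp only [line_re, line_im] at this
    exact sub_eq_zero.1 this
  have l4 := (l1.sub l2).add l3
  rw [add_zero] at l4
  refine tendsto_nhds_unique l4 ?_
  simp only [id]
  rw [funext hrect]
  exact tendsto_const_nhds

/-- The mean value property of `z ↦ e^{t z}` at the centre of the circle. -/
theorem integral_expExp_circle (t x₁ : ℝ) :
    ∫ y in (-Real.pi)..Real.pi, expExp t (line y x₁) = 2 * Real.pi := by
  have h1 := DiffContOnCl.circleAverage (f := fun z => Complex.exp (t * z)) (c := 0)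
    (R := Real.exp x₁) (by
      refine Differentiable.diffContOnCl ?_
      fun_prop)
  rw [Real.circleAverage_def] at h1
  have h2 : ∀ y, Complex.exp (t * circleMap 0 (Real.exp x₁) y) = expExp t (line y x₁) := by
    intro y
    rw [circleMap_zero, expExp, line, Complex.exp_add, Complex.ofReal_exp]
  simp only [h2, mul_zero, Complex.exp_zero] at h1
  have hper : Function.Periodic (fun y => expExp t (line y x₁)) (2 * Real.pi) := by
    intro y
    have : line (y + 2 * Real.pi) x₁ = line y x₁ + 2 * Real.pi * Complex.I := by
      rw [line, line]; push_cast; ring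
    simp only [expExp, this, Complex.exp_periodic (line y x₁)]
  have h3 := hper.intervalIntegral_add_eq 0 (-Real.pi)
  rw [zero_add, show -Real.pi + 2 * Real.pi = Real.pi by ring] at h3
  rw [h3] at h1
  have hpi : (2 * Real.pi : ℝ) ≠ 0 := by positivity
  rw [inv_smul_eq_iff₀ hpi] at h1
  rw [h1]
  simp

variable {E : Type*} [NormedAddCommGroup E] [NormedSpace ℂ E] [CompleteSpace E]

/-- After rotation to the angles `±π` the two rays coincide and cancel, and the full circle remains.
This is what turns the constant operator `1` into the constant kernel `1`. -/
theorem invLap_const {θ : ℝ} (hθ : Real.pi / 2 < θ) (hpi : θ < Real.pi) (ht : 0 < t) (x₁ : ℝ)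
    (c : E) : invLap θ x₁ (fun _ => c) 0 t = c := by
  set k := -Real.cos θ with hk
  have hk0 : 0 < k := by
    have := Real.cos_neg_of_pi_div_two_lt_of_lt hθ (by linarith)
    linarith
  have h0 : 0 < θ := by linarith [Real.pi_pos]
  have hcos : ∀ y, θ ≤ |y| → |y| ≤ Real.pi → Real.cos y ≤ -k := fun y h1 h2 => by
    rw [hk, neg_neg, ← Real.cos_abs y]
    exact Real.cos_le_cos_of_nonneg_of_le_pi h0.le h2 h1
  have e1 := integral_expExp_sub hk0 ht hpi.le (fun y hy => hcos y
    (hy.1.trans (le_abs_self _)) (abs_le.2 ⟨by linarith [hy.1, Real.pi_pos], hy.2⟩)) x₁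
  have e2 := integral_expExp_sub hk0 ht (neg_le_neg hpi.le) (fun y hy => hcos y
    (by rw [← abs_neg]; exact (le_neg_of_le_neg hy.2).trans (le_abs_self _))
    (abs_le.2 ⟨hy.1, by linarith [hy.2, Real.pi_pos]⟩)) x₁
  have e3 : ∀ x, expExp t (line (-Real.pi) x) = expExp t (line Real.pi x) := by
    intro x
    have : line Real.pi x = line (-Real.pi) x + 2 * Real.pi * Complex.I := by
      rw [line, line]; push_cast; ring
    rw [this, expExp, expExp, Complex.exp_periodic]
  have hii : ∀ a b, IntervalIntegrable (fun y => expExp t (line y x₁)) volume a b := fun a b =>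
    ((differentiable_expExp t).continuous.comp
      (by unfold line; fun_prop : Continuous fun y => line y x₁)).intervalIntegrable a b
  have e4 := intervalIntegral.integral_add_adjacent_intervals
    ((hii (-Real.pi) (-θ)).trans (hii (-θ) θ)) (hii θ Real.pi)
  rw [← intervalIntegral.integral_add_adjacent_intervals (hii (-Real.pi) (-θ)) (hii (-θ) θ),
    integral_expExp_circle] at e4
  have key : (∫ x in Ioi x₁, expExp t (line θ x)) - (∫ x in Ioi x₁, expExp t (line (-θ) x)) +
      Complex.I * ∫ y in (-θ)..θ, expExp t (line y x₁) = 2 * Real.pi * Complex.I := by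
    simp only [e3, smul_eq_mul] at e1 e2
    linear_combination e1 + e2 + Complex.I * e4
  have hl : lapIntegrand (fun _ => c) 0 t = fun w => expExp t w • c := by
    funext w
    simp [lapIntegrand, expExp]
  rw [intervalIntegral.integral_of_le (by linarith)] at key
  rw [invLap, contourInt, hl]
  have s1 : ∀ y : ℝ, (∫ x in Ioi x₁, expExp t (line y x) • c) =
      (∫ x in Ioi x₁, expExp t (line y x)) • c := fun y => integral_smul_const _ c
  have s2 : (∫ y in Ioc (-θ) θ, expExp t (line y x₁) • c) =
      (∫ y in Ioc (-θ) θ, expExp t (line y x₁)) • c := integral_smul_const _ c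
  rw [s1, s1, s2, smul_smul, ← sub_smul, ← add_smul, key, smul_smul, inv_mul_cancel₀, one_smul]
  simp [Real.pi_ne_zero]

end HankelConstant

end

section

open Filter Topology

/-! ### Linearity of contour integrals -/

section ContourAlgebra

variable {E F : Type*} [NormedAddCommGroup E] [NormedSpace ℂ E] [NormedAddCommGroup F]
  [NormedSpace ℂ F] {θ θ₀ x₀ x₁ : ℝ} {H H' : ℂ → E}

/-- Integrability along the boundary of a half-strip. -/
structure ContourIntegrable (θ x₁ : ℝ) (H : ℂ → E) : Prop where
  upper : IntegrableOn (fun x => H (line θ x)) (Ioi x₁)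
  lower : IntegrableOn (fun x => H (line (-θ) x)) (Ioi x₁)
  vertical : IntegrableOn (fun y => H (line y x₁)) (Ioc (-θ) θ)

omit [NormedSpace ℂ E] in
theorem ContourIntegrable.sub (h : ContourIntegrable θ x₁ H) (h' : ContourIntegrable θ x₁ H') :
    ContourIntegrable θ x₁ (fun w => H w - H' w) :=
  ⟨h.upper.sub h'.upper, h.lower.sub h'.lower, h.vertical.sub h'.vertical⟩

theorem contourInt_sub (h : ContourIntegrable θ x₁ H) (h' : ContourIntegrable θ x₁ H') :
    contourInt θ x₁ (fun w => H w - H' w) = contourInt θ x₁ H - contourInt θ x₁ H' := by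
  unfold contourInt
  rw [integral_sub h.upper h'.upper, integral_sub h.lower h'.lower,
    integral_sub h.vertical h'.vertical]
  module

theorem ContourIntegrable.clm (h : ContourIntegrable θ x₁ H) (L : E →L[ℂ] F) :
    ContourIntegrable θ x₁ (fun w => L (H w)) :=
  ⟨L.integrable_comp h.upper, L.integrable_comp h.lower, L.integrable_comp h.vertical⟩

theorem contourInt_clm [CompleteSpace E] [CompleteSpace F] (h : ContourIntegrable θ x₁ H)
    (L : E →L[ℂ] F) : contourInt θ x₁ (fun w => L (H w)) = L (contourInt θ x₁ H) := by
  unfold contourInt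
  rw [L.integral_comp_comm h.upper, L.integral_comp_comm h.lower, L.integral_comp_comm h.vertical]
  simp only [map_smul, map_add, map_sub]

theorem contourInt_congr (hx : x₀ < x₁) (hθ : 0 < θ) (hθ₀ : θ < θ₀)
    (h : ∀ w ∈ halfStrip x₀ θ₀, H w = H' w) : contourInt θ x₁ H = contourInt θ x₁ H' := by
  have hr : ∀ y : ℝ, |y| = θ → ∫ x in Ioi x₁, H (line y x) = ∫ x in Ioi x₁, H' (line y x) :=
    fun y hy => setIntegral_congr_fun measurableSet_Ioi fun x hx' =>
      h _ (line_mem_halfStrip (hx.trans hx') (by rw [hy]; exact hθ₀))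
  unfold contourInt
  rw [hr θ (abs_of_pos hθ), hr (-θ) (by rw [abs_neg, abs_of_pos hθ])]
  congr 3
  exact setIntegral_congr_fun measurableSet_Ioc fun y hy =>
    h _ (line_mem_halfStrip hx ((abs_le.2 ⟨hy.1.le, hy.2⟩).trans_lt hθ₀))

theorem BddHolo.contourIntegrable {C m t : ℝ} {N : ℂ → E} (h : BddHolo x₀ θ₀ C N)
    (hθ : Real.pi / 2 < θ) (hθ₀ : θ < θ₀) (hpi : θ₀ ≤ Real.pi) (ht : 0 < t) (hm : -3 < m)
    (hx : x₀ < x₁) : ContourIntegrable θ x₁ (lapIntegrand N m t) :=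
  have h0 : 0 < θ := by linarith [Real.pi_pos]
  ⟨h.integrableOn_ray hθ hθ₀ hpi ht hm (abs_of_pos h0) hx,
    h.integrableOn_ray hθ hθ₀ hpi ht hm (by rw [abs_neg, abs_of_pos h0]) hx,
    h.integrableOn_vertical hx hθ₀⟩

end ContourAlgebra

/-! ### Kernels with the estimates of a singular integral -/

section SingularKernel

variable {E : Type*} [NormedAddCommGroup E] [NormedSpace ℂ E]

/-- A bounded kernel `G` on `(0, M]` with the estimates `|G'(t)| ≤ C / t`, `|G''(t)| ≤ C / t²`. -/
structure SingularKernel (M C : ℝ) (G S : ℝ → E) : Prop where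
  hasDerivAt : ∀ t, 0 < t → HasDerivAt G (S t) t
  continuousOn : ContinuousOn S (Ioi 0)
  norm_le : ∀ t ∈ Ioc 0 M, ‖G t‖ ≤ C
  norm_deriv_le : ∀ t ∈ Ioc 0 M, ‖S t‖ ≤ C / t
  norm_deriv_sub_le : ∀ s t, 0 < s → s ≤ t → t ≤ M → ‖S t - S s‖ ≤ C * (t - s) / s ^ 2

variable {M C C' : ℝ} {G S G' S' : ℝ → E}

theorem SingularKernel.mono (h : SingularKernel M C G S) (hC : C ≤ C') :
    SingularKernel M C' G S where
  hasDerivAt := h.hasDerivAt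
  continuousOn := h.continuousOn
  norm_le t ht := (h.norm_le t ht).trans hC
  norm_deriv_le t ht := (h.norm_deriv_le t ht).trans (div_le_div_of_nonneg_right hC ht.1.le)
  norm_deriv_sub_le s t hs hst htM := (h.norm_deriv_sub_le s t hs hst htM).trans
    (div_le_div_of_nonneg_right (mul_le_mul_of_nonneg_right hC (by linarith)) (by positivity))

theorem SingularKernel.const_sub (h : SingularKernel M C G S) (c : E) :
    SingularKernel M (‖c‖ + C) (fun t => c - G t) (fun t => -S t) where
  hasDerivAt t ht := (h.hasDerivAt t ht).const_sub c
  continuousOn := h.continuousOn.neg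
  norm_le t ht := (norm_sub_le _ _).trans (by linarith [h.norm_le t ht])
  norm_deriv_le t ht := by
    rw [norm_neg]
    refine (h.norm_deriv_le t ht).trans (div_le_div_of_nonneg_right ?_ ht.1.le)
    linarith [norm_nonneg c]
  norm_deriv_sub_le s t hs hst htM := by
    rw [neg_sub_neg, norm_sub_rev]
    refine (h.norm_deriv_sub_le s t hs hst htM).trans (div_le_div_of_nonneg_right
      (mul_le_mul_of_nonneg_right ?_ (by linarith)) (by positivity))
    linarith [norm_nonneg c]

theorem SingularKernel.add (h : SingularKernel M C G S) (h' : SingularKernel M C' G' S') :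
    SingularKernel M (C + C') (fun t => G t + G' t) (fun t => S t + S' t) where
  hasDerivAt t ht := (h.hasDerivAt t ht).add (h'.hasDerivAt t ht)
  continuousOn := h.continuousOn.add h'.continuousOn
  norm_le t ht := (norm_add_le _ _).trans (add_le_add (h.norm_le t ht) (h'.norm_le t ht))
  norm_deriv_le t ht := by
    rw [add_div]
    exact (norm_add_le _ _).trans (add_le_add (h.norm_deriv_le t ht) (h'.norm_deriv_le t ht))
  norm_deriv_sub_le s t hs hst htM := by
    rw [add_mul, add_div, add_sub_add_comm]
    exact (norm_add_le _ _).trans (add_le_add (h.norm_deriv_sub_le s t hs hst htM)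
      (h'.norm_deriv_sub_le s t hs hst htM))

theorem SingularKernel.const_smul (h : SingularKernel M C G S) (c : ℂ) :
    SingularKernel M (‖c‖ * C) (fun t => c • G t) (fun t => c • S t) where
  hasDerivAt t ht := (h.hasDerivAt t ht).const_smul c
  continuousOn := h.continuousOn.const_smul c
  norm_le t ht := by
    rw [norm_smul]
    exact mul_le_mul_of_nonneg_left (h.norm_le t ht) (norm_nonneg c)
  norm_deriv_le t ht := by
    rw [norm_smul, mul_div_assoc]
    exact mul_le_mul_of_nonneg_left (h.norm_deriv_le t ht) (norm_nonneg c)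
  norm_deriv_sub_le s t hs hst htM := by
    rw [← smul_sub, norm_smul, mul_assoc, mul_div_assoc]
    exact mul_le_mul_of_nonneg_left (h.norm_deriv_sub_le s t hs hst htM) (norm_nonneg c)

/-- The three bounds are the cases `m = 0, -1, -2` of the power estimate. The last one enters
through the mean value inequality, with `1 / r²` estimated by its value at the left endpoint. -/
theorem BddHolo.exists_singularKernel {x₀ θ₀ θ B : ℝ} {N : ℂ → E} (h : BddHolo x₀ θ₀ B N)
    (hθ : Real.pi / 2 < θ) (hθ₀ : θ < θ₀) (hpi : θ₀ ≤ Real.pi) (hM : 0 < M) :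
    ∃ C, SingularKernel M C (invLap θ (x₀ + 1) N 0) (invLap θ (x₀ + 1) N (-1)) := by
  obtain ⟨B₀, hB₀, h₀⟩ := h.exists_norm_invLap_le hθ hθ₀ hpi (m := 0) (by norm_num) hM
  obtain ⟨B₁, hB₁, h₁⟩ := h.exists_norm_invLap_le hθ hθ₀ hpi (m := -1) (by norm_num) hM
  obtain ⟨B₂, hB₂, h₂⟩ := h.exists_norm_invLap_le hθ hθ₀ hpi (m := -2) (by norm_num) hM
  have hx : x₀ < x₀ + 1 := by linarith
  have hd : ∀ t, 0 < t → HasDerivAt (invLap θ (x₀ + 1) N (-1)) (invLap θ (x₀ + 1) N (-2) t) t := by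
    intro t ht
    have := h.hasDerivAt_invLap hθ hθ₀ hpi ht (m := -1) (by norm_num) hx
    norm_num at this
    exact this
  refine ⟨B₀ + B₁ + B₂, fun t ht => ?_, fun t ht => (hd t ht).continuousAt.continuousWithinAt,
    fun t ht => ?_, fun t ht => ?_, fun s t hs hst htM => ?_⟩
  · simpa using h.hasDerivAt_invLap hθ hθ₀ hpi ht (m := 0) (by norm_num) hx
  · have := h₀ t ht
    rw [Real.rpow_zero] at this
    linarith
  · have := h₁ t ht
    rw [Real.rpow_neg_one, ← div_eq_mul_inv] at this
    exact this.trans (div_le_div_of_nonneg_right (by linarith) ht.1.le)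
  · have hb : ∀ r ∈ Icc s t, ‖invLap θ (x₀ + 1) N (-2) r‖ ≤ (B₀ + B₁ + B₂) / s ^ 2 := by
      intro r hr
      have hr0 : 0 < r := hs.trans_le hr.1
      refine (h₂ r ⟨hr0, hr.2.trans htM⟩).trans ?_
      rw [Real.rpow_neg hr0.le, ← div_eq_mul_inv, Real.rpow_two]
      gcongr
      · linarith
      · exact hr.1
    have := (convex_Icc s t).norm_image_sub_le_of_norm_hasDerivWithin_le
      (fun r hr => (hd r (hs.trans_le hr.1)).hasDerivWithinAt) hb (left_mem_Icc.2 hst)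
      (right_mem_Icc.2 hst)
    rw [Real.norm_of_nonneg (by linarith)] at this
    refine this.trans (le_of_eq ?_)
    ring

end SingularKernel

/-! ### The kernels of the solution operators -/

section SolutionKernels

variable {X : Type*} [NormedAddCommGroup X] [NormedSpace ℂ X]

/-- The kernels of the solution operators `f ↦ u` (`K`), `f ↦ u'` (`G₁`), and of the antiderivative
of `f ↦ A^ε u'` (`G₂`); moreover `κ` is the antiderivative of `K`. -/
structure SolutionKernels (J e : X →L[ℂ] X) (n : ℕ) (α M C : ℝ)
    (κ K G₁ G₂ S₁ S₂ : ℝ → X →L[ℂ] X) : Prop where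
  singular₁ : SingularKernel M C G₁ S₁
  singular₂ : SingularKernel M C G₂ S₂
  deriv_K : ∀ t, 0 < t → HasDerivAt K (G₁ t) t
  deriv_κ : ∀ t, 0 < t → HasDerivAt κ (K t) t
  norm_K : ∀ t ∈ Ioc 0 M, ‖K t‖ ≤ C * t
  norm_κ : ∀ t ∈ Ioc 0 M, ‖κ t‖ ≤ C * t ^ 2
  frac : ∀ t, 0 < t → e * K t = J ^ n * G₂ t
  main : ∀ t, 0 < t → J * (κ t + (1 - G₁ t - (α : ℂ) • G₂ t)) = κ t
  commute_J : ∀ t, 0 < t → Commute J (κ t)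
  commute_e : ∀ t, 0 < t → Commute e (K t)

variable [CompleteSpace X]

theorem BddHolo.commute_invLap {θ x₀ θ₀ B m t : ℝ} {N : ℂ → X →L[ℂ] X} {T : X →L[ℂ] X}
    (h : BddHolo x₀ θ₀ B N) (hθ : Real.pi / 2 < θ) (hθ₀ : θ < θ₀) (hpi : θ₀ ≤ Real.pi) (ht : 0 < t)
    (hm : -3 < m) (hT : ∀ p ∈ halfStrip x₀ θ₀, Commute T (N p)) :
    Commute T (invLap θ (x₀ + 1) N m t) := by
  have hi := h.contourIntegrable hθ hθ₀ hpi ht hm (by linarith : x₀ < x₀ + 1)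
  have e1 := contourInt_clm hi (ContinuousLinearMap.mul ℂ (X →L[ℂ] X) T)
  have e2 := contourInt_clm hi ((ContinuousLinearMap.mul ℂ (X →L[ℂ] X)).flip T)
  refine Eq.trans e1.symm (Eq.trans ?_ e2)
  refine contourInt_congr (by linarith : x₀ < x₀ + 1) (by linarith [Real.pi_pos]) hθ₀
    fun w hw => ?_
  simp only [lapIntegrand, map_smul, ContinuousLinearMap.mul_apply', ContinuousLinearMap.flip_apply]
  rw [(hT w hw).eq]

/-- `κ`, `K`, `G₁`, `G₂` are the inverse transforms of `λ⁻³ N₁`, `λ⁻² N₁`, `λ⁻¹ N₁`, `λ⁻¹ N₂`.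
Multiplied by `λ⁻²`, the relation `e N₁ = λ Jⁿ N₂` becomes `frac`; multiplied by `λ⁻³`, the relation
`J (N₁ + λ² N₃) = N₁` becomes `main`, where the kernel of `λ⁻¹ N₃` is `1 - G₁ - α G₂`. -/
theorem ResolventFamily.exists_solutionKernels {J e : X →L[ℂ] X} {n : ℕ} {α θ x₀ M : ℝ}
    {N₁ N₂ N₃ : ℂ → X →L[ℂ] X} (h : ResolventFamily J e n α θ x₀ N₁ N₂ N₃) (hM : 0 < M) :
    ∃ C κ K G₁ G₂ S₁ S₂, SolutionKernels J e n α M C κ K G₁ G₂ S₁ S₂ := by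
  obtain ⟨C₁, hC₁⟩ := h.bdd₁
  obtain ⟨C₂, hC₂⟩ := h.bdd₂
  have h₁ : BddHolo x₀ θ C₁ N₁ := ⟨h.diff₁, hC₁⟩
  have h₂ : BddHolo x₀ θ C₂ N₂ := ⟨h.diff₂, hC₂⟩
  -- The contour is taken at an angle strictly inside the sector of holomorphy, but still beyond `π
  -- / 2`.
  obtain ⟨η, hη, hηθ⟩ := exists_between h.half_pi_lt
  have hη0 : 0 < η := by linarith [Real.pi_pos]
  have hpi := h.lt_pi.le
  have hx : x₀ < x₀ + 1 := by linarith
  obtain ⟨B₁, k₁⟩ := h₁.exists_singularKernel hη hηθ hpi hM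
  obtain ⟨B₂, k₂⟩ := h₂.exists_singularKernel hη hηθ hpi hM
  obtain ⟨B₃, hB₃, k₃⟩ := h₁.exists_norm_invLap_le hη hηθ hpi (m := 1) (by norm_num) hM
  obtain ⟨B₄, hB₄, k₄⟩ := h₁.exists_norm_invLap_le hη hηθ hpi (m := 2) (by norm_num) hM
  set C := max (max B₁ B₂) (max B₃ B₄) with hC
  refine ⟨C, invLap η (x₀ + 1) N₁ 2, invLap η (x₀ + 1) N₁ 1, invLap η (x₀ + 1) N₁ 0,
    invLap η (x₀ + 1) N₂ 0, invLap η (x₀ + 1) N₁ (-1), invLap η (x₀ + 1) N₂ (-1),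
    k₁.mono ((le_max_left _ _).trans (le_max_left _ _)),
    k₂.mono ((le_max_right _ _).trans (le_max_left _ _)), fun t ht => ?_, fun t ht => ?_,
    fun t ht => ?_, fun t ht => ?_, fun t ht => ?_, fun t ht => ?_,
    fun t ht => h₁.commute_invLap hη hηθ hpi ht (by norm_num) h.commute_J,
    fun t ht => h₁.commute_invLap hη hηθ hpi ht (by norm_num) h.commute_e⟩
  · simpa using h₁.hasDerivAt_invLap hη hηθ hpi ht (m := 1) (by norm_num) hx
  · have := h₁.hasDerivAt_invLap hη hηθ hpi ht (m := 2) (by norm_num) hx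
    norm_num at this
    exact this
  · refine (k₃ t ht).trans ?_
    rw [Real.rpow_one]
    exact mul_le_mul_of_nonneg_right ((le_max_left _ _).trans (le_max_right _ _)) ht.1.le
  · refine (k₄ t ht).trans ?_
    rw [Real.rpow_two]
    exact mul_le_mul_of_nonneg_right ((le_max_right _ _).trans (le_max_right _ _)) (by positivity)
  · have i1 := h₁.contourIntegrable hη hηθ hpi ht (m := 1) (by norm_num) hx
    have i2 := h₂.contourIntegrable hη hηθ hpi ht (m := 0) (by norm_num) hx
    have e1 := contourInt_clm i1 (ContinuousLinearMap.mul ℂ (X →L[ℂ] X) e)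
    have e2 := contourInt_clm i2 (ContinuousLinearMap.mul ℂ (X →L[ℂ] X) (J ^ n))
    refine Eq.trans e1.symm (Eq.trans ?_ e2)
    refine contourInt_congr hx hη0 hηθ fun w hw => ?_
    simp only [lapIntegrand, map_smul, ContinuousLinearMap.mul_apply']
    rw [h.frac w hw, smul_smul (Complex.exp _) (Complex.exp w), ← Complex.exp_add]
    simp
  · have i0 := h₁.contourIntegrable hη hηθ hpi ht (m := 2) (by norm_num) hx
    have i1 := h₁.contourIntegrable hη hηθ hpi ht (m := 0) (by norm_num) hx
    have i2 := h₂.contourIntegrable hη hηθ hpi ht (m := 0) (by norm_num) hx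
    -- The constant in `N₃ = 1 - N₁ - α N₂` is treated as a bounded holomorphic function of its own.
    have hJ : BddHolo x₀ θ ‖(-1 : X →L[ℂ] X)‖ (fun _ => (-1 : X →L[ℂ] X)) :=
      ⟨differentiableOn_const _, fun _ _ => le_rfl⟩
    have i3 := hJ.contourIntegrable hη hηθ hpi ht (m := 0) (by norm_num) hx
    have e0 := contourInt_sub ((i0.sub i3).sub i1) (i2.clm ((α : ℂ) • ContinuousLinearMap.id ℂ _))
    rw [contourInt_sub (i0.sub i3) i1, contourInt_sub i0 i3, contourInt_clm i2] at e0
    have e1 := contourInt_clm (((i0.sub i3).sub i1).sub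
      (i2.clm ((α : ℂ) • ContinuousLinearMap.id ℂ _))) (ContinuousLinearMap.mul ℂ (X →L[ℂ] X) J)
    rw [e0] at e1
    have e3 := invLap_const hη (hηθ.trans h.lt_pi) ht (x₀ + 1) (-1 : X →L[ℂ] X)
    have e4 : contourInt η (x₀ + 1) (lapIntegrand (fun _ => (-1 : X →L[ℂ] X)) 0 t) = -1 := e3
    rw [e4] at e1
    have e5 : J * (invLap η (x₀ + 1) N₁ 2 t + (1 - invLap η (x₀ + 1) N₁ 0 t -
        (α : ℂ) • invLap η (x₀ + 1) N₂ 0 t)) = J * (contourInt η (x₀ + 1) (lapIntegrand N₁ 2 t) - -1 -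
        contourInt η (x₀ + 1) (lapIntegrand N₁ 0 t) - ((α : ℂ) • ContinuousLinearMap.id ℂ
          (X →L[ℂ] X)) (contourInt η (x₀ + 1) (lapIntegrand N₂ 0 t))) := by
      congr 1
      simp only [invLap, smul_apply, ContinuousLinearMap.id_apply]
      abel
    rw [e5]
    refine Eq.trans e1.symm ?_
    refine contourInt_congr hx hη0 hηθ fun w hw => ?_
    have r1 := h.main w hw
    have r2 : N₃ w = 1 - N₁ w - (α : ℂ) • N₂ w := by
      rw [← h.sum w hw]; abel
    rw [r2] at r1
    have x1 : Complex.exp (-((2 : ℝ) : ℂ) * w) * Complex.exp (2 * w) = 1 := by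
      rw [← Complex.exp_add]; simp
    have x0 : Complex.exp (-((0 : ℝ) : ℂ) * w) = 1 := by simp
    simp only [lapIntegrand, ContinuousLinearMap.mul_apply', smul_apply,
      ContinuousLinearMap.id_apply, x0, one_smul]
    set a := Complex.exp (t * Complex.exp w)
    set b := Complex.exp (-((2 : ℝ) : ℂ) * w)
    have e6 : a • b • N₁ w - a • (-1 : X →L[ℂ] X) - a • N₁ w - (α : ℂ) • a • N₂ w =
        (a * b) • (N₁ w + Complex.exp (2 * w) • (1 - N₁ w - (α : ℂ) • N₂ w)) := by
      rw [smul_add, smul_smul (a * b), mul_assoc a b, x1]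
      module
    rw [e6, mul_smul_comm, r1, smul_smul]

end SolutionKernels

end

section

open Filter Topology

/-! ### Minkowski's integral inequality -/

section Minkowski

variable {α β : Type*} [MeasurableSpace α] [MeasurableSpace β] {μ : Measure α} {ν : Measure β}
  [SFinite μ] [SFinite ν]

/-- Minkowski's integral inequality, for an upper bound `c` of the norms of the sections. -/
theorem eLpNorm_lintegral_le {F : α → β → ℝ≥0∞} (hF : Measurable (Function.uncurry F))
    {p : ℝ≥0∞} (hp : 1 ≤ p) {c : β → ℝ≥0∞} (hc : Measurable c)
    (h : ∀ᵐ b ∂ν, eLpNorm (fun a => F a b) p μ ≤ c b) :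
    eLpNorm (fun a => ∫⁻ b, F a b ∂ν) p μ ≤ ∫⁻ b, c b ∂ν := by
  rcases eq_or_ne p ∞ with rfl | hp'
  · simp only [eLpNorm_exponent_top] at h ⊢
    have h1 : ∀ᵐ b ∂ν, ∀ᵐ a ∂μ, F a b ≤ c b := by
      filter_upwards [h] with b hb
      filter_upwards [ae_le_eLpNormEssSup (f := fun a => F a b) (μ := μ)] with a ha
      simpa using ha.trans hb
    have h2 : ∀ᵐ a ∂μ, ∀ᵐ b ∂ν, F a b ≤ c b := by
      have hm : MeasurableSet {x : α × β | F x.1 x.2 ≤ c x.2} :=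
        measurableSet_le hF (hc.comp measurable_snd)
      exact (Measure.ae_ae_comm (p := fun a b => F a b ≤ c b) hm).2 h1
    refine essSup_le_of_ae_le _ ?_
    filter_upwards [h2] with a ha
    simpa using lintegral_mono_ae ha
  by_cases hI : ∫⁻ b, c b ∂ν = ∞
  · rw [hI]; exact le_top
  have hp0 : p ≠ 0 := (zero_lt_one.trans_le hp).ne'
  set r := p.toReal with hr
  have hr1 : 1 ≤ r := by
    rw [hr, ← ENNReal.toReal_one]
    exact ENNReal.toReal_mono hp' hp
  have hr0 : 0 < r := by linarith
  have hcfin : ∀ᵐ b ∂ν, c b < ∞ := ae_lt_top hc hI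
  have hpow : ∀ g : α → ℝ≥0∞, eLpNorm g p μ = (∫⁻ a, g a ^ r ∂μ) ^ (1 / r) := fun g => by
    rw [eLpNorm_eq_lintegral_rpow_enorm_toReal hp0 hp']
    simp [← hr]
  have hsec : ∀ᵐ b ∂ν, ∫⁻ a, F a b ^ r ∂μ ≤ c b ^ r := by
    filter_upwards [h] with b hb
    rwa [hpow, one_div, ENNReal.rpow_inv_le_iff hr0] at hb
  -- Where the bound vanishes, so does almost every value of `F`; division by `c` below loses
  -- nothing.
  have hzero : ∀ᵐ a ∂μ, ∀ᵐ b ∂ν, c b = 0 → F a b = 0 := by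
    have hm : MeasurableSet {x : α × β | c x.2 = 0 → F x.1 x.2 = 0} := by
      have e : {x : α × β | c x.2 = 0 → F x.1 x.2 = 0} =
          {x : α × β | c x.2 = 0}ᶜ ∪ {x : α × β | F x.1 x.2 = 0} := by
        ext x; simp [imp_iff_not_or]
      rw [e]
      exact ((hc.comp measurable_snd) (measurableSet_singleton 0)).compl.union
        (hF (measurableSet_singleton 0))
    refine (Measure.ae_ae_comm (p := fun a b => c b = 0 → F a b = 0) hm).2 ?_
    filter_upwards [hsec] with b hb
    have hFb : Measurable (fun a => F a b) := hF.comp measurable_prodMk_right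
    by_cases hcb : c b = 0
    · rw [hcb, ENNReal.zero_rpow_of_pos hr0, nonpos_iff_eq_zero,
        lintegral_eq_zero_iff (hFb.pow_const r)] at hb
      filter_upwards [hb] with a ha _
      exact (ENNReal.rpow_eq_zero_iff_of_pos hr0).1 ha
    · exact Eventually.of_forall fun a ha => absurd ha hcb
  set I := ∫⁻ b, c b ∂ν with hIdef
  set ν' := ν.withDensity c with hν'
  have hmass : ν' univ = I := by rw [hν', withDensity_apply _ MeasurableSet.univ,
    Measure.restrict_univ]
  -- Jensen's inequality for `F / c` with respect to the measure `c ν` of total mass `I`.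
  -- Integration in `a` and Tonelli's theorem complete the proof.
  have hjensen : ∀ᵐ a ∂μ, (∫⁻ b, F a b ∂ν) ^ r ≤
      I ^ (r - 1) * ∫⁻ b, F a b ^ r * (c b)⁻¹ ^ r * c b ∂ν := by
    filter_upwards [hzero] with a ha
    have hFa : Measurable (F a) := hF.comp measurable_prodMk_left
    have hq : Measurable (fun b => F a b * (c b)⁻¹) := hFa.mul hc.inv
    have h1 := eLpNorm_le_eLpNorm_mul_rpow_measure_univ (μ := ν') (p := 1) (q := p) hp
      hq.aestronglyMeasurable
    rw [eLpNorm_one_eq_lintegral_enorm, eLpNorm_eq_lintegral_rpow_enorm_toReal hp0 hp', hmass, hν',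
      lintegral_withDensity_eq_lintegral_mul _ hc (by fun_prop),
      lintegral_withDensity_eq_lintegral_mul _ hc (by fun_prop)] at h1
    simp only [Pi.mul_apply, enorm_eq_self, ENNReal.toReal_one, div_one] at h1
    have e1 : ∫⁻ b, c b * (F a b * (c b)⁻¹) ∂ν = ∫⁻ b, F a b ∂ν := by
      refine lintegral_congr_ae ?_
      filter_upwards [ha, hcfin] with b hb hb'
      by_cases hcb : c b = 0
      · simp [hb hcb]
      · rw [mul_left_comm, ENNReal.mul_inv_cancel hcb hb'.ne, mul_one]
    rw [e1] at h1
    have h2 := ENNReal.rpow_le_rpow h1 hr0.le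
    rw [ENNReal.mul_rpow_of_nonneg _ _ hr0.le, ← ENNReal.rpow_mul, ← ENNReal.rpow_mul, ← hr,
      one_div_mul_cancel hr0.ne', ENNReal.rpow_one] at h2
    refine h2.trans (le_of_eq ?_)
    rw [mul_comm]
    congr 1
    · congr 1
      field_simp
    · refine lintegral_congr fun b => ?_
      rw [ENNReal.mul_rpow_of_nonneg _ _ hr0.le, mul_comm]
  rw [hpow, one_div, ENNReal.rpow_inv_le_iff hr0]
  calc ∫⁻ a, (∫⁻ b, F a b ∂ν) ^ r ∂μ
      ≤ ∫⁻ a, I ^ (r - 1) * ∫⁻ b, F a b ^ r * (c b)⁻¹ ^ r * c b ∂ν ∂μ := lintegral_mono_ae hjensen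
    _ = I ^ (r - 1) * ∫⁻ b, (∫⁻ a, F a b ^ r ∂μ) * ((c b)⁻¹ ^ r * c b) ∂ν := by
      rw [lintegral_const_mul' _ _ (ENNReal.rpow_ne_top_of_nonneg (by linarith) hI),
        lintegral_lintegral_swap]
      · congr 1
        refine lintegral_congr fun b => ?_
        simp only [mul_assoc]
        have hFb : Measurable (fun a => F a b) := hF.comp measurable_prodMk_right
        rw [lintegral_mul_const _ (hFb.pow_const r)]
      · exact (((hF.pow_const r).mul ((hc.comp measurable_snd).inv.pow_const r)).mul
          (hc.comp measurable_snd)).aemeasurable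
    _ ≤ I ^ (r - 1) * ∫⁻ b, c b ∂ν := by
      gcongr 1
      refine lintegral_mono_ae ?_
      filter_upwards [hsec, hcfin] with b hb hb'
      refine (mul_le_mul_left hb _).trans ?_
      rw [← mul_assoc, ← ENNReal.mul_rpow_of_nonneg _ _ hr0.le]
      by_cases hcb : c b = 0
      · simp [hcb]
      · rw [ENNReal.mul_inv_cancel hcb hb'.ne, ENNReal.one_rpow, one_mul]
    _ = I ^ r := by
      rw [← hIdef]
      nth_rw 2 [← ENNReal.rpow_one I]
      rw [← ENNReal.rpow_add_of_nonneg _ _ (by linarith) zero_le_one, sub_add_cancel]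

end Minkowski

end

section

open Filter Topology

/-! ### The dilation invariant measure `dh / h` -/

section MultiplicativeHaar

/-- The measure `dh / h` on `(0, ∞)`. -/
def invMeas : Measure ℝ := (volume.restrict (Ioi 0)).withDensity (fun h => ENNReal.ofReal h⁻¹)

instance : SFinite invMeas := by unfold invMeas; infer_instance

theorem measurable_ofReal_inv : Measurable (fun h : ℝ => ENNReal.ofReal h⁻¹) := by fun_prop

theorem invMeas_restrict (T : ℝ) : invMeas.restrict (Ioo 0 T) = dhh T := by
  rw [invMeas, dhh, restrict_withDensity measurableSet_Ioo,
    Measure.restrict_restrict measurableSet_Ioo]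
  congr 2
  exact inter_eq_left.2 Ioo_subset_Ioi_self

theorem lintegral_invMeas_restrict {s : Set ℝ} (hs : MeasurableSet s) (h0 : s ⊆ Ioi 0)
    {g : ℝ → ℝ≥0∞} (hg : Measurable g) :
    ∫⁻ h in s, g h ∂invMeas = ∫⁻ h in s, ENNReal.ofReal h⁻¹ * g h := by
  rw [invMeas, restrict_withDensity hs, Measure.restrict_restrict hs, inter_eq_left.2 h0,
    lintegral_withDensity_eq_lintegral_mul _ measurable_ofReal_inv hg]
  rfl

theorem ae_invMeas_pos : ∀ᵐ h ∂invMeas, 0 < h := by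
  have : invMeas ≪ volume.restrict (Ioi 0) := withDensity_absolutelyContinuous _ _
  exact this.ae_le (ae_restrict_mem measurableSet_Ioi)

theorem lintegral_invMeas_comp_mul {σ : ℝ} (hσ : 0 < σ) {g : ℝ → ℝ≥0∞} (hg : Measurable g) :
    ∫⁻ h, g (σ * h) ∂invMeas = ∫⁻ h, g h ∂invMeas := by
  have key : ∀ k : ℝ → ℝ≥0∞, Measurable k → ∫⁻ h, k h ∂invMeas =
      ∫⁻ h, (Ioi 0).indicator (fun h => ENNReal.ofReal h⁻¹ * k h) h := by
    intro k hk
    rw [invMeas, lintegral_withDensity_eq_lintegral_mul _ measurable_ofReal_inv hk,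
      lintegral_indicator measurableSet_Ioi]
    rfl
  have hm : Measurable ((Ioi (0 : ℝ)).indicator (fun h => ENNReal.ofReal h⁻¹ * g h)) :=
    (measurable_ofReal_inv.mul hg).indicator measurableSet_Ioi
  have hg' : Measurable (fun h => g (σ * h)) := hg.comp (measurable_const_mul σ)
  rw [key g hg, key _ hg']
  have h1 : ∫⁻ h, (Ioi (0 : ℝ)).indicator (fun h => ENNReal.ofReal h⁻¹ * g h) h
      ∂(ENNReal.ofReal |σ| • Measure.map (σ * ·) volume) =
      ∫⁻ h, (Ioi (0 : ℝ)).indicator (fun h => ENNReal.ofReal h⁻¹ * g h) h := by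
    rw [Real.smul_map_volume_mul_left hσ.ne']
  rw [← h1, lintegral_smul_measure, lintegral_map hm (measurable_const_mul σ),
    abs_of_pos hσ, smul_eq_mul, ← lintegral_const_mul (ENNReal.ofReal σ)
      (f := fun a => (Ioi (0 : ℝ)).indicator (fun h => ENNReal.ofReal h⁻¹ * g h) (σ * a))
      (hm.comp (measurable_const_mul σ))]
  refine lintegral_congr fun h => ?_
  by_cases hh : 0 < h
  · rw [indicator_of_mem (mem_Ioi.2 hh), indicator_of_mem (mem_Ioi.2 (mul_pos hσ hh)),
      ← mul_assoc, ← ENNReal.ofReal_mul hσ.le]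
    congr 2
    field_simp
  · rw [indicator_of_notMem (by simpa using hh), indicator_of_notMem, mul_zero]
    simpa using mul_nonpos_of_nonneg_of_nonpos hσ.le (not_lt.1 hh)

theorem measurePreserving_mul {σ : ℝ} (hσ : 0 < σ) :
    MeasurePreserving (fun h : ℝ => σ * h) invMeas invMeas := by
  refine ⟨measurable_const_mul σ, Measure.ext fun s hs => ?_⟩
  rw [Measure.map_apply (measurable_const_mul σ) hs, ← lintegral_indicator_one hs,
    ← lintegral_invMeas_comp_mul hσ (measurable_one.indicator hs),
    ← lintegral_indicator_one (measurable_const_mul σ hs)]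
  rfl

variable {q : ℝ≥0∞} {Φ : ℝ → ℝ≥0∞}

theorem eLpNorm_comp_mul {σ : ℝ} (hσ : 0 < σ) (hΦ : Measurable Φ) :
    eLpNorm (fun h => Φ (σ * h)) q invMeas = eLpNorm Φ q invMeas :=
  eLpNorm_comp_measurePreserving hΦ.aestronglyMeasurable (measurePreserving_mul hσ)

theorem eLpNorm_ennreal_const_mul {α : Type*} [MeasurableSpace α] {μ : Measure α} {q : ℝ≥0∞}
    (hq : q ≠ 0) (c : ℝ≥0∞) {g : α → ℝ≥0∞} (hg : Measurable g) :
    eLpNorm (fun x => c * g x) q μ = c * eLpNorm g q μ := by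
  rcases eq_or_ne q ∞ with rfl | hq'
  · simp only [eLpNorm_exponent_top, eLpNormEssSup, enorm_eq_self]
    exact ENNReal.essSup_const_mul
  · have hr := ENNReal.toReal_pos hq hq'
    rw [eLpNorm_eq_lintegral_rpow_enorm_toReal hq hq', eLpNorm_eq_lintegral_rpow_enorm_toReal hq hq']
    simp only [enorm_eq_self, ENNReal.mul_rpow_of_nonneg _ _ hr.le]
    rw [lintegral_const_mul _ (hg.pow_const _), ENNReal.mul_rpow_of_nonneg _ _ (by positivity),
      ← ENNReal.rpow_mul, mul_one_div_cancel hr.ne', ENNReal.rpow_one]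

/-- Averages of dilations are bounded in `L^q(dh / h)`. -/
theorem eLpNorm_lintegral_dilation_le {w : ℝ → ℝ≥0∞} (hq : 1 ≤ q) (hΦ : Measurable Φ)
    (hw : Measurable w) {s : Set ℝ} (hs : MeasurableSet s) (h0 : s ⊆ Ioi 0) :
    eLpNorm (fun h => ∫⁻ σ in s, w σ * Φ (σ * h)) q invMeas ≤
      (∫⁻ σ in s, w σ) * eLpNorm Φ q invMeas := by
  refine (eLpNorm_lintegral_le (F := fun h σ => w σ * Φ (σ * h)) ?_ hq
    (hw.mul_const (eLpNorm Φ q invMeas)) ?_).trans (le_of_eq (lintegral_mul_const _ hw))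
  · exact (hw.comp measurable_snd).mul (hΦ.comp (measurable_snd.mul measurable_fst))
  · filter_upwards [ae_restrict_mem hs] with σ hσ
    have hm : Measurable (fun h => Φ (σ * h)) := hΦ.comp (measurable_const_mul σ)
    rw [eLpNorm_ennreal_const_mul (zero_lt_one.trans_le hq).ne' _ hm, eLpNorm_comp_mul (h0 hσ) hΦ]

/-- The discrete counterpart of `eLpNorm_lintegral_dilation_le`: Minkowski's inequality with the
counting measure. -/
theorem eLpNorm_tsum_dilation_le {c l : ℕ → ℝ} (hq : 1 ≤ q) (hΦ : Measurable Φ)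
    (hl : ∀ j, 0 < l j) :
    eLpNorm (fun h => ∑' j, ENNReal.ofReal (c j) * Φ (l j * h)) q invMeas ≤
      (∑' j, ENNReal.ofReal (c j)) * eLpNorm Φ q invMeas := by
  have := eLpNorm_lintegral_le (μ := invMeas) (ν := Measure.count)
    (F := fun h (j : ℕ) => ENNReal.ofReal (c j) * Φ (l j * h)) (p := q)
    (c := fun j => ENNReal.ofReal (c j) * eLpNorm Φ q invMeas) ?_ hq (measurable_of_countable _)
    (Eventually.of_forall fun j => ?_)
  · simpa only [lintegral_count, ENNReal.tsum_mul_right] using this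
  · refine measurable_from_prod_countable_left fun j => ?_
    have hm : Measurable (fun h => Φ (l j * h)) := hΦ.comp (measurable_const_mul (l j))
    exact hm.const_mul (ENNReal.ofReal (c j))
  · have hm : Measurable (fun h => Φ (l j * h)) := hΦ.comp (measurable_const_mul (l j))
    rw [eLpNorm_ennreal_const_mul (zero_lt_one.trans_le hq).ne' _ hm, eLpNorm_comp_mul (hl j) hΦ]

theorem eLpNorm_rpow_lt_top {s : Set ℝ} (hs : MeasurableSet s) (h0 : s ⊆ Ioi 0) {a B : ℝ}
    (hB : ∀ h ∈ s, h ^ a ≤ B)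
    (hint : ∀ r : ℝ, 0 < r → IntegrableOn (fun h : ℝ => h ^ (a * r - 1)) s) (hq : q ≠ 0) :
    eLpNorm (fun h : ℝ => ENNReal.ofReal (h ^ a)) q (invMeas.restrict s) < ∞ := by
  rcases eq_or_ne q ∞ with rfl | hq'
  · rw [eLpNorm_exponent_top]
    refine (essSup_le_of_ae_le (ENNReal.ofReal B) ?_).trans_lt ENNReal.ofReal_lt_top
    filter_upwards [ae_restrict_mem hs] with h hh
    exact ENNReal.ofReal_le_ofReal (hB h hh)
  · rw [eLpNorm_lt_top_iff_lintegral_rpow_enorm_lt_top hq hq']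
    have hr := ENNReal.toReal_pos hq hq'
    simp only [enorm_eq_self]
    rw [lintegral_invMeas_restrict hs h0 (by fun_prop)]
    refine lt_of_eq_of_lt ?_ (hint _ hr).lintegral_lt_top
    refine setLIntegral_congr_fun hs fun h hh => ?_
    have hh0 : 0 < h := h0 hh
    rw [ENNReal.ofReal_rpow_of_nonneg (by positivity) hr.le, ← ENNReal.ofReal_mul (by positivity),
      ← Real.rpow_mul hh0.le, Real.rpow_sub_one hh0.ne', div_eq_mul_inv, mul_comm]

theorem eLpNorm_rpow_Ioi_lt_top {a T : ℝ} (ha : a < 0) (hT : 0 < T) (hq : q ≠ 0) :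
    eLpNorm (fun h : ℝ => ENNReal.ofReal (h ^ a)) q (invMeas.restrict (Ioi T)) < ∞ := by
  refine eLpNorm_rpow_lt_top measurableSet_Ioi (Ioi_subset_Ioi hT.le) (B := T ^ a)
    (fun h hh => Real.rpow_le_rpow_of_nonpos hT (le_of_lt hh) ha.le) (fun r hr => ?_) hq
  refine integrableOn_Ioi_rpow_of_lt ?_ hT
  have := mul_neg_of_neg_of_pos ha hr
  linarith

/-- Hölder's inequality against a power weight. -/
theorem lintegral_rpow_mul_le {θ H : ℝ} (hθ : 0 < θ) (hH : 0 < H) (hq : 1 ≤ q) (hΦ : Measurable Φ) :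
    ∫⁻ s in Ioo 0 H, ENNReal.ofReal (s ^ (θ - 1)) * Φ s ≤
      ENNReal.ofReal (H ^ θ) * ENNReal.ofReal (max 1 θ⁻¹) * eLpNorm Φ q invMeas := by
  -- The measure `s^{θ-1} ds` on `(0, H)` is finite and at most `H^θ dh / h`. The inequality is the
  -- embedding of `L^q` in `L^1` for it, and the maximum with `1` makes the constant independent of
  -- `q`.
  set ρ : ℝ → ℝ≥0∞ := fun s => ENNReal.ofReal (s ^ θ) with hρ
  have hρm : Measurable ρ := by fun_prop
  set ν := (invMeas.restrict (Ioo 0 H)).withDensity ρ with hν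
  have hle : ν ≤ ENNReal.ofReal (H ^ θ) • invMeas := by
    refine Measure.le_iff.2 fun s hs => ?_
    rw [hν, withDensity_apply _ hs, Measure.smul_apply, smul_eq_mul,
      Measure.restrict_restrict hs]
    calc ∫⁻ h in s ∩ Ioo 0 H, ρ h ∂invMeas ≤ ∫⁻ _ in s ∩ Ioo 0 H, ENNReal.ofReal (H ^ θ) ∂invMeas :=
        setLIntegral_mono measurable_const fun h hh =>
          ENNReal.ofReal_le_ofReal (Real.rpow_le_rpow hh.2.1.le hh.2.2.le hθ.le)
      _ = ENNReal.ofReal (H ^ θ) * invMeas (s ∩ Ioo 0 H) := by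
        rw [lintegral_const, Measure.restrict_apply_univ]
      _ ≤ _ := by gcongr; exact inter_subset_left
  have heq : ∀ k : ℝ → ℝ≥0∞, Measurable k →
      ∫⁻ s, k s ∂ν = ∫⁻ s in Ioo 0 H, ENNReal.ofReal (s ^ (θ - 1)) * k s := by
    intro k hk
    rw [hν, lintegral_withDensity_eq_lintegral_mul _ hρm hk, lintegral_invMeas_restrict
      measurableSet_Ioo Ioo_subset_Ioi_self (hρm.mul hk)]
    refine setLIntegral_congr_fun measurableSet_Ioo fun s hs => ?_
    simp only [Pi.mul_apply, hρ]
    rw [← mul_assoc, ← ENNReal.ofReal_mul (inv_nonneg.2 hs.1.le), Real.rpow_sub_one hs.1.ne',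
      div_eq_mul_inv, mul_comm (s ^ θ)]
  have hmass : ν univ = ENNReal.ofReal (H ^ θ) * ENNReal.ofReal θ⁻¹ := by
    rw [← lintegral_one, heq _ measurable_const]
    simp only [mul_one]
    have hi : IntegrableOn (fun s : ℝ => s ^ (θ - 1)) (Ioo 0 H) := by
      rw [intervalIntegral.integrableOn_Ioo_rpow_iff hH]; linarith
    rw [← ofReal_integral_eq_lintegral_ofReal hi, ← integral_Ioc_eq_integral_Ioo,
      ← intervalIntegral.integral_of_le hH.le, integral_rpow (Or.inl (by linarith)),
      ← ENNReal.ofReal_mul (by positivity)]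
    · congr 1
      rw [sub_add_cancel, Real.zero_rpow hθ.ne', sub_zero, div_eq_mul_inv]
    · filter_upwards [ae_restrict_mem measurableSet_Ioo] with s hs
      exact Real.rpow_nonneg hs.1.le _
  have h1 := eLpNorm_le_eLpNorm_mul_rpow_measure_univ (μ := ν) (p := 1) (q := q) hq
    hΦ.aestronglyMeasurable
  rw [eLpNorm_one_eq_lintegral_enorm, heq _ (by fun_prop), hmass] at h1
  simp only [enorm_eq_self, ENNReal.toReal_one, div_one] at h1
  have hq1 : 0 ≤ 1 / q.toReal ∧ 1 / q.toReal ≤ 1 := by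
    refine ⟨by positivity, ?_⟩
    rcases eq_or_ne q ∞ with rfl | hq'
    · simp
    · have : 1 ≤ q.toReal := by
        rw [← ENNReal.toReal_one]; exact ENNReal.toReal_mono hq' hq
      exact (div_le_one (by linarith)).2 this
  refine h1.trans ((mul_le_mul_left (eLpNorm_le_of_measure_le_smul hle) _).trans ?_)
  have e : (1 / q).toReal = 1 / q.toReal := by simp
  rw [e, smul_eq_mul, ENNReal.mul_rpow_of_nonneg _ _ (by linarith [hq1.2])]
  set x := 1 / q.toReal
  have hHθ : 0 < H ^ θ := Real.rpow_pos_of_pos hH _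
  have e2 : ENNReal.ofReal (H ^ θ) ^ x * ENNReal.ofReal (H ^ θ) ^ (1 - x) =
      ENNReal.ofReal (H ^ θ) := by
    rw [← ENNReal.rpow_add_of_nonneg _ _ hq1.1 (by linarith [hq1.2]), add_sub_cancel,
      ENNReal.rpow_one]
  have e3 : ENNReal.ofReal θ⁻¹ ^ (1 - x) ≤ ENNReal.ofReal (max 1 θ⁻¹) := by
    calc ENNReal.ofReal θ⁻¹ ^ (1 - x) ≤ ENNReal.ofReal (max 1 θ⁻¹) ^ (1 - x) :=
          ENNReal.rpow_le_rpow (ENNReal.ofReal_le_ofReal (le_max_right _ _)) (by linarith [hq1.2])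
      _ ≤ ENNReal.ofReal (max 1 θ⁻¹) ^ (1 : ℝ) :=
          ENNReal.rpow_le_rpow_of_exponent_le (by
            rw [← ENNReal.ofReal_one]; exact ENNReal.ofReal_le_ofReal (le_max_left _ _))
            (by linarith [hq1.1])
      _ = _ := ENNReal.rpow_one _
  calc ENNReal.ofReal (H ^ θ) ^ x * eLpNorm Φ q invMeas *
        (ENNReal.ofReal (H ^ θ) ^ (1 - x) * ENNReal.ofReal θ⁻¹ ^ (1 - x))
      = (ENNReal.ofReal (H ^ θ) ^ x * ENNReal.ofReal (H ^ θ) ^ (1 - x)) *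
          ENNReal.ofReal θ⁻¹ ^ (1 - x) * eLpNorm Φ q invMeas := by ring
    _ ≤ _ := by rw [e2]; gcongr

end MultiplicativeHaar

end

section

open Filter Topology

/-! ### The singular integral operator and its effect on moduli of continuity -/

section SingularConvolution

variable {X : Type*} [NormedAddCommGroup X] [NormedSpace ℂ X] {M C T t h : ℝ}
  {G S : ℝ → X →L[ℂ] X} {f : ℝ → X}

/-- The derivative of the convolution `G * f`, in a form that makes sense for `f` which satisfies
a Dini condition; `f` is to vanish on `(-∞, 0]`, and `t ≤ M`. -/
def derivConv (G S : ℝ → X →L[ℂ] X) (M : ℝ) (f : ℝ → X) (t : ℝ) : X :=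
  G M (f t) + ∫ s in (0 : ℝ)..M, S s (f (t - s) - f t)

/-- The Dini integral at the point `t`. -/
def dini (M : ℝ) (f : ℝ → X) (t : ℝ) : ℝ≥0∞ :=
  ∫⁻ s in Ioc 0 M, ENNReal.ofReal s⁻¹ * ‖f (t - s) - f t‖ₑ

theorem aestronglyMeasurable_clm_apply {μ : Measure ℝ} {P : ℝ → X →L[ℂ] X} {D : ℝ → X}
    (hP : AEStronglyMeasurable P μ) (hD : AEStronglyMeasurable D μ) :
    AEStronglyMeasurable (fun s => P s (D s)) μ :=
  (isBoundedBilinearMap_apply (𝕜 := ℂ) (E := X) (F := X)).continuous.comp_aestronglyMeasurable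
    (hP.prodMk hD)

omit [NormedSpace ℂ X] in
theorem stronglyMeasurable_comp_const_sub (hf : StronglyMeasurable f) (t : ℝ) :
    StronglyMeasurable (fun s => f (t - s)) :=
  hf.comp_measurable (measurable_const.sub measurable_id)

theorem enorm_clm_apply_le {P : X →L[ℂ] X} {k : ℝ} (hk : ‖P‖ ≤ k) (x : X) :
    ‖P x‖ₑ ≤ ENNReal.ofReal k * ‖x‖ₑ := by
  have h1 : ‖P x‖ ≤ k * ‖x‖ := P.le_of_opNorm_le hk x
  have hk0 : 0 ≤ k := (norm_nonneg _).trans hk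
  rw [← ofReal_norm, ← ofReal_norm, ← ENNReal.ofReal_mul hk0]
  exact ENNReal.ofReal_le_ofReal h1

theorem lintegral_clm_apply_le {P : ℝ → X →L[ℂ] X} {D : ℝ → X} {k : ℝ → ℝ} {s : Set ℝ}
    (hs : MeasurableSet s) (hk : ∀ r ∈ s, ‖P r‖ ≤ k r) :
    ∫⁻ r in s, ‖P r (D r)‖ₑ ≤ ∫⁻ r in s, ENNReal.ofReal (k r) * ‖D r‖ₑ :=
  lintegral_mono_ae ((ae_restrict_mem hs).mono fun r hr => enorm_clm_apply_le (hk r hr) _)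

theorem enorm_integral_clm_apply_le {P : ℝ → X →L[ℂ] X} {D : ℝ → X} {k : ℝ → ℝ} {a b : ℝ}
    (hab : a ≤ b) (hk : ∀ r ∈ Ioc a b, ‖P r‖ ≤ k r) :
    ‖∫ r in a..b, P r (D r)‖ₑ ≤ ∫⁻ r in Ioc a b, ENNReal.ofReal (k r) * ‖D r‖ₑ := by
  rw [intervalIntegral.integral_of_le hab]
  exact (enorm_integral_le_lintegral_enorm _).trans (lintegral_clm_apply_le measurableSet_Ioc hk)

theorem SingularKernel.nonneg (hk : SingularKernel M C G S) (hM : 0 < M) : 0 ≤ C :=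
  (norm_nonneg _).trans (hk.norm_le M ⟨hM, le_rfl⟩)

theorem lintegral_ofReal_const_mul {s : Set ℝ} (hs : MeasurableSet s) (hC : 0 ≤ C)
    {k : ℝ → ℝ} {D : ℝ → ℝ≥0∞} :
    ∫⁻ r in s, ENNReal.ofReal (C * k r) * D r =
      ENNReal.ofReal C * ∫⁻ r in s, ENNReal.ofReal (k r) * D r := by
  rw [← lintegral_const_mul' _ _ ENNReal.ofReal_ne_top]
  refine setLIntegral_congr_fun hs fun r _ => ?_
  rw [ENNReal.ofReal_mul hC, mul_assoc]

theorem SingularKernel.intervalIntegrable (hk : SingularKernel M C G S) (hM : 0 < M)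
    (hf : StronglyMeasurable f) (hd : dini M f t < ∞) :
    IntervalIntegrable (fun s => S s (f (t - s) - f t)) volume 0 M := by
  rw [intervalIntegrable_iff_integrableOn_Ioc_of_le hM.le]
  refine ⟨aestronglyMeasurable_clm_apply
    ((hk.continuousOn.mono Ioc_subset_Ioi_self).aestronglyMeasurable measurableSet_Ioc)
    ((stronglyMeasurable_comp_const_sub hf t).sub stronglyMeasurable_const).aestronglyMeasurable, ?_⟩
  refine (lintegral_clm_apply_le (k := fun s => C * s⁻¹) measurableSet_Ioc fun s hs => ?_).trans_lt
    ?_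
  · rw [← div_eq_mul_inv]; exact hk.norm_deriv_le s hs
  · rw [lintegral_ofReal_const_mul measurableSet_Ioc (hk.nonneg hM)]
    exact ENNReal.mul_lt_top ENNReal.ofReal_lt_top hd

variable [CompleteSpace X]

theorem SingularKernel.integral_apply (hk : SingularKernel M C G S) {a b : ℝ} (ha : 0 < a)
    (hab : a ≤ b) (x : X) : ∫ s in a..b, S s x = G b x - G a x := by
  refine intervalIntegral.integral_eq_sub_of_hasDerivAt (f := fun s => G s x) (fun s hs => ?_) ?_
  · rw [uIcc_of_le hab] at hs
    exact ((ContinuousLinearMap.apply ℂ X x).restrictScalars ℝ).hasFDerivAt.comp_hasDerivAt s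
      (hk.hasDerivAt s (ha.trans_le hs.1))
  · refine ContinuousOn.intervalIntegrable ?_
    rw [uIcc_of_le hab]
    exact (hk.continuousOn.mono fun s hs => ha.trans_le hs.1).clm_apply continuousOn_const

/-- Away from the singularity, the integral at `t - h` is shifted by `h` so that both integrals
contain the same values of `f`; the kernels are then subtracted. Replacing the base value `f (t -
h)` by `f t` costs `G (2T) x - G h x` with `x = f (t - h) - f t`, of which the first term is
absorbed by the boundary term of `derivConv`. Beyond `2T` only `f t` is left, since `f` vanishes on
the negative axis. -/
theorem derivConv_sub (hk : SingularKernel (2 * T) C G S) (hf : StronglyMeasurable f)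
    (hf0 : ∀ s ≤ 0, f s = 0) (hh : 0 < h) (hhT : h ≤ T) (htT : t ≤ T)
    (hd : dini (2 * T) f t < ∞) (hd' : dini (2 * T) f (t - h) < ∞) :
    derivConv G S (2 * T) f (t - h) - derivConv G S (2 * T) f t =
      G h (f (t - h) - f t) + (∫ s in (0 : ℝ)..h, S s (f (t - h - s) - f (t - h))) -
        (∫ s in (0 : ℝ)..(2 * h), S s (f (t - s) - f t)) +
        (∫ s in (2 * h)..(2 * T), (S (s - h) - S s) (f (t - s) - f t)) -
        ∫ s in (2 * T)..(2 * T + h), S (s - h) (f t) := by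
  have hM : 0 < 2 * T := by linarith
  have hhM : h ≤ 2 * T := by linarith
  have iP := hk.intervalIntegrable hM hf hd'
  have iQ := hk.intervalIntegrable hM hf hd
  have iP1 : IntervalIntegrable (fun s => S s (f (t - h - s) - f (t - h))) volume 0 h :=
    iP.mono_set (by rw [uIcc_of_le hh.le, uIcc_of_le hM.le]; exact Icc_subset_Icc_right hhM)
  have iP2 : IntervalIntegrable (fun s => S s (f (t - h - s) - f (t - h))) volume h (2 * T) :=
    iP.mono_set (by rw [uIcc_of_le hhM, uIcc_of_le hM.le]; exact Icc_subset_Icc_left hh.le)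
  have iQ1 : IntervalIntegrable (fun s => S s (f (t - s) - f t)) volume 0 (2 * h) :=
    iQ.mono_set (by
      rw [uIcc_of_le (by linarith), uIcc_of_le hM.le]; exact Icc_subset_Icc_right (by linarith))
  have iQ2 : IntervalIntegrable (fun s => S s (f (t - s) - f t)) volume (2 * h) (2 * T) :=
    iQ.mono_set (by
      rw [uIcc_of_le (by linarith), uIcc_of_le hM.le]; exact Icc_subset_Icc_left (by linarith))
  set x := f (t - h) - f t with hx
  have iSx : IntervalIntegrable (fun s => S s x) volume h (2 * T) := by
    refine ContinuousOn.intervalIntegrable ?_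
    rw [uIcc_of_le hhM]
    exact (hk.continuousOn.mono fun s hs => hh.trans_le hs.1).clm_apply continuousOn_const
  have iR : IntervalIntegrable (fun s => S s (f (t - h - s) - f t)) volume h (2 * T) := by
    refine (iP2.add iSx).congr fun s _ => ?_
    simp only [hx, ← map_add]
    congr 1
    abel
  have eR : ∫ s in h..(2 * T), S s (f (t - h - s) - f t) =
      (∫ s in h..(2 * T), S s (f (t - h - s) - f (t - h))) + (G (2 * T) x - G h x) := by
    rw [← hk.integral_apply hh hhM, ← intervalIntegral.integral_add iP2 iSx]
    refine intervalIntegral.integral_congr fun s _ => ?_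
    simp only [hx, ← map_add]
    congr 1
    abel
  have iR' : IntervalIntegrable (fun s => S (s - h) (f (t - s) - f t)) volume (2 * h)
      (2 * T + h) := by
    have := iR.comp_sub_right h
    rw [← two_mul] at this
    refine this.congr fun s _ => ?_
    rw [show t - h - (s - h) = t - s by ring]
  have eR' : ∫ s in h..(2 * T), S s (f (t - h - s) - f t) =
      ∫ s in (2 * h)..(2 * T + h), S (s - h) (f (t - s) - f t) := by
    have := intervalIntegral.integral_comp_sub_right (a := 2 * h) (b := 2 * T + h)
      (fun s => S s (f (t - h - s) - f t)) h
    rw [show 2 * h - h = h by ring, show 2 * T + h - h = 2 * T by ring] at this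
    rw [← this]
    refine intervalIntegral.integral_congr fun s _ => ?_
    rw [show t - h - (s - h) = t - s by ring]
  have iA : IntervalIntegrable (fun s => S (s - h) (f (t - s) - f t)) volume (2 * h) (2 * T) :=
    iR'.mono_set (by
      rw [uIcc_of_le (by linarith), uIcc_of_le (by linarith)]
      exact Icc_subset_Icc_right (by linarith))
  have iB : IntervalIntegrable (fun s => S (s - h) (f (t - s) - f t)) volume (2 * T)
      (2 * T + h) :=
    iR'.mono_set (by
      rw [uIcc_of_le (by linarith), uIcc_of_le (by linarith)]
      exact Icc_subset_Icc_left (by linarith))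
  have e1 := intervalIntegral.integral_add_adjacent_intervals iP1 iP2
  have e2 := intervalIntegral.integral_add_adjacent_intervals iQ1 iQ2
  have e3 := intervalIntegral.integral_add_adjacent_intervals iA iB
  have e4 : ∫ s in (2 * h)..(2 * T), (S (s - h) - S s) (f (t - s) - f t) =
      (∫ s in (2 * h)..(2 * T), S (s - h) (f (t - s) - f t)) -
        ∫ s in (2 * h)..(2 * T), S s (f (t - s) - f t) :=
    intervalIntegral.integral_sub iA iQ2
  have e5 : ∫ s in (2 * T)..(2 * T + h), S (s - h) (f (t - s) - f t) =
      -∫ s in (2 * T)..(2 * T + h), S (s - h) (f t) := by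
    rw [← intervalIntegral.integral_neg]
    refine intervalIntegral.integral_congr fun s hs => ?_
    rw [uIcc_of_le (by linarith)] at hs
    rw [hf0 (t - s) (by linarith [hs.1]), zero_sub, map_neg]
  have e6 : G (2 * T) (f (t - h)) - G (2 * T) (f t) = G (2 * T) x := by rw [hx, map_sub]
  unfold derivConv
  rw [← e1, ← e2, e4]
  linear_combination (norm := module) e6 - eR + eR' - e3 + e5

/-- The modulus of continuity of `derivConv` is controlled by that of `f`. -/
theorem enorm_derivConv_sub_le (hk : SingularKernel (2 * T) C G S) (hf : StronglyMeasurable f)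
    (hf0 : ∀ s ≤ 0, f s = 0) (hh : 0 < h) (hhT : h ≤ T) (htT : t ≤ T)
    (hd : dini (2 * T) f t < ∞) (hd' : dini (2 * T) f (t - h) < ∞) :
    ‖derivConv G S (2 * T) f (t - h) - derivConv G S (2 * T) f t‖ₑ ≤
      ENNReal.ofReal (8 * C) * (‖f (t - h) - f t‖ₑ + (∫⁻ s in Ioc 0 (2 * h), ENNReal.ofReal s⁻¹ *
        ‖f (t - s) - f t‖ₑ) + (∫⁻ s in Ioc 0 h, ENNReal.ofReal s⁻¹ *
        ‖f (t - h - s) - f (t - h)‖ₑ) + ∫⁻ s in Ioc h (2 * T), ENNReal.ofReal (h * (s ^ 2)⁻¹) *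
        ‖f (t - s) - f t‖ₑ) := by
  have hM : 0 < 2 * T := by linarith
  have hT : 0 < T := by linarith
  have hC := hk.nonneg hM
  rw [derivConv_sub hk hf hf0 hh hhT htT hd hd']
  set a := ‖f (t - h) - f t‖ₑ
  set b := ∫⁻ s in Ioc 0 (2 * h), ENNReal.ofReal s⁻¹ * ‖f (t - s) - f t‖ₑ
  set c := ∫⁻ s in Ioc 0 h, ENNReal.ofReal s⁻¹ * ‖f (t - h - s) - f (t - h)‖ₑ
  set d := ∫⁻ s in Ioc h (2 * T), ENNReal.ofReal (h * (s ^ 2)⁻¹) * ‖f (t - s) - f t‖ₑ with hdd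
  have k1 : ‖G h (f (t - h) - f t)‖ₑ ≤ ENNReal.ofReal C * a :=
    enorm_clm_apply_le (hk.norm_le h ⟨hh, by linarith⟩) _
  have k2 : ‖∫ s in (0 : ℝ)..h, S s (f (t - h - s) - f (t - h))‖ₑ ≤ ENNReal.ofReal C * c := by
    refine (enorm_integral_clm_apply_le (k := fun s => C * s⁻¹) hh.le fun s hs => ?_).trans
      (le_of_eq ?_)
    · rw [← div_eq_mul_inv]; exact hk.norm_deriv_le s ⟨hs.1, by linarith [hs.2]⟩
    · exact lintegral_ofReal_const_mul measurableSet_Ioc hC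
  have k3 : ‖∫ s in (0 : ℝ)..(2 * h), S s (f (t - s) - f t)‖ₑ ≤ ENNReal.ofReal C * b := by
    refine (enorm_integral_clm_apply_le (k := fun s => C * s⁻¹) (by linarith) fun s hs => ?_).trans
      (le_of_eq ?_)
    · rw [← div_eq_mul_inv]; exact hk.norm_deriv_le s ⟨hs.1, by linarith [hs.2]⟩
    · exact lintegral_ofReal_const_mul measurableSet_Ioc hC
  have k4 : ‖∫ s in (2 * h)..(2 * T), (S (s - h) - S s) (f (t - s) - f t)‖ₑ ≤
      ENNReal.ofReal (4 * C) * d := by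
    refine (enorm_integral_clm_apply_le (k := fun s => 4 * C * (h * (s ^ 2)⁻¹)) (by linarith)
      fun s hs => ?_).trans ?_
    · have hs0 : 0 < s := by linarith [hs.1]
      have h1 := hk.norm_deriv_sub_le (s - h) s (by linarith [hs.1]) (by linarith) hs.2
      rw [norm_sub_rev, sub_sub_cancel] at h1
      refine h1.trans ?_
      -- Cutting at `2 h` instead of `h` ensures that `s - h ≥ s / 2`, so the singularity stays
      -- away.
      have h2 : (s / 2) ^ 2 ≤ (s - h) ^ 2 :=
        pow_le_pow_left₀ (by linarith) (by linarith [hs.1]) 2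
      calc C * h / (s - h) ^ 2 ≤ C * h / (s / 2) ^ 2 :=
            div_le_div_of_nonneg_left (by positivity) (by positivity) h2
        _ = 4 * C * (h * (s ^ 2)⁻¹) := by field_simp; ring
    · rw [lintegral_ofReal_const_mul measurableSet_Ioc (by positivity)]
      gcongr
      exact lintegral_mono_set (Ioc_subset_Ioc_left (by linarith))
  -- For `s > T ≥ t` one has `f (t - s) = 0`, so the part of `d` over `(T, 2T)` controls `f t`
  -- itself. This is the reason to truncate at `2T` instead of `T`.
  have k5 : ‖∫ s in (2 * T)..(2 * T + h), S (s - h) (f t)‖ₑ ≤ ENNReal.ofReal (4 * C) * d := by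
    have h1 : ‖∫ s in (2 * T)..(2 * T + h), S (s - h) (f t)‖ₑ ≤
        ENNReal.ofReal (C / T * h) * ‖f t‖ₑ := by
      refine (enorm_integral_clm_apply_le (k := fun _ => C / T) (by linarith)
        fun s hs => ?_).trans (le_of_eq ?_)
      · refine (hk.norm_deriv_le (s - h) ⟨by linarith [hs.1], by linarith [hs.2]⟩).trans ?_
        gcongr
        linarith [hs.1]
      · rw [lintegral_const, Measure.restrict_apply_univ, Real.volume_Ioc,
          ENNReal.ofReal_mul (by positivity), add_sub_cancel_left, mul_right_comm]
    have h2 : ENNReal.ofReal (h * ((2 * T) ^ 2)⁻¹ * T) * ‖f t‖ₑ ≤ d := by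
      calc ENNReal.ofReal (h * ((2 * T) ^ 2)⁻¹ * T) * ‖f t‖ₑ =
          ∫⁻ _ in Ioc T (2 * T), ENNReal.ofReal (h * ((2 * T) ^ 2)⁻¹) * ‖f t‖ₑ := by
            rw [lintegral_const, Measure.restrict_apply_univ, Real.volume_Ioc,
              mul_right_comm (ENNReal.ofReal _), ← ENNReal.ofReal_mul (by positivity)]
            congr 3
            ring
        _ ≤ ∫⁻ s in Ioc T (2 * T), ENNReal.ofReal (h * (s ^ 2)⁻¹) * ‖f (t - s) - f t‖ₑ := by
            refine lintegral_mono_ae ((ae_restrict_mem measurableSet_Ioc).mono fun s hs => ?_)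
            have hs0 : 0 < s := by linarith [hs.1]
            rw [hf0 (t - s) (by linarith [hs.1]), zero_sub, enorm_neg]
            have := hs.2
            gcongr
        _ ≤ d := lintegral_mono_set (Ioc_subset_Ioc_left hhT)
    refine (h1.trans (le_of_eq ?_)).trans (mul_le_mul_right h2 (ENNReal.ofReal (4 * C)))
    rw [← mul_assoc, ← ENNReal.ofReal_mul (by positivity)]
    congr 2
    field_simp
    ring
  have e4 : ENNReal.ofReal (4 * C) = 4 * ENNReal.ofReal C := by
    rw [ENNReal.ofReal_mul (by norm_num)]; norm_num
  have e8 : ENNReal.ofReal (8 * C) = 8 * ENNReal.ofReal C := by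
    rw [ENNReal.ofReal_mul (by norm_num)]; norm_num
  rw [e4] at k4 k5
  rw [e8]
  calc _ ≤ ENNReal.ofReal C * a + ENNReal.ofReal C * c + ENNReal.ofReal C * b +
        4 * ENNReal.ofReal C * d + 4 * ENNReal.ofReal C * d :=
        enorm_sub_le.trans (add_le_add ((enorm_add_le _ _).trans (add_le_add (enorm_sub_le.trans
          (add_le_add ((enorm_add_le _ _).trans (add_le_add k1 k2)) k3)) k4)) k5)
    _ = 1 * (ENNReal.ofReal C * (a + b + c)) + 8 * (ENNReal.ofReal C * d) := by ring
    _ ≤ 8 * (ENNReal.ofReal C * (a + b + c)) + 8 * (ENNReal.ofReal C * d) := by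
        gcongr
        norm_num
    _ = _ := by ring

end SingularConvolution

end

section

open Filter Topology

/-! ### The singular integral as the derivative of a convolution -/

section ConvolutionFubini

variable {X : Type*} [NormedAddCommGroup X] [NormedSpace ℂ X] {M C T t τ : ℝ}
  {G S : ℝ → X →L[ℂ] X} {f : ℝ → X}

/-- The convolution of an operator-valued kernel with a function, on `[0, t]`. -/
def conv (G : ℝ → X →L[ℂ] X) (f : ℝ → X) (t : ℝ) : X := ∫ s in (0 : ℝ)..t, G s (f (t - s))

theorem conv_eq_integral (hf0 : ∀ s ≤ 0, f s = 0) (ht : 0 ≤ t) (htM : t ≤ M) :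
    conv G f t = ∫ s in Ioc 0 M, G s (f (t - s)) := by
  rw [conv, intervalIntegral.integral_of_le ht]
  refine (setIntegral_eq_of_subset_of_forall_sdiff_eq_zero measurableSet_Ioc
    (Ioc_subset_Ioc_right htM) fun s hs => ?_).symm
  have : t < s := by
    by_contra! hcon
    exact hs.2 ⟨hs.1.1, hcon⟩
  rw [hf0 _ (by linarith), map_zero]

theorem derivConv_eq_of_nonpos (hf0 : ∀ s ≤ 0, f s = 0) (hM : 0 ≤ M) (ht : t ≤ 0) :
    derivConv G S M f t = 0 := by
  have : ∫ s in (0 : ℝ)..M, S s (f (t - s) - f t) = ∫ _ in (0 : ℝ)..M, (0 : X) := by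
    refine intervalIntegral.integral_congr fun s hs => ?_
    rw [uIcc_of_le hM] at hs
    simp [hf0 t ht, hf0 (t - s) (by linarith [hs.1])]
  rw [derivConv, this, hf0 t ht]
  simp

omit [NormedSpace ℂ X] in
theorem integrableOn_comp_const_sub (hfi : IntegrableOn f (Iic T)) (hτ : τ ≤ T) :
    IntegrableOn (fun s => f (τ - s)) (Ici 0) := by
  have h1 := (hfi.mono_set (Iic_subset_Iic.2 hτ)).integrable_indicator measurableSet_Iic
  have h2 := (integrable_comp_sub_left _ τ).2 h1
  rw [← integrable_indicator_iff measurableSet_Ici]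
  refine h2.congr (Eventually.of_forall fun s => ?_)
  change (Iic τ).indicator f (τ - s) = _
  by_cases hs : 0 ≤ s
  · rw [indicator_of_mem (mem_Ici.2 hs), indicator_of_mem (by simpa using hs)]
  · rw [indicator_of_notMem (by simpa using hs), indicator_of_notMem (by simpa using hs)]

omit [NormedSpace ℂ X] in
-- The integral of `|f|` up to `τ` is at most that of the translate plus that of the difference; the
-- integral of the translate goes up to `τ - s` only, and subtracting it leaves the window of length
-- `s`. This lets the Dini condition compensate the singularity `1 / s` in the second application of
-- Fubini's theorem.
theorem lintegral_window_le (hfm : StronglyMeasurable f) (hf0 : ∀ s ≤ 0, f s = 0)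
    (hfi : IntegrableOn f (Iic T)) (hτ : τ ≤ T) {s : ℝ} (hs : 0 ≤ s) :
    ∫⁻ σ in Ioc 0 s, ‖f (τ - σ)‖ₑ ≤ ∫⁻ t in Ioc 0 τ, ‖f (t - s) - f t‖ₑ := by
  have hsub : ∫⁻ σ in Ioc 0 s, ‖f (τ - σ)‖ₑ = ∫⁻ r in Ico (τ - s) τ, ‖f r‖ₑ := by
    have := (Measure.measurePreserving_sub_left volume τ).setLIntegral_comp_preimage
      (measurableSet_Ico (a := τ - s) (b := τ)) hfm.enorm
    rw [← this]
    congr 2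
    ext σ
    simp only [mem_Ioc, mem_preimage, mem_Ico]
    constructor <;> rintro ⟨h1, h2⟩ <;> constructor <;> linarith
  have hsh : ∫⁻ t in Iio τ, ‖f (t - s)‖ₑ = ∫⁻ r in Iio (τ - s), ‖f r‖ₑ := by
    have := (measurePreserving_sub_right volume s).setLIntegral_comp_preimage
      (measurableSet_Iio (a := τ - s)) hfm.enorm
    rw [← this]
    congr 2
    ext t
    simp
  have hfin : ∫⁻ r in Iio (τ - s), ‖f r‖ₑ ≠ ∞ :=
    ((lintegral_mono_set (fun r hr => by
      have : r < τ - s := hr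
      simp only [mem_Iic]; linarith)).trans_lt hfi.2).ne
  have hsplit : ∫⁻ r in Iio τ, ‖f r‖ₑ = (∫⁻ r in Iio (τ - s), ‖f r‖ₑ) +
      ∫⁻ r in Ico (τ - s) τ, ‖f r‖ₑ := by
    rw [← lintegral_union measurableSet_Ico, Iio_union_Ico_eq_Iio (by linarith)]
    exact disjoint_left.2 fun r h1 h2 => not_lt.2 h2.1 h1
  have htri : ∫⁻ r in Iio τ, ‖f r‖ₑ ≤ (∫⁻ r in Iio (τ - s), ‖f r‖ₑ) +
      ∫⁻ t in Iio τ, ‖f (t - s) - f t‖ₑ := by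
    have hm : Measurable fun r => ‖f (r - s)‖ₑ :=
      (hfm.comp_measurable (measurable_id.sub_const s)).enorm
    rw [← hsh, ← lintegral_add_left hm]
    refine lintegral_mono fun r => ?_
    have e : f r = f (r - s) - (f (r - s) - f r) := by abel
    calc ‖f r‖ₑ = ‖f (r - s) - (f (r - s) - f r)‖ₑ := by rw [← e]
      _ ≤ _ := enorm_sub_le
  rw [hsplit] at htri
  rw [hsub]
  refine (ENNReal.le_of_add_le_add_left hfin htri).trans ?_
  have hz : ∫⁻ t in Iic 0, ‖f (t - s) - f t‖ₑ = 0 := by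
    refine setLIntegral_eq_zero measurableSet_Iic fun t ht => ?_
    have ht' : t ≤ 0 := ht
    simp [hf0 t ht', hf0 (t - s) (by linarith)]
  calc ∫⁻ t in Iio τ, ‖f (t - s) - f t‖ₑ
      ≤ ∫⁻ t in Iic 0 ∪ Ioc 0 τ, ‖f (t - s) - f t‖ₑ := by
        refine lintegral_mono_set fun r hr => ?_
        rcases le_or_gt r 0 with h | h
        · exact Or.inl h
        · exact Or.inr ⟨h, le_of_lt hr⟩
    _ ≤ _ := (lintegral_union_le _ _ _).trans (by rw [hz, zero_add])

theorem SingularKernel.integrable_prod (hk : SingularKernel M C G S) (hM : 0 < M)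
    (hfm : StronglyMeasurable f) (hd : ∫⁻ t in Ioc 0 T, dini M f t < ∞) :
    Integrable (Function.uncurry fun t s => S s (f (t - s) - f t))
      ((volume.restrict (Ioc 0 T)).prod (volume.restrict (Ioc 0 M))) := by
  have hC := hk.nonneg hM
  have hS : AEStronglyMeasurable S (volume.restrict (Ioc 0 M)) :=
    (hk.continuousOn.mono Ioc_subset_Ioi_self).aestronglyMeasurable measurableSet_Ioc
  have hSle : ∀ᵐ s ∂volume.restrict (Ioc 0 M), ‖S s‖ ≤ C * s⁻¹ :=
    (ae_restrict_mem measurableSet_Ioc).mono fun s hs => by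
      rw [← div_eq_mul_inv]; exact hk.norm_deriv_le s hs
  set μ : Measure ℝ := volume.restrict (Ioc 0 T) with hμ
  set ν : Measure ℝ := volume.restrict (Ioc 0 M) with hν
  have hm : AEStronglyMeasurable (Function.uncurry fun t s => S s (f (t - s) - f t))
      (μ.prod ν) :=
    (isBoundedBilinearMap_apply (𝕜 := ℂ) (E := X) (F := X)).continuous.comp_aestronglyMeasurable
      (hS.comp_snd.prodMk ((hfm.comp_measurable (measurable_fst.sub measurable_snd)).sub
      (hfm.comp_measurable measurable_fst)).aestronglyMeasurable)
  refine ⟨hm, ?_⟩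
  change ∫⁻ z, _ ∂_ < _
  rw [lintegral_prod _ hm.enorm]
  calc ∫⁻ t, ∫⁻ s, ‖S s (f (t - s) - f t)‖ₑ ∂ν ∂μ
      ≤ ∫⁻ t, ENNReal.ofReal C * ∫⁻ s, ENNReal.ofReal s⁻¹ * ‖f (t - s) - f t‖ₑ ∂ν ∂μ := by
        refine lintegral_mono fun t => ?_
        rw [← lintegral_const_mul' _ _ ENNReal.ofReal_ne_top]
        refine lintegral_mono_ae (hSle.mono fun s hs => ?_)
        rw [← mul_assoc, ← ENNReal.ofReal_mul hC]
        exact enorm_clm_apply_le hs _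
    _ = ENNReal.ofReal C * ∫⁻ t, ∫⁻ s, ENNReal.ofReal s⁻¹ * ‖f (t - s) - f t‖ₑ ∂ν ∂μ :=
        lintegral_const_mul' _ _ ENNReal.ofReal_ne_top
    _ < ∞ := ENNReal.mul_lt_top ENNReal.ofReal_lt_top hd

theorem integrableOn_derivConv [CompleteSpace X] (hk : SingularKernel M C G S) (hM : 0 < M)
    (hfm : StronglyMeasurable f) (hfi : IntegrableOn f (Iic T))
    (hd : ∫⁻ t in Ioc 0 T, dini M f t < ∞) : IntegrableOn (derivConv G S M f) (Ioc 0 T) := by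
  have h1 := (hk.integrable_prod hM hfm hd).integral_prod_left
  have h2 : IntegrableOn (fun t => G M (f t)) (Ioc 0 T) :=
    (G M).integrable_comp (hfi.mono_set fun t ht => ht.2)
  refine (h2.add h1).congr (Eventually.of_forall fun t => ?_)
  simp [derivConv, intervalIntegral.integral_of_le hM.le]

/-- The singular integral operator is the derivative of the convolution. -/
theorem integral_derivConv [CompleteSpace X] (hk : SingularKernel M C G S) (hM : 0 < M)
    (hfm : StronglyMeasurable f) (hf0 : ∀ s ≤ 0, f s = 0) (hfi : IntegrableOn f (Iic T))
    (hd : ∫⁻ t in Ioc 0 T, dini M f t < ∞) (hTM : T ≤ M) (hτ : τ ∈ Icc 0 T) :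
    ∫ t in (0 : ℝ)..τ, derivConv G S M f t = conv G f τ := by
  have hC := hk.nonneg hM
  have hτM : τ ≤ M := hτ.2.trans hTM
  set μ : Measure ℝ := volume.restrict (Ioc 0 τ) with hμ
  set ν : Measure ℝ := volume.restrict (Ioc 0 M) with hν
  have hS : AEStronglyMeasurable S ν :=
    (hk.continuousOn.mono Ioc_subset_Ioi_self).aestronglyMeasurable measurableSet_Ioc
  have hG : AEStronglyMeasurable G ν := by
    refine ContinuousOn.aestronglyMeasurable (fun s hs => ?_) measurableSet_Ioc
    exact (hk.hasDerivAt s hs.1).continuousAt.continuousWithinAt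
  have hdm : Measurable (Function.uncurry fun t s : ℝ => ENNReal.ofReal s⁻¹ * ‖f (t - s) - f t‖ₑ) :=
    (measurable_snd.inv.ennreal_ofReal).mul
      ((hfm.comp_measurable (measurable_fst.sub measurable_snd)).sub
        (hfm.comp_measurable measurable_fst)).enorm
  have hdτ : ∫⁻ t, ∫⁻ s, ENNReal.ofReal s⁻¹ * ‖f (t - s) - f t‖ₑ ∂ν ∂μ < ∞ :=
    (lintegral_mono_set (Ioc_subset_Ioc_right hτ.2)).trans_lt hd
  have hSle : ∀ᵐ s ∂ν, ‖S s‖ ≤ C * s⁻¹ := (ae_restrict_mem measurableSet_Ioc).mono fun s hs => by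
    rw [← div_eq_mul_inv]; exact hk.norm_deriv_le s hs
  have i1 : Integrable (Function.uncurry fun t s => S s (f (t - s) - f t)) (μ.prod ν) :=
    hk.integrable_prod hM hfm ((lintegral_mono_set (Ioc_subset_Ioc_right hτ.2)).trans_lt hd)
  have j4 : Integrable (fun t => ∫ s, S s (f (t - s) - f t) ∂ν) μ := i1.integral_prod_left
  have hfw : IntegrableOn (fun s => f (τ - s)) (Ioc 0 M) :=
    (integrableOn_comp_const_sub hfi hτ.2).mono_set fun s hs => hs.1.le
  have i2 : Integrable (Function.uncurry fun s σ => (Ioc 0 s).indicator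
      (fun σ => S s (f (τ - σ))) σ) (ν.prod ν) := by
    have hset : MeasurableSet {z : ℝ × ℝ | z.2 ∈ Ioc 0 z.1} :=
      (measurableSet_lt measurable_const measurable_snd).inter
        (measurableSet_le measurable_snd measurable_fst)
    have hm : AEStronglyMeasurable (Function.uncurry fun s σ => (Ioc 0 s).indicator
        (fun σ => S s (f (τ - σ))) σ) (ν.prod ν) := by
      have := ((isBoundedBilinearMap_apply (𝕜 := ℂ) (E := X)
        (F := X)).continuous.comp_aestronglyMeasurable (hS.comp_fst.prodMk
        ((stronglyMeasurable_comp_const_sub hfm τ).comp_measurable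
          measurable_snd).aestronglyMeasurable) (μ := ν.prod ν)).indicator hset
      refine this.congr (Eventually.of_forall fun z => ?_)
      simp only [Function.uncurry, indicator, mem_ofPred_eq]
      rfl
    refine ⟨hm, ?_⟩
    change ∫⁻ z, _ ∂_ < _
    rw [lintegral_prod _ hm.enorm]
    calc ∫⁻ s, ∫⁻ σ, ‖(Ioc 0 s).indicator (fun σ => S s (f (τ - σ))) σ‖ₑ ∂ν ∂ν
        ≤ ∫⁻ s, ∫⁻ t, ENNReal.ofReal C * (ENNReal.ofReal s⁻¹ * ‖f (t - s) - f t‖ₑ) ∂μ ∂ν := by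
          refine lintegral_mono_ae ?_
          filter_upwards [hSle, ae_restrict_mem measurableSet_Ioc] with s hs hs'
          rw [lintegral_const_mul' _ _ ENNReal.ofReal_ne_top,
            lintegral_const_mul' _ _ ENNReal.ofReal_ne_top, ← mul_assoc, ← ENNReal.ofReal_mul hC]
          refine le_trans ?_ (mul_le_mul_right (lintegral_window_le hfm hf0 hfi hτ.2 hs'.1.le) _)
          rw [← lintegral_const_mul' _ _ ENNReal.ofReal_ne_top]
          refine (setLIntegral_le_lintegral _ _).trans ?_
          rw [← lintegral_indicator measurableSet_Ioc]
          refine lintegral_mono fun σ => ?_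
          simp only [indicator]
          split_ifs
          · exact enorm_clm_apply_le hs _
          · simp
      _ = ENNReal.ofReal C * ∫⁻ s, ∫⁻ t, ENNReal.ofReal s⁻¹ * ‖f (t - s) - f t‖ₑ ∂μ ∂ν := by
          rw [← lintegral_const_mul' _ _ ENNReal.ofReal_ne_top]
          exact lintegral_congr fun s => lintegral_const_mul' _ _ ENNReal.ofReal_ne_top
      _ < ∞ := by
          refine ENNReal.mul_lt_top ENNReal.ofReal_lt_top ?_
          rw [← lintegral_lintegral_swap hdm.aemeasurable]
          exact hdτ
  have hfii : ∀ a b : ℝ, a ≤ T → b ≤ T → IntervalIntegrable f volume a b := fun a b ha hb =>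
    (hfi.mono_set fun r hr => (hr.2.trans (max_le ha hb))).intervalIntegrable
  -- Integrated over `t`, the difference telescopes: only the last window of length `s` before `τ`
  -- survives.
  have hwin : ∀ s ∈ Ioc 0 M, ∫ t, (f (t - s) - f t) ∂μ = - ∫ σ in Ioc 0 s, f (τ - σ) := by
    intro s hs
    rw [← intervalIntegral.integral_of_le hs.1.le, intervalIntegral.integral_comp_sub_left f τ,
      sub_zero, hμ, ← intervalIntegral.integral_of_le hτ.1, intervalIntegral.integral_sub
      (by
        have := hfii (-s) (τ - s) (by linarith [hs.1, hτ.1, hτ.2]) (by linarith [hs.1, hτ.2])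
        simpa using this.comp_sub_right s)
      (hfii 0 τ (hτ.1.trans hτ.2) hτ.2), intervalIntegral.integral_comp_sub_right f s, zero_sub]
    have z : ∫ t in (-s)..0, f t = 0 := by
      rw [intervalIntegral.integral_of_le (by linarith [hs.1])]
      exact setIntegral_eq_zero_of_forall_eq_zero fun t ht => hf0 t ht.2
    have h1 := hτ.1
    have h2 := hτ.2
    have h3 := hs.1
    rw [← intervalIntegral.integral_add_adjacent_intervals
        (hfii (-s) 0 (by linarith) (by linarith)) (hfii 0 (τ - s) (by linarith) (by linarith)),
      ← intervalIntegral.integral_add_adjacent_intervals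
        (hfii 0 (τ - s) (by linarith) (by linarith)) (hfii (τ - s) τ (by linarith) h2), z]
    abel
  have e1 : ∫ t, ∫ s, S s (f (t - s) - f t) ∂ν ∂μ = ∫ s, ∫ t, S s (f (t - s) - f t) ∂μ ∂ν :=
    integral_integral_swap i1
  have e2 : ∫ s, ∫ t, S s (f (t - s) - f t) ∂μ ∂ν =
      - ∫ s, ∫ σ, (Ioc 0 s).indicator (fun σ => S s (f (τ - σ))) σ ∂ν ∂ν := by
    rw [← integral_neg]
    refine integral_congr_ae ((ae_restrict_mem measurableSet_Ioc).mono fun s hs => ?_)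
    have j1 : Integrable (fun t => f (t - s) - f t) μ := by
      refine Integrable.sub ?_ (hfi.mono_set fun t ht => ht.2.trans hτ.2)
      have := hfii (0 - s) (τ - s) (by linarith [hs.1, hτ.1, hτ.2]) (by linarith [hs.1, hτ.2])
      have := this.comp_sub_right s
      simp only [sub_add_cancel] at this
      exact (intervalIntegrable_iff_integrableOn_Ioc_of_le hτ.1).1 this
    change ∫ t, S s (f (t - s) - f t) ∂μ = - ∫ σ, _ ∂ν
    rw [ContinuousLinearMap.integral_comp_comm _ j1, hwin s hs, map_neg,
      integral_indicator measurableSet_Ioc, hν, Measure.restrict_restrict measurableSet_Ioc,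
      Ioc_inter_Ioc, max_self, min_eq_left hs.2,
      ContinuousLinearMap.integral_comp_comm _ (hfw.mono_set (Ioc_subset_Ioc_right hs.2))]
  -- In the other order, `S` is integrated from `σ` to `M`. The resulting `G M` cancels the boundary
  -- term of `derivConv`, and `G σ` yields the convolution.
  have e3 : ∫ s, ∫ σ, (Ioc 0 s).indicator (fun σ => S s (f (τ - σ))) σ ∂ν ∂ν =
      ∫ σ, (G M (f (τ - σ)) - G σ (f (τ - σ))) ∂ν := by
    rw [integral_integral_swap i2]
    refine integral_congr_ae ((ae_restrict_mem measurableSet_Ioc).mono fun σ hσ => ?_)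
    have : ∫ s, (Ioc 0 s).indicator (fun σ => S s (f (τ - σ))) σ ∂ν =
        ∫ s, (Ici σ).indicator (fun s => S s (f (τ - σ))) s ∂ν := by
      refine integral_congr_ae (Eventually.of_forall fun s => ?_)
      simp [indicator, hσ.1]
    change ∫ s, (Ioc 0 s).indicator (fun σ => S s (f (τ - σ))) σ ∂ν = _
    have hset : Ici σ ∩ Ioc 0 M = Icc σ M := by
      ext r
      simp only [mem_inter_iff, mem_Ici, mem_Ioc, mem_Icc]
      exact ⟨fun h => ⟨h.1, h.2.2⟩, fun h => ⟨h.1, hσ.1.trans_le h.1, h.2⟩⟩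
    rw [this, integral_indicator measurableSet_Ici, hν,
      Measure.restrict_restrict measurableSet_Ici, hset, integral_Icc_eq_integral_Ioc,
      ← intervalIntegral.integral_of_le hσ.2, hk.integral_apply hσ.1 hσ.2]
  have j2 : Integrable (fun σ => G M (f (τ - σ))) ν := (G M).integrable_comp hfw
  have j3 : Integrable (fun σ => G σ (f (τ - σ))) ν := by
    refine Integrable.mono' (hfw.norm.const_mul C) (aestronglyMeasurable_clm_apply hG
      (stronglyMeasurable_comp_const_sub hfm τ).aestronglyMeasurable) ?_
    exact (ae_restrict_mem measurableSet_Ioc).mono fun s hs =>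
      (G s).le_of_opNorm_le (hk.norm_le s hs) _
  have e4 : ∫ t, G M (f t) ∂μ = ∫ σ, G M (f (τ - σ)) ∂ν := by
    have := conv_eq_integral (G := fun _ => G M) hf0 hτ.1 hτM
    rw [← this, conv, intervalIntegral.integral_comp_sub_left (fun t => G M (f t)), sub_self,
      sub_zero, intervalIntegral.integral_of_le hτ.1]
  have e5 : ∫ t in (0 : ℝ)..τ, derivConv G S M f t =
      ∫ t, (G M (f t) + ∫ s, S s (f (t - s) - f t) ∂ν) ∂μ := by
    rw [intervalIntegral.integral_of_le hτ.1]
    refine integral_congr_ae (Eventually.of_forall fun t => ?_)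
    simp only [derivConv]
    rw [intervalIntegral.integral_of_le hM.le]
  rw [e5, integral_add ((G M).integrable_comp (hfi.mono_set fun t ht => ht.2.trans hτ.2))
    j4, e1, e2, e3, integral_sub j2 j3, e4, conv_eq_integral hf0 hτ.1 hτM]
  abel

end ConvolutionFubini

end

section

open Filter Topology

/-! ### Algebra of singular integral operators -/

section KernelAlgebra

variable {X : Type*} [NormedAddCommGroup X] [NormedSpace ℂ X] [CompleteSpace X]
  {M C T t τ : ℝ} {G S P Q : ℝ → X →L[ℂ] X} {f : ℝ → X}

omit [CompleteSpace X] in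
/-- A primitive of a singular kernel which vanishes at `0` is a singular kernel. -/
theorem SingularKernel.primitive (hk : SingularKernel M C G S) (hM : 0 < M)
    (hP : ∀ t, 0 < t → HasDerivAt P (G t) t) (hPC : ∀ t ∈ Ioc 0 M, ‖P t‖ ≤ C * t) :
    SingularKernel M (C * M) P G where
  hasDerivAt := hP
  continuousOn t ht := (hk.hasDerivAt t ht).continuousAt.continuousWithinAt
  norm_le t ht := (hPC t ht).trans (mul_le_mul_of_nonneg_left ht.2 (hk.nonneg hM))
  norm_deriv_le t ht := by
    refine (hk.norm_le t ht).trans ?_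
    rw [le_div_iff₀ ht.1]
    exact mul_le_mul_of_nonneg_left ht.2 (hk.nonneg hM)
  norm_deriv_sub_le s t hs hst htM := by
    have h1 : ‖G t - G s‖ ≤ C / s * (t - s) := by
      refine norm_image_sub_le_of_norm_deriv_le_segment' (f' := S) (fun r hr =>
        (hk.hasDerivAt r (hs.trans_le hr.1)).hasDerivWithinAt) (fun r hr => ?_) t ⟨hst, le_rfl⟩
      exact (hk.norm_deriv_le r ⟨hs.trans_le hr.1, hr.2.le.trans htM⟩).trans
        (div_le_div_of_nonneg_left (hk.nonneg hM) hs hr.1)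
    refine h1.trans ?_
    rw [div_mul_eq_mul_div, div_le_div_iff₀ hs (by positivity)]
    have h2 : 0 ≤ C * (t - s) * s := by
      have := hk.nonneg hM
      have : 0 ≤ t - s := by linarith
      positivity
    nlinarith [mul_le_mul_of_nonneg_left (hst.trans htM) h2]

omit [CompleteSpace X] in
theorem tendsto_zero_of_norm_le (hM : 0 < M) (hPC : ∀ t ∈ Ioc 0 M, ‖P t‖ ≤ C * t) :
    Tendsto P (𝓝[>] 0) (𝓝 0) := by
  have h1 : Tendsto (fun t : ℝ => C * t) (𝓝[>] 0) (𝓝 0) := by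
    have : Tendsto (fun t : ℝ => C * t) (𝓝 0) (𝓝 (C * 0)) :=
      (continuous_const.mul continuous_id).tendsto 0
    rw [mul_zero] at this
    exact this.mono_left nhdsWithin_le_nhds
  exact squeeze_zero_norm' (eventually_of_mem (Ioc_mem_nhdsGT hM) hPC) h1

/-- For a bounded kernel no regularity of the function is needed. -/
theorem derivConv_eq_conv (hk : SingularKernel M C Q S) (hM : 0 < M)
    (hP : ∀ t, 0 < t → HasDerivAt P (Q t) t) (hPC : ∀ t ∈ Ioc 0 M, ‖P t‖ ≤ C * t)
    (hfm : StronglyMeasurable f) (hf0 : ∀ s ≤ 0, f s = 0) (hfi : IntegrableOn f (Iic T))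
    (ht : 0 ≤ t) (htT : t ≤ T) (htM : t ≤ M) : derivConv P Q M f t = conv Q f t := by
  have hQ : AEStronglyMeasurable Q (volume.restrict (Ioc 0 M)) := by
    refine ContinuousOn.aestronglyMeasurable (fun s hs => ?_) measurableSet_Ioc
    exact (hk.hasDerivAt s hs.1).continuousAt.continuousWithinAt
  have hfw : IntegrableOn (fun s => f (t - s)) (Ioc 0 M) :=
    (integrableOn_comp_const_sub hfi htT).mono_set fun s hs => hs.1.le
  have j1 : IntegrableOn (fun s => Q s (f (t - s))) (Ioc 0 M) := by
    refine Integrable.mono' (hfw.norm.const_mul C) (aestronglyMeasurable_clm_apply hQ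
      (stronglyMeasurable_comp_const_sub hfm t).aestronglyMeasurable) ?_
    exact (ae_restrict_mem measurableSet_Ioc).mono fun s hs =>
      (Q s).le_of_opNorm_le (hk.norm_le s hs) _
  have j2 : IntegrableOn (fun s => Q s (f t)) (Ioc 0 M) := by
    refine Integrable.mono' (integrable_const (C * ‖f t‖)) (aestronglyMeasurable_clm_apply hQ
      aestronglyMeasurable_const) ?_
    exact (ae_restrict_mem measurableSet_Ioc).mono fun s hs =>
      (Q s).le_of_opNorm_le (hk.norm_le s hs) _
  -- As `P` vanishes at `0`, the subtracted term `f t` in the integrand exactly cancels the boundary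
  -- term.
  have e : ∫ s in (0 : ℝ)..M, Q s (f t) = P M (f t) := by
    have hd : ∀ s, 0 < s → HasDerivAt (fun s => P s (f t)) (Q s (f t)) s := fun s hs =>
      ((ContinuousLinearMap.apply ℂ X (f t)).restrictScalars ℝ).hasFDerivAt.comp_hasDerivAt s
        (hP s hs)
    have h0 : Tendsto (fun s => P s (f t)) (𝓝[>] 0) (𝓝 0) := by
      have := ((ContinuousLinearMap.apply ℂ X (f t)).continuous.tendsto 0).comp
        (tendsto_zero_of_norm_le hM hPC)
      simpa [Function.comp_def] using this
    have := intervalIntegral.integral_eq_sub_of_hasDerivAt_of_tendsto hM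
      (fun s hs => hd s hs.1) ((intervalIntegrable_iff_integrableOn_Ioc_of_le hM.le).2 j2) h0
      ((hd M hM).continuousAt.tendsto.mono_left nhdsWithin_le_nhds)
    rw [this, sub_zero]
  rw [derivConv, conv_eq_integral hf0 ht htM, ← e, intervalIntegral.integral_of_le hM.le,
    intervalIntegral.integral_of_le hM.le, ← integral_add j2]
  · refine integral_congr_ae (Eventually.of_forall fun s => ?_)
    simp [map_sub]
  · refine (j1.sub j2).congr (Eventually.of_forall fun s => ?_)
    simp [map_sub]

theorem clm_derivConv (L : X →L[ℂ] X) (hk : SingularKernel M C G S) (hM : 0 < M)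
    (hfm : StronglyMeasurable f) (hd : dini M f t < ∞) :
    L (derivConv G S M f t) =
      derivConv (fun s => L * G s) (fun s => L * S s) M f t := by
  rw [derivConv, map_add, ← ContinuousLinearMap.intervalIntegral_comp_comm _
    (hk.intervalIntegrable hM hfm hd)]
  rfl

omit [CompleteSpace X] in
theorem derivConv_congr {G' S' : ℝ → X →L[ℂ] X} (hM : 0 < M)
    (hG : ∀ t, 0 < t → HasDerivAt G (S t) t) (hG' : ∀ t, 0 < t → HasDerivAt G' (S' t) t)
    (h : ∀ s, 0 < s → G s = G' s) (t : ℝ) : derivConv G S M f t = derivConv G' S' M f t := by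
  have hS : ∀ s, 0 < s → S s = S' s := fun s hs =>
    ((hG s hs).congr_of_eventuallyEq ((eventually_gt_nhds hs).mono fun r hr =>
      (h r hr).symm)).unique (hG' s hs)
  rw [derivConv, derivConv, h M hM, intervalIntegral.integral_of_le hM.le,
    intervalIntegral.integral_of_le hM.le]
  congr 1
  exact setIntegral_congr_fun measurableSet_Ioc fun s hs => by rw [hS s hs.1]

/-- Linear relations between kernels carry over to the singular integral operators. -/
theorem clm_derivConv_congr {C' : ℝ} (L L' : X →L[ℂ] X) (hk : SingularKernel M C G S)
    (hk' : SingularKernel M C' P Q) (hM : 0 < M) (hfm : StronglyMeasurable f)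
    (hd : dini M f t < ∞) (h : ∀ s, 0 < s → L * G s = L' * P s) :
    L (derivConv G S M f t) = L' (derivConv P Q M f t) := by
  rw [clm_derivConv L hk hM hfm hd, clm_derivConv L' hk' hM hfm hd]
  exact derivConv_congr hM (fun s hs => (hk.hasDerivAt s hs).const_mul L)
    (fun s hs => (hk'.hasDerivAt s hs).const_mul L') h t

omit [CompleteSpace X] in
theorem derivConv_kernel_add {C' : ℝ} (hk : SingularKernel M C G S)
    (hk' : SingularKernel M C' P Q) (hM : 0 < M) (hfm : StronglyMeasurable f)
    (hd : dini M f t < ∞) :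
    derivConv (fun s => G s + P s) (fun s => S s + Q s) M f t =
      derivConv G S M f t + derivConv P Q M f t := by
  simp only [derivConv, add_apply]
  rw [intervalIntegral.integral_add (hk.intervalIntegrable hM hfm hd)
    (hk'.intervalIntegrable hM hfm hd)]
  abel

omit [CompleteSpace X] in
theorem derivConv_kernel_smul (c : ℂ) :
    derivConv (fun s => c • G s) (fun s => c • S s) M f t = c • derivConv G S M f t := by
  simp only [derivConv, smul_apply]
  rw [intervalIntegral.integral_smul, smul_add]

omit [CompleteSpace X] in
theorem derivConv_kernel_const_sub (L : X →L[ℂ] X) :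
    derivConv (fun s => L - G s) (fun s => -S s) M f t = L (f t) - derivConv G S M f t := by
  simp only [derivConv, sub_apply, neg_apply]
  rw [intervalIntegral.integral_neg]
  abel

end KernelAlgebra

end

section

open Filter Topology

/-! ### The solution in terms of its kernels -/

section Solution

variable {X : Type*} [NormedAddCommGroup X] [NormedSpace ℂ X] [CompleteSpace X]
  {J e : X →L[ℂ] X} {n : ℕ} {α M C T t τ : ℝ} {κ K G₁ G₂ S₁ S₂ : ℝ → X →L[ℂ] X} {f : ℝ → X}

/-- Functions on `(-∞, T]` which vanish on `(-∞, 0]` and satisfy an integrated Dini condition. -/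
structure IsDini (M T : ℝ) (f : ℝ → X) : Prop where
  stronglyMeasurable : StronglyMeasurable f
  eq_zero : ∀ s ≤ 0, f s = 0
  integrableOn : IntegrableOn f (Iic T)
  lintegral_dini_lt_top : ∫⁻ t in Ioc 0 T, dini M f t < ∞

namespace SolutionKernels

omit [CompleteSpace X] in
theorem singularK (h : SolutionKernels J e n α M C κ K G₁ G₂ S₁ S₂) (hM : 0 < M) :
    SingularKernel M (C * M) K G₁ := h.singular₁.primitive hM h.deriv_K h.norm_K

omit [CompleteSpace X] in
theorem norm_κ_le (h : SolutionKernels J e n α M C κ K G₁ G₂ S₁ S₂) (hM : 0 < M) :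
    ∀ t ∈ Ioc 0 M, ‖κ t‖ ≤ C * M * t := fun t ht => by
  refine (h.norm_κ t ht).trans ?_
  rw [sq, ← mul_assoc]
  exact mul_le_mul_of_nonneg_right (mul_le_mul_of_nonneg_left ht.2 (h.singular₁.nonneg hM)) ht.1.le

omit [CompleteSpace X] in
theorem singularκ (h : SolutionKernels J e n α M C κ K G₁ G₂ S₁ S₂) (hM : 0 < M) :
    SingularKernel M (C * M * M) κ K := (h.singularK hM).primitive hM h.deriv_κ (h.norm_κ_le hM)

omit [CompleteSpace X] in
/-- The kernel of `A u`. -/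
theorem singular₃ (h : SolutionKernels J e n α M C κ K G₁ G₂ S₁ S₂) :
    SingularKernel M (‖(1 : X →L[ℂ] X)‖ + (C + ‖(α : ℂ)‖ * C))
      (fun t => 1 - (G₁ t + (α : ℂ) • G₂ t)) (fun t => -(S₁ t + (α : ℂ) • S₂ t)) :=
  (h.singular₁.add (h.singular₂.const_smul α)).const_sub 1

/-- Ordinary convolutions are written as `derivConv` of a primitive of the kernel. In this way `u`
and `u'` inherit regularity from the same theorem as `u''`, and relations between kernels need to be
transferred for `derivConv` only. -/
theorem conv_K_eq (h : SolutionKernels J e n α M C κ K G₁ G₂ S₁ S₂) (hM : 0 < M)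
    (hf : IsDini M T f) (hTM : T ≤ M) (ht : t ∈ Icc 0 T) :
    derivConv κ K M f t = conv K f t :=
  derivConv_eq_conv (h.singularK hM) hM h.deriv_κ (h.norm_κ_le hM) hf.stronglyMeasurable
    hf.eq_zero hf.integrableOn ht.1 ht.2 (ht.2.trans hTM)

theorem conv_G_eq (h : SolutionKernels J e n α M C κ K G₁ G₂ S₁ S₂) (hM : 0 < M)
    (hf : IsDini M T f) (hTM : T ≤ M) (ht : t ∈ Icc 0 T) :
    derivConv K G₁ M f t = conv G₁ f t :=
  derivConv_eq_conv h.singular₁ hM h.deriv_K h.norm_K hf.stronglyMeasurable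
    hf.eq_zero hf.integrableOn ht.1 ht.2 (ht.2.trans hTM)

theorem integral_conv_G (h : SolutionKernels J e n α M C κ K G₁ G₂ S₁ S₂) (hM : 0 < M)
    (hf : IsDini M T f) (hTM : T ≤ M) (hτ : τ ∈ Icc 0 T) :
    ∫ t in (0 : ℝ)..τ, conv G₁ f t = conv K f τ := by
  rw [← integral_derivConv (h.singularK hM) hM hf.stronglyMeasurable hf.eq_zero hf.integrableOn
    hf.lintegral_dini_lt_top hTM hτ]
  refine intervalIntegral.integral_congr fun t ht => ?_
  rw [uIcc_of_le hτ.1] at ht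
  exact (h.conv_G_eq hM hf hTM ⟨ht.1, ht.2.trans hτ.2⟩).symm

omit [CompleteSpace X] in
-- The three kernels add up to the identity, and `derivConv` of a constant kernel is multiplication
-- by it.
theorem equation (h : SolutionKernels J e n α M C κ K G₁ G₂ S₁ S₂) (hM : 0 < M)
    (hfm : StronglyMeasurable f) (hd : dini M f t < ∞) :
    derivConv G₁ S₁ M f t + (α : ℂ) • derivConv G₂ S₂ M f t +
      derivConv (fun t => 1 - (G₁ t + (α : ℂ) • G₂ t)) (fun t => -(S₁ t + (α : ℂ) • S₂ t)) M f t =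
      f t := by
  rw [derivConv_kernel_const_sub, derivConv_kernel_add h.singular₁ (h.singular₂.const_smul α) hM
    hfm hd, derivConv_kernel_smul, one_apply_eq_self]
  abel

/-- With `e = e(A)` and `J = (1 + A)⁻¹` this says that `u'` lies in the domain of `A^ε`, and that
`derivConv G₂ S₂ M f t` is `A^ε u'`. -/
theorem apply_e (h : SolutionKernels J e n α M C κ K G₁ G₂ S₁ S₂) (hM : 0 < M)
    (hf : IsDini M T f) (hTM : T ≤ M) (ht : t ∈ Icc 0 T) (hd : dini M f t < ∞) :
    e (conv G₁ f t) = (J ^ n) (derivConv G₂ S₂ M f t) := by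
  rw [← h.conv_G_eq hM hf hTM ht]
  exact clm_derivConv_congr e (J ^ n) (h.singularK hM) h.singular₂ hM hf.stronglyMeasurable hd
    h.frac

/-- In the form `(1 + A)⁻¹ (u + v) = u`, this says that `u` lies in the domain of `A` and `A u = v`.
-/
theorem apply_J (h : SolutionKernels J e n α M C κ K G₁ G₂ S₁ S₂) (hM : 0 < M)
    (hf : IsDini M T f) (hTM : T ≤ M) (ht : t ∈ Icc 0 T) (hd : dini M f t < ∞) :
    J (conv K f t + derivConv (fun t => 1 - (G₁ t + (α : ℂ) • G₂ t))
      (fun t => -(S₁ t + (α : ℂ) • S₂ t)) M f t) = conv K f t := by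
  rw [← h.conv_K_eq hM hf hTM ht, ← derivConv_kernel_add (h.singularκ hM) h.singular₃ hM
    hf.stronglyMeasurable hd]
  have := clm_derivConv_congr J 1 ((h.singularκ hM).add h.singular₃) (h.singularκ hM) hM
    hf.stronglyMeasurable hd (fun s hs => by
      rw [one_mul, ← sub_sub]; exact h.main s hs)
  simpa using this

end SolutionKernels

end Solution

/-! ### Graphs in terms of bounded operators -/

section Domains

variable {X : Type*} [NormedAddCommGroup X] [NormedSpace ℂ X] {A : X →ₗ.[ℂ] X} {φ : ℝ}

theorem app_of_mem_graph {B : X →ₗ.[ℂ] X} {x y : X} (h : (x, y) ∈ B.graph) :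
    x ∈ B.domain ∧ app B x = y := by
  obtain ⟨z, hz1, hz2⟩ := (LinearPMap.mem_graph_iff B).1 h
  simp only at hz1 hz2
  have hx : x ∈ B.domain := by rw [← hz1]; exact z.2
  refine ⟨hx, ?_⟩
  rw [app, dif_pos hx, ← hz2]
  exact congrArg B (Subtype.ext hz1.symm)

theorem mem_graph_app {B : X →ₗ.[ℂ] X} {x : X} (h : x ∈ B.domain) : (x, app B x) ∈ B.graph := by
  rw [app, dif_pos h]
  exact B.mem_graph ⟨x, h⟩

theorem IsSectorial.isResolvent_neg_one (hA : IsSectorial A φ) (hφ : φ ∈ Ioo 0 Real.pi) :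
    IsResolvent A (-1) (res A (-1)) := by
  refine isResolvent_res (hA.exists_resolvent _ ?_)
  simp [sector, Complex.arg_neg_one, abs_of_pos Real.pi_pos, hφ.2]

/-- `A x = y` means `(1 + A) x = x + y`, and `1 + A` has the bounded inverse `-res A (-1)`. -/
theorem IsSectorial.mem_graph_iff (hA : IsSectorial A φ) (hφ : φ ∈ Ioo 0 Real.pi) {x y : X} :
    (x, y) ∈ A.graph ↔ (-res A (-1)) (x + y) = x := by
  have hr := hA.isResolvent_neg_one hφ
  constructor
  · intro h
    obtain ⟨z, hz1, hz2⟩ := (LinearPMap.mem_graph_iff A).1 h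
    have := hr.left_inv z
    simp only at hz1 hz2
    rw [hz1, hz2] at this
    have e : (-1 : ℂ) • x - y = -(x + y) := by module
    rw [e, map_neg] at this
    simpa using this
  · intro h
    obtain ⟨h1, h2⟩ := hr.right_inv (-(x + y))
    have e : res A (-1) (-(x + y)) = x := by rw [map_neg]; simpa using h
    have hx : x ∈ A.domain := by rw [← e]; exact h1
    have e2 : A ⟨res A (-1) (-(x + y)), h1⟩ = A ⟨x, hx⟩ := congrArg A (Subtype.ext e)
    rw [e2, e] at h2
    refine (LinearPMap.mem_graph_iff A).2 ⟨⟨x, hx⟩, rfl, ?_⟩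
    have : A ⟨x, hx⟩ = (-1 : ℂ) • x + (x + y) := by
      rw [sub_eq_iff_eq_add] at h2
      rw [h2]; module
    rw [this]; simp

theorem IsSectorial.mem_graph_smul_fracPow_iff (hA : IsSectorial A φ) (hφ : φ ∈ Ioo 0 Real.pi)
    {ω ε : ℝ} {c : ℂ} (hc : c ≠ 0) {x y : X} :
    (x, c • y) ∈ (c • fracPow A ω ε).graph ↔
      sectorCalc A ω (fun w => w ^ (ε : ℂ) / (1 + w) ^ (⌊ε⌋₊ + 1)) x =
        ((-res A (-1)) ^ (⌊ε⌋₊ + 1)) y := by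
  have h1 : (x, c • y) ∈ (c • fracPow A ω ε).graph ↔ (x, y) ∈ (fracPow A ω ε).graph := by
    simp only [LinearPMap.mem_graph_iff]
    constructor
    · rintro ⟨z, hz1, hz2⟩
      exact ⟨z, hz1, smul_right_injective X hc hz2⟩
    · rintro ⟨z, hz1, hz2⟩
      refine ⟨z, hz1, ?_⟩
      rw [LinearPMap.smul_apply]
      exact congrArg (c • ·) hz2
  rw [h1, hA.graph_fracPow hφ]
  rfl

end Domains

end

section

open Filter Topology

/-! ### Uniqueness by pairing with the kernels -/

section Uniqueness

variable {X : Type*} [NormedAddCommGroup X] [NormedSpace ℂ X]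

theorem hasDerivAt_clm_apply {P : ℝ → X →L[ℂ] X} {P' : X →L[ℂ] X} {x : ℝ → X} {x' : X} {s : ℝ}
    (hP : HasDerivAt P P' s) (hx : HasDerivAt x x' s) :
    HasDerivAt (fun s => P s (x s)) (P' (x s) + P s x') s := by
  have h1 := ((isBoundedBilinearMap_apply (𝕜 := ℂ) (E := X) (F := X)).hasFDerivAt
    (P s, x s)).restrictScalars ℝ
  have h2 := h1.comp_hasDerivAt s (hP.prodMk hx)
  simpa [add_comm, Function.comp_def] using h2

theorem HasDerivAt.clm {L : X →L[ℂ] X} {x : ℝ → X} {x' : X} {s : ℝ} (hx : HasDerivAt x x' s) :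
    HasDerivAt (fun s => L (x s)) (L x') s :=
  (L.restrictScalars ℝ).hasFDerivAt.comp_hasDerivAt s hx

theorem tendsto_clm_apply_zero {l : Filter ℝ} {P : ℝ → X →L[ℂ] X} {x : ℝ → X} {x₀ : X}
    (hP : Tendsto P l (𝓝 0)) (hx : Tendsto x l (𝓝 x₀)) : Tendsto (fun s => P s (x s)) l (𝓝 0) := by
  have := (isBoundedBilinearMap_apply (𝕜 := ℂ) (E := X) (F := X)).continuous.tendsto (0, x₀)
  have := this.comp (hP.prodMk_nhds hx)
  simpa [Function.comp_def] using this

theorem tendsto_apply_clm_zero {l : Filter ℝ} {P : ℝ → X →L[ℂ] X} {P₀ : X →L[ℂ] X} {x : ℝ → X}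
    (hP : Tendsto P l (𝓝 P₀)) (hx : Tendsto x l (𝓝 0)) : Tendsto (fun s => P s (x s)) l (𝓝 0) := by
  have := (isBoundedBilinearMap_apply (𝕜 := ℂ) (E := X) (F := X)).continuous.tendsto (P₀, 0)
  have := this.comp (hP.prodMk_nhds hx)
  simpa [Function.comp_def] using this

variable [CompleteSpace X] {J e : X →L[ℂ] X} {n : ℕ} {α M C T t : ℝ}
  {κ K G₁ G₂ S₁ S₂ : ℝ → X →L[ℂ] X}

/-- Duhamel's argument, regularised by `J^{n+1}` so that only bounded operators occur: `J^{n+1} A =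
Jⁿ - J^{n+1}` and `J^{n+1} A^ε = J e`. The auxiliary function `Ψ` pairs the kernels at time `t - s`
with `d`, `d'` at time `s`; the equation and the relations between the kernels give `Ψ' = -J^{n+1}
d`. At `0` it vanishes because of the initial values, at `t` because `κ` and `K` vanish at `0`. -/
theorem SolutionKernels.integral_eq_zero (h : SolutionKernels J e n α M C κ K G₁ G₂ S₁ S₂)
    (hM : 0 < M) {d d' d'' : ℝ → X}
    (hd : ∀ s ∈ Ioo 0 T, HasDerivAt d (d' s) s) (hd' : ∀ s ∈ Ioo 0 T, HasDerivAt d' (d'' s) s)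
    (hc : ContinuousOn d (Icc 0 T)) (hc' : ContinuousOn d' (Icc 0 T)) (h0 : d 0 = 0)
    (h0' : d' 0 = 0) (heq : ∀ s ∈ Ioo 0 T, (J ^ (n + 1)) (d'' s) + (α : ℂ) • J (e (d' s)) +
      (J ^ n) (d s) - (J ^ (n + 1)) (d s) = 0) (ht : t ∈ Ioc 0 T) :
    ∫ s in (0 : ℝ)..t, (J ^ (n + 1)) (d s) = 0 := by
  set Ψ : ℝ → X := fun s => (J ^ (n + 1)) (κ (t - s) (d' s) + K (t - s) (d s)) +
    (α : ℂ) • J (κ (t - s) (e (d s))) with hΨ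
  have hder : ∀ s ∈ Ioo 0 t, HasDerivAt Ψ (-(J ^ (n + 1)) (d s)) s := by
    intro s hs
    have hsT : s ∈ Ioo 0 T := ⟨hs.1, hs.2.trans_le ht.2⟩
    have hts : 0 < t - s := sub_pos.2 hs.2
    have hκ : HasDerivAt (fun s => κ (t - s)) (-K (t - s)) s := by
      simpa [Function.comp_def] using (h.deriv_κ _ hts).scomp s ((hasDerivAt_id s).const_sub t)
    have hK : HasDerivAt (fun s => K (t - s)) (-G₁ (t - s)) s := by
      simpa [Function.comp_def] using (h.deriv_K _ hts).scomp s ((hasDerivAt_id s).const_sub t)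
    have := (HasDerivAt.clm (L := J ^ (n + 1)) ((hasDerivAt_clm_apply hκ (hd' s hsT)).add
      (hasDerivAt_clm_apply hK (hd s hsT)))).add ((HasDerivAt.clm (L := J)
      (hasDerivAt_clm_apply hκ (HasDerivAt.clm (L := e) (hd s hsT)))).const_smul (α : ℂ))
    refine this.congr_deriv (Eq.symm ?_)
    have c1 : ∀ (m : ℕ) (x : X), (J ^ m) (κ (t - s) x) = κ (t - s) ((J ^ m) x) := fun m x =>
      DFunLike.congr_fun ((h.commute_J _ hts).pow_left m).eq x
    have c1' : ∀ x : X, J (κ (t - s) x) = κ (t - s) (J x) := fun x =>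
      DFunLike.congr_fun (h.commute_J _ hts).eq x
    have c2 : ∀ x : X, K (t - s) (e x) = (J ^ n) (G₂ (t - s) x) := fun x => by
      have e1 : e (K (t - s) x) = K (t - s) (e x) := DFunLike.congr_fun (h.commute_e _ hts).eq x
      rw [← e1]
      exact DFunLike.congr_fun (h.frac _ hts) x
    have c3 : (J ^ (n + 1)) (κ (t - s) (d s)) + (J ^ (n + 1)) (d s) -
        (J ^ (n + 1)) (G₁ (t - s) (d s)) - (α : ℂ) • (J ^ (n + 1)) (G₂ (t - s) (d s)) =
        (J ^ n) (κ (t - s) (d s)) := by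
      have := congrArg (J ^ n) (DFunLike.congr_fun (h.main _ hts) (d s))
      simp only [mul_apply_eq_comp, add_apply, sub_apply,
        smul_apply, one_apply_eq_self, map_add, map_sub, map_smul] at this
      simp only [pow_succ, mul_apply_eq_comp]
      rw [← this]
      abel
    have c4 := congrArg (κ (t - s)) (heq s hsT)
    simp only [map_add, map_sub, map_smul, map_zero, ← c1, ← c1'] at c4
    have c5 : J ((J ^ n) (G₂ (t - s) (d s))) = (J ^ (n + 1)) (G₂ (t - s) (d s)) := by
      rw [pow_succ']; rfl
    simp only [map_add, map_neg, neg_apply, c2, c5, smul_add, smul_neg]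
    linear_combination (norm := module) -c3 - c4
  have hsub0 : 𝓝[>] (0 : ℝ) ≤ 𝓝[Icc 0 T] 0 := by
    rw [← nhdsWithin_Ioo_eq_nhdsGT (ht.1.trans_le ht.2)]
    exact nhdsWithin_mono _ Ioo_subset_Icc_self
  have hsubt : 𝓝[<] t ≤ 𝓝[Icc 0 T] t := by
    rw [← nhdsWithin_Ioo_eq_nhdsLT ht.1]
    exact nhdsWithin_mono _ fun s hs => ⟨hs.1.le, hs.2.le.trans ht.2⟩
  have h0T : (0 : ℝ) ∈ Icc 0 T := ⟨le_rfl, (ht.1.trans_le ht.2).le⟩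
  have l0 : Tendsto d (𝓝[>] 0) (𝓝 0) := by
    have := (hc 0 h0T).mono_left hsub0
    rwa [h0] at this
  have l0' : Tendsto d' (𝓝[>] 0) (𝓝 0) := by
    have := (hc' 0 h0T).mono_left hsub0
    rwa [h0'] at this
  have lt := (hc t ⟨ht.1.le, ht.2⟩).mono_left hsubt
  have lt' := (hc' t ⟨ht.1.le, ht.2⟩).mono_left hsubt
  have le0 : Tendsto (fun s => e (d s)) (𝓝[>] 0) (𝓝 0) := by
    simpa [Function.comp_def] using (e.continuous.tendsto 0).comp l0
  have let' : Tendsto (fun s => e (d s)) (𝓝[<] t) (𝓝 (e (d t))) := (e.continuous.tendsto _).comp lt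
  have hΨlim : ∀ {l : Filter ℝ}, Tendsto (fun s => κ (t - s) (d' s)) l (𝓝 0) →
      Tendsto (fun s => K (t - s) (d s)) l (𝓝 0) →
      Tendsto (fun s => κ (t - s) (e (d s))) l (𝓝 0) → Tendsto Ψ l (𝓝 0) := by
    intro l a b c
    have := (((J ^ (n + 1)).continuous.tendsto _).comp (a.add b)).add
      (((J.continuous.tendsto _).comp c).const_smul (α : ℂ))
    simpa [Function.comp_def, hΨ] using this
  have hrefl0 : Tendsto (fun s => t - s) (𝓝[>] 0) (𝓝 t) := by
    have : Tendsto (fun s => t - s) (𝓝 0) (𝓝 (t - 0)) := (continuous_const.sub continuous_id).tendsto 0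
    rw [sub_zero] at this
    exact this.mono_left nhdsWithin_le_nhds
  have hreflt : Tendsto (fun s => t - s) (𝓝[<] t) (𝓝[>] 0) := by
    refine tendsto_nhdsWithin_iff.2 ⟨?_, eventually_mem_nhdsWithin.mono fun s hs =>
      mem_Ioi.2 (sub_pos.2 hs)⟩
    have : Tendsto (fun s => t - s) (𝓝 t) (𝓝 (t - t)) := (continuous_const.sub continuous_id).tendsto t
    rw [sub_self] at this
    exact this.mono_left nhdsWithin_le_nhds
  have hκ0 := (tendsto_zero_of_norm_le hM (h.norm_κ_le hM)).comp hreflt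
  have hK0 := (tendsto_zero_of_norm_le hM h.norm_K).comp hreflt
  have hκt := ((h.deriv_κ t ht.1).continuousAt.tendsto).comp hrefl0
  have hKt := ((h.deriv_K t ht.1).continuousAt.tendsto).comp hrefl0
  have hlim0 : Tendsto Ψ (𝓝[>] 0) (𝓝 0) :=
    hΨlim (tendsto_apply_clm_zero hκt l0') (tendsto_apply_clm_zero hKt l0)
      (tendsto_apply_clm_zero hκt le0)
  have hlimt : Tendsto Ψ (𝓝[<] t) (𝓝 0) :=
    hΨlim (tendsto_clm_apply_zero hκ0 lt') (tendsto_clm_apply_zero hK0 lt)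
      (tendsto_clm_apply_zero hκ0 let')
  have hint : IntervalIntegrable (fun s => -(J ^ (n + 1)) (d s)) volume 0 t := by
    refine ContinuousOn.intervalIntegrable ?_
    rw [uIcc_of_le ht.1.le]
    exact ((J ^ (n + 1)).continuous.comp_continuousOn
      (hc.mono (Icc_subset_Icc_right ht.2))).neg
  have := intervalIntegral.integral_eq_sub_of_hasDerivAt_of_tendsto ht.1 hder hint hlim0 hlimt
  rw [intervalIntegral.integral_neg, sub_zero, neg_eq_zero] at this
  exact this

theorem hasDerivAt_of_eq_integral {v w : ℝ → X} (hw : ContinuousOn w (Icc 0 T))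
    (hv : ∀ t ∈ Icc 0 T, v t = ∫ s in (0 : ℝ)..t, w s) {s : ℝ} (hs : s ∈ Ioo 0 T) :
    HasDerivAt v (w s) s := by
  have hT : 0 < T := hs.1.trans hs.2
  have hnhds : Icc 0 T ∈ 𝓝 s := Icc_mem_nhds hs.1 hs.2
  have h1 : HasDerivAt (fun t => ∫ s in (0 : ℝ)..t, w s) (w s) s := by
    refine intervalIntegral.integral_hasDerivAt_right ?_ ?_ (hw.continuousAt hnhds)
    · exact (hw.mono (by rw [uIcc_of_le hs.1.le]; exact Icc_subset_Icc_right hs.2.le)).intervalIntegrable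
    · exact ContinuousOn.stronglyMeasurableAtFilter isOpen_Ioo (hw.mono Ioo_subset_Icc_self) s hs
  exact h1.congr_of_eventuallyEq (eventually_of_mem hnhds hv)

omit [CompleteSpace X] in
theorem continuousOn_of_eq_integral {v w : ℝ → X} (hT : 0 ≤ T) (hw : IntegrableOn w (Icc 0 T))
    (hv : ∀ t ∈ Icc 0 T, v t = ∫ s in (0 : ℝ)..t, w s) : ContinuousOn v (Icc 0 T) := by
  have := intervalIntegral.continuousOn_primitive_interval (μ := volume) (f := w) (a := 0) (b := T)
    (by rwa [uIcc_of_le hT])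
  rw [uIcc_of_le hT] at this
  exact this.congr hv

/-- Uniqueness for the homogeneous problem, in terms of bounded operators. -/
theorem SolutionKernels.eq_zero_of_homogeneous (h : SolutionKernels J e n α M C κ K G₁ G₂ S₁ S₂)
    (hM : 0 < M) (hT : 0 < T) (hJ : Function.Injective J) {u u' u'' : ℝ → X}
    (hi : IntegrableOn u'' (Icc 0 T)) (hu' : ∀ t ∈ Icc 0 T, u' t = ∫ s in (0 : ℝ)..t, u'' s)
    (hu : ∀ t ∈ Icc 0 T, u t = ∫ s in (0 : ℝ)..t, u' s)
    (heq : ∀ᵐ t ∂volume.restrict (Ioo 0 T), (J ^ (n + 1)) (u'' t) + (α : ℂ) • J (e (u' t)) +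
      (J ^ n) (u t) - (J ^ (n + 1)) (u t) = 0) : ∀ t ∈ Icc 0 T, u t = 0 := by
  have hcu' := continuousOn_of_eq_integral hT.le hi hu'
  have hcu := continuousOn_of_eq_integral hT.le (hcu'.integrableOn_Icc) hu
  -- One integration turns the equation, known almost everywhere only, into one which holds at every
  -- point for a `C²` function.
  set d : ℝ → X := fun t => ∫ s in (0 : ℝ)..t, u s with hd
  have hcd : ContinuousOn d (Icc 0 T) :=
    continuousOn_of_eq_integral hT.le (hcu.integrableOn_Icc) fun t _ => rfl
  have h0 : (0 : ℝ) ∈ Icc 0 T := ⟨le_rfl, hT.le⟩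
  have heq' : ∀ t ∈ Icc 0 T, (J ^ (n + 1)) (u' t) + (α : ℂ) • J (e (u t)) +
      (J ^ n) (d t) - (J ^ (n + 1)) (d t) = 0 := by
    intro t ht
    have ii : ∀ {w : ℝ → X}, IntegrableOn w (Icc 0 T) → IntervalIntegrable w volume 0 t :=
      fun hw => (intervalIntegrable_iff_integrableOn_Icc_of_le ht.1).2
        (hw.mono_set (Icc_subset_Icc_right ht.2))
    have i2 := ii hi
    have i1 := ii hcu'.integrableOn_Icc
    have i0 := ii hcu.integrableOn_Icc
    have il : ∀ {w : ℝ → X} (L : X →L[ℂ] X), IntervalIntegrable w volume 0 t →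
        IntervalIntegrable (fun s => L (w s)) volume 0 t := fun L hw =>
      ⟨L.integrable_comp hw.1, L.integrable_comp hw.2⟩
    have hz : ∫ s in (0 : ℝ)..t, ((J ^ (n + 1)) (u'' s) + (α : ℂ) • J (e (u' s)) +
        (J ^ n) (u s) - (J ^ (n + 1)) (u s)) = 0 := by
      rw [intervalIntegral.integral_of_le ht.1, integral_Ioc_eq_integral_Ioo]
      refine integral_eq_zero_of_ae ?_
      exact ae_restrict_of_ae_restrict_of_subset (Ioo_subset_Ioo_right ht.2) heq
    have ie : IntervalIntegrable (fun s => (α : ℂ) • J (e (u' s))) volume 0 t :=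
      (il J (il e i1)).smul (α : ℂ)
    rw [intervalIntegral.integral_sub (((il _ i2).add ie).add (il _ i0)) (il _ i0),
      intervalIntegral.integral_add ((il _ i2).add ie) (il _ i0),
      intervalIntegral.integral_add (il _ i2) ie, intervalIntegral.integral_smul,
      ContinuousLinearMap.intervalIntegral_comp_comm _ i2,
      ContinuousLinearMap.intervalIntegral_comp_comm _ (il e i1),
      ContinuousLinearMap.intervalIntegral_comp_comm _ i1,
      ContinuousLinearMap.intervalIntegral_comp_comm _ i0,
      ContinuousLinearMap.intervalIntegral_comp_comm _ i0, ← hu' t ht, ← hu t ht] at hz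
    exact hz
  have hzero : ∀ t ∈ Icc 0 T, (∫ s in (0 : ℝ)..t, (J ^ (n + 1)) (d s)) = 0 := by
    intro t ht
    rcases ht.1.eq_or_lt with h1 | h1
    · rw [← h1, intervalIntegral.integral_same]
    · refine h.integral_eq_zero hM (d' := u) (d'' := u') (fun s hs => hasDerivAt_of_eq_integral hcu
        (fun _ _ => rfl) hs) (fun s hs => hasDerivAt_of_eq_integral hcu' hu hs) hcd hcu
        intervalIntegral.integral_same ?_
        (fun s hs => heq' s (Ioo_subset_Icc_self hs)) ⟨h1, ht.2⟩
      rw [hu 0 h0, intervalIntegral.integral_same]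
  -- The way back: a continuous function whose primitive vanishes is zero. It is used for `J^{n+1}
  -- d` and for `u`.
  have hdz : ∀ {v w : ℝ → X}, ContinuousOn w (Icc 0 T) →
      (∀ t ∈ Icc 0 T, v t = ∫ s in (0 : ℝ)..t, w s) → (∀ t ∈ Ioo 0 T, v t = 0) →
      ∀ t ∈ Ioo 0 T, w t = 0 := by
    intro v w hw hv hv0 t ht
    have h1 := hasDerivAt_of_eq_integral hw hv ht
    have h2 : HasDerivAt v 0 t := (hasDerivAt_const t (0 : X)).congr_of_eventuallyEq
      (eventually_of_mem (Ioo_mem_nhds ht.1 ht.2) hv0)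
    exact h1.unique h2
  have hJn : ∀ (m : ℕ) (x : X), (J ^ m) x = 0 → x = 0 := by
    intro m
    induction m with
    | zero => intro x hx; simpa using hx
    | succ k ih =>
      intro x hx
      rw [pow_succ] at hx
      exact hJ ((ih _ hx).trans (map_zero _).symm)
  have hd0 : ∀ t ∈ Ioo 0 T, d t = 0 := fun t ht => hJn _ _
    (hdz (v := fun _ => 0) ((J ^ (n + 1)).continuous.comp_continuousOn hcd)
      (fun t ht => (hzero t ht).symm) (fun _ _ => rfl) t ht)
  have hu0 : ∀ t ∈ Ioo 0 T, u t = 0 := hdz hcu (fun _ _ => rfl) hd0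
  have hcl : EqOn u (fun _ => 0) (Icc 0 T) :=
    EqOn.of_subset_closure (fun t ht => hu0 t ht) hcu continuousOn_const Ioo_subset_Icc_self
      (closure_Ioo hT.ne).ge
  exact hcl

end Uniqueness

end

section

open Filter Topology

/-! ### Existence and uniqueness of strong and strict solutions -/

section StrongSolution

variable {X : Type*} [NormedAddCommGroup X] [NormedSpace ℂ X]
  {A : X →ₗ.[ℂ] X} {φ α ε ω M C T : ℝ} {p : ℝ≥0∞} {f g : ℝ → X}
  {κ K G₁ G₂ S₁ S₂ : ℝ → X →L[ℂ] X}

omit [NormedSpace ℂ X] in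
theorem ContinuousOn.memLpT (hg : ContinuousOn g (Icc 0 T)) : MemLpT T p g := by
  obtain ⟨B, hB⟩ := isCompact_Icc.exists_bound_of_continuousOn hg
  refine MemLp.of_bound ((hg.mono Ioo_subset_Icc_self).aestronglyMeasurable measurableSet_Ioo) B ?_
  exact (ae_restrict_mem measurableSet_Ioo).mono fun t ht => hB t (Ioo_subset_Icc_self ht)

omit [NormedSpace ℂ X] in
theorem MemLpT.integrableOn (hp : 1 ≤ p) (hg : MemLpT T p g) : IntegrableOn g (Icc 0 T) := by
  rw [integrableOn_Icc_iff_integrableOn_Ioo]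
  exact memLp_one_iff_integrable.1 (hg.mono_exponent hp)

/-- Through this lemma uniqueness has to be proved for strong solutions only. -/
theorem IsStrictSolution.isStrongSolution [CompleteSpace X] {A B : X →ₗ.[ℂ] X}
    {u u' u'' : ℝ → X} (h : IsStrictSolution A B T f u u' u'') :
    IsStrongSolution A B T p f u u' u'' := by
  have key : ∀ {v w : ℝ → X}, (∀ t ∈ Icc 0 T, HasDerivWithinAt v (w t) (Icc 0 T) t) →
      ContinuousOn w (Icc 0 T) → HasSobolevDeriv T p v w := by
    intro v w hv hw
    refine ⟨ContinuousOn.memLpT hw, fun t ht => ?_⟩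
    rw [intervalIntegral.integral_eq_sub_of_hasDerivAt_of_le ht.1 (f := v)]
    · abel
    · exact fun s hs => (hv s ⟨hs.1, hs.2.trans ht.2⟩).continuousWithinAt.mono
        (Icc_subset_Icc_right ht.2)
    · exact fun s hs => (hv s ⟨hs.1.le, hs.2.le.trans ht.2⟩).hasDerivAt
        (Icc_mem_nhds hs.1 (hs.2.trans_le ht.2))
    · refine (hw.mono ?_).intervalIntegrable
      rw [uIcc_of_le ht.1]
      exact Icc_subset_Icc_right ht.2
  have hae : ∀ {P : ℝ → Prop}, (∀ t ∈ Icc 0 T, P t) → ∀ᵐ t ∂volume.restrict (Ioo 0 T), P t :=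
    fun hP => (ae_restrict_mem measurableSet_Ioo).mono fun t ht => hP t (Ioo_subset_Icc_self ht)
  exact ⟨key h.deriv_fst (fun t ht => (h.deriv_snd t ht).continuousWithinAt),
    key h.deriv_snd h.cont, h.init_fst, h.init_snd, hae h.mem_domain_fst, hae h.mem_domain_snd,
    ContinuousOn.memLpT h.cont_fst, ContinuousOn.memLpT h.cont_snd, hae h.equation⟩

variable [CompleteSpace X]

/-- The operator `e(A) = A^ε (1 + A)⁻ⁿ`, `n = ⌊ε⌋ + 1`. -/
def regPow (A : X →ₗ.[ℂ] X) (ω ε : ℝ) : X →L[ℂ] X :=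
  sectorCalc A ω (fun w => w ^ (ε : ℂ) / (1 + w) ^ (⌊ε⌋₊ + 1))

/-- The problem `u'' + α A^ε u' + A u = f` has solution kernels. -/
abbrev HasKernels (A : X →ₗ.[ℂ] X) (ω ε α M C : ℝ) (κ K G₁ G₂ S₁ S₂ : ℝ → X →L[ℂ] X) : Prop :=
  SolutionKernels (-res A (-1)) (regPow A ω ε) (⌊ε⌋₊ + 1) α M C κ K G₁ G₂ S₁ S₂

/-- The kernel `G` of `A u`. -/
def kerG₃ (α : ℝ) (G₁ G₂ : ℝ → X →L[ℂ] X) (t : ℝ) : X →L[ℂ] X := 1 - (G₁ t + (α : ℂ) • G₂ t)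

/-- The derivative of `kerG₃`. -/
def kerS₃ (α : ℝ) (S₁ S₂ : ℝ → X →L[ℂ] X) (t : ℝ) : X →L[ℂ] X := -(S₁ t + (α : ℂ) • S₂ t)

theorem IsSectorial.pointwise (hA : IsSectorial A φ) (hφ : φ ∈ Ioo 0 Real.pi) (hα : 0 < α)
    (h : HasKernels A ω ε α M C κ K G₁ G₂ S₁ S₂) (hM : 0 < M) (hTM : T ≤ M)
    (hg : IsDini M T g) {t : ℝ} (ht : t ∈ Icc 0 T) (hd : dini M g t < ∞) :
    (conv K g t ∈ A.domain ∧ app A (conv K g t) = derivConv (kerG₃ α G₁ G₂) (kerS₃ α S₁ S₂) M g t) ∧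
    (conv G₁ g t ∈ ((α : ℂ) • fracPow A ω ε).domain ∧
      app ((α : ℂ) • fracPow A ω ε) (conv G₁ g t) = (α : ℂ) • derivConv G₂ S₂ M g t) ∧
    derivConv G₁ S₁ M g t + app ((α : ℂ) • fracPow A ω ε) (conv G₁ g t) + app A (conv K g t) =
      g t := by
  have h1 := app_of_mem_graph ((hA.mem_graph_iff hφ).2 (h.apply_J hM hg hTM ht hd))
  have h2 := app_of_mem_graph ((hA.mem_graph_smul_fracPow_iff hφ (ω := ω) (ε := ε)
    (Complex.ofReal_ne_zero.2 hα.ne')).2 (h.apply_e hM hg hTM ht hd))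
  refine ⟨h1, h2, ?_⟩
  rw [h1.2, h2.2]
  exact h.equation hM hg.stronglyMeasurable hd

/-- Applying `J^{n+1}` to the equation replaces `A` and `α A^ε` by bounded operators. The difference
of two solutions then satisfies the regularised homogeneous equation. -/
theorem IsSectorial.strongSolution_unique (hA : IsSectorial A φ) (hφ : φ ∈ Ioo 0 Real.pi)
    (hα : 0 < α) (h : HasKernels A ω ε α M C κ K G₁ G₂ S₁ S₂) (hM : 0 < M) (hT : 0 < T)
    (hp : 1 ≤ p) {u u' u'' v v' v'' : ℝ → X}
    (hu : IsStrongSolution A ((α : ℂ) • fracPow A ω ε) T p f u u' u'')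
    (hv : IsStrongSolution A ((α : ℂ) • fracPow A ω ε) T p f v v' v'') : EqOn v u (Icc 0 T) := by
  have hα' : (α : ℂ) ≠ 0 := Complex.ofReal_ne_zero.2 hα.ne'
  have hJ : Function.Injective (-res A (-1)) := by
    have := (hA.isResolvent_neg_one hφ).injective
    intro x y hxy
    apply this
    simpa using hxy
  have hII : ∀ {w : ℝ → X}, IntegrableOn w (Icc 0 T) → ∀ t ∈ Icc 0 T,
      IntervalIntegrable w volume 0 t := fun hw t ht =>
    (intervalIntegrable_iff_integrableOn_Icc_of_le ht.1).2
      (hw.mono_set (Icc_subset_Icc_right ht.2))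
  have hdiff : ∀ {a a' b b' : ℝ → X}, HasSobolevDeriv T p a a' → HasSobolevDeriv T p b b' →
      a 0 = 0 → b 0 = 0 → ∀ t ∈ Icc 0 T, a t - b t = ∫ s in (0 : ℝ)..t, (a' s - b' s) := by
    intro a a' b b' ha hb ha0 hb0 t ht
    rw [intervalIntegral.integral_sub (hII (ha.memLp.integrableOn hp) t ht)
      (hII (hb.memLp.integrableOn hp) t ht), ha.eq_integral t ht, hb.eq_integral t ht, ha0, hb0]
    simp
  have key := h.eq_zero_of_homogeneous hM hT hJ (u := fun t => v t - u t)
    (u' := fun t => v' t - u' t) (u'' := fun t => v'' t - u'' t)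
    ((hv.deriv_snd.memLp.integrableOn hp).sub (hu.deriv_snd.memLp.integrableOn hp))
    (hdiff hv.deriv_snd hu.deriv_snd hv.init_snd hu.init_snd)
    (hdiff hv.deriv_fst hu.deriv_fst hv.init_fst hu.init_fst) ?_
  · exact fun t ht => sub_eq_zero.1 (key t ht)
  filter_upwards [hu.mem_domain_fst, hu.mem_domain_snd, hu.equation, hv.mem_domain_fst,
    hv.mem_domain_snd, hv.equation] with t a1 a2 a3 b1 b2 b3
  have hBg : ∀ {x : X}, x ∈ ((α : ℂ) • fracPow A ω ε).domain →
      (α : ℂ) • regPow A ω ε x =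
        ((-res A (-1)) ^ (⌊ε⌋₊ + 1)) (app ((α : ℂ) • fracPow A ω ε) x) := by
    intro x hx
    have h1 := mem_graph_app hx
    rw [← smul_inv_smul₀ hα' (app _ x)] at h1
    have h2 := (hA.mem_graph_smul_fracPow_iff hφ hα').1 h1
    rw [regPow, h2, ← map_smul, smul_inv_smul₀ hα']
  have eu := (hA.mem_graph_iff hφ).1 (mem_graph_app a1)
  have ev := (hA.mem_graph_iff hφ).1 (mem_graph_app b1)
  have hu2 := hBg a2
  have hv2 := hBg b2
  set J := -res A (-1) with hJd
  set n := ⌊ε⌋₊ + 1 with hn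
  have e3 := congrArg (J ^ (n + 1)) (b3.trans a3.symm)
  have eJ : ∀ x, (J ^ (n + 1)) x = (J ^ n) (J x) := fun x => by rw [pow_succ]; rfl
  have eJ' : ∀ x, (J ^ (n + 1)) x = J ((J ^ n) x) := fun x => by rw [pow_succ']; rfl
  have eu' := congrArg (J ^ n) eu
  have ev' := congrArg (J ^ n) ev
  simp only [map_add] at e3 eu' ev'
  rw [eJ' (app _ (v' t)), eJ' (app _ (u' t)), ← hu2, ← hv2] at e3
  simp only [map_sub, smul_sub, map_smul, ← eJ] at e3 eu' ev' ⊢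
  linear_combination (norm := module) e3 - ev' + eu'

omit [NormedSpace ℂ X] [CompleteSpace X] in
theorem measurable_dini (hg : StronglyMeasurable g) : Measurable (dini M g) := by
  have : Measurable (Function.uncurry fun t s : ℝ => ENNReal.ofReal s⁻¹ * ‖g (t - s) - g t‖ₑ) :=
    (measurable_snd.inv.ennreal_ofReal).mul
      ((hg.comp_measurable (measurable_fst.sub measurable_snd)).sub
        (hg.comp_measurable measurable_fst)).enorm
  exact this.lintegral_prod_right

omit [NormedSpace ℂ X] [CompleteSpace X] in
theorem IsDini.ae_dini_lt_top (hg : IsDini M T g) :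
    ∀ᵐ t ∂volume.restrict (Ioo 0 T), dini M g t < ∞ :=
  ae_lt_top (measurable_dini hg.stronglyMeasurable)
    ((lintegral_mono_set Ioo_subset_Ioc_self).trans_lt hg.lintegral_dini_lt_top).ne

omit [CompleteSpace X] in
theorem conv_zero {G : ℝ → X →L[ℂ] X} : conv G g 0 = 0 := intervalIntegral.integral_same

theorem SolutionKernels.continuousOn_conv_G {J e : X →L[ℂ] X} {n : ℕ}
    (h : SolutionKernels J e n α M C κ K G₁ G₂ S₁ S₂) (hM : 0 < M) (hT : 0 ≤ T) (hTM : T ≤ M)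
    (hg : IsDini M T g) : ContinuousOn (conv G₁ g) (Icc 0 T) :=
  continuousOn_of_eq_integral hT ((integrableOn_Icc_iff_integrableOn_Ioc).2
    (integrableOn_derivConv h.singular₁ hM hg.stronglyMeasurable hg.integrableOn
      hg.lintegral_dini_lt_top)) fun _ ht => (integral_derivConv h.singular₁ hM
      hg.stronglyMeasurable hg.eq_zero hg.integrableOn hg.lintegral_dini_lt_top hTM ht).symm

/-- The pointwise relations hold wherever the Dini integral is finite, which is almost everywhere.
Regularity of the singular integrals beyond integrability is needed only to place them in `L^p`. -/
theorem IsSectorial.isStrongSolution (hA : IsSectorial A φ) (hφ : φ ∈ Ioo 0 Real.pi)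
    (hα : 0 < α) (h : HasKernels A ω ε α M C κ K G₁ G₂ S₁ S₂) (hM : 0 < M) (hT : 0 ≤ T) (hTM : T ≤ M)
    (hg : IsDini M T g) (hfg : f =ᵐ[volume.restrict (Ioo 0 T)] g)
    (h₁ : MemLpT T p (derivConv G₁ S₁ M g)) (h₂ : MemLpT T p (derivConv G₂ S₂ M g))
    (h₃ : MemLpT T p (derivConv (kerG₃ α G₁ G₂) (kerS₃ α S₁ S₂) M g)) :
    IsStrongSolution A ((α : ℂ) • fracPow A ω ε) T p f (conv K g) (conv G₁ g)
      (derivConv G₁ S₁ M g) ∧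
    (fun t => app ((α : ℂ) • fracPow A ω ε) (conv G₁ g t)) =ᵐ[volume.restrict (Ioo 0 T)]
      (fun t => (α : ℂ) • derivConv G₂ S₂ M g t) ∧
    (fun t => app A (conv K g t)) =ᵐ[volume.restrict (Ioo 0 T)]
      derivConv (kerG₃ α G₁ G₂) (kerS₃ α S₁ S₂) M g := by
  have hpt : ∀ᵐ t ∂volume.restrict (Ioo 0 T), t ∈ Icc 0 T ∧ dini M g t < ∞ :=
    ((ae_restrict_mem measurableSet_Ioo).mono fun t ht => Ioo_subset_Icc_self ht).and
      hg.ae_dini_lt_top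
  have eB : (fun t => app ((α : ℂ) • fracPow A ω ε) (conv G₁ g t))
      =ᵐ[volume.restrict (Ioo 0 T)] (fun t => (α : ℂ) • derivConv G₂ S₂ M g t) :=
    hpt.mono fun t ht => (hA.pointwise hφ hα h hM hTM hg ht.1 ht.2).2.1.2
  have eA : (fun t => app A (conv K g t)) =ᵐ[volume.restrict (Ioo 0 T)]
      derivConv (kerG₃ α G₁ G₂) (kerS₃ α S₁ S₂) M g :=
    hpt.mono fun t ht => (hA.pointwise hφ hα h hM hTM hg ht.1 ht.2).1.2
  refine ⟨?_, eB, eA⟩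
  exact
    { deriv_fst := ⟨ContinuousOn.memLpT (h.continuousOn_conv_G hM hT hTM hg), fun t ht => by
        rw [conv_zero, zero_add, h.integral_conv_G hM hg hTM ht]⟩
      deriv_snd := ⟨h₁, fun t ht => by
        rw [conv_zero, zero_add, integral_derivConv h.singular₁ hM hg.stronglyMeasurable hg.eq_zero
          hg.integrableOn hg.lintegral_dini_lt_top hTM ht]⟩
      init_fst := conv_zero
      init_snd := conv_zero
      mem_domain_fst := hpt.mono fun t ht => (hA.pointwise hφ hα h hM hTM hg ht.1 ht.2).1.1
      mem_domain_snd := hpt.mono fun t ht => (hA.pointwise hφ hα h hM hTM hg ht.1 ht.2).2.1.1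
      memLp_fst := (memLp_congr_ae eA).2 h₃
      memLp_snd := (memLp_congr_ae eB).2 (h₂.const_smul (α : ℂ))
      equation := by
        filter_upwards [hpt, hfg] with t ht e
        rw [e]
        exact (hA.pointwise hφ hα h hM hTM hg ht.1 ht.2).2.2 }

theorem hasDerivWithinAt_of_eq_integral {v w : ℝ → X} (hT : 0 ≤ T) (hw : ContinuousOn w (Icc 0 T))
    (hv : ∀ t ∈ Icc 0 T, v t = ∫ s in (0 : ℝ)..t, w s) {t : ℝ} (ht : t ∈ Icc 0 T) :
    HasDerivWithinAt v (w t) (Icc 0 T) t := by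
  -- The integrand is extended by constants to a continuous function on the line, so that the
  -- endpoints of the interval need no separate treatment.
  have hc : Continuous (IccExtend hT ((Icc 0 T).domRestrict w)) :=
    (continuousOn_iff_continuous_domRestrict.1 hw).Icc_extend'
  have he : ∀ s ∈ Icc 0 T, IccExtend hT ((Icc 0 T).domRestrict w) s = w s := fun s hs => by
    rw [IccExtend_of_mem _ _ hs]; rfl
  have h1 := (intervalIntegral.integral_hasDerivAt_right (hc.intervalIntegrable 0 t)
    hc.aestronglyMeasurable.stronglyMeasurableAtFilter hc.continuousAt).hasDerivWithinAt
    (s := Icc 0 T)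
  rw [he t ht] at h1
  have h2 : ∀ s ∈ Icc 0 T, v s = ∫ r in (0 : ℝ)..s, IccExtend hT ((Icc 0 T).domRestrict w) r := by
    intro s hs
    rw [hv s hs]
    refine intervalIntegral.integral_congr fun r hr => ?_
    rw [uIcc_of_le hs.1] at hr
    exact (he r ⟨hr.1, hr.2.trans hs.2⟩).symm
  exact h1.congr h2 (h2 t ht)

theorem IsSectorial.isStrictSolution (hA : IsSectorial A φ) (hφ : φ ∈ Ioo 0 Real.pi)
    (hα : 0 < α) (h : HasKernels A ω ε α M C κ K G₁ G₂ S₁ S₂) (hM : 0 < M) (hT : 0 ≤ T)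
    (hTM : T ≤ M) (hg : IsDini M T g) (hfg : EqOn f g (Icc 0 T))
    (hd : ∀ t ∈ Icc 0 T, dini M g t < ∞)
    (h₁ : ContinuousOn (derivConv G₁ S₁ M g) (Icc 0 T))
    (h₂ : ContinuousOn (derivConv G₂ S₂ M g) (Icc 0 T))
    (h₃ : ContinuousOn (derivConv (kerG₃ α G₁ G₂) (kerS₃ α S₁ S₂) M g) (Icc 0 T)) :
    IsStrictSolution A ((α : ℂ) • fracPow A ω ε) T f (conv K g) (conv G₁ g)
      (derivConv G₁ S₁ M g) ∧
    EqOn (fun t => app ((α : ℂ) • fracPow A ω ε) (conv G₁ g t))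
      (fun t => (α : ℂ) • derivConv G₂ S₂ M g t) (Icc 0 T) ∧
    EqOn (fun t => app A (conv K g t)) (derivConv (kerG₃ α G₁ G₂) (kerS₃ α S₁ S₂) M g)
      (Icc 0 T) := by
  have eB : EqOn (fun t => app ((α : ℂ) • fracPow A ω ε) (conv G₁ g t))
      (fun t => (α : ℂ) • derivConv G₂ S₂ M g t) (Icc 0 T) :=
    fun t ht => (hA.pointwise hφ hα h hM hTM hg ht (hd t ht)).2.1.2
  have eA : EqOn (fun t => app A (conv K g t)) (derivConv (kerG₃ α G₁ G₂) (kerS₃ α S₁ S₂) M g)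
      (Icc 0 T) :=
    fun t ht => (hA.pointwise hφ hα h hM hTM hg ht (hd t ht)).1.2
  refine ⟨?_, eB, eA⟩
  exact
    { deriv_fst := fun t ht => hasDerivWithinAt_of_eq_integral hT
        (h.continuousOn_conv_G hM hT hTM hg)
        (fun t ht => (h.integral_conv_G hM hg hTM ht).symm) ht
      deriv_snd := fun t ht => hasDerivWithinAt_of_eq_integral hT h₁
        (fun t ht => (integral_derivConv h.singular₁ hM hg.stronglyMeasurable hg.eq_zero
          hg.integrableOn hg.lintegral_dini_lt_top hTM ht).symm) ht
      cont := h₁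
      init_fst := conv_zero
      init_snd := conv_zero
      mem_domain_fst := fun t ht => (hA.pointwise hφ hα h hM hTM hg ht (hd t ht)).1.1
      mem_domain_snd := fun t ht => (hA.pointwise hφ hα h hM hTM hg ht (hd t ht)).2.1.1
      cont_fst := h₃.congr eA
      cont_snd := (h₂.const_smul (α : ℂ)).congr eB
      equation := fun t ht => by
        rw [hfg ht]
        exact (hA.pointwise hφ hα h hM hTM hg ht (hd t ht)).2.2 }

end StrongSolution

end

section

open Filter Topology

/-! ### Singular integrals in Hölder and little Hölder spaces -/

section HolderRegularity

theorem lintegral_Ioc_rpow {c r : ℝ} (hc : 0 < c) (hr : 0 ≤ r) :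
    ∫⁻ s in Ioc 0 r, ENNReal.ofReal (s ^ (c - 1)) = ENNReal.ofReal (r ^ c / c) := by
  have hi : IntegrableOn (fun s : ℝ => s ^ (c - 1)) (Ioc 0 r) :=
    (intervalIntegrable_iff_integrableOn_Ioc_of_le hr).1
      (intervalIntegral.intervalIntegrable_rpow' (by linarith))
  rw [← ofReal_integral_eq_lintegral_ofReal hi ((ae_restrict_mem measurableSet_Ioc).mono
    fun s hs => Real.rpow_nonneg hs.1.le _), ← intervalIntegral.integral_of_le hr,
    integral_rpow (Or.inl (by linarith)), sub_add_cancel, Real.zero_rpow hc.ne', sub_zero]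

theorem lintegral_Ioi_rpow {c r : ℝ} (hc : 0 < c) (hr : 0 < r) :
    ∫⁻ s in Ioi r, ENNReal.ofReal (s ^ (-c - 1)) = ENNReal.ofReal (r ^ (-c) / c) := by
  have hi : IntegrableOn (fun s : ℝ => s ^ (-c - 1)) (Ioi r) :=
    integrableOn_Ioi_rpow_of_lt (by linarith) hr
  rw [← ofReal_integral_eq_lintegral_ofReal hi ((ae_restrict_mem measurableSet_Ioi).mono
    fun s hs => Real.rpow_nonneg (hr.trans hs).le _), integral_Ioi_rpow_of_lt (by linarith) hr,
    sub_add_cancel, neg_div_neg_eq]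

variable {X : Type*} [NormedAddCommGroup X] {T θ a b δ h t : ℝ} {f g : ℝ → X}

theorem lintegral_inv_mul_le (hθ : 0 < θ) {r : ℝ} (hr : 0 ≤ r) (ha : 0 ≤ a)
    (hg : ∀ s ∈ Ioc 0 r, ‖g (t - s) - g t‖ ≤ a * s ^ θ) :
    ∫⁻ s in Ioc 0 r, ENNReal.ofReal s⁻¹ * ‖g (t - s) - g t‖ₑ ≤
      ENNReal.ofReal (a * (r ^ θ / θ)) := by
  calc ∫⁻ s in Ioc 0 r, ENNReal.ofReal s⁻¹ * ‖g (t - s) - g t‖ₑ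
      ≤ ∫⁻ s in Ioc 0 r, ENNReal.ofReal a * ENNReal.ofReal (s ^ (θ - 1)) := by
        refine setLIntegral_mono' measurableSet_Ioc fun s hs => ?_
        rw [← ofReal_norm, ← ENNReal.ofReal_mul (inv_nonneg.2 hs.1.le), ← ENNReal.ofReal_mul ha]
        refine ENNReal.ofReal_le_ofReal ?_
        calc s⁻¹ * ‖g (t - s) - g t‖ ≤ s⁻¹ * (a * s ^ θ) :=
              mul_le_mul_of_nonneg_left (hg s hs) (inv_nonneg.2 hs.1.le)
          _ = a * s ^ (θ - 1) := by
              rw [Real.rpow_sub_one hs.1.ne']; ring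
    _ = _ := by
        rw [lintegral_const_mul' _ _ ENNReal.ofReal_ne_top, lintegral_Ioc_rpow hθ hr,
          ← ENNReal.ofReal_mul ha]

theorem lintegral_inv_sq_mul_le (hθ : θ < 1) {s : Set ℝ} (hs : MeasurableSet s) {r : ℝ}
    (hr : 0 < r) (hsr : s ⊆ Ici r) (ha : 0 ≤ a) (hh : 0 ≤ h)
    (hg : ∀ σ ∈ s, ‖g (t - σ) - g t‖ ≤ a * σ ^ θ) :
    ∫⁻ σ in s, ENNReal.ofReal (h * (σ ^ 2)⁻¹) * ‖g (t - σ) - g t‖ₑ ≤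
      ENNReal.ofReal (a * h * (r ^ (θ - 1) / (1 - θ))) := by
  have hah : 0 ≤ a * h := by positivity
  calc ∫⁻ σ in s, ENNReal.ofReal (h * (σ ^ 2)⁻¹) * ‖g (t - σ) - g t‖ₑ
      ≤ ∫⁻ σ in s, ENNReal.ofReal (a * h) * ENNReal.ofReal (σ ^ (-(1 - θ) - 1)) := by
        refine setLIntegral_mono' hs fun σ hσ => ?_
        have h0 : 0 < σ := hr.trans_le (hsr hσ)
        rw [← ofReal_norm, ← ENNReal.ofReal_mul (by positivity), ← ENNReal.ofReal_mul hah]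
        refine ENNReal.ofReal_le_ofReal ?_
        calc h * (σ ^ 2)⁻¹ * ‖g (t - σ) - g t‖ ≤ h * (σ ^ 2)⁻¹ * (a * σ ^ θ) :=
              mul_le_mul_of_nonneg_left (hg σ hσ) (by positivity)
          _ = a * h * σ ^ (-(1 - θ) - 1) := by
              rw [show -(1 - θ) - 1 = θ - (2 : ℕ) by push_cast; ring, Real.rpow_sub_natCast h0.ne']
              ring
    _ ≤ ∫⁻ σ in Ici r, ENNReal.ofReal (a * h) * ENNReal.ofReal (σ ^ (-(1 - θ) - 1)) :=
        lintegral_mono_set hsr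
    _ = _ := by
        rw [lintegral_const_mul' _ _ ENNReal.ofReal_ne_top, setLIntegral_congr Ioi_ae_eq_Ici.symm,
          lintegral_Ioi_rpow (by linarith) hr, ← ENNReal.ofReal_mul hah, neg_sub]

variable [NormedSpace ℂ X] [CompleteSpace X] {C : ℝ} {G S : ℝ → X →L[ℂ] X}

/-- The effect of the singular integral operator on the modulus of continuity. -/
theorem norm_derivConv_sub_le (hk : SingularKernel (2 * T) C G S) (hgm : StronglyMeasurable g)
    (hg0 : ∀ s ≤ 0, g s = 0) (hθ : θ ∈ Ioo 0 1) (ha : 0 ≤ a) (hb : 0 ≤ b)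
    (hgb : ∀ t ≤ T, ∀ s, 0 < s → ‖g (t - s) - g t‖ ≤ b * s ^ θ)
    (hga : ∀ t ≤ T, ∀ s ∈ Ioo 0 δ, ‖g (t - s) - g t‖ ≤ a * s ^ θ)
    (hh : 0 < h) (hhT : h ≤ T) (hhδ : 2 * h < δ) (htT : t ≤ T) :
    ‖derivConv G S (2 * T) g (t - h) - derivConv G S (2 * T) g t‖ ≤
      8 * C * (4 / (θ * (1 - θ))) * (a + b * (h / δ) ^ (1 - θ)) * h ^ θ := by
  have hM : 0 ≤ 2 * T := by linarith
  have hC := hk.nonneg (by linarith)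
  have hδ : 0 < δ := by linarith
  have hdini : ∀ t ≤ T, dini (2 * T) g t < ∞ := fun t ht =>
    (lintegral_inv_mul_le hθ.1 hM hb fun s hs => hgb t ht s hs.1).trans_lt ENNReal.ofReal_lt_top
  have key := enorm_derivConv_sub_le hk hgm hg0 hh hhT htT (hdini t htT) (hdini _ (by linarith))
  have k1 : ‖g (t - h) - g t‖ₑ ≤ ENNReal.ofReal (a * h ^ θ) := by
    rw [← ofReal_norm]
    exact ENNReal.ofReal_le_ofReal (hga t htT h ⟨hh, by linarith⟩)
  have k2 := lintegral_inv_mul_le (g := g) (t := t) hθ.1 (r := 2 * h) (by linarith) ha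
    fun s hs => hga t htT s ⟨hs.1, hs.2.trans_lt hhδ⟩
  have k3 := lintegral_inv_mul_le (g := g) (t := t - h) hθ.1 (r := h) hh.le ha
    fun s hs => hga _ (by linarith) s ⟨hs.1, by linarith [hs.2]⟩
  -- The tail is split at `δ`: below it the possibly small constant `a` applies, above it the global
  -- constant `b`, which is damped by the factor `(h / δ)^{1-θ}`.
  have k4 : ∫⁻ s in Ioc h (2 * T), ENNReal.ofReal (h * (s ^ 2)⁻¹) * ‖g (t - s) - g t‖ₑ ≤
      ENNReal.ofReal (a * h * (h ^ (θ - 1) / (1 - θ))) +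
        ENNReal.ofReal (b * h * (δ ^ (θ - 1) / (1 - θ))) := by
    refine (lintegral_mono_set (t := Ioo h δ ∪ Ici δ) fun s hs => ?_).trans
      ((lintegral_union_le _ _ _).trans (add_le_add ?_ ?_))
    · rcases lt_or_ge s δ with h1 | h1
      · exact Or.inl ⟨hs.1, h1⟩
      · exact Or.inr h1
    · exact lintegral_inv_sq_mul_le hθ.2 measurableSet_Ioo hh (fun s hs => hs.1.le) ha hh.le
        fun s hs => hga t htT s ⟨hh.trans hs.1, hs.2⟩
    · exact lintegral_inv_sq_mul_le hθ.2 measurableSet_Ici hδ (fun s hs => hs) hb hh.le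
        fun s hs => hgb t htT s (hδ.trans_le hs)
  have h1θ : 0 < 1 - θ := by linarith [hθ.2]
  have hθ0 := hθ.1
  have p1 : 0 ≤ a * h ^ θ := by positivity
  have p2 : 0 ≤ a * ((2 * h) ^ θ / θ) := by positivity
  have p3 : 0 ≤ a * (h ^ θ / θ) := by positivity
  have p4 : 0 ≤ a * h * (h ^ (θ - 1) / (1 - θ)) := by positivity
  have p5 : 0 ≤ b * h * (δ ^ (θ - 1) / (1 - θ)) := by positivity
  have key2 := key.trans (mul_le_mul_right (add_le_add (add_le_add (add_le_add k1 k2) k3) k4) _)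
  rw [← ENNReal.ofReal_add p1 p2, ← ENNReal.ofReal_add (by positivity) p3,
    ← ENNReal.ofReal_add p4 p5, ← ENNReal.ofReal_add (by positivity) (by positivity),
    ← ENNReal.ofReal_mul (by positivity), ← ofReal_norm,
    ENNReal.ofReal_le_ofReal_iff (by positivity)] at key2
  refine key2.trans ?_
  have e1 : h * h ^ (θ - 1) = h ^ θ := by rw [Real.rpow_sub_one hh.ne']; field_simp
  have e2 : h * δ ^ (θ - 1) = (h / δ) ^ (1 - θ) * h ^ θ := by
    rw [Real.div_rpow hh.le hδ.le, show θ - 1 = -(1 - θ) by ring, Real.rpow_neg hδ.le, ← e1,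
      show θ - 1 = -(1 - θ) by ring, Real.rpow_neg hh.le]
    field_simp
  have e3 : (2 * h) ^ θ ≤ 2 * h ^ θ := by
    rw [Real.mul_rpow (by norm_num) hh.le]
    refine mul_le_mul_of_nonneg_right ?_ (by positivity)
    calc (2 : ℝ) ^ θ ≤ 2 ^ (1 : ℝ) := Real.rpow_le_rpow_of_exponent_le (by norm_num) hθ.2.le
      _ = 2 := Real.rpow_one 2
  rw [mul_assoc (8 * C), mul_assoc (8 * C)]
  refine mul_le_mul_of_nonneg_left ?_ (by positivity)
  have q1 : a * ((2 * h) ^ θ / θ) ≤ a * (2 * h ^ θ / θ) := by gcongr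
  have q4 : a * h * (h ^ (θ - 1) / (1 - θ)) = a * h ^ θ / (1 - θ) := by rw [← e1]; ring
  have q5 : b * h * (δ ^ (θ - 1) / (1 - θ)) = b * (h / δ) ^ (1 - θ) * h ^ θ / (1 - θ) := by
    rw [mul_assoc b (_ ^ _), ← e2]; ring
  rw [q4, q5]
  set P := a * h ^ θ with hP
  set Q := b * (h / δ) ^ (1 - θ) * h ^ θ with hQ
  have hP0 : 0 ≤ P := p1
  have hQ0 : 0 ≤ Q := by positivity
  have goal : P + 2 * P / θ + P / θ + (P / (1 - θ) + Q / (1 - θ)) ≤ 4 / (θ * (1 - θ)) * (P + Q) := by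
    rw [div_mul_eq_mul_div, le_div_iff₀ (by positivity)]
    have : (P + 2 * P / θ + P / θ + (P / (1 - θ) + Q / (1 - θ))) * (θ * (1 - θ)) =
        P * (3 - θ - θ ^ 2) + Q * θ := by
      field_simp
      ring
    rw [this]
    nlinarith [mul_nonneg hP0 (by positivity : 0 ≤ 1 + θ + θ ^ 2), mul_nonneg hQ0 h1θ.le]
  calc _ ≤ P + 2 * P / θ + P / θ + (P / (1 - θ) + Q / (1 - θ)) := by
        have : a * (2 * h ^ θ / θ) = 2 * P / θ := by rw [hP]; ring
        have : a * (h ^ θ / θ) = P / θ := by rw [hP]; ring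
        linarith
    _ ≤ _ := goal
    _ = _ := by rw [hP, hQ]; ring

omit [NormedSpace ℂ X] [CompleteSpace X] in
theorem MemHolderZero.congr (hf : MemHolderZero T θ f) (hT : 0 ≤ T) (h : EqOn g f (Icc 0 T)) :
    MemHolderZero T θ g := by
  obtain ⟨h1, ⟨b, h2⟩, h3⟩ := hf
  refine ⟨h1.congr h, ⟨b, fun s hs t ht => ?_⟩, ?_⟩
  · rw [h hs, h ht]; exact h2 s hs t ht
  · rw [h ⟨le_rfl, hT⟩, h3]

omit [NormedSpace ℂ X] [CompleteSpace X] in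
theorem MemLittleHolderZero.congr (hf : MemLittleHolderZero T θ f) (hT : 0 ≤ T)
    (h : EqOn g f (Icc 0 T)) : MemLittleHolderZero T θ g := by
  refine ⟨hf.1.congr hT h, fun η hη => ?_⟩
  obtain ⟨δ, hδ, hδ'⟩ := hf.2 η hη
  refine ⟨δ, hδ, fun s hs t ht hst => ?_⟩
  rw [h hs, h ht]
  exact hδ' s hs t ht hst

/-- The extension of a function on `[0, T]` to the line by constants. -/
def extend (T : ℝ) (f : ℝ → X) (t : ℝ) : X := f (max 0 (min t T))

omit [NormedAddCommGroup X] [NormedSpace ℂ X] [CompleteSpace X] in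
theorem extend_of_mem (ht : t ∈ Icc 0 T) : extend T f t = f t := by
  rw [extend, min_eq_left ht.2, max_eq_right ht.1]

omit [NormedSpace ℂ X] [CompleteSpace X] in
theorem extend_of_nonpos (hf : f 0 = 0) (ht : t ≤ 0) : extend T f t = 0 := by
  rw [extend, max_eq_left ((min_le_left _ _).trans ht), hf]

theorem clamp_mem (hT : 0 ≤ T) : max 0 (min t T) ∈ Icc 0 T :=
  ⟨le_max_left _ _, max_le hT (min_le_right _ _)⟩

theorem abs_clamp_sub_le (s t : ℝ) : |max 0 (min t T) - max 0 (min s T)| ≤ |t - s| := by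
  have h1 := abs_max_sub_max_le_max 0 (min t T) 0 (min s T)
  have h2 := abs_min_sub_min_le_max t T s T
  exact h1.trans (max_le (by simp) (h2.trans (max_le le_rfl (by simp))))

omit [NormedSpace ℂ X] [CompleteSpace X] in
theorem norm_extend_sub_le (hT : 0 ≤ T) (hθ : 0 ≤ θ) (ha : 0 ≤ a)
    (hf : ∀ s ∈ Icc 0 T, ∀ t ∈ Icc 0 T, |t - s| < δ → ‖f t - f s‖ ≤ a * |t - s| ^ θ) {s : ℝ}
    (hs : s ∈ Ioo 0 δ) : ‖extend T f (t - s) - extend T f t‖ ≤ a * s ^ θ := by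
  have h1 := abs_clamp_sub_le (T := T) t (t - s)
  rw [show |t - s - t| = s by rw [show t - s - t = -s by ring, abs_neg, abs_of_pos hs.1]] at h1
  exact (hf _ (clamp_mem hT) _ (clamp_mem hT) (h1.trans_lt hs.2)).trans
    (mul_le_mul_of_nonneg_left (Real.rpow_le_rpow (abs_nonneg _) h1 hθ) ha)

omit [NormedSpace ℂ X] [CompleteSpace X] in
theorem MemHolderZero.exists_norm_le (hf : MemHolderZero T θ f) (hT : 0 ≤ T) (hθ : 0 ≤ θ) :
    ∃ b, 0 ≤ b ∧ ∀ t s, 0 < s → ‖extend T f (t - s) - extend T f t‖ ≤ b * s ^ θ := by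
  obtain ⟨b, hb⟩ := hf.2.1
  refine ⟨|b|, abs_nonneg b, fun t s hs => ?_⟩
  refine norm_extend_sub_le (δ := s + 1) hT hθ (abs_nonneg b) (fun s hs t ht _ => ?_)
    ⟨hs, by linarith⟩
  exact (hb s hs t ht).trans (mul_le_mul_of_nonneg_right (le_abs_self b) (by positivity))

omit [NormedSpace ℂ X] [CompleteSpace X] in
theorem MemHolderZero.continuous_extend (hf : MemHolderZero T θ f) (hT : 0 ≤ T) :
    Continuous (extend T f) :=
  hf.1.comp_continuous (by fun_prop) fun _ => clamp_mem hT

omit [NormedSpace ℂ X] [CompleteSpace X] in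
theorem MemHolderZero.dini_lt_top (hf : MemHolderZero T θ f) (hT : 0 ≤ T) (hθ : 0 < θ) {M : ℝ}
    (hM : 0 ≤ M) : ∃ B < ∞, ∀ t, dini M (extend T f) t ≤ B := by
  obtain ⟨b, hb, hb'⟩ := hf.exists_norm_le hT hθ.le
  exact ⟨_, ENNReal.ofReal_lt_top, fun t => lintegral_inv_mul_le hθ hM hb fun s hs => hb' t s hs.1⟩

omit [NormedSpace ℂ X] [CompleteSpace X] in
theorem MemHolderZero.isDini (hf : MemHolderZero T θ f) (hT : 0 ≤ T) (hθ : 0 < θ) {M : ℝ}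
    (hM : 0 ≤ M) : IsDini M T (extend T f) where
  stronglyMeasurable := (hf.continuous_extend hT).stronglyMeasurable
  eq_zero s hs := extend_of_nonpos hf.2.2 hs
  integrableOn := by
    refine IntegrableOn.mono_set (t := Iic 0 ∪ Icc 0 T) (IntegrableOn.union ?_
      (hf.continuous_extend hT).continuousOn.integrableOn_Icc) fun t ht => ?_
    · exact integrableOn_zero.congr_fun (fun t ht => (extend_of_nonpos hf.2.2 ht).symm)
        measurableSet_Iic
    · rcases le_total t 0 with h | h
      · exact Or.inl h
      · exact Or.inr ⟨h, ht⟩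
  lintegral_dini_lt_top := by
    obtain ⟨B, hB, hB'⟩ := hf.dini_lt_top hT hθ hM
    refine (lintegral_mono hB').trans_lt ?_
    rw [setLIntegral_const]
    exact ENNReal.mul_lt_top hB measure_Ioc_lt_top

theorem MemHolderZero.derivConv (hf : MemHolderZero T θ f) (hT : 0 < T) (hθ : θ ∈ Ioo 0 1)
    (hk : SingularKernel (2 * T) C G S) :
    MemHolderZero T θ (derivConv G S (2 * T) (extend T f)) := by
  obtain ⟨b, hb, hb'⟩ := hf.exists_norm_le hT.le hθ.1.le
  have hC := hk.nonneg (by linarith)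
  have h0 : ∀ s ≤ 0, extend T f s = 0 := fun s hs => extend_of_nonpos hf.2.2 hs
  set L := 8 * C * (4 / (θ * (1 - θ))) * (b + b * 1) with hL
  have h1θ : 0 < 1 - θ := by linarith [hθ.2]
  have hθ0 := hθ.1
  have hL0 : 0 ≤ L := by positivity
  have key : ∀ s ∈ Icc 0 T, ∀ t ∈ Icc 0 T, s < t →
      ‖MaxReg.derivConv G S (2 * T) (extend T f) s -
        MaxReg.derivConv G S (2 * T) (extend T f) t‖ ≤ L * |t - s| ^ θ := by
    intro s hs t ht hst
    have h1 : 0 < t - s := sub_pos.2 hst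
    -- With `a = b` the position of the cut does not matter; any `δ > 2 h` is admissible.
    have := norm_derivConv_sub_le (δ := 3 * (t - s)) (a := b) (b := b) hk
      (hf.continuous_extend hT.le).stronglyMeasurable h0 hθ hb hb (fun t _ => hb' t)
      (fun t _ s hs => hb' t s hs.1) h1 (by linarith [hs.1, ht.2]) (by linarith) ht.2
    rw [sub_sub_cancel] at this
    rw [abs_of_pos h1]
    refine this.trans (mul_le_mul_of_nonneg_right ?_ (by positivity))
    refine mul_le_mul_of_nonneg_left ?_ (by positivity)
    gcongr
    refine Real.rpow_le_one (by positivity) ?_ h1θ.le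
    rw [div_le_one (by positivity)]
    linarith
  have key' : ∀ s ∈ Icc 0 T, ∀ t ∈ Icc 0 T,
      ‖MaxReg.derivConv G S (2 * T) (extend T f) t -
        MaxReg.derivConv G S (2 * T) (extend T f) s‖ ≤ L * |t - s| ^ θ := by
    intro s hs t ht
    rcases lt_trichotomy s t with h | h | h
    · rw [norm_sub_rev]; exact key s hs t ht h
    · rw [h, sub_self, norm_zero]; positivity
    · rw [abs_sub_comm]; exact key t ht s hs h
  refine ⟨fun t ht => ?_, ⟨L, key'⟩, derivConv_eq_of_nonpos h0 (by linarith) le_rfl⟩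
  rw [ContinuousWithinAt, tendsto_iff_norm_sub_tendsto_zero]
  have hlim : Tendsto (fun s => L * |s - t| ^ θ) (𝓝[Icc 0 T] t) (𝓝 0) := by
    have : Continuous fun s => L * |s - t| ^ θ :=
      continuous_const.mul ((continuous_abs.comp (continuous_id.sub continuous_const)).rpow_const
        fun _ => Or.inr hθ.1.le)
    have := this.tendsto t
    simp only [sub_self, abs_zero, Real.zero_rpow hθ.1.ne', mul_zero] at this
    exact this.mono_left nhdsWithin_le_nhds
  exact squeeze_zero' (Eventually.of_forall fun _ => norm_nonneg _)
    (eventually_mem_nhdsWithin.mono fun s hs => key' t ht s hs) hlim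

theorem MemLittleHolderZero.derivConv (hf : MemLittleHolderZero T θ f) (hT : 0 < T)
    (hθ : θ ∈ Ioo 0 1) (hk : SingularKernel (2 * T) C G S) :
    MemLittleHolderZero T θ (derivConv G S (2 * T) (extend T f)) := by
  refine ⟨hf.1.derivConv hT hθ hk, fun η hη => ?_⟩
  obtain ⟨b, hb, hb'⟩ := hf.1.exists_norm_le hT.le hθ.1.le
  have hC := hk.nonneg (by linarith)
  have h0 : ∀ s ≤ 0, extend T f s = 0 := fun s hs => extend_of_nonpos hf.1.2.2 hs
  have h1θ : 0 < 1 - θ := by linarith [hθ.2]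
  have hθ0 := hθ.1
  set L := 8 * C * (4 / (θ * (1 - θ))) with hL
  have hL0 : 0 ≤ L := by positivity
  -- Small enough for `L a < η`. The other term tends to `0` with `h`, since `δ` is fixed once `a`
  -- is.
  set a := η / (2 * (L + 1)) with ha
  have ha0 : 0 < a := by positivity
  obtain ⟨δ, hδ, hδ'⟩ := hf.2 a ha0
  have hlim : Tendsto (fun h : ℝ => L * (a + b * (h / δ) ^ (1 - θ))) (𝓝 0) (𝓝 (L * a)) := by
    have : Continuous fun h : ℝ => L * (a + b * (h / δ) ^ (1 - θ)) :=
      continuous_const.mul (continuous_const.add (continuous_const.mul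
        ((continuous_id.div_const δ).rpow_const fun _ => Or.inr h1θ.le)))
    have := this.tendsto 0
    simpa [Real.zero_rpow h1θ.ne'] using this
  have hlt : L * a < η := by
    rw [ha, mul_div_assoc', div_lt_iff₀ (by positivity)]
    nlinarith
  obtain ⟨δ', hδ'0, hball⟩ := Metric.eventually_nhds_iff.1 (hlim.eventually_lt_const hlt)
  refine ⟨min (δ / 2) δ', by positivity, ?_⟩
  have key : ∀ s ∈ Icc 0 T, ∀ t ∈ Icc 0 T, s < t → |t - s| < min (δ / 2) δ' →
      ‖MaxReg.derivConv G S (2 * T) (extend T f) s -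
        MaxReg.derivConv G S (2 * T) (extend T f) t‖ ≤ η * |t - s| ^ θ := by
    intro s hs t ht hst hlt
    have h1 : 0 < t - s := sub_pos.2 hst
    rw [abs_of_pos h1] at hlt ⊢
    have := norm_derivConv_sub_le (δ := δ) (a := a) (b := b) hk
      (hf.1.continuous_extend hT.le).stronglyMeasurable h0 hθ ha0.le hb (fun t _ => hb' t)
      (fun t _ s hs => norm_extend_sub_le hT.le hθ.1.le ha0.le hδ' hs) h1
      (by linarith [hs.1, ht.2]) (by linarith [hlt.trans_le (min_le_left _ _)]) ht.2
    rw [sub_sub_cancel] at this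
    refine this.trans (mul_le_mul_of_nonneg_right ?_ (by positivity))
    refine (hball ?_).le
    rw [Real.dist_eq, sub_zero, abs_of_pos h1]
    exact hlt.trans_le (min_le_right _ _)
  intro s hs t ht hst
  rcases lt_trichotomy s t with h | h | h
  · rw [norm_sub_rev]; exact key s hs t ht h hst
  · rw [h, sub_self, norm_zero]; positivity
  · rw [abs_sub_comm] at hst ⊢; exact key t ht s hs h hst

end HolderRegularity

end

section

open Filter Topology

/-! ### Maximal regularity in Hölder spaces -/

section HolderMaxReg

variable {X : Type*} [NormedAddCommGroup X] [NormedSpace ℂ X] [CompleteSpace X]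
  {A : X →ₗ.[ℂ] X} {φ α ε ω C T θ : ℝ} {κ K G₁ G₂ S₁ S₂ : ℝ → X →L[ℂ] X}

omit [CompleteSpace X] in
theorem MemHolderZero.const_smul {f : ℝ → X} (hf : MemHolderZero T θ f) (c : ℂ) :
    MemHolderZero T θ (fun t => c • f t) := by
  obtain ⟨h1, ⟨b, h2⟩, h3⟩ := hf
  refine ⟨h1.const_smul c, ⟨‖c‖ * b, fun s hs t ht => ?_⟩, by simp [h3]⟩
  rw [← smul_sub, norm_smul, mul_assoc]
  exact mul_le_mul_of_nonneg_left (h2 s hs t ht) (norm_nonneg c)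

omit [CompleteSpace X] in
theorem MemLittleHolderZero.const_smul {f : ℝ → X} (hf : MemLittleHolderZero T θ f) (c : ℂ) :
    MemLittleHolderZero T θ (fun t => c • f t) := by
  refine ⟨hf.1.const_smul c, fun η hη => ?_⟩
  obtain ⟨δ, hδ, h⟩ := hf.2 (η / (‖c‖ + 1)) (by positivity)
  refine ⟨δ, hδ, fun s hs t ht hst => ?_⟩
  rw [← smul_sub, norm_smul]
  have h1 := h s hs t ht hst
  have h2 : 0 ≤ |t - s| ^ θ := by positivity
  calc ‖c‖ * ‖f t - f s‖ ≤ (‖c‖ + 1) * (η / (‖c‖ + 1) * |t - s| ^ θ) := by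
        gcongr; linarith
    _ = η * |t - s| ^ θ := by field_simp

/-- Maximal regularity for strict solutions in a class of Hölder functions which is preserved by
the singular integral operators. -/
theorem IsSectorial.hasMaxReg_strict (hA : IsSectorial A φ) (hφ : φ ∈ Ioo 0 Real.pi)
    (hα : 0 < α) (h : HasKernels A ω ε α (2 * T) C κ K G₁ G₂ S₁ S₂) (hT : 0 < T)
    (hθ : 0 < θ) {E : (ℝ → X) → Prop} (hE : ∀ f, E f → MemHolderZero T θ f)
    (hcongr : ∀ f g, E f → EqOn g f (Icc 0 T) → E g)
    (hsmul : ∀ f (c : ℂ), E f → E (fun t => c • f t))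
    (hreg : ∀ f C' G S, E f → SingularKernel (2 * T) C' G S →
      E (derivConv G S (2 * T) (extend T f))) :
    HasMaxReg A ((α : ℂ) • fracPow A ω ε) T
      (IsStrictSolution A ((α : ℂ) • fracPow A ω ε) T) E := by
  intro f hf
  have hM : 0 < 2 * T := by linarith
  have hTM : T ≤ 2 * T := by linarith
  have hg := (hE f hf).isDini hT.le hθ hM.le
  have r₁ := hreg f _ _ _ hf h.singular₁
  have r₂ := hreg f _ _ _ hf h.singular₂
  have r₃ := hreg f _ (kerG₃ α G₁ G₂) (kerS₃ α S₁ S₂) hf h.singular₃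
  obtain ⟨B, hB, hB'⟩ := (hE f hf).dini_lt_top hT.le hθ hM.le
  obtain ⟨hs, eB, eA⟩ := hA.isStrictSolution hφ hα h hM hT.le hTM hg
    (fun t ht => (extend_of_mem ht).symm) (fun t _ => (hB' t).trans_lt hB) (hE _ r₁).1 (hE _ r₂).1
    (hE _ r₃).1
  -- Uniqueness is that of strong solutions for `p = 1`.
  refine ⟨_, _, _, hs, ⟨?_, ?_, r₁, ?_, ?_⟩, fun v v' v'' hv =>
    hA.strongSolution_unique hφ hα h hM hT le_rfl hs.isStrongSolution hv.isStrongSolution⟩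
  · exact hcongr _ _ (hreg f _ _ _ hf (h.singularκ hM)) fun t ht => (h.conv_K_eq hM hg hTM ht).symm
  · exact hcongr _ _ (hreg f _ _ _ hf (h.singularK hM)) fun t ht => (h.conv_G_eq hM hg hTM ht).symm
  · exact hcongr _ _ (hsmul _ _ r₂) eB
  · exact hcongr _ _ r₃ eA

theorem IsSectorial.hasMaxReg_holder (hA : IsSectorial A φ) (hφ : φ ∈ Ioo 0 Real.pi)
    (hα : 0 < α) (h : HasKernels A ω ε α (2 * T) C κ K G₁ G₂ S₁ S₂) (hT : 0 < T)
    (hθ : θ ∈ Ioo 0 1) : HasMaxReg A ((α : ℂ) • fracPow A ω ε) T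
      (IsStrictSolution A ((α : ℂ) • fracPow A ω ε) T) (MemHolderZero T θ) :=
  hA.hasMaxReg_strict hφ hα h hT hθ.1 (fun _ hf => hf) (fun _ _ hf e => hf.congr hT.le e)
    (fun _ c hf => hf.const_smul c) fun _ _ _ _ hf hk => hf.derivConv hT hθ hk

theorem IsSectorial.hasMaxReg_littleHolder (hA : IsSectorial A φ) (hφ : φ ∈ Ioo 0 Real.pi)
    (hα : 0 < α) (h : HasKernels A ω ε α (2 * T) C κ K G₁ G₂ S₁ S₂) (hT : 0 < T)
    (hθ : θ ∈ Ioo 0 1) : HasMaxReg A ((α : ℂ) • fracPow A ω ε) T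
      (IsStrictSolution A ((α : ℂ) • fracPow A ω ε) T) (MemLittleHolderZero T θ) :=
  hA.hasMaxReg_strict hφ hα h hT hθ.1 (fun _ hf => hf.1) (fun _ _ hf e => hf.congr hT.le e)
    (fun _ c hf => hf.const_smul c) fun _ _ _ _ hf hk => hf.derivConv hT hθ hk

end HolderMaxReg

end

section

open Filter Topology

/-! ### Besov spaces through moduli of continuity of zero extensions -/

section Modulus

theorem eLpNorm_mono_ennreal {β : Type*} [MeasurableSpace β] {μ : Measure β} {p : ℝ≥0∞}
    {F H : β → ℝ≥0∞} (h : ∀ᵐ x ∂μ, F x ≤ H x) : eLpNorm F p μ ≤ eLpNorm H p μ :=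
  eLpNorm_mono_enorm_ae (by simpa only [enorm_eq_self] using h)

theorem ae_dhh_mem {T : ℝ} : ∀ᵐ h ∂dhh T, h ∈ Ioo 0 T := by
  rw [← invMeas_restrict]
  exact ae_restrict_mem measurableSet_Ioo

variable {X : Type*} [NormedAddCommGroup X] {T θ h : ℝ} {p q : ℝ≥0∞} {f g : ℝ → X}

theorem eLpNorm_comp_sub_right (F : ℝ → X) (h a b : ℝ) :
    eLpNorm (fun t => F (t - h)) p (volume.restrict (Ioo a b)) =
      eLpNorm F p (volume.restrict (Ioo (a - h) (b - h))) := by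
  have hm := (measurePreserving_sub_right volume h).restrict_preimage
    (measurableSet_Ioo (a := a - h) (b := b - h))
  have he : MeasurableEmbedding fun t : ℝ => t - h := measurableEmbedding_subRight h
  rw [← hm.map_eq, he.eLpNorm_map_measure]
  congr 2
  ext t
  simp

/-- The `L^p` modulus of continuity of a function on `(-∞, T)` which vanishes on `(-∞, 0]`. -/
def modulus (T : ℝ) (p : ℝ≥0∞) (g : ℝ → X) (h : ℝ) : ℝ≥0∞ :=
  eLpNorm (fun t => g (t - h) - g t) p (volume.restrict (Ioo 0 T))

/-- The `L^p` modulus of continuity in the interior of `(0, T)`. -/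
def innerModulus (T : ℝ) (p : ℝ≥0∞) (g : ℝ → X) (h : ℝ) : ℝ≥0∞ :=
  eLpNorm ((Ioi h).indicator fun t => g (t - h) - g t) p (volume.restrict (Ioo 0 T))

theorem innerModulus_eq (hh : 0 < h) : innerModulus T p g h =
    eLpNorm (fun t => g (t + h) - g t) p (volume.restrict (Ioo 0 (T - h))) := by
  have hset : Ioi h ∩ Ioo 0 T = Ioo h T := by
    ext t
    simp only [mem_inter_iff, mem_Ioi, mem_Ioo]
    exact ⟨fun H => ⟨H.1, H.2.2⟩, fun H => ⟨H.1, hh.trans H.1, H.2⟩⟩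
  rw [innerModulus, eLpNorm_indicator_eq_eLpNorm_restrict measurableSet_Ioi,
    Measure.restrict_restrict measurableSet_Ioi, hset]
  have := eLpNorm_comp_sub_right (p := p) (fun t => g t - g (t + h)) h h T
  simp only [sub_add_cancel, sub_self] at this
  rw [this]
  exact eLpNorm_sub_comm (fun t => g t) (fun t => g (t + h)) p _

theorem innerModulus_le : innerModulus T p g h ≤ modulus T p g h :=
  eLpNorm_indicator_le _

theorem eLpNorm_le_modulus (hg0 : ∀ t ≤ 0, g t = 0) (hhT : h ≤ T) :
    eLpNorm g p (volume.restrict (Ioo 0 h)) ≤ modulus T p g h := by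
  calc eLpNorm g p (volume.restrict (Ioo 0 h))
      = eLpNorm (fun t => g (t - h) - g t) p (volume.restrict (Ioo 0 h)) := by
        refine eLpNorm_congr_enorm_ae ((ae_restrict_mem measurableSet_Ioo).mono fun t ht => ?_)
        rw [hg0 (t - h) (by linarith [ht.2]), zero_sub, enorm_neg]
    _ ≤ _ := eLpNorm_mono_measure _ (Measure.restrict_mono (Ioo_subset_Ioo_right hhT) le_rfl)

theorem modulus_of_le (hg0 : ∀ t ≤ 0, g t = 0) (hhT : T ≤ h) :
    modulus T p g h = eLpNorm g p (volume.restrict (Ioo 0 T)) := by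
  refine eLpNorm_congr_enorm_ae ((ae_restrict_mem measurableSet_Ioo).mono fun t ht => ?_)
  rw [hg0 (t - h) (by linarith [ht.2]), zero_sub, enorm_neg]

/-- For `t < h` the translate vanishes, so what the inner modulus misses is the norm of `g` over
`(0, h)`. Regularity of the zero extension is therefore Besov regularity on `(0, T)` together with
the Hardy condition. -/
theorem modulus_le (hg : StronglyMeasurable g) (hg0 : ∀ t ≤ 0, g t = 0) (hp : 1 ≤ p) :
    modulus T p g h ≤ innerModulus T p g h + eLpNorm g p (volume.restrict (Ioo 0 h)) := by
  have hm : AEStronglyMeasurable (fun t => g (t - h) - g t) (volume.restrict (Ioo 0 T)) :=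
    ((hg.comp_measurable (measurable_id.sub_const h)).sub hg).aestronglyMeasurable
  have hsplit : (fun t => g (t - h) - g t) = (Ioi h).indicator (fun t => g (t - h) - g t) +
      (Iic h).indicator (fun t => g (t - h) - g t) := by
    rw [← compl_Ioi, indicator_self_add_compl]
  rw [modulus, hsplit]
  refine (eLpNorm_add_le (hm.indicator measurableSet_Ioi) (hm.indicator measurableSet_Iic)
    hp).trans (add_le_add le_rfl ?_)
  rw [eLpNorm_indicator_eq_eLpNorm_restrict measurableSet_Iic,
    Measure.restrict_restrict measurableSet_Iic]
  calc eLpNorm (fun t => g (t - h) - g t) p (volume.restrict (Iic h ∩ Ioo 0 T))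
      ≤ eLpNorm (fun t => g (t - h) - g t) p (volume.restrict (Ioc 0 h)) :=
        eLpNorm_mono_measure _ (Measure.restrict_mono
          (fun t ht => (⟨ht.2.1, ht.1⟩ : t ∈ Ioc 0 h)) le_rfl)
    _ = eLpNorm (fun t => g (t - h) - g t) p (volume.restrict (Ioo 0 h)) := by
        rw [restrict_Ioo_eq_restrict_Ioc]
    _ = _ := by
        refine eLpNorm_congr_enorm_ae ((ae_restrict_mem measurableSet_Ioo).mono fun t ht => ?_)
        rw [hg0 (t - h) (by linarith [ht.2]), zero_sub, enorm_neg]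

/-- Translation of functions that vanish on `(-∞, 0]` decreases norms over `(0, T)`. -/
theorem eLpNorm_comp_sub_le {F : ℝ → X} (hF : ∀ t ≤ 0, F t = 0) {s : ℝ} (hs : 0 ≤ s) :
    eLpNorm (fun t => F (t - s)) p (volume.restrict (Ioo 0 T)) ≤
      eLpNorm F p (volume.restrict (Ioo 0 T)) := by
  rw [eLpNorm_comp_sub_right, ← eLpNorm_indicator_eq_eLpNorm_restrict measurableSet_Ioo,
    ← eLpNorm_indicator_eq_eLpNorm_restrict measurableSet_Ioo]
  refine eLpNorm_mono_enorm fun t => ?_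
  by_cases h0 : t ≤ 0
  · simp [indicator, hF t h0]
  · by_cases h1 : t ∈ Ioo (0 - s) (T - s)
    · rw [indicator_of_mem h1, indicator_of_mem (show t ∈ Ioo 0 T from
        ⟨not_le.1 h0, by linarith [h1.2]⟩)]
    · rw [indicator_of_notMem h1]; simp

theorem modulus_le_add (hg : StronglyMeasurable g) (hg0 : ∀ t ≤ 0, g t = 0) (hp : 1 ≤ p) {s : ℝ}
    (hs : 0 ≤ s) (hsh : s ≤ h) : modulus T p g h ≤ modulus T p g s + modulus T p g (h - s) := by
  have hm : ∀ r, AEStronglyMeasurable (fun t => g (t - r)) (volume.restrict (Ioo 0 T)) := fun r =>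
    (hg.comp_measurable (measurable_id.sub_const r)).aestronglyMeasurable
  have hsplit : (fun t => g (t - h) - g t) = (fun t => g (t - s) - g t) +
      (fun t => g (t - h) - g (t - s)) := by
    ext t; simp
  rw [modulus, hsplit]
  refine (eLpNorm_add_le ((hm s).sub hg.aestronglyMeasurable) ((hm h).sub (hm s)) hp).trans
    (add_le_add le_rfl ?_)
  have := eLpNorm_comp_sub_le (p := p) (T := T) (F := fun t => g (t - (h - s)) - g t)
    (fun t ht => by rw [hg0 t ht, hg0 _ (by linarith), sub_zero]) hs
  simp only [sub_sub, add_sub_cancel] at this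
  exact this

theorem measurable_modulus (hg : StronglyMeasurable g) (hp : p ≠ 0) (hp' : p ≠ ∞) :
    Measurable (modulus T p g) := by
  have : Measurable (Function.uncurry fun h t : ℝ => ‖g (t - h) - g t‖ₑ ^ p.toReal) :=
    (((hg.comp_measurable (measurable_snd.sub measurable_fst)).sub
        (hg.comp_measurable measurable_snd)).enorm).pow_const _
  have e : modulus T p g = fun h => (∫⁻ t in Ioo 0 T, ‖g (t - h) - g t‖ₑ ^ p.toReal) ^
      (1 / p.toReal) := by
    ext h
    rw [modulus, eLpNorm_eq_lintegral_rpow_enorm_toReal hp hp']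
  rw [e]
  exact this.lintegral_prod_right.pow_const _

theorem measurable_innerModulus (hg : StronglyMeasurable g) (hp : p ≠ 0) (hp' : p ≠ ∞) :
    Measurable (innerModulus T p g) := by
  have hset : MeasurableSet {z : ℝ × ℝ | z.1 < z.2} := measurableSet_lt measurable_fst measurable_snd
  have : Measurable (Function.uncurry fun h t : ℝ =>
      ‖(Ioi h).indicator (fun t => g (t - h) - g t) t‖ₑ ^ p.toReal) := by
    have h1 : StronglyMeasurable ({z : ℝ × ℝ | z.1 < z.2}.indicator fun z => g (z.2 - z.1) - g z.2) :=
      ((hg.comp_measurable (measurable_snd.sub measurable_fst)).sub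
        (hg.comp_measurable measurable_snd)).indicator hset
    exact h1.enorm.pow_const _
  have e : innerModulus T p g = fun h => (∫⁻ t in Ioo 0 T,
      ‖(Ioi h).indicator (fun t => g (t - h) - g t) t‖ₑ ^ p.toReal) ^ (1 / p.toReal) := by
    ext h
    rw [innerModulus, eLpNorm_eq_lintegral_rpow_enorm_toReal hp hp']
  rw [e]
  exact this.lintegral_prod_right.pow_const _

/-- Functions on `(-∞, T)` which vanish on `(-∞, 0]` and are in the Besov space. -/
structure ZeroExtBesov (T θ : ℝ) (p q : ℝ≥0∞) (g : ℝ → X) : Prop where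
  eq_zero : ∀ t ≤ 0, g t = 0
  memLpT : MemLpT T p g
  lt_top : eLpNorm (fun h : ℝ => ENNReal.ofReal (h ^ (-θ)) * modulus T p g h) q (dhh T) < ∞

theorem ZeroExtBesov.memBesov (hg : ZeroExtBesov T θ p q g) : MemBesov T θ p q g := by
  refine ⟨hg.memLpT, (eLpNorm_mono_ennreal (ae_dhh_mem.mono fun h hh => ?_)).trans_lt hg.lt_top⟩
  rw [← innerModulus_eq hh.1]
  exact mul_le_mul_right innerModulus_le _

theorem ZeroExtBesov.hardyCond (hg : ZeroExtBesov T θ p q g) : HardyCond T θ p q g :=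
  (eLpNorm_mono_ennreal (ae_dhh_mem.mono fun _ hh =>
    mul_le_mul_right (eLpNorm_le_modulus hg.eq_zero hh.2.le) _)).trans_lt hg.lt_top

theorem ZeroExtBesov.of_memBesov (hg : StronglyMeasurable g) (hg0 : ∀ t ≤ 0, g t = 0) (hp : 1 ≤ p)
    (hp' : p ≠ ∞) (hq : 1 ≤ q) (hB : MemBesov T θ p q g) (hH : HardyCond T θ p q g) :
    ZeroExtBesov T θ p q g := by
  refine ⟨hg0, hB.1, ?_⟩
  have hp0 : p ≠ 0 := (zero_lt_one.trans_le hp).ne'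
  have hmono : Monotone fun h : ℝ => eLpNorm g p (volume.restrict (Ioo 0 h)) := fun a b hab =>
    eLpNorm_mono_measure _ (Measure.restrict_mono (Ioo_subset_Ioo_right hab) le_rfl)
  have hρ : Measurable fun h : ℝ => ENNReal.ofReal (h ^ (-θ)) := by fun_prop
  have m1 : Measurable fun h : ℝ => ENNReal.ofReal (h ^ (-θ)) * innerModulus T p g h :=
    hρ.mul (measurable_innerModulus hg hp0 hp')
  have m2 : Measurable fun h : ℝ => ENNReal.ofReal (h ^ (-θ)) *
      eLpNorm g p (volume.restrict (Ioo 0 h)) := hρ.mul hmono.measurable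
  have h1 : eLpNorm (fun h : ℝ => ENNReal.ofReal (h ^ (-θ)) * innerModulus T p g h) q (dhh T) <
      ∞ := by
    refine (eLpNorm_mono_ennreal (ae_dhh_mem.mono fun h hh => ?_)).trans_lt hB.2
    rw [← innerModulus_eq hh.1]
  refine lt_of_le_of_lt ?_ (ENNReal.add_lt_top.2 ⟨h1, hH⟩)
  refine le_trans (eLpNorm_mono_ennreal (Eventually.of_forall fun h => ?_)) (eLpNorm_add_le
    m1.aestronglyMeasurable m2.aestronglyMeasurable hq)
  rw [Pi.add_apply, ← mul_add]
  exact mul_le_mul_right (modulus_le hg hg0 hp) _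

/-- The seminorm can be taken over all `h > 0`. -/
theorem ZeroExtBesov.lt_top' (h : ZeroExtBesov T θ p q g) (hT : 0 < T) (hθ : 0 < θ) (hp : 1 ≤ p)
    (hp' : p ≠ ∞) (hq : 1 ≤ q) (hg : StronglyMeasurable g) :
    eLpNorm (fun h : ℝ => ENNReal.ofReal (h ^ (-θ)) * modulus T p g h) q invMeas < ∞ := by
  have hp0 : p ≠ 0 := (zero_lt_one.trans_le hp).ne'
  have hρ : Measurable fun h : ℝ => ENNReal.ofReal (h ^ (-θ)) := by fun_prop
  set N := eLpNorm g p (volume.restrict (Ioo 0 T)) with hN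
  have m1 : Measurable ((Ioo 0 T).indicator fun h : ℝ =>
      ENNReal.ofReal (h ^ (-θ)) * modulus T p g h) :=
    (hρ.mul (measurable_modulus hg hp0 hp')).indicator measurableSet_Ioo
  -- From `h = T` on the modulus is the constant `N`, and `h^{-θ}` is in `L^q(dh / h)` away from
  -- `0`. The indicator starts at `T / 2` so that `h = T` is included.
  have m2 : Measurable ((Ioi (T / 2)).indicator fun h : ℝ => N * ENNReal.ofReal (h ^ (-θ))) :=
    (hρ.const_mul N).indicator measurableSet_Ioi
  refine lt_of_le_of_lt (le_trans (eLpNorm_mono_ennreal (ae_invMeas_pos.mono fun r hr => ?_))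
    (eLpNorm_add_le m1.aestronglyMeasurable m2.aestronglyMeasurable hq)) (ENNReal.add_lt_top.2 ⟨?_,
    ?_⟩)
  · rcases lt_or_ge r T with h1 | h1
    · rw [Pi.add_apply, indicator_of_mem (show r ∈ Ioo 0 T from ⟨hr, h1⟩)]
      exact le_self_add
    · rw [Pi.add_apply, indicator_of_mem (show r ∈ Ioi (T / 2) from
        mem_Ioi.2 (by linarith)), modulus_of_le h.eq_zero h1, mul_comm]
      exact le_add_self
  · rw [eLpNorm_indicator_eq_eLpNorm_restrict measurableSet_Ioo, invMeas_restrict]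
    exact h.lt_top
  · rw [eLpNorm_indicator_eq_eLpNorm_restrict measurableSet_Ioi,
      eLpNorm_ennreal_const_mul (zero_lt_one.trans_le hq).ne' _ hρ]
    exact ENNReal.mul_lt_top h.memLpT.2 (eLpNorm_rpow_Ioi_lt_top (by linarith) (by linarith)
      (zero_lt_one.trans_le hq).ne')

theorem ae_shift {P : ℝ → Prop} (hP : ∀ᵐ t ∂volume.restrict (Ioo 0 T), P t) (hh : 0 ≤ h) :
    ∀ᵐ t ∂volume.restrict (Ioo 0 (T - h)), P (t + h) := by
  rw [ae_restrict_iff' measurableSet_Ioo] at hP ⊢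
  have := (measurePreserving_add_right volume h).quasiMeasurePreserving.ae hP
  filter_upwards [this] with t ht hT
  exact ht ⟨by linarith [hT.1], by linarith [hT.2]⟩

theorem MemBesov.congr (hf : MemBesov T θ p q f) (h : g =ᵐ[volume.restrict (Ioo 0 T)] f) :
    MemBesov T θ p q g := by
  refine ⟨(memLp_congr_ae h).2 hf.1, (eLpNorm_mono_ennreal (ae_dhh_mem.mono fun r hr => ?_)).trans_lt
    hf.2⟩
  refine mul_le_mul_right (le_of_eq (eLpNorm_congr_ae ?_)) _
  filter_upwards [ae_shift h hr.1.le, ae_restrict_of_ae_restrict_of_subset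
    (Ioo_subset_Ioo_right (by linarith [hr.1] : T - r ≤ T)) h] with t h1 h2
  rw [h1, h2]

theorem HardyCond.congr (hf : HardyCond T θ p q f) (h : g =ᵐ[volume.restrict (Ioo 0 T)] f) :
    HardyCond T θ p q g := by
  refine (eLpNorm_mono_ennreal (ae_dhh_mem.mono fun r hr => ?_)).trans_lt hf
  exact mul_le_mul_right (le_of_eq (eLpNorm_congr_ae
    (ae_restrict_of_ae_restrict_of_subset (Ioo_subset_Ioo_right hr.2.le) h))) _

theorem ZeroTrace.congr (hf : ZeroTrace T f) (h : g =ᵐ[volume.restrict (Ioo 0 T)] f) :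
    ZeroTrace T g := by
  obtain ⟨v, h1, h2, h3⟩ := hf
  exact ⟨v, h1, h.trans h2, h3⟩

end Modulus

end

section

open Filter Topology

/-! ### Singular integrals in Besov spaces -/

section BesovRegularity

theorem lintegral_inv_mul_subst {h : ℝ} (hh : 0 < h) {A : Set ℝ} (hA : MeasurableSet A)
    (h0 : A ⊆ Ioi 0) {k : ℝ → ℝ≥0∞} (hk : Measurable k) :
    ∫⁻ s in A, ENNReal.ofReal s⁻¹ * k s =
      ∫⁻ σ in (fun σ => h * σ) ⁻¹' A, ENNReal.ofReal σ⁻¹ * k (h * σ) := by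
  have hpre : MeasurableSet ((fun σ => h * σ) ⁻¹' A) := measurable_const_mul h hA
  have h0' : (fun σ => h * σ) ⁻¹' A ⊆ Ioi 0 := fun σ hσ => (pos_iff_pos_of_mul_pos (h0 hσ)).1 hh
  have hk' : Measurable fun σ => k (h * σ) := hk.comp (measurable_const_mul h)
  rw [← lintegral_invMeas_restrict hA h0 hk, ← lintegral_invMeas_restrict hpre h0' hk', ← lintegral_indicator hA, ← lintegral_indicator hpre,
    ← lintegral_invMeas_comp_mul hh (hk.indicator hA)]
  rfl

variable {X : Type*} [NormedAddCommGroup X] {M C T θ h : ℝ} {p q : ℝ≥0∞} {g : ℝ → X}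

/-- Minkowski's inequality reduces this to single values of `s`; the translation by `r` does not
increase the norm, since the functions vanish on the negative axis. -/
theorem eLpNorm_window_le (hgm : StronglyMeasurable g) (hg0 : ∀ t ≤ 0, g t = 0) (hp : 1 ≤ p)
    (hp' : p ≠ ∞) {k : ℝ → ℝ≥0∞} (hk : Measurable k) {A : Set ℝ} (hA : MeasurableSet A)
    (h0 : A ⊆ Ioi 0) {r : ℝ} (hr : 0 ≤ r) :
    eLpNorm (fun t => ∫⁻ s in A, k s * ‖g (t - r - s) - g (t - r)‖ₑ) p (volume.restrict (Ioo 0 T)) ≤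
      ∫⁻ s in A, k s * modulus T p g s := by
  have hp0 : p ≠ 0 := (zero_lt_one.trans_le hp).ne'
  refine eLpNorm_lintegral_le (F := fun t s => k s * ‖g (t - r - s) - g (t - r)‖ₑ) ?_ hp
    (hk.mul (measurable_modulus hgm hp0 hp')) ?_
  · exact (hk.comp measurable_snd).mul ((hgm.comp_measurable
      ((measurable_fst.sub_const r).sub measurable_snd)).sub
      (hgm.comp_measurable (measurable_fst.sub_const r))).enorm
  · filter_upwards [ae_restrict_mem hA] with s hs
    have hs0 : 0 < s := h0 hs
    have hm : Measurable fun t => ‖g (t - r - s) - g (t - r)‖ₑ :=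
      ((hgm.comp_measurable ((measurable_id.sub_const r).sub_const s)).sub
      (hgm.comp_measurable (measurable_id.sub_const r))).enorm
    rw [eLpNorm_ennreal_const_mul hp0 _ hm, eLpNorm_enorm]
    exact mul_le_mul_right (eLpNorm_comp_sub_le (F := fun t => g (t - s) - g t)
      (fun t ht => by rw [hg0 t ht, hg0 _ (by linarith), sub_zero]) hr) _

theorem ofReal_inv_mul_eq (θ : ℝ) {s : ℝ} (hs : 0 < s) : ENNReal.ofReal s⁻¹ =
    ENNReal.ofReal (s ^ (θ - 1)) * ENNReal.ofReal (s ^ (-θ)) := by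
  rw [← ENNReal.ofReal_mul (by positivity), ← Real.rpow_add hs]
  congr 1
  rw [show θ - 1 + -θ = -1 by ring, Real.rpow_neg_one]

theorem ZeroExtBesov.measurable (hgm : StronglyMeasurable g) (hp : 1 ≤ p) (hp' : p ≠ ∞) :
    Measurable fun h : ℝ => ENNReal.ofReal (h ^ (-θ)) * modulus T p g h := by
  have hρ : Measurable fun h : ℝ => ENNReal.ofReal (h ^ (-θ)) := by fun_prop
  exact hρ.mul (measurable_modulus hgm (zero_lt_one.trans_le hp).ne' hp')

/-- By `s⁻¹ = s^{θ-1} s^{-θ}` this is Hölder's inequality against the power weight. It is the Dini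
condition in the `L^p` norm. -/
theorem ZeroExtBesov.lintegral_inv_mul_lt_top (hg : ZeroExtBesov T θ p q g)
    (hgm : StronglyMeasurable g) (hT : 0 < T) (hθ : 0 < θ) (hp : 1 ≤ p) (hp' : p ≠ ∞)
    (hq : 1 ≤ q) {H : ℝ} (hH : 0 < H) :
    ∫⁻ s in Ioc 0 H, ENNReal.ofReal s⁻¹ * modulus T p g s < ∞ := by
  have hΦ := hg.lt_top' hT hθ hp hp' hq hgm
  have hΦm := ZeroExtBesov.measurable (T := T) (θ := θ) hgm hp hp'
  rw [← restrict_Ioo_eq_restrict_Ioc]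
  refine lt_of_eq_of_lt ?_ ((lintegral_rpow_mul_le hθ hH hq hΦm).trans_lt
    (ENNReal.mul_lt_top (ENNReal.mul_lt_top ENNReal.ofReal_lt_top ENNReal.ofReal_lt_top) hΦ))
  refine setLIntegral_congr_fun measurableSet_Ioo fun s hs => ?_
  rw [ofReal_inv_mul_eq θ hs.1, mul_assoc]

theorem ZeroExtBesov.isDini (hg : ZeroExtBesov T θ p q g) (hgm : StronglyMeasurable g) (hT : 0 < T)
    (hθ : 0 < θ) (hp : 1 ≤ p) (hp' : p ≠ ∞) (hq : 1 ≤ q) (hM : 0 < M) : IsDini M T g where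
  stronglyMeasurable := hgm
  eq_zero := hg.eq_zero
  integrableOn := by
    refine IntegrableOn.mono_set (t := Iic 0 ∪ Icc 0 T) (IntegrableOn.union ?_
      (hg.memLpT.integrableOn hp)) fun t ht => ?_
    · exact integrableOn_zero.congr_fun (fun t ht => (hg.eq_zero t ht).symm) measurableSet_Iic
    · rcases le_total t 0 with h | h
      · exact Or.inl h
      · exact Or.inr ⟨h, ht⟩
  lintegral_dini_lt_top := by
    have hdm : Measurable (Function.uncurry fun t s : ℝ =>
        ENNReal.ofReal s⁻¹ * ‖g (t - s) - g t‖ₑ) :=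
      (measurable_snd.inv.ennreal_ofReal).mul
        ((hgm.comp_measurable (measurable_fst.sub measurable_snd)).sub
          (hgm.comp_measurable measurable_fst)).enorm
    set μ : Measure ℝ := volume.restrict (Ioo 0 T) with hμ
    set k : ℝ≥0∞ := μ univ ^ (1 / (1 : ℝ≥0∞).toReal - 1 / p.toReal) with hk
    have hk' : k ≠ ∞ := by
      refine ENNReal.rpow_ne_top_of_nonneg ?_ (by simp [hμ])
      have : 1 ≤ p.toReal := by
        have := ENNReal.toReal_mono hp' hp
        simpa using this
      rw [ENNReal.toReal_one, div_one, sub_nonneg]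
      exact (div_le_one (by linarith)).2 this
    have h1 : ∀ s, ∫⁻ t, ‖g (t - s) - g t‖ₑ ∂μ ≤ modulus T p g s * k := by
      intro s
      rw [← eLpNorm_one_eq_lintegral_enorm]
      exact eLpNorm_le_eLpNorm_mul_rpow_measure_univ hp
        ((hgm.comp_measurable (measurable_id.sub_const s)).sub hgm).aestronglyMeasurable
    unfold dini
    rw [← restrict_Ioo_eq_restrict_Ioc, lintegral_lintegral_swap hdm.aemeasurable]
    calc ∫⁻ s in Ioc 0 M, ∫⁻ t, ENNReal.ofReal s⁻¹ * ‖g (t - s) - g t‖ₑ ∂μ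
        ≤ ∫⁻ s in Ioc 0 M, ENNReal.ofReal s⁻¹ * modulus T p g s * k := by
          refine lintegral_mono fun s => ?_
          rw [lintegral_const_mul' _ _ ENNReal.ofReal_ne_top, mul_assoc]
          exact mul_le_mul_right (h1 s) _
      _ = (∫⁻ s in Ioc 0 M, ENNReal.ofReal s⁻¹ * modulus T p g s) * k :=
          lintegral_mul_const' _ _ hk'
      _ < ∞ := ENNReal.mul_lt_top (hg.lintegral_inv_mul_lt_top hgm hT hθ hp hp' hq hM)
          (lt_top_iff_ne_top.2 hk')

variable [NormedSpace ℂ X] [CompleteSpace X] {G S : ℝ → X →L[ℂ] X}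

/-- The effect of the singular integral operator on the `L^p` modulus of continuity. -/
theorem modulus_derivConv_le (hk : SingularKernel (2 * T) C G S) (hg : IsDini (2 * T) T g)
    (hp : 1 ≤ p) (hp' : p ≠ ∞) (hh : 0 < h) (hhT : h ≤ T) :
    modulus T p (derivConv G S (2 * T) g) h ≤ ENNReal.ofReal (8 * C) * (modulus T p g h +
      (∫⁻ s in Ioc 0 (2 * h), ENNReal.ofReal s⁻¹ * modulus T p g s) +
      (∫⁻ s in Ioc 0 h, ENNReal.ofReal s⁻¹ * modulus T p g s) +
      ∫⁻ s in Ioc h (2 * T), ENNReal.ofReal (h * (s ^ 2)⁻¹) * modulus T p g s) := by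
  have hp0 : p ≠ 0 := (zero_lt_one.trans_le hp).ne'
  have hgm := hg.stronglyMeasurable
  have hg0 := hg.eq_zero
  -- Stated on the whole half line, including the negative axis, so that it can be translated by
  -- `h`.
  have hfin : ∀ᵐ t ∂volume, t ∈ Iio T → dini (2 * T) g t < ∞ := by
    filter_upwards [(ae_restrict_iff' measurableSet_Ioo).1 hg.ae_dini_lt_top] with t ht htT
    rcases le_or_gt t 0 with h0 | h0
    · have : dini (2 * T) g t = 0 := by
        refine setLIntegral_eq_zero measurableSet_Ioc fun s hs => ?_
        simp [hg0 t h0, hg0 (t - s) (by linarith [hs.1])]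
      rw [this]; exact ENNReal.zero_lt_top
    · exact ht ⟨h0, htT⟩
  have hfin' : ∀ᵐ t ∂volume, t - h ∈ Iio T → dini (2 * T) g (t - h) < ∞ :=
    (measurePreserving_sub_right volume h).quasiMeasurePreserving.ae hfin
  have hdiff : ∀ r s, Measurable fun t => ‖g (t - r - s) - g (t - r)‖ₑ := fun r s =>
    ((hgm.comp_measurable ((measurable_id.sub_const r).sub_const s)).sub
      (hgm.comp_measurable (measurable_id.sub_const r))).enorm
  have hint : ∀ (k : ℝ → ℝ≥0∞) (A : Set ℝ) (r : ℝ), Measurable k →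
      Measurable fun t => ∫⁻ s in A, k s * ‖g (t - r - s) - g (t - r)‖ₑ := by
    intro k A r hk
    have : Measurable (Function.uncurry fun t s : ℝ => k s * ‖g (t - r - s) - g (t - r)‖ₑ) :=
      (hk.comp measurable_snd).mul ((hgm.comp_measurable
        ((measurable_fst.sub_const r).sub measurable_snd)).sub
        (hgm.comp_measurable (measurable_fst.sub_const r))).enorm
    exact this.lintegral_prod_right
  have hk1 : Measurable fun s : ℝ => ENNReal.ofReal s⁻¹ := measurable_ofReal_inv
  have hk2 : Measurable fun s : ℝ => ENNReal.ofReal (h * (s ^ 2)⁻¹) := by fun_prop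
  set f₁ : ℝ → ℝ≥0∞ := fun t => ‖g (t - 0 - h) - g (t - 0)‖ₑ with hf₁
  set f₂ : ℝ → ℝ≥0∞ := fun t => ∫⁻ s in Ioc 0 (2 * h), ENNReal.ofReal s⁻¹ *
    ‖g (t - 0 - s) - g (t - 0)‖ₑ with hf₂
  set f₃ : ℝ → ℝ≥0∞ := fun t => ∫⁻ s in Ioc 0 h, ENNReal.ofReal s⁻¹ *
    ‖g (t - h - s) - g (t - h)‖ₑ with hf₃
  set f₄ : ℝ → ℝ≥0∞ := fun t => ∫⁻ s in Ioc h (2 * T), ENNReal.ofReal (h * (s ^ 2)⁻¹) *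
    ‖g (t - 0 - s) - g (t - 0)‖ₑ with hf₄
  have m₁ : Measurable f₁ := hdiff 0 h
  have m₂ : Measurable f₂ := hint _ _ _ hk1
  have m₃ : Measurable f₃ := hint _ _ _ hk1
  have m₄ : Measurable f₄ := hint _ _ _ hk2
  have key : modulus T p (derivConv G S (2 * T) g) h ≤
      eLpNorm (fun t => ENNReal.ofReal (8 * C) * (f₁ + f₂ + f₃ + f₄) t) p
        (volume.restrict (Ioo 0 T)) := by
    refine eLpNorm_mono_enorm_ae ?_
    rw [ae_restrict_iff' measurableSet_Ioo]
    filter_upwards [hfin, hfin'] with t h1 h2 ht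
    have := enorm_derivConv_sub_le hk hgm hg0 hh hhT ht.2.le (h1 ht.2)
      (h2 (by simp only [mem_Iio]; linarith [ht.2]))
    simpa only [enorm_eq_self, hf₁, hf₂, hf₃, hf₄, Pi.add_apply, sub_zero] using this
  refine key.trans ?_
  rw [eLpNorm_ennreal_const_mul hp0 _ (((m₁.add m₂).add m₃).add m₄)]
  refine mul_le_mul_right ?_ _
  refine (eLpNorm_add_le ((m₁.add m₂).add m₃).aestronglyMeasurable m₄.aestronglyMeasurable hp).trans
    (add_le_add ((eLpNorm_add_le (m₁.add m₂).aestronglyMeasurable m₃.aestronglyMeasurable hp).trans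
    (add_le_add ((eLpNorm_add_le m₁.aestronglyMeasurable m₂.aestronglyMeasurable hp).trans
    (add_le_add ?_ ?_)) ?_)) ?_)
  · simp only [hf₁, sub_zero]
    rw [eLpNorm_enorm]
    rfl
  · exact eLpNorm_window_le hgm hg0 hp hp' hk1 measurableSet_Ioc Ioc_subset_Ioi_self le_rfl
  · exact eLpNorm_window_le hgm hg0 hp hp' hk1 measurableSet_Ioc Ioc_subset_Ioi_self hh.le
  · exact eLpNorm_window_le hgm hg0 hp hp' hk2 measurableSet_Ioc
      (fun s hs => hh.trans hs.1) le_rfl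

/-- After the substitution `s = h σ`, the bound for the modulus becomes a sum of averages of the
dilates `Φ (σ h)`, where `Φ` is the weighted modulus of `g`. The weights are `σ^{θ-1}` near `0` and
`σ^{θ-2}` near infinity, integrable because `0 < θ < 1`. As `dh / h` is dilation invariant, each
average is bounded in `L^q`. -/
theorem ZeroExtBesov.derivConv (hg : ZeroExtBesov T θ p q g) (hgm : StronglyMeasurable g)
    (hT : 0 < T) (hθ : θ ∈ Ioo 0 1) (hp : 1 ≤ p) (hp' : p ≠ ∞) (hq : 1 ≤ q)
    (hk : SingularKernel (2 * T) C G S) :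
    ZeroExtBesov T θ p q (derivConv G S (2 * T) g) := by
  have hM : 0 < 2 * T := by linarith
  have hd := hg.isDini hgm hT hθ.1 hp hp' hq hM
  have hp0 : p ≠ 0 := (zero_lt_one.trans_le hp).ne'
  have hq0 : q ≠ 0 := (zero_lt_one.trans_le hq).ne'
  have hzero : ∀ t ≤ 0, MaxReg.derivConv G S (2 * T) g t = 0 := fun t ht =>
    derivConv_eq_of_nonpos hg.eq_zero hM.le ht
  have hmm : Measurable (modulus T p g) := measurable_modulus hgm hp0 hp'
  refine ⟨hzero, ⟨?_, ?_⟩, ?_⟩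
  · exact ((integrableOn_derivConv hk hM hgm hd.integrableOn
      hd.lintegral_dini_lt_top).mono_set Ioo_subset_Ioc_self).aestronglyMeasurable
  -- At `h = T` the modulus is the whole `L^p` norm, so the estimate for the modulus yields the
  -- integrability as well.
  · rw [← modulus_of_le hzero le_rfl]
    refine (modulus_derivConv_le hk hd hp hp' hT le_rfl).trans_lt ?_
    have hI := fun H (hH : (0 : ℝ) < H) => hg.lintegral_inv_mul_lt_top hgm hT hθ.1 hp hp' hq hH
    refine ENNReal.mul_lt_top ENNReal.ofReal_lt_top (ENNReal.add_lt_top.2 ⟨ENNReal.add_lt_top.2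
      ⟨ENNReal.add_lt_top.2 ⟨?_, hI _ hM⟩, hI _ hT⟩, lt_of_le_of_lt ?_ (hI _ hM)⟩)
    · rw [modulus_of_le hg.eq_zero le_rfl]
      exact hg.memLpT.2
    · refine (setLIntegral_mono' measurableSet_Ioc fun s hs => ?_).trans
        (lintegral_mono_set (Ioc_subset_Ioc_left hT.le))
      refine mul_le_mul_left (ENNReal.ofReal_le_ofReal ?_) _
      have hs0 : 0 < s := hT.trans hs.1
      rw [← div_eq_mul_inv, div_le_iff₀ (by positivity), sq, ← mul_assoc, inv_mul_cancel₀ hs0.ne',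
        one_mul]
      exact hs.1.le
  · set Φ : ℝ → ℝ≥0∞ := fun h => ENNReal.ofReal (h ^ (-θ)) * modulus T p g h with hΦd
    have hΦ : eLpNorm Φ q invMeas < ∞ := hg.lt_top' hT hθ.1 hp hp' hq hgm
    have hΦm : Measurable Φ := ZeroExtBesov.measurable hgm hp hp'
    set w₁ : ℝ → ℝ≥0∞ := fun σ => ENNReal.ofReal (σ ^ (θ - 1)) with hw₁
    set w₂ : ℝ → ℝ≥0∞ := fun σ => ENNReal.ofReal (σ ^ (-(1 - θ) - 1)) with hw₂
    have hw₁m : Measurable w₁ := by fun_prop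
    have hw₂m : Measurable w₂ := by fun_prop
    set F₂ : ℝ → ℝ≥0∞ := fun h => ∫⁻ σ in Ioc 0 2, w₁ σ * Φ (σ * h) with hF₂
    set F₃ : ℝ → ℝ≥0∞ := fun h => ∫⁻ σ in Ioc 0 1, w₁ σ * Φ (σ * h) with hF₃
    set F₄ : ℝ → ℝ≥0∞ := fun h => ∫⁻ σ in Ioi 1, w₂ σ * Φ (σ * h) with hF₄
    have hFm : ∀ (w : ℝ → ℝ≥0∞) (A : Set ℝ), Measurable w →
        Measurable fun h => ∫⁻ σ in A, w σ * Φ (σ * h) := by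
      intro w A hw
      have : Measurable (Function.uncurry fun h σ : ℝ => w σ * Φ (σ * h)) :=
        (hw.comp measurable_snd).mul (hΦm.comp (measurable_snd.mul measurable_fst))
      exact this.lintegral_prod_right
    have hbound : ∀ h ∈ Ioo 0 T, ENNReal.ofReal (h ^ (-θ)) *
        modulus T p (MaxReg.derivConv G S (2 * T) g) h ≤
        ENNReal.ofReal (8 * C) * (Φ + F₂ + F₃ + F₄) h := by
      intro h hh
      have hρ : ∀ σ, 0 < σ → ENNReal.ofReal (h ^ (-θ)) * (ENNReal.ofReal σ⁻¹ *
          modulus T p g (h * σ)) = w₁ σ * Φ (σ * h) := by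
        intro σ hσ
        rw [hw₁, hΦd, ofReal_inv_mul_eq θ hσ]
        simp only
        rw [Real.mul_rpow hσ.le hh.1.le, ENNReal.ofReal_mul (by positivity), mul_comm σ h]
        ring
      refine (mul_le_mul_right (modulus_derivConv_le hk hd hp hp' hh.1 hh.2.le) _).trans ?_
      rw [mul_left_comm]
      refine mul_le_mul_right ?_ _
      rw [mul_add, mul_add, mul_add]
      have hpre : ∀ b, (fun σ => h * σ) ⁻¹' Ioc 0 (b * h) = Ioc 0 b := by
        intro b
        ext σ
        simp only [mem_preimage, mem_Ioc]
        rw [mul_comm b h, mul_le_mul_iff_right₀ hh.1, mul_pos_iff_of_pos_left hh.1]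
      have hsub : ∀ b, ENNReal.ofReal (h ^ (-θ)) * ∫⁻ s in Ioc 0 (b * h), ENNReal.ofReal s⁻¹ *
          modulus T p g s = ∫⁻ σ in Ioc 0 b, w₁ σ * Φ (σ * h) := by
        intro b
        rw [lintegral_inv_mul_subst hh.1 measurableSet_Ioc Ioc_subset_Ioi_self hmm, hpre,
          ← lintegral_const_mul' _ _ ENNReal.ofReal_ne_top]
        exact setLIntegral_congr_fun measurableSet_Ioc fun σ hσ => hρ σ hσ.1
      refine add_le_add (add_le_add (add_le_add le_rfl (hsub 2).le) ?_) ?_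
      · have := hsub 1
        rw [one_mul] at this
        exact this.le
      · have hpre' : (fun σ => h * σ) ⁻¹' Ioi h = Ioi 1 := by
          ext σ
          simp only [mem_preimage, mem_Ioi]
          rw [lt_mul_iff_one_lt_right hh.1]
        have hkm : Measurable fun s => ENNReal.ofReal (h * s⁻¹) * modulus T p g s :=
          Measurable.mul (by fun_prop) hmm
        calc ENNReal.ofReal (h ^ (-θ)) * ∫⁻ s in Ioc h (2 * T),
              ENNReal.ofReal (h * (s ^ 2)⁻¹) * modulus T p g s
            ≤ ENNReal.ofReal (h ^ (-θ)) * ∫⁻ s in Ioi h,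
              ENNReal.ofReal s⁻¹ * (ENNReal.ofReal (h * s⁻¹) * modulus T p g s) := by
              refine mul_le_mul_right ((lintegral_mono_set Ioc_subset_Ioi_self).trans (le_of_eq ?_)) _
              refine setLIntegral_congr_fun measurableSet_Ioi fun s hs => ?_
              have hs0 : 0 < s := hh.1.trans hs
              rw [← mul_assoc, ← ENNReal.ofReal_mul (by positivity)]
              congr 2
              rw [sq, mul_inv]; ring
          _ = F₄ h := by
              rw [lintegral_inv_mul_subst hh.1 measurableSet_Ioi (Ioi_subset_Ioi hh.1.le) hkm, hpre',
                ← lintegral_const_mul' _ _ ENNReal.ofReal_ne_top]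
              refine setLIntegral_congr_fun measurableSet_Ioi fun σ hσ => ?_
              have hσ0 : 0 < σ := zero_lt_one.trans hσ
              have e1 : h * (h * σ)⁻¹ = σ⁻¹ := by
                have := hh.1.ne'
                field_simp
              have e2 : w₂ σ = ENNReal.ofReal σ⁻¹ * w₁ σ := by
                rw [hw₁, hw₂]
                simp only
                rw [← ENNReal.ofReal_mul (by positivity), ← Real.rpow_neg_one, ← Real.rpow_add hσ0]
                congr 2
                ring
              rw [e1, e2, mul_assoc, ← hρ σ hσ0]
              ring
    have hfin : eLpNorm (fun h => ENNReal.ofReal (8 * C) * (Φ + F₂ + F₃ + F₄) h) q invMeas < ∞ := by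
      have m₂ : Measurable F₂ := hFm _ _ hw₁m
      have m₃ : Measurable F₃ := hFm _ _ hw₁m
      have m₄ : Measurable F₄ := hFm _ _ hw₂m
      rw [eLpNorm_ennreal_const_mul hq0 _ (((hΦm.add m₂).add m₃).add m₄)]
      refine ENNReal.mul_lt_top ENNReal.ofReal_lt_top ?_
      refine ((eLpNorm_add_le ((hΦm.add m₂).add m₃).aestronglyMeasurable m₄.aestronglyMeasurable
        hq).trans (add_le_add ((eLpNorm_add_le (hΦm.add m₂).aestronglyMeasurable
        m₃.aestronglyMeasurable hq).trans (add_le_add (eLpNorm_add_le hΦm.aestronglyMeasurable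
        m₂.aestronglyMeasurable hq) le_rfl)) le_rfl)).trans_lt ?_
      have hw₁i : ∀ b : ℝ, 0 ≤ b → ∫⁻ σ in Ioc 0 b, w₁ σ < ∞ := fun b hb => by
        rw [hw₁, lintegral_Ioc_rpow hθ.1 hb]; exact ENNReal.ofReal_lt_top
      have hw₂i : ∫⁻ σ in Ioi 1, w₂ σ < ∞ := by
        rw [hw₂, lintegral_Ioi_rpow (by linarith [hθ.2]) one_pos]; exact ENNReal.ofReal_lt_top
      refine ENNReal.add_lt_top.2 ⟨ENNReal.add_lt_top.2 ⟨ENNReal.add_lt_top.2 ⟨hΦ, ?_⟩, ?_⟩, ?_⟩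
      · exact (eLpNorm_lintegral_dilation_le hq hΦm hw₁m measurableSet_Ioc
          Ioc_subset_Ioi_self).trans_lt (ENNReal.mul_lt_top (hw₁i 2 zero_le_two) hΦ)
      · exact (eLpNorm_lintegral_dilation_le hq hΦm hw₁m measurableSet_Ioc
          Ioc_subset_Ioi_self).trans_lt (ENNReal.mul_lt_top (hw₁i 1 zero_le_one) hΦ)
      · exact (eLpNorm_lintegral_dilation_le hq hΦm hw₂m measurableSet_Ioi
          (Ioi_subset_Ioi zero_le_one)).trans_lt (ENNReal.mul_lt_top hw₂i hΦ)
    refine (eLpNorm_mono_ennreal (ae_dhh_mem.mono hbound)).trans_lt (lt_of_le_of_lt ?_ hfin)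
    rw [← invMeas_restrict]
    exact eLpNorm_mono_measure _ Measure.restrict_le_self

end BesovRegularity

end

section

open Filter Topology

/-! ### Hardy's inequalities -/

section Hardy

/-- Iteration of a dilation inequality. -/
theorem le_tsum_of_dilation_le {A W : ℝ → ℝ≥0∞} {k l : ℝ} (hk : 0 ≤ k) {s : Set ℝ}
    (hs : ∀ h ∈ s, l * h ∈ s) (hrec : ∀ h ∈ s, A h ≤ ENNReal.ofReal k * A (l * h) + W h)
    (hlim : ∀ h ∈ s, Tendsto (fun n : ℕ => ENNReal.ofReal (k ^ n) * A (l ^ n * h)) atTop (𝓝 0))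
    {h : ℝ} (hh : h ∈ s) : A h ≤ ∑' j : ℕ, ENNReal.ofReal (k ^ j) * W (l ^ j * h) := by
  have hmem : ∀ n : ℕ, l ^ n * h ∈ s := by
    intro n
    induction n with
    | zero => simpa using hh
    | succ n ih => rw [pow_succ', mul_assoc]; exact hs _ ih
  have hn : ∀ n : ℕ, A h ≤ ENNReal.ofReal (k ^ n) * A (l ^ n * h) +
      ∑ j ∈ Finset.range n, ENNReal.ofReal (k ^ j) * W (l ^ j * h) := by
    intro n
    induction n with
    | zero => simp
    | succ n ih =>
      refine ih.trans ?_
      rw [Finset.sum_range_succ]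
      have := mul_le_mul_right (hrec _ (hmem n)) (ENNReal.ofReal (k ^ n))
      rw [mul_add, ← mul_assoc, ← ENNReal.ofReal_mul (by positivity), ← pow_succ, ← mul_assoc l,
        ← pow_succ'] at this
      calc _ ≤ ENNReal.ofReal (k ^ (n + 1)) * A (l ^ (n + 1) * h) +
            ENNReal.ofReal (k ^ n) * W (l ^ n * h) +
            ∑ j ∈ Finset.range n, ENNReal.ofReal (k ^ j) * W (l ^ j * h) := by gcongr
        _ = _ := by ring
  have h1 : Tendsto (fun n : ℕ => ENNReal.ofReal (k ^ n) * A (l ^ n * h) +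
      ∑' j : ℕ, ENNReal.ofReal (k ^ j) * W (l ^ j * h)) atTop
      (𝓝 (0 + ∑' j : ℕ, ENNReal.ofReal (k ^ j) * W (l ^ j * h))) :=
    (hlim h hh).add tendsto_const_nhds
  rw [zero_add] at h1
  exact ge_of_tendsto' h1 fun n => (hn n).trans (add_le_add le_rfl (ENNReal.sum_le_tsum _))

/-- In the iterated inequality the weight `h^{-θ}` turns the `j`-th term into `(k l^θ)^j` times a
dilate of the weighted `W`. All dilates have the same norm, and the geometric series converges. -/
theorem eLpNorm_lt_top_of_dilation_le {A W : ℝ → ℝ≥0∞} {k l θ : ℝ} {q : ℝ≥0∞} (hq : 1 ≤ q)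
    (hk : 0 ≤ k) (hl : 0 < l) (hkl : k * l ^ θ < 1) {s : Set ℝ} (hsm : MeasurableSet s)
    (hs0 : s ⊆ Ioi 0) (hs : ∀ h ∈ s, l * h ∈ s)
    (hrec : ∀ h ∈ s, A h ≤ ENNReal.ofReal k * A (l * h) + W h)
    (hlim : ∀ h ∈ s, Tendsto (fun n : ℕ => ENNReal.ofReal (k ^ n) * A (l ^ n * h)) atTop (𝓝 0))
    (hW : Measurable W)
    (hWq : eLpNorm (fun h => ENNReal.ofReal (h ^ (-θ)) * W h) q invMeas < ∞) :
    eLpNorm (fun h => ENNReal.ofReal (h ^ (-θ)) * A h) q (invMeas.restrict s) < ∞ := by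
  set Φ : ℝ → ℝ≥0∞ := fun h => ENNReal.ofReal (h ^ (-θ)) * W h with hΦ
  have hΦm : Measurable Φ := Measurable.mul (by fun_prop) hW
  have hkl0 : 0 ≤ k * l ^ θ := by positivity
  have hle : ∀ h ∈ s, ENNReal.ofReal (h ^ (-θ)) * A h ≤
      ∑' j : ℕ, ENNReal.ofReal ((k * l ^ θ) ^ j) * Φ (l ^ j * h) := by
    intro h hh
    have h0 : 0 < h := hs0 hh
    refine (mul_le_mul_right (le_tsum_of_dilation_le hk hs hrec hlim hh) _).trans (le_of_eq ?_)
    rw [← ENNReal.tsum_mul_left]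
    refine tsum_congr fun j => ?_
    have hlj : 0 < l ^ j := pow_pos hl j
    have e : (k * l ^ θ) ^ j * (l ^ j * h) ^ (-θ) = h ^ (-θ) * k ^ j := by
      rw [Real.mul_rpow hlj.le h0.le, mul_pow, ← Real.rpow_natCast (l ^ θ), ← Real.rpow_mul hl.le,
        ← Real.rpow_natCast l, ← Real.rpow_mul hl.le, mul_neg, Real.rpow_neg hl.le,
        mul_comm (j : ℝ) θ]
      have := (Real.rpow_pos_of_pos hl (θ * j)).ne'
      field_simp
    rw [hΦ]
    simp only
    rw [← mul_assoc, ← mul_assoc, ← ENNReal.ofReal_mul (by positivity),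
      ← ENNReal.ofReal_mul (by positivity), e]
  refine (eLpNorm_mono_ennreal ((ae_restrict_mem hsm).mono hle)).trans_lt
    ((eLpNorm_mono_measure _ Measure.restrict_le_self).trans_lt
    ((eLpNorm_tsum_dilation_le (l := fun j => l ^ j) hq hΦm fun j => pow_pos hl j).trans_lt
    (ENNReal.mul_lt_top ?_ hWq)))
  rw [← ENNReal.ofReal_tsum_of_nonneg (fun n => by positivity)
    (summable_geometric_of_lt_one hkl0 hkl)]
  exact ENNReal.ofReal_lt_top

variable {X : Type*} [NormedAddCommGroup X] {T θ h : ℝ} {p q : ℝ≥0∞} {f g : ℝ → X}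

theorem eLpNorm_rpow_Ioo_two_mul (F : ℝ → X) (hp0 : p ≠ 0) (hp' : p ≠ ∞) (hh : 0 < h) :
    eLpNorm F p (volume.restrict (Ioo 0 (2 * h))) ^ p.toReal =
      eLpNorm F p (volume.restrict (Ioo 0 h)) ^ p.toReal +
      eLpNorm F p (volume.restrict (Ioo h (2 * h))) ^ p.toReal := by
  have hr : p.toReal ≠ 0 := (ENNReal.toReal_pos hp0 hp').ne'
  simp only [eLpNorm_eq_lintegral_rpow_enorm_toReal hp0 hp', ← ENNReal.rpow_mul,
    one_div_mul_cancel hr, ENNReal.rpow_one]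
  rw [restrict_Ioo_eq_restrict_Ioc (a := 0) (b := h), ← lintegral_union measurableSet_Ioo,
    Ioc_union_Ioo_eq_Ioo hh.le (by linarith)]
  exact disjoint_left.2 fun t h1 h2 => not_lt.2 h1.2 h2.1

/-- Comparison of a function on `(0, 2h)` with its restriction to `(0, h)`, repeated. -/
theorem eLpNorm_two_mul_le (hg : StronglyMeasurable g) (hp : 1 ≤ p) (hp' : p ≠ ∞) (hh : 0 < h) :
    ENNReal.ofReal (2 ^ (1 / p.toReal)) * eLpNorm g p (volume.restrict (Ioo 0 h)) ≤
      eLpNorm g p (volume.restrict (Ioo 0 (2 * h))) + innerModulus (2 * h) p g h ∧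
    eLpNorm g p (volume.restrict (Ioo 0 (2 * h))) ≤ ENNReal.ofReal (2 ^ (1 / p.toReal)) *
      eLpNorm g p (volume.restrict (Ioo 0 h)) + innerModulus (2 * h) p g h := by
  have hp0 : p ≠ 0 := (zero_lt_one.trans_le hp).ne'
  have hr := ENNReal.toReal_pos hp0 hp'
  -- `g + D` repeats the values of `g` on `(0, h)` once more on `(h, 2h)`; its norm is `2^{1/p}`
  -- times that of `g` on `(0, h)`.
  set D : ℝ → X := (Ioi h).indicator fun t => g (t - h) - g t with hD
  have hDm : StronglyMeasurable D :=
    ((hg.comp_measurable (measurable_id.sub_const h)).sub hg).indicator measurableSet_Ioi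
  have e1 : eLpNorm (g + D) p (volume.restrict (Ioo 0 h)) =
      eLpNorm g p (volume.restrict (Ioo 0 h)) := by
    refine eLpNorm_congr_ae ((ae_restrict_mem measurableSet_Ioo).mono fun t ht => ?_)
    rw [Pi.add_apply, hD, indicator_of_notMem (by simpa using ht.2.le), add_zero]
  have e2 : eLpNorm (g + D) p (volume.restrict (Ioo h (2 * h))) =
      eLpNorm g p (volume.restrict (Ioo 0 h)) := by
    have := eLpNorm_comp_sub_right (p := p) g h h (2 * h)
    rw [sub_self, show 2 * h - h = h by ring] at this
    rw [← this]
    refine eLpNorm_congr_ae ((ae_restrict_mem measurableSet_Ioo).mono fun t ht => ?_)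
    rw [Pi.add_apply, hD, indicator_of_mem (mem_Ioi.2 ht.1), add_sub_cancel]
  have e3 : eLpNorm (g + D) p (volume.restrict (Ioo 0 (2 * h))) =
      ENNReal.ofReal (2 ^ (1 / p.toReal)) * eLpNorm g p (volume.restrict (Ioo 0 h)) := by
    have h1 := eLpNorm_rpow_Ioo_two_mul (g + D) hp0 hp' hh
    rw [e1, e2, ← two_mul] at h1
    have h2 := congrArg (fun x : ℝ≥0∞ => x ^ (1 / p.toReal)) h1
    simp only [← ENNReal.rpow_mul, mul_one_div_cancel hr.ne', ENNReal.rpow_one] at h2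
    rw [h2, ENNReal.mul_rpow_of_nonneg _ _ (by positivity), ← ENNReal.rpow_mul,
      mul_one_div_cancel hr.ne', ENNReal.rpow_one, ← ENNReal.ofReal_rpow_of_pos two_pos,
      ENNReal.ofReal_ofNat]
  rw [← e3]
  refine ⟨eLpNorm_add_le hg.aestronglyMeasurable hDm.aestronglyMeasurable hp, ?_⟩
  have := eLpNorm_sub_le (μ := volume.restrict (Ioo 0 (2 * h)))
    (hg.add hDm).aestronglyMeasurable hDm.aestronglyMeasurable hp
  rwa [add_sub_cancel_right] at this

theorem innerModulus_mono {T' : ℝ} (hT : T' ≤ T) : innerModulus T' p g h ≤ innerModulus T p g h :=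
  eLpNorm_mono_measure _ (Measure.restrict_mono (Ioo_subset_Ioo_right hT) le_rfl)

theorem innerModulus_eq_zero (hh : T ≤ h) : innerModulus T p g h = 0 := by
  have : eLpNorm ((Ioi h).indicator fun t => g (t - h) - g t) p (volume.restrict (Ioo 0 T)) =
      eLpNorm (fun _ => (0 : X)) p (volume.restrict (Ioo 0 T)) := by
    refine eLpNorm_congr_ae ((ae_restrict_mem measurableSet_Ioo).mono fun t ht => ?_)
    exact indicator_of_notMem (by simpa using (ht.2.trans_le hh).le) _
  rw [innerModulus, this, eLpNorm_zero']

theorem MemBesov.innerModulus_lt_top (hg : MemBesov T θ p q g) :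
    eLpNorm (fun h : ℝ => ENNReal.ofReal (h ^ (-θ)) * innerModulus T p g h) q invMeas < ∞ := by
  have h1 : eLpNorm ((Ioo 0 T).indicator fun h : ℝ =>
      ENNReal.ofReal (h ^ (-θ)) * innerModulus T p g h) q invMeas < ∞ := by
    rw [eLpNorm_indicator_eq_eLpNorm_restrict measurableSet_Ioo, invMeas_restrict]
    refine (eLpNorm_mono_ennreal (ae_dhh_mem.mono fun h hh => ?_)).trans_lt hg.2
    rw [← innerModulus_eq hh.1]
  refine (eLpNorm_mono_ennreal (ae_invMeas_pos.mono fun h hh => ?_)).trans_lt h1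
  rcases lt_or_ge h T with h2 | h2
  · rw [indicator_of_mem (show h ∈ Ioo 0 T from ⟨hh, h2⟩)]
  · rw [innerModulus_eq_zero h2, mul_zero]; exact zero_le

theorem eLpNorm_le_of_eq_zero (hg0 : ∀ t, t ∉ Ioo 0 T → g t = 0) (s : Set ℝ) :
    eLpNorm g p (volume.restrict s) ≤ eLpNorm g p (volume.restrict (Ioo 0 T)) := by
  have : g = (Ioo 0 T).indicator g := (indicator_eq_self.2 fun t ht => by
    by_contra hcon; exact ht (hg0 t hcon)).symm
  rw [← eLpNorm_indicator_eq_eLpNorm_restrict (f := g) measurableSet_Ioo, ← this]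
  exact eLpNorm_mono_measure _ Measure.restrict_le_self

/-- Hardy's inequality for small smoothness. -/
theorem MemBesov.hardyCond_of_lt (hg : MemBesov T θ p q g) (hgm : StronglyMeasurable g)
    (hg0 : ∀ t, t ∉ Ioo 0 T → g t = 0) (hT : 0 < T) (hθ : 0 < θ) (hθp : θ < 1 / p.toReal)
    (hp : 1 ≤ p) (hp' : p ≠ ∞) (hq : 1 ≤ q) : HardyCond T θ p q g := by
  have hp0 : p ≠ 0 := (zero_lt_one.trans_le hp).ne'
  have hq0 : q ≠ 0 := (zero_lt_one.trans_le hq).ne'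
  have hr := ENNReal.toReal_pos hp0 hp'
  have hr1 : 1 ≤ p.toReal := by simpa using ENNReal.toReal_mono hp' hp
  set N := eLpNorm g p (volume.restrict (Ioo 0 T)) with hN
  have hNtop : N < ∞ := hg.1.2
  set d : ℝ := 2 ^ (1 / p.toReal) with hd
  have hd0 : 0 < d := by positivity
  have hd1 : 1 < d := Real.one_lt_rpow one_lt_two (by positivity)
  have hd2 : d ≤ 2 := by
    calc d ≤ 2 ^ (1 : ℝ) := Real.rpow_le_rpow_of_exponent_le one_le_two
          ((div_le_one hr).2 hr1)
      _ = 2 := Real.rpow_one 2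
  -- For `h > T / 2` doubling would leave the interval; there the full norm is used as the error
  -- term.
  set W : ℝ → ℝ≥0∞ := innerModulus T p g + (Ioi (T / 2)).indicator fun _ => N with hW
  have hWm : Measurable W := (measurable_innerModulus hgm hp0 hp').add
    (measurable_const.indicator measurableSet_Ioi)
  have hAN : ∀ h, eLpNorm g p (volume.restrict (Ioo 0 h)) ≤ N := fun h =>
    eLpNorm_le_of_eq_zero hg0 _
  have hrec : ∀ h ∈ Ioi (0 : ℝ), eLpNorm g p (volume.restrict (Ioo 0 h)) ≤
      ENNReal.ofReal d⁻¹ * eLpNorm g p (volume.restrict (Ioo 0 (2 * h))) + W h := by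
    intro h hh
    rcases le_or_gt (2 * h) T with h1 | h1
    · have h2 := (eLpNorm_two_mul_le hgm hp hp' hh).1
      have h3 := mul_le_mul_right h2 (ENNReal.ofReal d⁻¹)
      rw [← mul_assoc, ← ENNReal.ofReal_mul (by positivity), inv_mul_cancel₀ hd0.ne',
        ENNReal.ofReal_one, one_mul, mul_add] at h3
      refine h3.trans (add_le_add le_rfl ?_)
      calc ENNReal.ofReal d⁻¹ * innerModulus (2 * h) p g h ≤ 1 * innerModulus T p g h := by
            refine mul_le_mul' ?_ (innerModulus_mono h1)
            rw [← ENNReal.ofReal_one]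
            exact ENNReal.ofReal_le_ofReal (inv_le_one_of_one_le₀ hd1.le)
        _ ≤ W h := by rw [one_mul]; exact le_self_add
    · refine (hAN h).trans (le_trans ?_ le_add_self)
      refine le_trans ?_ le_add_self
      rw [indicator_of_mem (by simp only [mem_Ioi]; linarith)]
  -- Passing from `h` to `2 h` has the factor `2^{-1/p}`, so the ratio of the series is `2^{θ-1/p}`.
  have key := eLpNorm_lt_top_of_dilation_le (θ := θ) (l := 2) (k := d⁻¹) hq (by positivity) two_pos
    (by
      rw [hd, ← Real.rpow_neg two_pos.le, ← Real.rpow_add two_pos]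
      exact Real.rpow_lt_one_of_one_lt_of_neg one_lt_two (by linarith))
    measurableSet_Ioi le_rfl (fun h hh => mem_Ioi.2 (mul_pos two_pos hh)) hrec (fun h hh => ?_) hWm ?_
  · refine lt_of_le_of_lt ?_ key
    rw [← invMeas_restrict]
    exact eLpNorm_mono_measure _ (Measure.restrict_mono Ioo_subset_Ioi_self le_rfl)
  · have h1 : Tendsto (fun n : ℕ => ENNReal.ofReal (d⁻¹ ^ n) * N) atTop (𝓝 0) := by
      have h2 : Tendsto (fun n : ℕ => ENNReal.ofReal (d⁻¹ ^ n)) atTop (𝓝 0) := by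
        rw [← ENNReal.ofReal_zero]
        exact ENNReal.tendsto_ofReal (tendsto_pow_atTop_nhds_zero_of_lt_one (by positivity)
          (inv_lt_one_of_one_lt₀ hd1))
      have := ENNReal.Tendsto.mul_const (b := N) h2 (Or.inr hNtop.ne)
      rwa [zero_mul] at this
    exact tendsto_of_tendsto_of_tendsto_of_le_of_le tendsto_const_nhds h1 (fun _ => zero_le)
      fun n => mul_le_mul_right (hAN _) _
  · have hρ : Measurable fun h : ℝ => ENNReal.ofReal (h ^ (-θ)) := by fun_prop
    have m1 : Measurable fun h : ℝ => ENNReal.ofReal (h ^ (-θ)) * innerModulus T p g h :=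
      hρ.mul (measurable_innerModulus hgm hp0 hp')
    have m2 : Measurable ((Ioi (T / 2)).indicator fun h : ℝ => N * ENNReal.ofReal (h ^ (-θ))) :=
      (hρ.const_mul N).indicator measurableSet_Ioi
    refine lt_of_le_of_lt (le_trans (eLpNorm_mono_ennreal (Eventually.of_forall fun h => le_of_eq ?_))
      (eLpNorm_add_le m1.aestronglyMeasurable m2.aestronglyMeasurable hq))
      (ENNReal.add_lt_top.2 ⟨hg.innerModulus_lt_top, ?_⟩)
    · simp only [hW, Pi.add_apply, mul_add, indicator]
      split_ifs
      · rw [mul_comm N]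
      · rw [mul_zero]
    · rw [eLpNorm_indicator_eq_eLpNorm_restrict measurableSet_Ioi,
        eLpNorm_ennreal_const_mul hq0 _ hρ]
      exact ENNReal.mul_lt_top hNtop (eLpNorm_rpow_Ioi_lt_top (by linarith) (by linarith) hq0)

/-- Hardy's inequality for functions with zero trace. -/
theorem MemBesov.hardyCond_of_zeroTrace (hg : MemBesov T θ p q g) (hgm : StronglyMeasurable g)
    (htr : ZeroTrace T g) (hθp : 1 / p.toReal < θ)
    (hp : 1 ≤ p) (hp' : p ≠ ∞) (hq : 1 ≤ q) : HardyCond T θ p q g := by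
  have hp0 : p ≠ 0 := (zero_lt_one.trans_le hp).ne'
  have hr := ENNReal.toReal_pos hp0 hp'
  obtain ⟨v, hv, hgv, hv0⟩ := htr
  set d : ℝ := 2 ^ (1 / p.toReal) with hd
  have hd0 : 0 < d := by positivity
  set W : ℝ → ℝ≥0∞ := fun h => innerModulus T p g (2⁻¹ * h) with hW
  have hWm : Measurable W := (measurable_innerModulus hgm hp0 hp').comp (measurable_const_mul _)
  have hrec : ∀ h ∈ Ioo (0 : ℝ) T, eLpNorm g p (volume.restrict (Ioo 0 h)) ≤
      ENNReal.ofReal d * eLpNorm g p (volume.restrict (Ioo 0 (2⁻¹ * h))) + W h := by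
    intro h hh
    have h1 := (eLpNorm_two_mul_le hgm hp hp' (h := 2⁻¹ * h) (by linarith [hh.1])).2
    rw [show 2 * (2⁻¹ * h) = h by ring] at h1
    exact h1.trans (add_le_add le_rfl (innerModulus_mono hh.2.le))
  -- The opposite direction: passing from `h` to `h / 2` has the factor `2^{1/p}`, and the ratio is
  -- `2^{1/p-θ}`.
  have key := eLpNorm_lt_top_of_dilation_le (θ := θ) (l := 2⁻¹) (k := d) hq hd0.le (by positivity)
    (by
      rw [Real.inv_rpow two_pos.le, hd, ← Real.rpow_neg two_pos.le, ← Real.rpow_add two_pos]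
      exact Real.rpow_lt_one_of_one_lt_of_neg one_lt_two (by linarith))
    measurableSet_Ioo Ioo_subset_Ioi_self
    (fun h hh => ⟨by linarith [hh.1], by linarith [hh.1, hh.2]⟩) hrec (fun h hh => ?_) hWm ?_
  · rwa [invMeas_restrict] at key
  -- The zero trace enters here: it gives `‖g‖_{L^p(0,s)} = o(s^{1/p})`, which offsets the growth
  -- `2^{n/p}` of the factors at `s = 2^{-n} h`.
  · rw [ENNReal.tendsto_nhds_zero]
    intro ε hε
    obtain ⟨η, hη0, hη⟩ : ∃ η : ℝ, 0 < η ∧ ENNReal.ofReal (h ^ (1 / p.toReal) * η) ≤ ε := by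
      rcases eq_or_ne ε ∞ with rfl | hε'
      · exact ⟨1, one_pos, le_top⟩
      · have hh0 := Real.rpow_pos_of_pos hh.1 (1 / p.toReal)
        refine ⟨ε.toReal / h ^ (1 / p.toReal), div_pos (ENNReal.toReal_pos hε.ne' hε') hh0, ?_⟩
        rw [mul_div_cancel₀ _ hh0.ne', ENNReal.ofReal_toReal hε']
    have hT : 0 < T := hh.1.trans hh.2
    have h1 := Metric.continuousWithinAt_iff.1 (hv 0 ⟨le_rfl, hT.le⟩) η hη0
    obtain ⟨δ, hδ, hball⟩ := h1
    have h2 : Tendsto (fun n : ℕ => (2⁻¹ : ℝ) ^ n * h) atTop (𝓝 0) := by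
      have := (tendsto_pow_atTop_nhds_zero_of_lt_one (r := (2⁻¹ : ℝ)) (by norm_num)
        (by norm_num)).mul_const h
      rwa [zero_mul] at this
    filter_upwards [h2.eventually_lt_const hδ, h2.eventually_lt_const hT] with n hn hnT
    set s : ℝ := (2⁻¹ : ℝ) ^ n * h with hs
    have hs0 : 0 < s := mul_pos (by positivity) hh.1
    have h3 : eLpNorm g p (volume.restrict (Ioo 0 s)) ≤
        ENNReal.ofReal (s ^ (1 / p.toReal)) * ENNReal.ofReal η := by
      have hb : ∀ᵐ t ∂volume.restrict (Ioo 0 s), ‖g t‖ ≤ η := by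
        filter_upwards [ae_restrict_of_ae_restrict_of_subset (Ioo_subset_Ioo_right hnT.le) hgv,
          ae_restrict_mem measurableSet_Ioo] with t h1 h2
        rw [h1]
        have := hball (x := t) ⟨h2.1.le, (h2.2.trans hnT).le⟩ (by
          rw [Real.dist_eq, sub_zero, abs_of_pos h2.1]; exact h2.2.trans hn)
        rw [hv0, dist_zero_right] at this
        exact this.le
      have := eLpNorm_le_of_ae_bound (p := p) hb
      rwa [Measure.restrict_apply_univ, Real.volume_Ioo, sub_zero,
        ENNReal.ofReal_rpow_of_pos hs0, ← one_div] at this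
    refine (mul_le_mul_right h3 _).trans (le_trans (le_of_eq ?_) hη)
    rw [← mul_assoc, ← ENNReal.ofReal_mul (by positivity), ← ENNReal.ofReal_mul (by positivity)]
    congr 2
    rw [hs, Real.mul_rpow (by positivity) hh.1.le, ← mul_assoc, hd, inv_pow,
      Real.inv_rpow (by positivity), ← Real.rpow_natCast, ← Real.rpow_natCast,
      ← Real.rpow_mul two_pos.le, ← Real.rpow_mul two_pos.le, mul_comm (1 / p.toReal) (n : ℝ),
      mul_inv_cancel₀ (by positivity), one_mul]
  · have m : Measurable fun h : ℝ => ENNReal.ofReal (h ^ (-θ)) * innerModulus T p g h :=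
      Measurable.mul (by fun_prop) (measurable_innerModulus hgm hp0 hp')
    have h1 := eLpNorm_comp_mul (q := q) (σ := 2⁻¹) (by norm_num) m
    have h2 : eLpNorm (fun h : ℝ => ENNReal.ofReal (2⁻¹ ^ θ) * (ENNReal.ofReal ((2⁻¹ * h) ^ (-θ)) *
        innerModulus T p g (2⁻¹ * h))) q invMeas < ∞ := by
      have m' : Measurable fun h : ℝ => ENNReal.ofReal ((2⁻¹ * h) ^ (-θ)) *
          innerModulus T p g (2⁻¹ * h) := m.comp (measurable_const_mul _)
      rw [eLpNorm_ennreal_const_mul (zero_lt_one.trans_le hq).ne' _ m', h1]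
      exact ENNReal.mul_lt_top ENNReal.ofReal_lt_top hg.innerModulus_lt_top
    refine (eLpNorm_mono_ennreal (ae_invMeas_pos.mono fun h hh => le_of_eq ?_)).trans_lt h2
    rw [← mul_assoc, ← ENNReal.ofReal_mul (by positivity), Real.mul_rpow (by norm_num) hh.le,
      ← mul_assoc, ← Real.rpow_add (by norm_num), add_neg_cancel, Real.rpow_zero, one_mul]

end Hardy

end

section

open Filter Topology

/-! ### Existence and vanishing of the trace -/

section Trace

variable {X : Type*} [NormedAddCommGroup X] {T θ h : ℝ} {p q : ℝ≥0∞} {f g : ℝ → X}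

theorem MemLpT.exists_zeroExt (hf : MemLpT T p f) : ∃ g : ℝ → X, StronglyMeasurable g ∧
    (∀ t, t ∉ Ioo 0 T → g t = 0) ∧ f =ᵐ[volume.restrict (Ioo 0 T)] g := by
  refine ⟨(Ioo 0 T).indicator (hf.1.mk f), hf.1.stronglyMeasurable_mk.indicator measurableSet_Ioo,
    fun t ht => indicator_of_notMem ht _, ?_⟩
  filter_upwards [hf.1.ae_eq_mk, ae_restrict_mem measurableSet_Ioo] with t h1 h2
  rw [indicator_of_mem h2, h1]

/-- Averaging the subadditivity `ω(h) ≤ ω(s) + ω(h - s)` of the modulus `ω` over `s` gives `h ω(h) ≤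
2 ∫₀^h ω`, and Hölder's inequality against a power weight applies to the integral. It is the
embedding of the space with index `q` in that with index `∞`. -/
theorem ZeroExtBesov.exists_modulus_le (hg : ZeroExtBesov T θ p q g) (hgm : StronglyMeasurable g)
    (hT : 0 < T) (hθ : 0 < θ) (hp : 1 ≤ p) (hp' : p ≠ ∞) (hq : 1 ≤ q) :
    ∃ K : ℝ, 0 ≤ K ∧ ∀ h, 0 < h → modulus T p g h ≤ ENNReal.ofReal (K * h ^ θ) := by
  have hΦ := hg.lt_top' hT hθ hp hp' hq hgm
  have hΦm := ZeroExtBesov.measurable (T := T) (θ := θ) hgm hp hp'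
  have hmm := measurable_modulus (T := T) hgm (zero_lt_one.trans_le hp).ne' hp'
  set L : ℝ≥0∞ := ENNReal.ofReal (max 1 (θ + 1)⁻¹) *
    eLpNorm (fun h : ℝ => ENNReal.ofReal (h ^ (-θ)) * modulus T p g h) q invMeas with hL
  have hLtop : L < ∞ := ENNReal.mul_lt_top ENNReal.ofReal_lt_top hΦ
  refine ⟨2 * L.toReal, by positivity, fun h hh => ?_⟩
  have hI : ∫⁻ s in Ioo 0 h, modulus T p g s ≤ ENNReal.ofReal (h ^ (θ + 1)) * L := by
    refine le_trans (le_of_eq ?_) ((lintegral_rpow_mul_le (by linarith : 0 < θ + 1) hh hq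
      hΦm).trans (le_of_eq (mul_assoc _ _ _)))
    refine setLIntegral_congr_fun measurableSet_Ioo fun s hs => ?_
    rw [← mul_assoc, ← ENNReal.ofReal_mul (Real.rpow_nonneg hs.1.le _), ← Real.rpow_add hs.1]
    simp
  have hI' : ∫⁻ s in Ioo 0 h, modulus T p g (h - s) = ∫⁻ s in Ioo 0 h, modulus T p g s := by
    have := (Measure.measurePreserving_sub_left volume h).setLIntegral_comp_preimage
      (measurableSet_Ioo (a := 0) (b := h)) hmm
    rw [← this]
    congr 2
    ext s
    simp only [mem_Ioo, mem_preimage]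
    constructor <;> rintro ⟨h1, h2⟩ <;> constructor <;> linarith
  have hc : ENNReal.ofReal h * modulus T p g h ≤ ENNReal.ofReal h *
      (2 * (ENNReal.ofReal (h ^ θ) * L)) := by
    calc ENNReal.ofReal h * modulus T p g h = ∫⁻ _ in Ioo 0 h, modulus T p g h := by
          rw [setLIntegral_const, Real.volume_Ioo, sub_zero, mul_comm]
      _ ≤ ∫⁻ s in Ioo 0 h, (modulus T p g s + modulus T p g (h - s)) :=
          setLIntegral_mono' measurableSet_Ioo fun s hs =>
            modulus_le_add hgm hg.eq_zero hp hs.1.le hs.2.le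
      _ = 2 * ∫⁻ s in Ioo 0 h, modulus T p g s := by
          rw [lintegral_add_left hmm, hI', two_mul]
      _ ≤ 2 * (ENNReal.ofReal (h ^ (θ + 1)) * L) := mul_le_mul_right hI 2
      _ = _ := by
          rw [Real.rpow_add_one hh.ne', ENNReal.ofReal_mul (by positivity)]
          ring
  have hh0 : ENNReal.ofReal h ≠ 0 := (ENNReal.ofReal_pos.2 hh).ne'
  refine ((ENNReal.mul_le_mul_iff_right hh0 ENNReal.ofReal_ne_top).1 hc).trans (le_of_eq ?_)
  rw [ENNReal.ofReal_mul (by positivity), ENNReal.ofReal_mul zero_le_two,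
    ENNReal.ofReal_toReal hLtop.ne, ENNReal.ofReal_ofNat]
  ring

theorem lintegral_window_le_modulus (hg0 : ∀ t ≤ 0, g t = 0) (hgm : StronglyMeasurable g)
    (hp : 1 ≤ p) {k t : ℝ} (hk : 0 < k) (ht : t ≤ T) :
    ∫⁻ s in Ioo (t - k) t, ‖g (s - k) - g s‖ₑ ≤
      modulus T p g k * ENNReal.ofReal k ^ (1 - 1 / p.toReal) := by
  have h1 := eLpNorm_le_eLpNorm_mul_rpow_measure_univ (μ := volume.restrict (Ioo (t - k) t)) hp
    ((hgm.comp_measurable (measurable_id.sub_const k)).sub hgm).aestronglyMeasurable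
  rw [eLpNorm_one_eq_lintegral_enorm, Measure.restrict_apply_univ, Real.volume_Ioo,
    sub_sub_cancel, ENNReal.toReal_one, div_one] at h1
  refine h1.trans (mul_le_mul_left ?_ _)
  rw [modulus, ← eLpNorm_indicator_eq_eLpNorm_restrict measurableSet_Ioo,
    ← eLpNorm_indicator_eq_eLpNorm_restrict measurableSet_Ioo]
  refine eLpNorm_mono_enorm fun s => ?_
  by_cases hs : s ∈ Ioo (t - k) t
  · rw [indicator_of_mem hs]
    rcases le_or_gt s 0 with h0 | h0
    · simp [hg0 s h0, hg0 (s - k) (by linarith)]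
    · rw [indicator_of_mem (show s ∈ Ioo 0 T from ⟨h0, hs.2.trans_le ht⟩)]
      rfl
  · rw [indicator_of_notMem hs]; simp

variable [NormedSpace ℂ X] [CompleteSpace X]

/-- Means of `g` over the windows of length `2^{-n}` to the left of `t` are continuous in `t`, and
consecutive means differ by a multiple of `2^{-n(θ-1/p)}` uniformly. The limit is continuous and
agrees with `g` almost everywhere by Lebesgue's theorem; it vanishes at `0` since the windows there
miss the support of `g`. -/
theorem ZeroExtBesov.zeroTrace_of_zeroExt (hg : ZeroExtBesov T θ p q g)
    (hgm : StronglyMeasurable g) (hg0 : ∀ t, t ∉ Ioo 0 T → g t = 0) (hT : 0 < T)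
    (hθp : 1 / p.toReal < θ) (hp : 1 ≤ p) (hp' : p ≠ ∞) (hq : 1 ≤ q) : ZeroTrace T g := by
  have hp0 : p ≠ 0 := (zero_lt_one.trans_le hp).ne'
  have hr := ENNReal.toReal_pos hp0 hp'
  have hθ : 0 < θ := lt_trans (by positivity) hθp
  obtain ⟨K, hK0, hK⟩ := hg.exists_modulus_le hgm hT hθ hp hp' hq
  have hgi : Integrable g := by
    have h1 : IntegrableOn g (Ioo 0 T) := (hg.memLpT.integrableOn hp).mono_set Ioo_subset_Icc_self
    rw [← integrable_indicator_iff measurableSet_Ioo, indicator_eq_self.2 fun t ht => by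
      by_contra hcon; exact ht (hg0 t hcon)] at h1
    exact h1
  have hii : ∀ a b, IntervalIntegrable g volume a b := fun a b => hgi.intervalIntegrable
  set P : ℝ → X := fun t => ∫ s in (0 : ℝ)..t, g s with hP
  have hPc : Continuous P := intervalIntegral.continuous_primitive hii 0
  have hPsub : ∀ a b, P b - P a = ∫ s in a..b, g s := fun a b =>
    intervalIntegral.integral_interval_sub_left (hii 0 b) (hii 0 a)
  have hPz : ∀ t ≤ 0, P t = 0 := by
    intro t ht
    rw [hP]
    simp only
    rw [intervalIntegral.integral_symm, intervalIntegral.integral_of_le ht,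
      setIntegral_eq_zero_of_forall_eq_zero fun s hs => hg.eq_zero s hs.2, neg_zero]
  set k : ℕ → ℝ := fun n => 2⁻¹ ^ n with hk
  have hkpos : ∀ n, 0 < k n := fun n => by positivity
  have hk0 : Tendsto k atTop (𝓝 0) :=
    tendsto_pow_atTop_nhds_zero_of_lt_one (by norm_num) (by norm_num)
  set a : ℕ → ℝ → X := fun n t => (k n)⁻¹ • (P t - P (t - k n)) with ha
  have hac : ∀ n, Continuous (a n) := fun n =>
    (hPc.sub (hPc.comp (continuous_id.sub continuous_const))).const_smul _
  set δ : ℝ := θ - 1 / p.toReal with hδ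
  have hδ0 : 0 < δ := sub_pos.2 hθp
  have hstep : ∀ n, ∀ t ∈ Icc 0 T, ‖a (n + 1) t - a n t‖ ≤ K * ((2⁻¹ : ℝ) ^ δ) ^ (n + 1) := by
    intro n t ht
    have hkk : k n = 2 * k (n + 1) := by rw [hk]; simp only; rw [pow_succ]; ring
    have hkp := hkpos (n + 1)
    set r := k (n + 1) with hr'
    have e1 : a (n + 1) t - a n t = (2 * r)⁻¹ • ∫ s in (t - r)..t, (g s - g (s - r)) := by
      rw [intervalIntegral.integral_sub (hii _ _) (by
        have := (hii (t - r - r) (t - r)).comp_sub_right r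
        simpa using this), intervalIntegral.integral_comp_sub_right g, ← hPsub, ← hPsub, ha]
      simp only
      rw [← hr', hkk, show t - r - r = t - 2 * r by ring]
      have : r⁻¹ = 2 * (2 * r)⁻¹ := by field_simp
      rw [this]
      module
    have e2 : ‖∫ s in (t - r)..t, (g s - g (s - r))‖ₑ ≤
        ENNReal.ofReal (K * r ^ θ * r ^ (1 - 1 / p.toReal)) := by
      rw [intervalIntegral.integral_of_le (by linarith), integral_Ioc_eq_integral_Ioo]
      refine (enorm_integral_le_lintegral_enorm _).trans ?_
      simp only [fun s => enorm_sub_rev (g s) (g (s - r))]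
      refine (lintegral_window_le_modulus hg.eq_zero hgm hp hkp ht.2).trans ?_
      rw [ENNReal.ofReal_mul (by positivity), ← ENNReal.ofReal_rpow_of_pos hkp]
      exact mul_le_mul_left (hK r hkp) _
    rw [← ofReal_norm, ENNReal.ofReal_le_ofReal_iff (by positivity)] at e2
    rw [e1, norm_smul, Real.norm_of_nonneg (by positivity)]
    have e3 : ((2⁻¹ : ℝ) ^ δ) ^ (n + 1) = r ^ δ := by
      rw [hr', hk]
      simp only
      rw [← Real.rpow_natCast, ← Real.rpow_natCast, ← Real.rpow_mul (by norm_num),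
        ← Real.rpow_mul (by norm_num), mul_comm]
    have e4 : r ^ θ * r ^ (1 - 1 / p.toReal) = r ^ δ * r := by
      rw [← Real.rpow_add hkp, ← Real.rpow_add_one hkp.ne', hδ]
      congr 1; ring
    rw [e3]
    calc (2 * r)⁻¹ * ‖∫ s in (t - r)..t, (g s - g (s - r))‖
        ≤ (2 * r)⁻¹ * (K * r ^ θ * r ^ (1 - 1 / p.toReal)) := by gcongr
      _ = K * r ^ δ * 2⁻¹ := by rw [mul_assoc K, e4]; field_simp
      _ ≤ K * r ^ δ := by
          have : 0 ≤ K * r ^ δ := by positivity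
          linarith
  have hρ1 : (2⁻¹ : ℝ) ^ δ < 1 := Real.rpow_lt_one (by norm_num) (by norm_num) hδ0
  have hsum : Summable fun n : ℕ => K * ((2⁻¹ : ℝ) ^ δ) ^ (n + 1) :=
    ((summable_nat_add_iff 1).2 (summable_geometric_of_lt_one (by positivity) hρ1)).mul_left K
  set v : ℝ → X := fun t => a 0 t + ∑' n, (a (n + 1) t - a n t) with hv
  have hlim : ∀ t ∈ Icc 0 T, Tendsto (fun n => a n t) atTop (𝓝 (v t)) := by
    intro t ht
    have h1 : Summable fun n => a (n + 1) t - a n t :=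
      Summable.of_norm_bounded hsum fun n => hstep n t ht
    have h2 := (h1.hasSum.tendsto_sum_nat).const_add (a 0 t)
    refine h2.congr fun n => ?_
    rw [Finset.sum_range_sub (fun n => a n t)]
    abel
  refine ⟨v, ?_, ?_, ?_⟩
  · refine (hac 0).continuousOn.add (continuousOn_tsum (fun n => ((hac (n + 1)).sub
      (hac n)).continuousOn) hsum fun n t ht => hstep n t ht)
  · have hL := LocallyIntegrable.ae_hasDerivAt_integral hgi.locallyIntegrable
    filter_upwards [ae_restrict_of_ae hL, ae_restrict_mem measurableSet_Ioo] with t h1 h2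
    refine tendsto_nhds_unique ?_ (hlim t (Ioo_subset_Icc_self h2))
    have h3 := hasDerivAt_iff_tendsto_slope.1 (h1 0)
    have h4 : Tendsto (fun n => t - k n) atTop (𝓝[≠] t) := by
      refine tendsto_nhdsWithin_iff.2 ⟨?_, Eventually.of_forall fun n => ?_⟩
      · have := hk0.const_sub t
        rwa [sub_zero] at this
      · have := hkpos n
        simp only [mem_compl_iff, mem_singleton_iff]
        linarith
    refine (h3.comp h4).congr fun n => ?_
    rw [Function.comp_apply, slope_def_module, ha]
    simp only
    rw [show t - k n - t = -k n by ring, inv_neg, neg_smul, ← smul_neg, neg_sub]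
  · refine tendsto_nhds_unique (hlim 0 ⟨le_rfl, hT.le⟩) ?_
    refine tendsto_const_nhds.congr fun n => ?_
    rw [ha]
    simp only
    rw [hPz 0 le_rfl, hPz _ (by linarith [hkpos n]), sub_zero, smul_zero]

/-- Functions whose zero extension is in the Besov space have trace zero. -/
theorem ZeroExtBesov.zeroTrace (hf : ZeroExtBesov T θ p q f) (hT : 0 < T)
    (hθp : 1 / p.toReal < θ) (hp : 1 ≤ p) (hp' : p ≠ ∞) (hq : 1 ≤ q) : ZeroTrace T f := by
  obtain ⟨g, hgm, hg0, hfg⟩ := hf.memLpT.exists_zeroExt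
  have hg := ZeroExtBesov.of_memBesov hgm (fun t ht => hg0 t fun h => not_lt.2 ht h.1) hp hp' hq
    (hf.memBesov.congr hfg.symm) (hf.hardyCond.congr hfg.symm)
  exact (hg.zeroTrace_of_zeroExt hgm hg0 hT hθp hp hp' hq).congr hfg

end Trace

end

section

open Filter Topology

/-! ### Maximal regularity in Besov spaces -/

section BesovMaxReg

variable {X : Type*} [NormedAddCommGroup X] [NormedSpace ℂ X] [CompleteSpace X]
  {A : X →ₗ.[ℂ] X} {φ α ε ω C T θ : ℝ} {p q : ℝ≥0∞} {κ K G₁ G₂ S₁ S₂ : ℝ → X →L[ℂ] X}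

/-- Maximal regularity for strong solutions in a class of functions which, up to modification on
null sets, consists of the functions on `(0, T)` whose zero extension is in the Besov space. -/
theorem IsSectorial.hasMaxReg_strong (hA : IsSectorial A φ) (hφ : φ ∈ Ioo 0 Real.pi)
    (hα : 0 < α) (h : HasKernels A ω ε α (2 * T) C κ K G₁ G₂ S₁ S₂) (hT : 0 < T)
    (hθ : θ ∈ Ioo 0 1) (hp : 1 ≤ p) (hp' : p ≠ ∞) (hq : 1 ≤ q) {E : (ℝ → X) → Prop}
    (hE : ∀ f, E f → MemLpT T p f)
    (hext : ∀ g, E g → StronglyMeasurable g → (∀ t, t ∉ Ioo 0 T → g t = 0) →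
      HardyCond T θ p q g ∧ MemBesov T θ p q g)
    (hcongr : ∀ f g, E f → g =ᵐ[volume.restrict (Ioo 0 T)] f → E g)
    (hreg : ∀ w, ZeroExtBesov T θ p q w → E w) :
    HasMaxReg A ((α : ℂ) • fracPow A ω ε) T
      (IsStrongSolution A ((α : ℂ) • fracPow A ω ε) T p) E := by
  intro f hf
  have hM : 0 < 2 * T := by linarith
  have hTM : T ≤ 2 * T := by linarith
  obtain ⟨g, hgm, hg0, hfg⟩ := (hE f hf).exists_zeroExt
  obtain ⟨hH, hB⟩ := hext g (hcongr f g hf hfg.symm) hgm hg0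
  have hg := ZeroExtBesov.of_memBesov hgm (fun t ht => hg0 t fun h => not_lt.2 ht h.1) hp hp' hq
    hB hH
  have hd := hg.isDini hgm hT hθ.1 hp hp' hq hM
  have key : ∀ {C' : ℝ} {G S : ℝ → X →L[ℂ] X}, SingularKernel (2 * T) C' G S →
      ZeroExtBesov T θ p q (derivConv G S (2 * T) g) := fun hk =>
    hg.derivConv hgm hT hθ hp hp' hq hk
  have r₃ : ZeroExtBesov T θ p q (derivConv (kerG₃ α G₁ G₂) (kerS₃ α S₁ S₂) (2 * T) g) :=
    key h.singular₃
  obtain ⟨hs, eB, eA⟩ := hA.isStrongSolution hφ hα h hM hT.le hTM hd hfg (key h.singular₁).memLpT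
    (key h.singular₂).memLpT r₃.memLpT
  have hmem : ∀ᵐ t ∂volume.restrict (Ioo 0 T), t ∈ Icc 0 T :=
    (ae_restrict_mem measurableSet_Ioo).mono fun t ht => Ioo_subset_Icc_self ht
  refine ⟨_, _, _, hs, ⟨?_, ?_, hreg _ (key h.singular₁), ?_, hcongr _ _ (hreg _ r₃) eA⟩,
    fun v v' v'' hv => hA.strongSolution_unique hφ hα h hM hT hp hs hv⟩
  · exact hcongr _ _ (hreg _ (key (h.singularκ hM)))
      (hmem.mono fun t ht => (h.conv_K_eq hM hd hTM ht).symm)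
  · exact hcongr _ _ (hreg _ (key (h.singularK hM)))
      (hmem.mono fun t ht => (h.conv_G_eq hM hd hTM ht).symm)
  · exact hcongr _ _ (hreg _ (key (h.singular₂.const_smul (α : ℂ))))
      (eB.trans (Eventually.of_forall fun t => (derivConv_kernel_smul (α : ℂ)).symm))

theorem IsSectorial.hasMaxReg_besov (hA : IsSectorial A φ) (hφ : φ ∈ Ioo 0 Real.pi)
    (hα : 0 < α) (h : HasKernels A ω ε α (2 * T) C κ K G₁ G₂ S₁ S₂) (hT : 0 < T)
    (hθ : θ ∈ Ioo 0 1) (hp : 1 ≤ p) (hp' : p ≠ ∞) (hq : 1 ≤ q) (hθp : θ < 1 / p.toReal) :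
    HasMaxReg A ((α : ℂ) • fracPow A ω ε) T
      (IsStrongSolution A ((α : ℂ) • fracPow A ω ε) T p) (MemBesov T θ p q) :=
  hA.hasMaxReg_strong hφ hα h hT hθ hp hp' hq (fun _ hf => hf.1)
    (fun _ hg hgm hg0 => ⟨hg.hardyCond_of_lt hgm hg0 hT hθ.1 hθp hp hp' hq, hg⟩)
    (fun _ _ hf e => hf.congr e) fun _ hw => hw.memBesov

/-- For `θ > 1/p` the data satisfy the Hardy condition because of their zero trace, and the results
have zero trace because their zero extensions are regular. For `θ = 1/p` the Hardy condition is part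
of the definition of the space. -/
theorem IsSectorial.hasMaxReg_besovZero (hA : IsSectorial A φ) (hφ : φ ∈ Ioo 0 Real.pi)
    (hα : 0 < α) (h : HasKernels A ω ε α (2 * T) C κ K G₁ G₂ S₁ S₂) (hT : 0 < T)
    (hθ : θ ∈ Ioo 0 1) (hp : 1 ≤ p) (hp' : p ≠ ∞) (hq : 1 ≤ q) (hθp : 1 / p.toReal ≤ θ) :
    HasMaxReg A ((α : ℂ) • fracPow A ω ε) T
      (IsStrongSolution A ((α : ℂ) • fracPow A ω ε) T p) (MemBesovZero T θ p q) := by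
  refine hA.hasMaxReg_strong hφ hα h hT hθ hp hp' hq (fun _ hf => hf.1.1)
    (fun _ hg hgm _ => ⟨?_, hg.1⟩)
    (fun _ _ hf e => ⟨hf.1.congr e, fun hlt => (hf.2.1 hlt).congr e, fun he => (hf.2.2 he).congr e⟩)
    fun _ hw => ⟨hw.memBesov, fun hlt => hw.zeroTrace hT hlt hp hp' hq, fun _ => hw.hardyCond⟩
  rcases hθp.lt_or_eq with hlt | he
  · exact hg.1.hardyCond_of_zeroTrace hgm (hg.2.1 hlt) hlt hp hp' hq
  · exact hg.2.2 he.symm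

end BesovMaxReg

end

end MaxReg

end

theorem corollary4p2 {X : Type*} [NormedAddCommGroup X] [NormedSpace ℂ X] [CompleteSpace X]
    (A : X →ₗ.[ℂ] X) (φ α ε ω T : ℝ)
    (hφ : φ ∈ Set.Ioo 0 Real.pi) (hA : MaxReg.IsSectorial A φ) (hα : 0 < α) (hT : 0 < T)
    (hω : ω ∈ Set.Ioo φ Real.pi)
    (h : (ε = 1 / 2 ∧ 2 ≤ α) ∨
      (ε = 1 / 2 ∧ α < 2 ∧ φ < Real.pi - 2 * Real.arctan (Real.sqrt (4 - α ^ 2) / α)) ∨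
      (1 / 2 < ε ∧ ε ≤ 1 ∧ φ < Real.pi / (2 * ε))) :
    MaxReg.HasBesovHolderMaxReg A ((α : ℂ) • MaxReg.fracPow A ω ε) T := by
  obtain ⟨θ', x₀, N₁, N₂, N₃, hR⟩ := hA.exists_resolventFamily hφ hα hω h
  -- Kernel estimates are required up to time `2T`, where the singular integrals on `(0, T)` are
  -- truncated.
  obtain ⟨C, κ, K, G₁, G₂, S₁, S₂, hk⟩ :=
    hR.exists_solutionKernels (M := 2 * T) (by linarith)
  exact {
    besov := fun _ _ _ hθ hp hp' hq hθp => hA.hasMaxReg_besov hφ hα hk hT hθ hp hp' hq hθp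
    besov_zero := fun _ _ _ hθ hp hp' hq hθp => hA.hasMaxReg_besovZero hφ hα hk hT hθ hp hp' hq hθp
    holder := fun _ hθ => hA.hasMaxReg_holder hφ hα hk hT hθ
    little_holder := fun _ hθ => hA.hasMaxReg_littleHolder hφ hα hk hT hθ }
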